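/- **Notation.** Work over $\Bbbk=\mathbb{C}(q)$ with $z=q-q^{-1}$, and let $n\in\mathbb{N}$. Everything is super, i.e. $\mathbb{Z}/2$-graded: in a monoidal supercategory $(f'\otimes g)\circ(f\otimes g')=(-1)^{|f||g|}(f'\circ f)\otimes(g\circ g')$, (monoidal) superfunctors are linear and parity preserving and the monoidal ones are strict, and a supernatural transformation $\alpha\colon F\Rightarrow G$ of parity $|\alpha|$ satisfies $G(f)\circ\alpha_X=(-1)^{|\alpha||f|}\alpha_Y\circ F(f)$. *The quantum isomeric supercategory* $\mathcal{Q}(z)$ is the strict monoidal supercategory generated by objects $\uparrow,\downarrow$, even morphisms $\sigma_+,\sigma_-\colon\uparrow\otimes\uparrow\to\uparrow\otimes\uparrow$, $\rho_-\colon\uparrow\otimes\downarrow\to\downarrow\otimes\uparrow$, $\mathrm{cap}\colon\downarrow\otimes\uparrow\to\mathbb{1}$, $\mathrm{cup}\colon\mathbb{1}\to\uparrow\otimes\downarrow$ and an odd morphism $\tau\colon\uparrow\to\uparrow$, subject to: $\sigma_+$ and $\sigma_-$ are inverse to each other; $\rho_-$ is inverse to $\lambda_+:=(\mathrm{cap}\otimes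 1_{\uparrow\downarrow})\circ(1_\downarrow\otimes\sigma_+\otimes 1_\downarrow)\circ(1_{\downarrow\uparrow}\otimes\mathrm{cup})$; the braid relation for $\sigma_+$; $\sigma_+-\sigma_-=z\,1$; $\tau^2=-1$; $\sigma_+\circ(\tau\otimes 1)=(1\otimes\tau)\circ\sigma_+$; $\mathrm{rcap}\circ(\tau\otimes 1_\downarrow)\circ\mathrm{cup}=0=\mathrm{rcap}\circ\mathrm{cup}$, where $\mathrm{rcap}:=\mathrm{cap}\circ\rho_-$; and the two zigzag relations for $\mathrm{cup},\mathrm{cap}$. *The quantum affine isomeric supercategory* $\mathcal{AQ}(z)$ is obtained from $\mathcal{Q}(z)$ by adjoining an odd morphism $\omega\colon\uparrow\to\uparrow$, the open Clifford token, subject to $\omega^2=-1$, $\sigma_+\circ(1\otimes\omega)=(\omega\otimes 1)\circ\sigma_+$ and $\mathrm{rcap}\circ(\omega\otimes 1_\downarrow)\circ\mathrm{cup}=0$. Let $I=\{\pm1,\dots,\pm n\}$; let $p(i)=0$ if $i>0$ and $p(i)=1$ if $i<0$; let $\varphi(i,j)=\operatorname{sgn}(j)$ if $|i|=|j|$ and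 $\varphi(i,j)=0$ otherwise. Let $V$ have basis $v_i$ ($i\in I$), with $|v_i|=p(i)$, let $E_{ij}$ be the matrix units on $V$, with $|E_{ij}|=p(i)+p(j)$, let $Jv_i=(-1)^{p(i)}v_{-i}$, and put $$\Theta=\sum_{i,j}q^{\varphi(i,j)}E_{ii}\otimes E_{jj}+z\sum_{i<j}(-1)^{p(i)}(E_{ji}+E_{-j,-i})\otimes E_{ij}=\sum_{i\le j}\Theta_{ij}\otimes E_{ij}.$$ The superalgebra $U_q=U_q(\mathfrak{q}_n)$ is generated by $u_{ij}$ ($i\le j$), of parity $p(i)+p(j)$, subject to $u_{ii}u_{-i,-i}=1$ and $L^{12}L^{13}\Theta^{23}=\Theta^{23}L^{13}L^{12}$, where $L=\sum_{i\le j}u_{ij}\otimes E_{ij}$. It is a Hopf superalgebra, with comultiplication $\Delta(u_{ij})=\sum_{i\le k\le j}(-1)^{(p(i)+p(k))(p(k)+p(j))}u_{ik}\otimes u_{kj}$, counit $u_{ij}\mapsto\delta_{ij}$, and antipode $S$ such that $\sum_{i\le j}S(u_{ij})\otimes E_{ij}=L^{-1}$. Let $U_q\text{-smod}$ be the supercategory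 of $U_q$-supermodules, with even and odd homomorphisms ($f(xm)=(-1)^{|f||x|}xf(m)$), and let $\mathcal{SE}nd(U_q\text{-smod})$ be the strict monoidal supercategory of its endosuperfunctors and supernatural transformations, with $F\otimes G=F\circ G$. Then $V$ is a $U_q$-supermodule on which $u_{ij}$ acts by $\Theta_{ij}$; let $V^*$ be its dual, $(xf)(v)=(-1)^{|x||f|}f(S(x)v)$, with dual basis $v_i^*$. For a $U_q$-supermodule $M$ let $T_{MV}=\operatorname{flip}\circ L\colon M\otimes V\to V\otimes M$, where $\operatorname{flip}(m\otimes v)=(-1)^{|m||v|}v\otimes m$; this map is invertible. Let $$K_M=T_{MV}\circ(1_M\otimes J)\circ T_{MV}^{-1}\colon V\otimes M\to V\otimes M.$$ **Theorem.** (a) There is a unique monoidal superfunctor $\mathbf{R}_n\colon\mathcal{Q}(z)\to\mathcal{SE}nd(U_q\text{-smod})$, the action of $\mathcal{Q}(z)$ by tensoring on the left, that sends $\uparrow$ to $V\otimes-$, sends $\downarrow$ to $V^*\otimes-$, and sends each generating morphism $f$ to the supernatural transformation with components $\mathbf{F}_n(f)\otimes 1_M$ (up to the associativity isomorphisms of tensor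 products of vector spaces), where $\mathbf{F}_n(\sigma_\pm)=T_{VV}^{\pm1}$, $\mathbf{F}_n(\mathrm{cap})(f\otimes v)=f(v)$, $\mathbf{F}_n(\mathrm{cup})(1)=\sum_i v_i\otimes v_i^*$, $\mathbf{F}_n(\tau)=J$ and $$\mathbf{F}_n(\rho_-)(v_i\otimes v_j^*)=(-1)^{p(i)p(j)}q^{-\varphi(i,j)}v_j^*\otimes v_i-z\delta_{ij}\sum_{k>i}(-1)^{p(i)+p(k)}q^{2|i|-2|k|}v_k^*\otimes v_k-z\delta_{i,-j}\sum_{k>j}(-1)^{p(k)}q^{2|i|-2|k|}v_k^*\otimes v_{-k}.$$ (b) There is a unique monoidal superfunctor $$\hat{\mathbf{F}}_n\colon\mathcal{AQ}(z)\to\mathcal{SE}nd(U_q\text{-smod})$$ whose composite with the canonical superfunctor $\mathcal{Q}(z)\to\mathcal{AQ}(z)$ is the action $\mathbf{R}_n$ of (a) and which sends the open Clifford token $\omega$ to the (odd) supernatural transformation $K$ with components $K_M$. It is called the affine action superfunctor. -/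

import Mathlib

universe u v w

set_option linter.unusedSectionVars false

open CategoryTheory
open scoped TensorProduct

namespace QIso

/-! ## Superspaces -/

section Superspaces

/-- The Koszul sign `(-1)^(r s)` attached to two parities. -/
def ksgn (K : Type*) [Field K] (r s : ZMod 2) : K := if r = 1 ∧ s = 1 then -1 else 1

/-- A superspace: a vector space `M = M₀ ⊕ M₁`. -/
class Superspace (K : Type*) [Field K] (M : Type*) [AddCommGroup M] [Module K M] where
  gr : ZMod 2 → Submodule K M
  isCompl : IsCompl (gr 0) (gr 1)

variable (K : Type*) [Field K] (M : Type*) [AddCommGroup M] [Module K M]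

/-- The homogeneous part of parity `r` of a superspace. -/
def Par [Superspace K M] (r : ZMod 2) : Submodule K M := Superspace.gr r

/-- The parity involution `m ↦ (-1)^|m| m` of a superspace. -/
noncomputable def inv [Superspace K M] : M →ₗ[K] M :=
  (2 : K) • Submodule.projection _ _ (Superspace.isCompl (K := K) (M := M)) - LinearMap.id

variable {K M}

theorem zmod2_cases (r : ZMod 2) : r = 0 ∨ r = 1 := by revert r; decide

@[simp] theorem ksgn_zero_left (r : ZMod 2) : ksgn K 0 r = 1 := by simp [ksgn]
@[simp] theorem ksgn_zero_right (r : ZMod 2) : ksgn K r 0 = 1 := by simp [ksgn]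
@[simp] theorem ksgn_one_one : ksgn K 1 1 = -1 := by simp [ksgn]
theorem ksgn_add_left (r s t : ZMod 2) : ksgn K (r + s) t = ksgn K r t * ksgn K s t := by
  rcases zmod2_cases r with rfl | rfl <;> rcases zmod2_cases s with rfl | rfl <;>
    rcases zmod2_cases t with rfl | rfl <;> simp [show (1 + 1 : ZMod 2) = 0 from rfl]
theorem ksgn_comm (r s : ZMod 2) : ksgn K r s = ksgn K s r := by simp [ksgn, and_comm]
theorem ksgn_add_right (r s t : ZMod 2) : ksgn K r (s + t) = ksgn K r s * ksgn K r t := by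
  rw [ksgn_comm, ksgn_add_left, ksgn_comm s, ksgn_comm t]
@[simp] theorem ksgn_mul_self (r s : ZMod 2) : ksgn K r s * ksgn K r s = 1 := by
  unfold ksgn; split_ifs <;> simp
@[simp] theorem ksgn_mul_self_assoc (r s : ZMod 2) (x : K) :
    ksgn K r s * (ksgn K r s * x) = x := by rw [← mul_assoc, ksgn_mul_self, one_mul]
theorem zmod2_add_self (r : ZMod 2) : r + r = 0 := by revert r; decide

theorem inv_of_mem [Superspace K M] {r : ZMod 2} {m : M} (h : m ∈ Par K M r) :
    inv K M m = ksgn K r 1 • m := by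
  rcases zmod2_cases r with rfl | rfl
  · have h' := Submodule.projection_apply_of_mem_left (Superspace.isCompl (K := K) (M := M)) h
    simp [inv, two_smul, h']
  · have h' := Submodule.projection_apply_of_mem_right (Superspace.isCompl (K := K) (M := M)) h
    simp [inv, h']

theorem exists_decomp [Superspace K M] (m : M) :
    ∃ a ∈ Par K M 0, ∃ b ∈ Par K M 1, a + b = m := by
  have h : m ∈ Par K M 0 ⊔ Par K M 1 := by
    rw [show Par K M 0 ⊔ Par K M 1 = ⊤ from Superspace.isCompl.sup_eq_top]; trivial
  exact Submodule.mem_sup.mp h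

theorem ext_par [Superspace K M] {N : Type*} [AddCommGroup N] [Module K N] {f g : M →ₗ[K] N}
    (h : ∀ r, ∀ m ∈ Par K M r, f m = g m) : f = g := by
  ext m
  obtain ⟨a, ha, b, hb, rfl⟩ := exists_decomp (K := K) m
  rw [map_add, map_add, h 0 a ha, h 1 b hb]

theorem inv_inv [Superspace K M] (m : M) : inv K M (inv K M m) = m := by
  have : (inv K M).comp (inv K M) = LinearMap.id := by
    refine ext_par (K := K) fun r m hm => ?_
    simp [inv_of_mem hm, smul_smul]
  exact LinearMap.congr_fun this m

theorem mem_of_inv [NeZero (2 : K)] [Superspace K M] {r : ZMod 2} {m : M}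
    (h : inv K M m = ksgn K r 1 • m) : m ∈ Par K M r := by
  obtain ⟨a, ha, b, hb, rfl⟩ := exists_decomp (K := K) m
  rw [map_add, inv_of_mem ha, inv_of_mem hb] at h
  have h2 : (2 : K) ≠ 0 := NeZero.ne 2
  rcases zmod2_cases r with rfl | rfl
  · have : (2 : K) • b = 0 := by
      simp only [ksgn_zero_left, one_smul, ksgn_one_one, neg_smul] at h
      have := add_left_cancel h
      rw [two_smul]; nth_rw 1 [← this]; simp
    have hb0 : b = 0 := (smul_eq_zero.mp this).resolve_left h2
    simpa [hb0] using ha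
  · have : (2 : K) • a = 0 := by
      simp only [ksgn_zero_left, one_smul, ksgn_one_one, neg_smul, neg_add] at h
      have := add_right_cancel h
      rw [two_smul]; nth_rw 1 [this]; simp
    have ha0 : a = 0 := (smul_eq_zero.mp this).resolve_left h2
    simpa [ha0] using hb

/-- Away from characteristic two, a linear involution splits a vector space into a superspace:
the part of parity `r` is the eigenspace of eigenvalue `(-1)^r`. -/
@[reducible] def Superspace.ofInvolution [NeZero (2 : K)] (f : M →ₗ[K] M) (hf : ∀ m, f (f m) = m) :
    Superspace K M where
  gr r := LinearMap.eqLocus f (ksgn K r 1 • LinearMap.id)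
  isCompl := by
    have h2 : (2 : K) ≠ 0 := NeZero.ne 2
    constructor
    · rw [Submodule.disjoint_def]
      intro m h0 h1
      simp only [LinearMap.mem_eqLocus, LinearMap.id_apply, ksgn_zero_left, ksgn_one_one, one_smul, neg_smul] at h0 h1
      have : (2 : K) • m = 0 := by
        rw [two_smul]; nth_rw 1 [← h0]; rw [h1]; simp
      exact (smul_eq_zero.mp this).resolve_left h2
    · rw [codisjoint_iff, eq_top_iff]
      intro m _
      refine Submodule.mem_sup.mpr ⟨(2 : K)⁻¹ • (m + f m), ?_, (2 : K)⁻¹ • (m - f m), ?_, ?_⟩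
      · simp [hf, add_comm]
      · simp [hf]
      · rw [← smul_add, add_add_sub_cancel, ← two_smul K m, smul_smul, inv_mul_cancel₀ h2, one_smul]

theorem mem_ofInvolution [NeZero (2 : K)] (f : M →ₗ[K] M) (hf : ∀ m, f (f m) = m) {r : ZMod 2}
    {m : M} : m ∈ (Superspace.ofInvolution f hf).gr r ↔ f m = ksgn K r 1 • m := Iff.rfl

theorem inv_ofInvolution [NeZero (2 : K)] (f : M →ₗ[K] M) (hf : ∀ m, f (f m) = m) :
    @inv K _ M _ _ (Superspace.ofInvolution f hf) = f := by
  let _ := Superspace.ofInvolution f hf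
  refine ext_par (K := K) fun r m hm => ?_
  rw [inv_of_mem hm, (mem_ofInvolution f hf).mp hm]

/-- The superspace of sums of an element of `P 0` and an element of `P 1`. -/
@[reducible] def Superspace.ofDisjoint (P : ZMod 2 → Submodule K M) (h : Disjoint (P 0) (P 1)) :
    Superspace K ↥(P 0 ⊔ P 1) where
  gr r := (P r).comap (P 0 ⊔ P 1).subtype
  isCompl := by
    constructor
    · rw [Submodule.disjoint_def] at h ⊢
      intro m h0 h1
      exact Subtype.ext (h m.1 h0 h1)
    · rw [codisjoint_iff, eq_top_iff]
      rintro ⟨m, hm⟩ _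
      obtain ⟨a, ha, b, hb, rfl⟩ := Submodule.mem_sup.mp hm
      exact Submodule.mem_sup.mpr ⟨⟨a, Submodule.mem_sup_left ha⟩, ha,
        ⟨b, Submodule.mem_sup_right hb⟩, hb, rfl⟩

theorem le_sup01 (P : ZMod 2 → Submodule K M) (r : ZMod 2) : P r ≤ P 0 ⊔ P 1 := by
  rcases zmod2_cases r with rfl | rfl
  exacts [le_sup_left, le_sup_right]

theorem sup01_induction (P : ZMod 2 → Submodule K M) {motive : M → Prop}
    (hP : ∀ r, ∀ m ∈ P r, motive m) (hadd : ∀ a b, motive a → motive b → motive (a + b))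
    {m : M} (hm : m ∈ P 0 ⊔ P 1) : motive m := by
  obtain ⟨a, ha, b, hb, rfl⟩ := Submodule.mem_sup.mp hm
  exact hadd _ _ (hP 0 a ha) (hP 1 b hb)

end Superspaces

/-! ## Supercategories and superfunctors -/

/-- A supercategory: a category enriched in superspaces. -/
class Supercategory (K : Type*) [Field K] (C : Type u) [Category.{v} C] [Preadditive C]
    [Linear K C] where
  hom (X Y : C) : Superspace K (X ⟶ Y)
  id_mem (X : C) : 𝟙 X ∈ Par K (X ⟶ X) 0
  comp_mem {X Y Z : C} {r s : ZMod 2} {f : X ⟶ Y} {g : Y ⟶ Z} :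
    f ∈ Par K (X ⟶ Y) r → g ∈ Par K (Y ⟶ Z) s → f ≫ g ∈ Par K (X ⟶ Z) (r + s)

attribute [reducible, instance] Supercategory.hom

/-- A superfunctor: a functor that is linear and parity preserving on morphisms. -/
@[ext] structure Superfunctor (K : Type*) [Field K]
    (C : Type*) [Category C] [Preadditive C] [Linear K C] [Supercategory K C]
    (D : Type*) [Category D] [Preadditive D] [Linear K D] [Supercategory K D] extends C ⥤ D where
  map_add {X Y : C} (f g : X ⟶ Y) : map (f + g) = map f + map g
  map_smul {X Y : C} (a : K) (f : X ⟶ Y) : map (a • f) = a • map f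
  map_mem {X Y : C} {r : ZMod 2} {f : X ⟶ Y} : f ∈ Par K (X ⟶ Y) r →
    map f ∈ Par K (obj X ⟶ obj Y) r

namespace Superfunctor

variable {K : Type*} [Field K]
  {C : Type*} [Category C] [Preadditive C] [Linear K C] [Supercategory K C]
  {D : Type*} [Category D] [Preadditive D] [Linear K D] [Supercategory K D]
  {E : Type*} [Category E] [Preadditive E] [Linear K E] [Supercategory K E]

variable (K C) in
/-- The identity superfunctor. -/
def id : Superfunctor K C C where
  toFunctor := 𝟭 C
  map_add _ _ := rfl
  map_smul _ _ := rfl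
  map_mem h := h

/-- Composition of superfunctors: first `F`, then `G`. -/
def comp (F : Superfunctor K C D) (G : Superfunctor K D E) : Superfunctor K C E where
  toFunctor := F.toFunctor ⋙ G.toFunctor
  map_add f g := by simp [F.map_add, G.map_add]
  map_smul a f := by simp [F.map_smul, G.map_smul]
  map_mem h := G.map_mem (F.map_mem h)

/-- The supernatural transformations `F ⇒ G` of parity `r`: families `α` of morphisms of parity
`r` with `G f ∘ α_X = (-1)^(r |f|) α_Y ∘ F f`. -/
def natPar (F G : Superfunctor K C D) (r : ZMod 2) :
    Submodule K (∀ X : C, F.obj X ⟶ G.obj X) where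
  carrier := {α | (∀ X, α X ∈ Par K (F.obj X ⟶ G.obj X) r) ∧
    ∀ (X Y : C) (s : ZMod 2) (f : X ⟶ Y), f ∈ Par K (X ⟶ Y) s →
      α X ≫ G.map f = ksgn K r s • (F.map f ≫ α Y)}
  add_mem' := by
    rintro α β ⟨h1, h2⟩ ⟨h3, h4⟩
    refine ⟨fun X => add_mem (h1 X) (h3 X), fun X Y s f hf => ?_⟩
    simp [h2 X Y s f hf, h4 X Y s f hf]
  zero_mem' := ⟨fun X => zero_mem _, fun X Y s f _ => by simp⟩
  smul_mem' := by
    rintro a α ⟨h1, h2⟩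
    refine ⟨fun X => Submodule.smul_mem _ a (h1 X), fun X Y s f hf => ?_⟩
    simp [h2 X Y s f hf, smul_smul, mul_comm a]

theorem natPar_disjoint (F G : Superfunctor K C D) :
    Disjoint (natPar F G 0) (natPar F G 1) := by
  rw [Submodule.disjoint_def]
  intro α h0 h1
  funext X
  exact Submodule.disjoint_def.mp
    (Superspace.isCompl (K := K) (M := F.obj X ⟶ G.obj X)).disjoint _ (h0.1 X) (h1.1 X)

/-- The superspace of supernatural transformations `α = α₀ + α₁`, with `α_r` of parity `r`. -/
def NatTrans (F G : Superfunctor K C D) : Submodule K (∀ X : C, F.obj X ⟶ G.obj X) :=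
  natPar F G 0 ⊔ natPar F G 1

theorem natPar_comp {F G H : Superfunctor K C D} {r s : ZMod 2} {α : ∀ X : C, F.obj X ⟶ G.obj X}
    {β : ∀ X : C, G.obj X ⟶ H.obj X} (hα : α ∈ natPar F G r) (hβ : β ∈ natPar G H s) :
    (fun X => α X ≫ β X) ∈ natPar F H (r + s) := by
  refine ⟨fun X => Supercategory.comp_mem (hα.1 X) (hβ.1 X), fun X Y t f hf => ?_⟩
  rw [Category.assoc, hβ.2 X Y t f hf, Linear.comp_smul, ← Category.assoc, hα.2 X Y t f hf,
    Linear.smul_comp, smul_smul, Category.assoc, ksgn_add_left, mul_comm]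

theorem natPar_id (F : Superfunctor K C D) : (fun X => 𝟙 (F.obj X)) ∈ natPar F F 0 :=
  ⟨fun X => Supercategory.id_mem _, fun X Y s f _ => by simp⟩

theorem natTrans_comp {F G H : Superfunctor K C D} {α : ∀ X : C, F.obj X ⟶ G.obj X}
    {β : ∀ X : C, G.obj X ⟶ H.obj X} (hα : α ∈ NatTrans F G) (hβ : β ∈ NatTrans G H) :
    (fun X => α X ≫ β X) ∈ NatTrans F H := by
  refine sup01_induction (natPar F G) (motive := fun α => (fun X => α X ≫ β X) ∈ NatTrans F H)
    (fun r α hα => ?_) (fun a b ha hb => ?_) hα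
  · refine sup01_induction (natPar G H) (motive := fun β => (fun X => α X ≫ β X) ∈ NatTrans F H)
      (fun s β hβ => ?_) (fun a b ha hb => ?_) hβ
    · exact le_sup01 (natPar F H) _ (natPar_comp hα hβ)
    · have := add_mem ha hb
      convert this using 1
      funext X
      simp
  · have := add_mem ha hb
    convert this using 1
    funext X
    simp

instance : Category (Superfunctor K C D) where
  Hom F G := ↥(NatTrans F G)
  id F := ⟨fun X => 𝟙 (F.obj X), le_sup01 (natPar F F) 0 (natPar_id F)⟩
  comp α β := ⟨fun X => α.1 X ≫ β.1 X, natTrans_comp α.2 β.2⟩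
  id_comp α := Subtype.ext (funext fun X => by simp)
  comp_id α := Subtype.ext (funext fun X => by simp)
  assoc α β γ := Subtype.ext (funext fun X => by simp)

/-- The component at `X` of a supernatural transformation. -/
def app {F G : Superfunctor K C D} (α : F ⟶ G) (X : C) : F.obj X ⟶ G.obj X := α.1 X

theorem hom_ext {F G : Superfunctor K C D} {α β : F ⟶ G} (h : ∀ X, app α X = app β X) : α = β :=
  Subtype.ext (funext h)

instance : Preadditive (Superfunctor K C D) where
  homGroup F G := inferInstanceAs (AddCommGroup ↥(NatTrans F G))
  add_comp _ _ _ _ _ _ := Subtype.ext (funext fun _ => Preadditive.add_comp _ _ _ _ _ _)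
  comp_add _ _ _ _ _ _ := Subtype.ext (funext fun _ => Preadditive.comp_add _ _ _ _ _ _)

instance : Linear K (Superfunctor K C D) where
  homModule F G := inferInstanceAs (Module K ↥(NatTrans F G))
  smul_comp _ _ _ _ _ _ := Subtype.ext (funext fun _ => Linear.smul_comp _ _ _ _ _ _)
  comp_smul _ _ _ _ _ _ := Subtype.ext (funext fun _ => Linear.comp_smul _ _ _ _ _ _)

instance : Supercategory K (Superfunctor K C D) where
  hom F G := Superspace.ofDisjoint (natPar F G) (natPar_disjoint F G)
  id_mem F := natPar_id F
  comp_mem hf hg := natPar_comp hf hg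

end Superfunctor

/-! ## Strict monoidal supercategories -/

/-- A strict monoidal supercategory. The tensor product satisfies the super interchange law
`(f' ⊗ g) ∘ (f ⊗ g') = (-1)^(|f||g|) (f' ∘ f) ⊗ (g ∘ g')`, and it is strictly associative and
strictly unital on objects and on morphisms. -/
class StrictMonoidalSupercategory (K : Type*) [Field K] (C : Type u) [Category.{v} C]
    [Preadditive C] [Linear K C] [Supercategory K C] where
  unit : C
  tensorObj : C → C → C
  tensorHom {X Y X' Y' : C} (f : X ⟶ Y) (g : X' ⟶ Y') : tensorObj X X' ⟶ tensorObj Y Y'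
  add_tensor {X Y X' Y' : C} (f f' : X ⟶ Y) (g : X' ⟶ Y') :
    tensorHom (f + f') g = tensorHom f g + tensorHom f' g
  tensor_add {X Y X' Y' : C} (f : X ⟶ Y) (g g' : X' ⟶ Y') :
    tensorHom f (g + g') = tensorHom f g + tensorHom f g'
  smul_tensor {X Y X' Y' : C} (a : K) (f : X ⟶ Y) (g : X' ⟶ Y') :
    tensorHom (a • f) g = a • tensorHom f g
  tensor_smul {X Y X' Y' : C} (a : K) (f : X ⟶ Y) (g : X' ⟶ Y') :
    tensorHom f (a • g) = a • tensorHom f g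
  tensor_mem {X Y X' Y' : C} {r s : ZMod 2} {f : X ⟶ Y} {g : X' ⟶ Y'} :
    f ∈ Par K (X ⟶ Y) r → g ∈ Par K (X' ⟶ Y') s →
      tensorHom f g ∈ Par K (tensorObj X X' ⟶ tensorObj Y Y') (r + s)
  tensor_id (X Y : C) : tensorHom (𝟙 X) (𝟙 Y) = 𝟙 (tensorObj X Y)
  interchange {X Y Z X' Y' Z' : C} {r s : ZMod 2} (f : X ⟶ Y) (f' : Y ⟶ Z) (g' : X' ⟶ Y')
    (g : Y' ⟶ Z') : f ∈ Par K (X ⟶ Y) r → g ∈ Par K (Y' ⟶ Z') s →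
      tensorHom f g' ≫ tensorHom f' g = ksgn K r s • tensorHom (f ≫ f') (g' ≫ g)
  unit_tensorObj (X : C) : tensorObj unit X = X
  tensorObj_unit (X : C) : tensorObj X unit = X
  tensorObj_assoc (X Y Z : C) : tensorObj (tensorObj X Y) Z = tensorObj X (tensorObj Y Z)
  unit_tensorHom {X Y : C} (f : X ⟶ Y) : tensorHom (𝟙 unit) f =
    eqToHom (unit_tensorObj X) ≫ f ≫ eqToHom (unit_tensorObj Y).symm
  tensorHom_unit {X Y : C} (f : X ⟶ Y) : tensorHom f (𝟙 unit) =
    eqToHom (tensorObj_unit X) ≫ f ≫ eqToHom (tensorObj_unit Y).symm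
  tensorHom_assoc {X Y X' Y' X'' Y'' : C} (f : X ⟶ Y) (g : X' ⟶ Y') (h : X'' ⟶ Y'') :
    tensorHom (tensorHom f g) h = eqToHom (tensorObj_assoc X X' X'') ≫
      tensorHom f (tensorHom g h) ≫ eqToHom (tensorObj_assoc Y Y' Y'').symm

open StrictMonoidalSupercategory in
/-- A (strict) monoidal superfunctor between strict monoidal supercategories. -/
@[ext] structure MonoidalSuperfunctor (K : Type*) [Field K]
    (C : Type*) [Category C] [Preadditive C] [Linear K C] [Supercategory K C]
    [StrictMonoidalSupercategory K C]
    (D : Type*) [Category D] [Preadditive D] [Linear K D] [Supercategory K D]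
    [StrictMonoidalSupercategory K D] extends Superfunctor K C D where
  obj_unit : obj (unit K) = unit K
  obj_tensor (X Y : C) : obj (tensorObj K X Y) = tensorObj K (obj X) (obj Y)
  map_tensor {X Y X' Y' : C} (f : X ⟶ Y) (g : X' ⟶ Y') : map (tensorHom (K := K) f g) =
    eqToHom (obj_tensor X X') ≫ tensorHom (K := K) (map f) (map g) ≫ eqToHom (obj_tensor Y Y').symm

namespace MonoidalSuperfunctor

variable {K : Type*} [Field K]
  {C : Type*} [Category C] [Preadditive C] [Linear K C] [Supercategory K C]
  [StrictMonoidalSupercategory K C]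
  {D : Type*} [Category D] [Preadditive D] [Linear K D] [Supercategory K D]
  [StrictMonoidalSupercategory K D]
  {E : Type*} [Category E] [Preadditive E] [Linear K E] [Supercategory K E]
  [StrictMonoidalSupercategory K E]

/-- Composition of monoidal superfunctors: first `F`, then `G`. -/
def comp (F : MonoidalSuperfunctor K C D) (G : MonoidalSuperfunctor K D E) :
    MonoidalSuperfunctor K C E where
  toSuperfunctor := F.toSuperfunctor.comp G.toSuperfunctor
  obj_unit := (congrArg G.obj F.obj_unit).trans G.obj_unit
  obj_tensor X Y := (congrArg G.obj (F.obj_tensor X Y)).trans (G.obj_tensor _ _)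
  map_tensor f g := by
    change G.map (F.map _) = _
    rw [F.map_tensor, G.map_comp, G.map_comp, G.map_tensor, eqToHom_map, eqToHom_map]
    simp only [Category.assoc, eqToHom_trans, eqToHom_trans_assoc]
    rfl

end MonoidalSuperfunctor

/-! ## Endosuperfunctors -/

section SEnd

variable (K : Type*) [Field K] (C : Type*) [Category C] [Preadditive C] [Linear K C]
  [Supercategory K C]

/-- The supercategory of endosuperfunctors of `C` and supernatural transformations. -/
abbrev SEnd := Superfunctor K C C

variable {K C}

open Superfunctor

/-- The component at `M` of `α ⊗ β`, for `α : F ⇒ F'` and `β : G ⇒ G'`, is the composite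
`F (G M) ⟶ F (G' M) ⟶ F' (G' M)`. -/
def sendTensor {F F' G G' : SEnd K C} (α : ∀ X, F.obj X ⟶ F'.obj X)
    (β : ∀ X, G.obj X ⟶ G'.obj X) (M : C) : F.obj (G.obj M) ⟶ F'.obj (G'.obj M) :=
  F.map (β M) ≫ α (G'.obj M)

theorem sendTensor_mem {F F' G G' : SEnd K C} {r s : ZMod 2} {α : ∀ X, F.obj X ⟶ F'.obj X}
    {β : ∀ X, G.obj X ⟶ G'.obj X} (hα : α ∈ natPar F F' r) (hβ : β ∈ natPar G G' s) :
    (sendTensor α β : ∀ M, (G.comp F).obj M ⟶ (G'.comp F').obj M) ∈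
      natPar (G.comp F) (G'.comp F') (r + s) := by
  refine ⟨fun X => ?_, fun X Y t f hf => ?_⟩
  · rw [add_comm]
    exact Supercategory.comp_mem (F.map_mem (hβ.1 X)) (hα.1 _)
  · change (F.map (β X) ≫ α (G'.obj X)) ≫ F'.map (G'.map f) =
      ksgn K (r + s) t • (F.map (G.map f) ≫ F.map (β Y) ≫ α (G'.obj Y))
    rw [Category.assoc, hα.2 _ _ t _ (G'.map_mem hf), Linear.comp_smul, ← Category.assoc,
      ← F.map_comp, hβ.2 X Y t f hf, F.map_smul, Linear.smul_comp, smul_smul, F.map_comp,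
      Category.assoc, ksgn_add_left]

theorem sendTensor_mem' {F F' G G' : SEnd K C} {α : ∀ X, F.obj X ⟶ F'.obj X}
    {β : ∀ X, G.obj X ⟶ G'.obj X} (hα : α ∈ NatTrans F F') (hβ : β ∈ NatTrans G G') :
    (sendTensor α β : ∀ M, (G.comp F).obj M ⟶ (G'.comp F').obj M) ∈
      NatTrans (G.comp F) (G'.comp F') := by
  refine sup01_induction (natPar F F') (motive := fun α =>
    (sendTensor α β : ∀ M, (G.comp F).obj M ⟶ (G'.comp F').obj M) ∈ NatTrans (G.comp F) (G'.comp F'))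
    (fun r α hα => ?_) (fun a b ha hb => ?_) hα
  · refine sup01_induction (natPar G G') (motive := fun β =>
      (sendTensor α β : ∀ M, (G.comp F).obj M ⟶ (G'.comp F').obj M) ∈
        NatTrans (G.comp F) (G'.comp F')) (fun s β hβ => ?_) (fun a b ha hb => ?_) hβ
    · exact le_sup01 (natPar (G.comp F) (G'.comp F')) _ (sendTensor_mem hα hβ)
    · have : (sendTensor α (a + b) : ∀ M, (G.comp F).obj M ⟶ (G'.comp F').obj M) =
          sendTensor α a + sendTensor α b := by
        funext X
        simp [sendTensor, F.map_add]
      rw [this]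
      exact add_mem ha hb
  · have : (sendTensor (a + b) β : ∀ M, (G.comp F).obj M ⟶ (G'.comp F').obj M) =
        sendTensor a β + sendTensor b β := by
      funext X
      simp [sendTensor]
    rw [this]
    exact add_mem ha hb

/-- The tensor product of endosuperfunctors is composition: `(F ⊗ G) M = F (G M)`. -/
instance : StrictMonoidalSupercategory K (SEnd K C) where
  unit := Superfunctor.id K C
  tensorObj F G := G.comp F
  tensorHom α β := ⟨sendTensor α.1 β.1, sendTensor_mem' α.2 β.2⟩
  add_tensor α α' β := Subtype.ext (funext fun X => Preadditive.comp_add _ _ _ _ _ _)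
  tensor_add {F _ _ _} α β β' := Subtype.ext (funext fun X => by
    exact (congrArg (· ≫ α.1 _) (F.map_add (β.1 X) (β'.1 X))).trans
      (Preadditive.add_comp _ _ _ _ _ _))
  smul_tensor a α β := Subtype.ext (funext fun X => Linear.comp_smul _ _ _ _ _ _)
  tensor_smul {F _ _ _} a α β := Subtype.ext (funext fun X => by
    exact (congrArg (· ≫ α.1 _) (F.map_smul a (β.1 X))).trans (Linear.smul_comp _ _ _ _ _ _))
  tensor_mem hα hβ := sendTensor_mem hα hβ
  tensor_id F G := Subtype.ext (funext fun X => by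
    change F.map (𝟙 _) ≫ 𝟙 _ = 𝟙 _
    rw [F.map_id, Category.comp_id])
  interchange {F F' F'' G G' G''} r s α α' β' β hα hβ := Subtype.ext (funext fun X => by
    change (F.map (β'.1 X) ≫ α.1 (G'.obj X)) ≫ F'.map (β.1 X) ≫ α'.1 (G''.obj X) =
      ksgn K r s • (F.map (β'.1 X ≫ β.1 X) ≫ α.1 _ ≫ α'.1 _)
    have h := hα.2 _ _ s (β.1 X) (hβ.1 X)
    rw [Category.assoc, ← Category.assoc (α.1 _)]
    erw [h]
    simp)
  unit_tensorObj F := rfl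
  tensorObj_unit F := rfl
  tensorObj_assoc F G H := rfl
  unit_tensorHom {F G} α := Subtype.ext (funext fun X => by
    change α.1 X ≫ 𝟙 _ = (𝟙 F ≫ α ≫ 𝟙 G : F ⟶ G).1 X
    simp)
  tensorHom_unit {F G} α := Subtype.ext (funext fun X => by
    change F.map (𝟙 _) ≫ α.1 X = (𝟙 F ≫ α ≫ 𝟙 G : F ⟶ G).1 X
    simp)
  tensorHom_assoc {F F' G G' H H'} α β γ := Subtype.ext (funext fun X => by
    change F.map (G.map (γ.1 X)) ≫ F.map (β.1 _) ≫ α.1 _ = _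
    rw [← Category.assoc, ← F.map_comp]
    change _ = 𝟙 (F.obj (G.obj (H.obj X))) ≫
      (F.map (G.map (γ.1 X) ≫ β.1 (H'.obj X)) ≫ α.1 (G'.obj (H'.obj X))) ≫ 𝟙 _
    rw [Category.id_comp, Category.comp_id])

end SEnd

/-! ## Strict monoidal supercategories given by generators and relations -/

section Presentations

/-- Generating morphisms for a strict monoidal supercategory with generating objects `A`; the
objects are the words in `A`. -/
structure Signature (A : Type) where
  Gen : Type
  dom : Gen → List A
  cod : Gen → List A
  parity : Gen → ZMod 2

/-- Formal linear string diagrams. `eqTo h` is the identity of `X`, seen as a morphism `X ⟶ Y`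
along an equality `X = Y` of words; `comp f g` is `f` followed by `g`; `tensor f g` is `f ⊗ g`. -/
inductive Diagram {A : Type} (S : Signature A) (K : Type) : List A → List A → Type
  | gen (g : S.Gen) : Diagram S K (S.dom g) (S.cod g)
  | eqTo {X Y : List A} (h : X = Y) : Diagram S K X Y
  | comp {X Y Z : List A} (f : Diagram S K X Y) (g : Diagram S K Y Z) : Diagram S K X Z
  | tensor {X Y X' Y' : List A} (f : Diagram S K X Y) (g : Diagram S K X' Y') :
      Diagram S K (X ++ X') (Y ++ Y')
  | zero {X Y : List A} : Diagram S K X Y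
  | add {X Y : List A} (f g : Diagram S K X Y) : Diagram S K X Y
  | smul {X Y : List A} (a : K) (f : Diagram S K X Y) : Diagram S K X Y

namespace Diagram

variable {A : Type} {S : Signature A} {K : Type}

/-- The identity diagram. -/
abbrev id (X : List A) : Diagram S K X X := eqTo rfl

/-- `Homog f r` says that `f` is a linear combination of diagrams of parity `r`. -/
inductive Homog : ∀ {X Y : List A}, Diagram S K X Y → ZMod 2 → Prop
  | gen (g : S.Gen) : Homog (gen g) (S.parity g)
  | eqTo {X Y : List A} (h : X = Y) : Homog (eqTo h) 0
  | comp {X Y Z : List A} {f : Diagram S K X Y} {g : Diagram S K Y Z} {r s : ZMod 2} :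
      Homog f r → Homog g s → Homog (comp f g) (r + s)
  | tensor {X Y X' Y' : List A} {f : Diagram S K X Y} {g : Diagram S K X' Y'} {r s : ZMod 2} :
      Homog f r → Homog g s → Homog (tensor f g) (r + s)
  | zero {X Y : List A} (r : ZMod 2) : Homog (zero (X := X) (Y := Y)) r
  | add {X Y : List A} {f g : Diagram S K X Y} {r : ZMod 2} :
      Homog f r → Homog g r → Homog (add f g) r
  | smul {X Y : List A} {f : Diagram S K X Y} {r : ZMod 2} (a : K) :
      Homog f r → Homog (smul a f) r

/-- Diagrams over a signature, viewed over a signature with one more generator. -/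
def lift {S' : Signature A} (φ : S.Gen → S'.Gen) (hd : ∀ g, S'.dom (φ g) = S.dom g)
    (hc : ∀ g, S'.cod (φ g) = S.cod g) :
    ∀ {X Y : List A}, Diagram S K X Y → Diagram S' K X Y
  | _, _, gen g => comp (comp (eqTo (hd g).symm) (gen (φ g))) (eqTo (hc g))
  | _, _, eqTo h => eqTo h
  | _, _, comp f g => comp (lift φ hd hc f) (lift φ hd hc g)
  | _, _, tensor f g => tensor (lift φ hd hc f) (lift φ hd hc g)
  | _, _, zero => zero
  | _, _, add f g => add (lift φ hd hc f) (lift φ hd hc g)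
  | _, _, smul a f => smul a (lift φ hd hc f)

end Diagram

/-- Generators and relations for a strict monoidal supercategory; relations are homogeneous. -/
structure Presentation (A K : Type) [Field K] where
  sig : Signature A
  Rel : ∀ {X Y : List A}, Diagram sig K X Y → Diagram sig K X Y → Prop
  homog : ∀ {X Y : List A} {f g : Diagram sig K X Y}, Rel f g → ∃ r, f.Homog r ∧ g.Homog r

namespace Presentation

open Diagram

variable {A K : Type} [Field K]

/-- Equality of diagrams in the presented supercategory: the smallest congruence that contains the
defining relations and the axioms of a strict monoidal supercategory. -/
inductive Eqv (P : Presentation A K) :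
    ∀ {X Y : List A}, Diagram P.sig K X Y → Diagram P.sig K X Y → Prop
  | rel {X Y} {f g : Diagram P.sig K X Y} : P.Rel f g → Eqv P f g
  | refl {X Y} (f : Diagram P.sig K X Y) : Eqv P f f
  | symm {X Y} {f g : Diagram P.sig K X Y} : Eqv P f g → Eqv P g f
  | trans {X Y} {f g h : Diagram P.sig K X Y} : Eqv P f g → Eqv P g h → Eqv P f h
  | comp_congr {X Y Z} {f f' : Diagram P.sig K X Y} {g g' : Diagram P.sig K Y Z} :
      Eqv P f f' → Eqv P g g' → Eqv P (comp f g) (comp f' g')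
  | tensor_congr {X Y X' Y'} {f f' : Diagram P.sig K X Y} {g g' : Diagram P.sig K X' Y'} :
      Eqv P f f' → Eqv P g g' → Eqv P (tensor f g) (tensor f' g')
  | add_congr {X Y} {f f' g g' : Diagram P.sig K X Y} :
      Eqv P f f' → Eqv P g g' → Eqv P (add f g) (add f' g')
  | smul_congr {X Y} (a : K) {f f' : Diagram P.sig K X Y} :
      Eqv P f f' → Eqv P (smul a f) (smul a f')
  | add_comm {X Y} (f g : Diagram P.sig K X Y) : Eqv P (add f g) (add g f)
  | add_assoc {X Y} (f g h : Diagram P.sig K X Y) : Eqv P (add (add f g) h) (add f (add g h))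
  | zero_add {X Y} (f : Diagram P.sig K X Y) : Eqv P (add zero f) f
  | neg_add {X Y} (f : Diagram P.sig K X Y) : Eqv P (add (smul (-1) f) f) zero
  | smul_add {X Y} (a : K) (f g : Diagram P.sig K X Y) :
      Eqv P (smul a (add f g)) (add (smul a f) (smul a g))
  | add_smul {X Y} (a b : K) (f : Diagram P.sig K X Y) :
      Eqv P (smul (a + b) f) (add (smul a f) (smul b f))
  | mul_smul {X Y} (a b : K) (f : Diagram P.sig K X Y) :
      Eqv P (smul (a * b) f) (smul a (smul b f))
  | one_smul {X Y} (f : Diagram P.sig K X Y) : Eqv P (smul 1 f) f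
  | id_comp {X Y} (f : Diagram P.sig K X Y) : Eqv P (comp (id X) f) f
  | comp_id {X Y} (f : Diagram P.sig K X Y) : Eqv P (comp f (id Y)) f
  | comp_assoc {X Y Z W} (f : Diagram P.sig K X Y) (g : Diagram P.sig K Y Z)
      (h : Diagram P.sig K Z W) : Eqv P (comp (comp f g) h) (comp f (comp g h))
  | comp_add {X Y Z} (f : Diagram P.sig K X Y) (g g' : Diagram P.sig K Y Z) :
      Eqv P (comp f (add g g')) (add (comp f g) (comp f g'))
  | add_comp {X Y Z} (f f' : Diagram P.sig K X Y) (g : Diagram P.sig K Y Z) :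
      Eqv P (comp (add f f') g) (add (comp f g) (comp f' g))
  | comp_smul {X Y Z} (a : K) (f : Diagram P.sig K X Y) (g : Diagram P.sig K Y Z) :
      Eqv P (comp f (smul a g)) (smul a (comp f g))
  | smul_comp {X Y Z} (a : K) (f : Diagram P.sig K X Y) (g : Diagram P.sig K Y Z) :
      Eqv P (comp (smul a f) g) (smul a (comp f g))
  | tensor_add {X Y X' Y'} (f : Diagram P.sig K X Y) (g g' : Diagram P.sig K X' Y') :
      Eqv P (tensor f (add g g')) (add (tensor f g) (tensor f g'))
  | add_tensor {X Y X' Y'} (f f' : Diagram P.sig K X Y) (g : Diagram P.sig K X' Y') :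
      Eqv P (tensor (add f f') g) (add (tensor f g) (tensor f' g))
  | tensor_smul {X Y X' Y'} (a : K) (f : Diagram P.sig K X Y) (g : Diagram P.sig K X' Y') :
      Eqv P (tensor f (smul a g)) (smul a (tensor f g))
  | smul_tensor {X Y X' Y'} (a : K) (f : Diagram P.sig K X Y) (g : Diagram P.sig K X' Y') :
      Eqv P (tensor (smul a f) g) (smul a (tensor f g))
  | tensor_id (X Y : List A) : Eqv P (tensor (id X) (id Y)) (id (X ++ Y))
  | interchange {X Y Z X' Y' Z'} {r s : ZMod 2} {f : Diagram P.sig K X Y}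
      (f' : Diagram P.sig K Y Z) (g' : Diagram P.sig K X' Y') {g : Diagram P.sig K Y' Z'} :
      f.Homog r → g.Homog s → Eqv P (comp (tensor f g') (tensor f' g))
        (smul (ksgn K r s) (tensor (comp f f') (comp g' g)))
  | unit_tensor {X Y} (f : Diagram P.sig K X Y) : Eqv P (tensor (id []) f) f
  | tensor_unit {X Y} (f : Diagram P.sig K X Y) : Eqv P (tensor f (id []))
      (comp (eqTo (List.append_nil X)) (comp f (eqTo (List.append_nil Y).symm)))
  | tensor_assoc {X Y X' Y' X'' Y''} (f : Diagram P.sig K X Y) (g : Diagram P.sig K X' Y')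
      (h : Diagram P.sig K X'' Y'') : Eqv P (tensor (tensor f g) h)
        (comp (eqTo (List.append_assoc X X' X''))
          (comp (tensor f (tensor g h)) (eqTo (List.append_assoc Y Y' Y'').symm)))

/-- The diagram in which each odd generator is multiplied by `-1`. -/
def flipOdd {S : Signature A} : ∀ {X Y : List A}, Diagram S K X Y → Diagram S K X Y
  | _, _, gen g => smul (ksgn K (S.parity g) 1) (gen g)
  | _, _, eqTo h => eqTo h
  | _, _, comp f g => comp (flipOdd f) (flipOdd g)
  | _, _, tensor f g => tensor (flipOdd f) (flipOdd g)
  | _, _, zero => zero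
  | _, _, add f g => add (flipOdd f) (flipOdd g)
  | _, _, smul a f => smul a (flipOdd f)

theorem homog_flipOdd {S : Signature A} {X Y : List A} {f : Diagram S K X Y} {r : ZMod 2}
    (h : f.Homog r) : (flipOdd f).Homog r := by
  induction h with
  | gen g => exact (Homog.gen g).smul _
  | eqTo h => exact Homog.eqTo h
  | comp _ _ h1 h2 => exact h1.comp h2
  | tensor _ _ h1 h2 => exact h1.tensor h2
  | zero r => exact Homog.zero r
  | add _ _ h1 h2 => exact h1.add h2
  | smul a _ h1 => exact h1.smul a

variable (P : Presentation A K)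

/-- The setoid of equality in the presented supercategory. -/
def setoid (X Y : List A) : Setoid (Diagram P.sig K X Y) where
  r := Eqv P
  iseqv := ⟨Eqv.refl, Eqv.symm, Eqv.trans⟩

/-- The strict monoidal supercategory presented by `P`; its objects are the words in `A`. -/
@[ext] structure Cat (P : Presentation A K) : Type where
  word : List A

/-- Morphisms in the presented supercategory. -/
def Mor (X Y : List A) : Type := Quotient (P.setoid X Y)

variable {P}

/-- The morphism represented by a diagram. -/
def cls {X Y : List A} (f : Diagram P.sig K X Y) : P.Mor X Y := Quotient.mk (P.setoid X Y) f

theorem cls_eq {X Y : List A} {f g : Diagram P.sig K X Y} : cls f = cls g ↔ Eqv P f g :=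
  ⟨fun h => Quotient.exact h, fun h => Quotient.sound (s := P.setoid X Y) h⟩

theorem cls_surj {X Y : List A} (x : P.Mor X Y) : ∃ f, cls f = x := Quotient.exists_rep x

/-- Composition of morphisms. -/
def Mor.comp {X Y Z : List A} : P.Mor X Y → P.Mor Y Z → P.Mor X Z :=
  Quotient.map₂ Diagram.comp fun _ _ h _ _ h' => Eqv.comp_congr h h'

/-- Tensor product of morphisms. -/
def Mor.tensor {X Y X' Y' : List A} : P.Mor X Y → P.Mor X' Y' → P.Mor (X ++ X') (Y ++ Y') :=
  Quotient.map₂ Diagram.tensor fun _ _ h _ _ h' => Eqv.tensor_congr h h'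

/-- Sum of morphisms. -/
def Mor.add {X Y : List A} : P.Mor X Y → P.Mor X Y → P.Mor X Y :=
  Quotient.map₂ Diagram.add fun _ _ h _ _ h' => Eqv.add_congr h h'

/-- Scalar multiple of a morphism. -/
def Mor.smul {X Y : List A} (a : K) : P.Mor X Y → P.Mor X Y :=
  Quotient.map (Diagram.smul a) fun _ _ h => Eqv.smul_congr a h

instance (X Y : List A) : Add (P.Mor X Y) := ⟨Mor.add⟩
instance (X Y : List A) : Zero (P.Mor X Y) := ⟨cls Diagram.zero⟩
instance (X Y : List A) : Neg (P.Mor X Y) := ⟨Mor.smul (-1)⟩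

instance (X Y : List A) : AddCommGroup (P.Mor X Y) where
  nsmul := nsmulRec
  zsmul := zsmulRec
  add_assoc a b c := by
    obtain ⟨a, rfl⟩ := cls_surj a; obtain ⟨b, rfl⟩ := cls_surj b; obtain ⟨c, rfl⟩ := cls_surj c
    exact cls_eq.mpr (Eqv.add_assoc a b c)
  zero_add a := by
    obtain ⟨a, rfl⟩ := cls_surj a
    exact cls_eq.mpr (Eqv.zero_add a)
  add_zero a := by
    obtain ⟨a, rfl⟩ := cls_surj a
    exact cls_eq.mpr ((Eqv.add_comm a _).trans (Eqv.zero_add a))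
  neg_add_cancel a := by
    obtain ⟨a, rfl⟩ := cls_surj a
    exact cls_eq.mpr (Eqv.neg_add a)
  add_comm a b := by
    obtain ⟨a, rfl⟩ := cls_surj a; obtain ⟨b, rfl⟩ := cls_surj b
    exact cls_eq.mpr (Eqv.add_comm a b)

instance (X Y : List A) : SMul K (P.Mor X Y) := ⟨Mor.smul⟩

instance (X Y : List A) : Module K (P.Mor X Y) :=
  Module.ofMinimalAxioms
    (fun a f g => by
      obtain ⟨f, rfl⟩ := cls_surj f; obtain ⟨g, rfl⟩ := cls_surj g
      exact cls_eq.mpr (Eqv.smul_add a f g))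
    (fun a b f => by
      obtain ⟨f, rfl⟩ := cls_surj f
      exact cls_eq.mpr (Eqv.add_smul a b f))
    (fun a b f => by
      obtain ⟨f, rfl⟩ := cls_surj f
      exact cls_eq.mpr (Eqv.mul_smul a b f))
    (fun f => by
      obtain ⟨f, rfl⟩ := cls_surj f
      exact cls_eq.mpr (Eqv.one_smul f))

theorem cls_add {X Y : List A} (f g : Diagram P.sig K X Y) : cls (f.add g) = cls f + cls g := rfl
theorem cls_smul {X Y : List A} (a : K) (f : Diagram P.sig K X Y) :
    cls (f.smul a) = a • cls f := rfl
theorem cls_zero {X Y : List A} : cls (Diagram.zero : Diagram P.sig K X Y) = 0 := rfl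

instance : Category P.Cat where
  Hom X Y := P.Mor X.word Y.word
  id X := cls (Diagram.id X.word)
  comp f g := Mor.comp f g
  id_comp f := by
    obtain ⟨f, rfl⟩ := cls_surj f
    exact cls_eq.mpr (Eqv.id_comp f)
  comp_id f := by
    obtain ⟨f, rfl⟩ := cls_surj f
    exact cls_eq.mpr (Eqv.comp_id f)
  assoc f g h := by
    obtain ⟨f, rfl⟩ := cls_surj f; obtain ⟨g, rfl⟩ := cls_surj g; obtain ⟨h, rfl⟩ := cls_surj h
    exact cls_eq.mpr (Eqv.comp_assoc f g h)

/-- The morphism of the presented supercategory represented by a diagram. -/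
def mor {X Y : List A} (f : Diagram P.sig K X Y) : (⟨X⟩ : P.Cat) ⟶ (⟨Y⟩ : P.Cat) :=
  cls f

instance : Preadditive P.Cat where
  homGroup X Y := inferInstanceAs (AddCommGroup (P.Mor X.word Y.word))
  add_comp _ _ _ f g h := by
    obtain ⟨f, rfl⟩ := cls_surj f; obtain ⟨g, rfl⟩ := cls_surj g; obtain ⟨h, rfl⟩ := cls_surj h
    exact cls_eq.mpr (Eqv.add_comp f g h)
  comp_add _ _ _ f g h := by
    obtain ⟨f, rfl⟩ := cls_surj f; obtain ⟨g, rfl⟩ := cls_surj g; obtain ⟨h, rfl⟩ := cls_surj h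
    exact cls_eq.mpr (Eqv.comp_add f g h)

instance : Linear K P.Cat where
  homModule X Y := inferInstanceAs (Module K (P.Mor X.word Y.word))
  smul_comp _ _ _ a f g := by
    obtain ⟨f, rfl⟩ := cls_surj f; obtain ⟨g, rfl⟩ := cls_surj g
    exact cls_eq.mpr (Eqv.smul_comp a f g)
  comp_smul _ _ _ f a g := by
    obtain ⟨f, rfl⟩ := cls_surj f; obtain ⟨g, rfl⟩ := cls_surj g
    exact cls_eq.mpr (Eqv.comp_smul a f g)

theorem flipOdd_homog {X Y : List A} {f : Diagram P.sig K X Y} {r : ZMod 2} (h : f.Homog r) :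
    (cls (flipOdd f) : P.Mor X Y) = ksgn K r 1 • cls f := by
  induction h with
  | gen g => rfl
  | eqTo h => rw [ksgn_zero_left, _root_.one_smul]; rfl
  | @comp X Y Z f g r s _ _ h1 h2 =>
    have : (cls (flipOdd (f.comp g)) : P.Mor X Z) =
      (cls (flipOdd f) : P.Mor X Y).comp (cls (flipOdd g)) := rfl
    rw [this, h1, h2, ← cls_smul, ← cls_smul, ksgn_add_left]
    exact cls_eq.mpr ((Eqv.smul_comp _ _ _).trans
      ((Eqv.smul_congr _ (Eqv.comp_smul _ _ _)).trans (Eqv.mul_smul _ _ _).symm))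
  | @tensor X Y X' Y' f g r s _ _ h1 h2 =>
    have : (cls (flipOdd (f.tensor g)) : P.Mor (X ++ X') (Y ++ Y')) =
      (cls (flipOdd f) : P.Mor X Y).tensor (cls (flipOdd g)) := rfl
    rw [this, h1, h2, ← cls_smul, ← cls_smul, ksgn_add_left]
    exact cls_eq.mpr ((Eqv.smul_tensor _ _ _).trans
      ((Eqv.smul_congr _ (Eqv.tensor_smul _ _ _)).trans (Eqv.mul_smul _ _ _).symm))
  | zero r => exact (_root_.smul_zero _).symm
  | @add X Y f g r _ _ h1 h2 =>
    rw [cls_add, _root_.smul_add, ← h1, ← h2]; rfl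
  | @smul X Y f r a _ h1 =>
    rw [cls_smul, smul_comm, ← h1]; rfl

theorem eqv_flipOdd {X Y : List A} {f g : Diagram P.sig K X Y} (h : Eqv P f g) :
    Eqv P (flipOdd f) (flipOdd g) := by
  induction h with
  | @rel X Y f g h =>
    obtain ⟨r, hf, hg⟩ := P.homog h
    rw [← cls_eq, flipOdd_homog hf, flipOdd_homog hg, cls_eq.mpr (Eqv.rel h)]
  | refl f => exact .refl _
  | symm _ h => exact h.symm
  | trans _ _ h h' => exact h.trans h'
  | comp_congr _ _ h h' => exact .comp_congr h h'
  | tensor_congr _ _ h h' => exact .tensor_congr h h'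
  | add_congr _ _ h h' => exact .add_congr h h'
  | smul_congr a _ h => exact .smul_congr a h
  | add_comm f g => exact .add_comm _ _
  | add_assoc f g h => exact .add_assoc _ _ _
  | zero_add f => exact .zero_add _
  | neg_add f => exact .neg_add _
  | smul_add a f g => exact .smul_add _ _ _
  | add_smul a b f => exact .add_smul _ _ _
  | mul_smul a b f => exact .mul_smul _ _ _
  | one_smul f => exact .one_smul _
  | id_comp f => exact .id_comp _
  | comp_id f => exact .comp_id _
  | comp_assoc f g h => exact .comp_assoc _ _ _
  | comp_add f g g' => exact .comp_add _ _ _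
  | add_comp f f' g => exact .add_comp _ _ _
  | comp_smul a f g => exact .comp_smul _ _ _
  | smul_comp a f g => exact .smul_comp _ _ _
  | tensor_add f g g' => exact .tensor_add _ _ _
  | add_tensor f f' g => exact .add_tensor _ _ _
  | tensor_smul a f g => exact .tensor_smul _ _ _
  | smul_tensor a f g => exact .smul_tensor _ _ _
  | tensor_id X Y => exact .tensor_id X Y
  | interchange f' g' hf hg => exact .interchange _ _ (homog_flipOdd hf) (homog_flipOdd hg)
  | unit_tensor f => exact .unit_tensor _
  | tensor_unit f => exact .tensor_unit _
  | tensor_assoc f g h => exact .tensor_assoc _ _ _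

variable (P) in
/-- The morphisms of parity `r`: those represented by diagrams of parity `r`. -/
def morPar (X Y : List A) (r : ZMod 2) : Submodule K (P.Mor X Y) where
  carrier := {x | ∃ f : Diagram P.sig K X Y, f.Homog r ∧ cls f = x}
  add_mem' := by
    rintro _ _ ⟨f, hf, rfl⟩ ⟨g, hg, rfl⟩
    exact ⟨f.add g, hf.add hg, rfl⟩
  zero_mem' := ⟨Diagram.zero, .zero r, rfl⟩
  smul_mem' := by
    rintro a _ ⟨f, hf, rfl⟩
    exact ⟨f.smul a, hf.smul a, rfl⟩

theorem exists_homog {X Y : List A} (f : Diagram P.sig K X Y) :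
    cls f ∈ morPar P X Y 0 ⊔ morPar P X Y 1 := by
  have aux : ∀ {X Y : List A} (r : ZMod 2) (x : P.Mor X Y), x ∈ morPar P X Y r →
      x ∈ morPar P X Y 0 ⊔ morPar P X Y 1 := fun r x hx => le_sup01 (morPar P _ _) r hx
  induction f with
  | gen g => exact aux (P.sig.parity g) _ ⟨_, .gen g, rfl⟩
  | eqTo h => exact aux 0 _ ⟨_, .eqTo h, rfl⟩
  | @comp X Y Z f g h1 h2 =>
    change Mor.comp (cls f) (cls g) ∈ _
    refine sup01_induction (morPar P X Y) (motive := fun x => Mor.comp x (cls g) ∈ _)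
      (fun r x hx => ?_) (fun a b ha hb => ?_) h1
    · refine sup01_induction (morPar P Y Z) (motive := fun y => Mor.comp x y ∈ _)
        (fun s y hy => ?_) (fun a b ha hb => ?_) h2
      · obtain ⟨f, hf, rfl⟩ := hx
        obtain ⟨g, hg, rfl⟩ := hy
        exact aux (r + s) _ ⟨_, hf.comp hg, rfl⟩
      · have h : Mor.comp x (a + b) = Mor.comp x a + Mor.comp x b :=
          Preadditive.comp_add (C := P.Cat) ⟨X⟩ ⟨Y⟩ ⟨Z⟩ x a b
        rw [h]
        exact add_mem ha hb
    · have h : Mor.comp (a + b) (cls g) = Mor.comp a (cls g) + Mor.comp b (cls g) :=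
        Preadditive.add_comp (C := P.Cat) ⟨X⟩ ⟨Y⟩ ⟨Z⟩ a b (cls g)
      rw [h]
      exact add_mem ha hb
  | @tensor X Y X' Y' f g h1 h2 =>
    change Mor.tensor (cls f) (cls g) ∈ _
    refine sup01_induction (morPar P X Y) (motive := fun x => Mor.tensor x (cls g) ∈ _)
      (fun r x hx => ?_) (fun a b ha hb => ?_) h1
    · refine sup01_induction (morPar P X' Y') (motive := fun y => Mor.tensor x y ∈ _)
        (fun s y hy => ?_) (fun a b ha hb => ?_) h2
      · obtain ⟨f, hf, rfl⟩ := hx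
        obtain ⟨g, hg, rfl⟩ := hy
        exact aux (r + s) _ ⟨_, hf.tensor hg, rfl⟩
      · obtain ⟨x, rfl⟩ := cls_surj x; obtain ⟨a, rfl⟩ := cls_surj a; obtain ⟨b, rfl⟩ := cls_surj b
        have h : Mor.tensor (cls x) (cls a + cls b) =
          Mor.tensor (cls x) (cls a) + Mor.tensor (cls x) (cls b) := cls_eq.mpr (Eqv.tensor_add x a b)
        rw [h]
        exact add_mem ha hb
    · obtain ⟨a, rfl⟩ := cls_surj a; obtain ⟨b, rfl⟩ := cls_surj b
      have h : Mor.tensor (cls a + cls b) (cls g) =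
        Mor.tensor (cls a) (cls g) + Mor.tensor (cls b) (cls g) := cls_eq.mpr (Eqv.add_tensor a b g)
      rw [h]
      exact add_mem ha hb
  | zero => exact zero_mem _
  | add f g h1 h2 => exact add_mem h1 h2
  | smul a f h => exact Submodule.smul_mem _ a h

section Supercat

variable [NeZero (2 : K)]

theorem morPar_isCompl (X Y : List A) : IsCompl (morPar P X Y 0) (morPar P X Y 1) := by
  constructor
  · rw [Submodule.disjoint_def]
    rintro _ ⟨f, hf, rfl⟩ ⟨g, hg, hgf⟩
    have h1 := flipOdd_homog hf
    have h2 := flipOdd_homog hg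
    rw [cls_eq.mpr (eqv_flipOdd (cls_eq.mp hgf)), hgf, h1] at h2
    simp only [ksgn_zero_left, _root_.one_smul, ksgn_one_one, neg_smul] at h2
    have : (2 : K) • (cls f : P.Mor X Y) = 0 := by
      rw [two_smul]; nth_rw 1 [h2]; simp
    exact (smul_eq_zero.mp this).resolve_left (NeZero.ne 2)
  · rw [codisjoint_iff, eq_top_iff]
    intro x _
    obtain ⟨f, rfl⟩ := cls_surj x
    exact exists_homog f

instance : Supercategory K P.Cat where
  hom X Y := ⟨morPar P X.word Y.word, morPar_isCompl X.word Y.word⟩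
  id_mem X := ⟨_, .eqTo rfl, rfl⟩
  comp_mem := by
    rintro _ _ _ _ _ _ _ ⟨f, hf, rfl⟩ ⟨g, hg, rfl⟩
    exact ⟨_, hf.comp hg, rfl⟩

theorem mor_eqTo {X Y : P.Cat} (h : X = Y) :
    cls (Diagram.eqTo (congrArg Cat.word h)) = eqToHom h := by
  subst h; rfl

instance : StrictMonoidalSupercategory K P.Cat where
  unit := ⟨[]⟩
  tensorObj X Y := ⟨X.word ++ Y.word⟩
  tensorHom f g := Mor.tensor f g
  add_tensor f f' g := by
    obtain ⟨f, rfl⟩ := cls_surj f; obtain ⟨f', rfl⟩ := cls_surj f'; obtain ⟨g, rfl⟩ := cls_surj g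
    exact cls_eq.mpr (Eqv.add_tensor f f' g)
  tensor_add f g g' := by
    obtain ⟨f, rfl⟩ := cls_surj f; obtain ⟨g, rfl⟩ := cls_surj g; obtain ⟨g', rfl⟩ := cls_surj g'
    exact cls_eq.mpr (Eqv.tensor_add f g g')
  smul_tensor a f g := by
    obtain ⟨f, rfl⟩ := cls_surj f; obtain ⟨g, rfl⟩ := cls_surj g
    exact cls_eq.mpr (Eqv.smul_tensor a f g)
  tensor_smul a f g := by
    obtain ⟨f, rfl⟩ := cls_surj f; obtain ⟨g, rfl⟩ := cls_surj g
    exact cls_eq.mpr (Eqv.tensor_smul a f g)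
  tensor_mem := by
    rintro _ _ _ _ _ _ _ _ ⟨f, hf, rfl⟩ ⟨g, hg, rfl⟩
    exact ⟨_, hf.tensor hg, rfl⟩
  tensor_id X Y := cls_eq.mpr (Eqv.tensor_id X.word Y.word)
  interchange := by
    rintro _ _ _ _ _ _ _ _ _ f' g' _ ⟨f, hf, rfl⟩ ⟨g, hg, rfl⟩
    obtain ⟨f', rfl⟩ := cls_surj f'; obtain ⟨g', rfl⟩ := cls_surj g'
    exact cls_eq.mpr (Eqv.interchange f' g' hf hg)
  unit_tensorObj X := rfl
  tensorObj_unit X := Cat.ext (List.append_nil X.word)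
  tensorObj_assoc X Y Z := Cat.ext (List.append_assoc X.word Y.word Z.word)
  unit_tensorHom f := by
    rw [eqToHom_refl, eqToHom_refl, Category.id_comp, Category.comp_id]
    obtain ⟨f, rfl⟩ := cls_surj f
    exact cls_eq.mpr (Eqv.unit_tensor f)
  tensorHom_unit f := by
    rw [← mor_eqTo, ← mor_eqTo]
    obtain ⟨f, rfl⟩ := cls_surj f
    exact cls_eq.mpr (Eqv.tensor_unit f)
  tensorHom_assoc f g h := by
    rw [← mor_eqTo, ← mor_eqTo]
    obtain ⟨f, rfl⟩ := cls_surj f; obtain ⟨g, rfl⟩ := cls_surj g; obtain ⟨h, rfl⟩ := cls_surj h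
    exact cls_eq.mpr (Eqv.tensor_assoc f g h)

end Supercat

/-! ### Enlarging a presentation -/

variable {P' : Presentation A K}

theorem homog_lift {S S' : Signature A} {φ : S.Gen → S'.Gen} {hd : ∀ g, S'.dom (φ g) = S.dom g}
    {hc : ∀ g, S'.cod (φ g) = S.cod g} (hp : ∀ g, S'.parity (φ g) = S.parity g) {X Y : List A}
    {f : Diagram S K X Y} {r : ZMod 2} (h : f.Homog r) : (Diagram.lift φ hd hc f).Homog r := by
  induction h with
  | gen g =>
    have := ((Homog.eqTo (K := K) (hd g).symm).comp (Homog.gen (φ g))).comp (Homog.eqTo (hc g))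
    rw [_root_.zero_add, _root_.add_zero, hp] at this
    exact this
  | eqTo h => exact Homog.eqTo h
  | comp _ _ h1 h2 => exact h1.comp h2
  | tensor _ _ h1 h2 => exact h1.tensor h2
  | zero r => exact Homog.zero r
  | add _ _ h1 h2 => exact h1.add h2
  | smul a _ h1 => exact h1.smul a

theorem eqv_lift {φ : P.sig.Gen → P'.sig.Gen} {hd : ∀ g, P'.sig.dom (φ g) = P.sig.dom g}
    {hc : ∀ g, P'.sig.cod (φ g) = P.sig.cod g} (hp : ∀ g, P'.sig.parity (φ g) = P.sig.parity g)
    (hr : ∀ {X Y : List A} {f g : Diagram P.sig K X Y}, P.Rel f g →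
      P'.Rel (f.lift φ hd hc) (g.lift φ hd hc))
    {X Y : List A} {f g : Diagram P.sig K X Y} (h : Eqv P f g) :
    Eqv P' (f.lift φ hd hc) (g.lift φ hd hc) := by
  induction h with
  | rel h => exact .rel (hr h)
  | refl f => exact .refl _
  | symm _ h => exact h.symm
  | trans _ _ h h' => exact h.trans h'
  | comp_congr _ _ h h' => exact .comp_congr h h'
  | tensor_congr _ _ h h' => exact .tensor_congr h h'
  | add_congr _ _ h h' => exact .add_congr h h'
  | smul_congr a _ h => exact .smul_congr a h
  | add_comm f g => exact .add_comm _ _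
  | add_assoc f g h => exact .add_assoc _ _ _
  | zero_add f => exact .zero_add _
  | neg_add f => exact .neg_add _
  | smul_add a f g => exact .smul_add _ _ _
  | add_smul a b f => exact .add_smul _ _ _
  | mul_smul a b f => exact .mul_smul _ _ _
  | one_smul f => exact .one_smul _
  | id_comp f => exact .id_comp _
  | comp_id f => exact .comp_id _
  | comp_assoc f g h => exact .comp_assoc _ _ _
  | comp_add f g g' => exact .comp_add _ _ _
  | add_comp f f' g => exact .add_comp _ _ _
  | comp_smul a f g => exact .comp_smul _ _ _
  | smul_comp a f g => exact .smul_comp _ _ _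
  | tensor_add f g g' => exact .tensor_add _ _ _
  | add_tensor f f' g => exact .add_tensor _ _ _
  | tensor_smul a f g => exact .tensor_smul _ _ _
  | smul_tensor a f g => exact .smul_tensor _ _ _
  | tensor_id X Y => exact .tensor_id X Y
  | interchange f' g' hf hg => exact .interchange _ _ (homog_lift hp hf) (homog_lift hp hg)
  | unit_tensor f => exact .unit_tensor _
  | tensor_unit f => exact .tensor_unit _
  | tensor_assoc f g h => exact .tensor_assoc _ _ _

/-- The monoidal superfunctor, identical on objects, from a presented supercategory to one with
more generators and relations. -/
def inclusion [NeZero (2 : K)] (φ : P.sig.Gen → P'.sig.Gen)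
    (hd : ∀ g, P'.sig.dom (φ g) = P.sig.dom g) (hc : ∀ g, P'.sig.cod (φ g) = P.sig.cod g)
    (hp : ∀ g, P'.sig.parity (φ g) = P.sig.parity g)
    (hr : ∀ {X Y : List A} {f g : Diagram P.sig K X Y}, P.Rel f g →
      P'.Rel (f.lift φ hd hc) (g.lift φ hd hc)) :
    MonoidalSuperfunctor K P.Cat P'.Cat where
  obj X := ⟨X.word⟩
  map {_ _} := Quotient.map (Diagram.lift φ hd hc) fun _ _ h => eqv_lift hp hr h
  map_id _ := rfl
  map_comp f g := by
    obtain ⟨f, rfl⟩ := cls_surj f; obtain ⟨g, rfl⟩ := cls_surj g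
    rfl
  map_add f g := by
    obtain ⟨f, rfl⟩ := cls_surj f; obtain ⟨g, rfl⟩ := cls_surj g
    rfl
  map_smul a f := by
    obtain ⟨f, rfl⟩ := cls_surj f
    rfl
  map_mem := by
    rintro _ _ _ _ ⟨f, hf, rfl⟩
    exact ⟨_, homog_lift hp hf, rfl⟩
  obj_unit := rfl
  obj_tensor _ _ := rfl
  map_tensor f g := by
    rw [eqToHom_refl, eqToHom_refl, Category.id_comp, Category.comp_id]
    obtain ⟨f, rfl⟩ := cls_surj f; obtain ⟨g, rfl⟩ := cls_surj g
    rfl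

end Presentation
end Presentations

/-! ## The quantum isomeric supercategories -/

section Isomeric

/-- The generating objects `↑` and `↓`. -/
inductive Arrow
  | up
  | down

/-- The generating morphisms of the quantum isomeric supercategory: the positive and the negative
up-crossing, the negative right crossing `↑ ⊗ ↓ ⟶ ↓ ⊗ ↑`, the left cap `↓ ⊗ ↑ ⟶ 𝟙`, the left cup
`𝟙 ⟶ ↑ ⊗ ↓`, and the (closed) Clifford token `↑ ⟶ ↑`. -/
inductive QGen
  | pos
  | neg
  | negRight
  | cap
  | cup
  | tok

open Arrow in
/-- Domains, codomains and parities of the generators: only the Clifford token is odd. -/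
def QSig : Signature Arrow where
  Gen := QGen
  dom
    | .pos => [up, up]
    | .neg => [up, up]
    | .negRight => [up, down]
    | .cap => [down, up]
    | .cup => []
    | .tok => [up]
  cod
    | .pos => [up, up]
    | .neg => [up, up]
    | .negRight => [down, up]
    | .cap => []
    | .cup => [up, down]
    | .tok => [up]
  parity
    | .tok => 1
    | _ => 0

namespace QSig

open Diagram Arrow

variable {K : Type}

/-- The generator `pos`. -/
def pos : Diagram QSig K [up, up] [up, up] := .gen (S := QSig) QGen.pos
/-- The generator `neg`. -/
def neg : Diagram QSig K [up, up] [up, up] := .gen (S := QSig) QGen.neg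
/-- The generator `negRight`. -/
def negRight : Diagram QSig K [up, down] [down, up] := .gen (S := QSig) QGen.negRight
/-- The generator `cap`. -/
def cap : Diagram QSig K [down, up] [] := .gen (S := QSig) QGen.cap
/-- The generator `cup`. -/
def cup : Diagram QSig K [] [up, down] := .gen (S := QSig) QGen.cup
/-- The generator `tok`. -/
def tok : Diagram QSig K [up] [up] := .gen (S := QSig) QGen.tok

/-- The positive left crossing `↓ ⊗ ↑ ⟶ ↑ ⊗ ↓`: a left cup on the right, a positive up-crossing
of the two middle strands, and a left cap on the left. -/
def posLeft : Diagram QSig K [down, up] [up, down] :=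
  comp (tensor (id [down, up]) cup :) (comp (Y := [down, up, up, down])
    (tensor (tensor (id [down]) pos :) (id [down]) :) (tensor cap (id [up, down]) :))

/-- The right cap `↑ ⊗ ↓ ⟶ 𝟙`: the negative right crossing followed by the left cap. -/
def rightCap : Diagram QSig K [up, down] [] := comp negRight cap

end QSig

variable {K : Type} [Field K]

open Diagram Arrow QSig in
/-- The defining relations of the quantum isomeric supercategory. -/
inductive QRel (z : K) : ∀ {X Y : List Arrow}, Diagram QSig K X Y → Diagram QSig K X Y → Prop
  | pos_neg : QRel z (comp pos neg) (id [up, up])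
  | neg_pos : QRel z (comp neg pos) (id [up, up])
  | negRight_posLeft : QRel z (comp negRight posLeft) (id [up, down])
  | posLeft_negRight : QRel z (comp posLeft negRight) (id [down, up])
  | braid : QRel z
      (comp (tensor pos (id [up]) :) (comp (tensor (id [up]) pos :) (tensor pos (id [up]) :)))
      (comp (tensor (id [up]) pos :) (comp (tensor pos (id [up]) :) (tensor (id [up]) pos :)))
  | skein : QRel z (add pos (smul (-1) neg)) (smul z (id [up, up]))
  | tok_tok : QRel z (comp tok tok) (smul (-1) (id [up]))
  | tok_pos : QRel z (comp (tensor tok (id [up]) :) pos) (comp pos (tensor (id [up]) tok :))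
  | tok_bubble : QRel z (comp cup (comp (tensor tok (id [down]) :) rightCap)) zero
  | bubble : QRel z (comp cup rightCap) zero
  | zigzag_up : QRel z (comp (tensor cup (id [up]) :) (tensor (id [up]) cap :)) (id [up])
  | zigzag_down : QRel z (comp (tensor (id [down]) cup :) (tensor cap (id [down]) :)) (id [down])

/-- The signature of the affine supercategory: one more odd generator, the open Clifford token
`none : ↑ ⟶ ↑`. -/
def AQSig : Signature Arrow where
  Gen := Option QGen
  dom
    | none => [Arrow.up]
    | some g => QSig.dom g
  cod
    | none => [Arrow.up]
    | some g => QSig.cod g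
  parity
    | none => 1
    | some g => QSig.parity g

namespace AQSig

/-- A diagram of the quantum isomeric supercategory, viewed in the affine supercategory. -/
def ofQ {X Y : List Arrow} (f : Diagram QSig K X Y) : Diagram AQSig K X Y :=
  f.lift (S' := AQSig) some (fun _ => rfl) (fun _ => rfl)

/-- The open Clifford token. -/
def dot : Diagram AQSig K [Arrow.up] [Arrow.up] := .gen (S := AQSig) (none : Option QGen)

end AQSig

open Diagram Arrow QSig AQSig in
/-- The defining relations of the quantum affine isomeric supercategory. -/
inductive AQRel (z : K) : ∀ {X Y : List Arrow}, Diagram AQSig K X Y → Diagram AQSig K X Y → Prop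
  | ofQ {X Y : List Arrow} {f g : Diagram QSig K X Y} : QRel z f g → AQRel z (ofQ f) (ofQ g)
  | dot_dot : AQRel z (comp dot dot) (smul (-1) (id [up]))
  | dot_pos : AQRel z (comp (tensor (id [up]) dot :) (ofQ pos)) (comp (ofQ pos) (tensor dot (id [up]) :))
  | dot_bubble :
      AQRel z (comp (ofQ cup) (comp (tensor dot (id [down]) :) (ofQ rightCap))) zero

namespace QSig

open Diagram

theorem homog_pos : (pos : Diagram QSig K _ _).Homog 0 := Homog.gen (S := QSig) QGen.pos
theorem homog_neg : (neg : Diagram QSig K _ _).Homog 0 := Homog.gen (S := QSig) QGen.neg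
theorem homog_negRight : (negRight : Diagram QSig K _ _).Homog 0 :=
  Homog.gen (S := QSig) QGen.negRight
theorem homog_cap : (cap : Diagram QSig K _ _).Homog 0 := Homog.gen (S := QSig) QGen.cap
theorem homog_cup : (cup : Diagram QSig K _ _).Homog 0 := Homog.gen (S := QSig) QGen.cup
theorem homog_tok : (tok : Diagram QSig K _ _).Homog 1 := Homog.gen (S := QSig) QGen.tok
theorem homog_id {S : Signature Arrow} (X : List Arrow) : (id X : Diagram S K _ _).Homog 0 :=
  Homog.eqTo rfl
theorem homog_posLeft : (posLeft : Diagram QSig K _ _).Homog 0 :=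
  Homog.comp (r := 0) (s := 0) (Homog.tensor (r := 0) (s := 0) (homog_id _) homog_cup)
    (Homog.comp (r := 0) (s := 0)
      (Homog.tensor (r := 0) (s := 0) (Homog.tensor (r := 0) (s := 0) (homog_id _) homog_pos)
        (homog_id _))
      (Homog.tensor (r := 0) (s := 0) homog_cap (homog_id _)))
theorem homog_rightCap : (rightCap : Diagram QSig K _ _).Homog 0 :=
  homog_negRight.comp homog_cap

end QSig

open QSig Diagram in
/-- The presentation of the quantum isomeric supercategory. -/
def QPres (z : K) : Presentation Arrow K where
  sig := QSig
  Rel := QRel z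
  homog h := by
    cases h with
    | pos_neg => exact ⟨0, homog_pos.comp homog_neg, homog_id _⟩
    | neg_pos => exact ⟨0, homog_neg.comp homog_pos, homog_id _⟩
    | negRight_posLeft => exact ⟨0, homog_negRight.comp homog_posLeft, homog_id _⟩
    | posLeft_negRight => exact ⟨0, homog_posLeft.comp homog_negRight, homog_id _⟩
    | braid =>
      have h1 := homog_pos.tensor (homog_id (K := K) (S := QSig) [Arrow.up])
      have h2 := (homog_id (K := K) (S := QSig) [Arrow.up]).tensor homog_pos
      exact ⟨0, Homog.comp (s := 0) h1 (Homog.comp (r := 0) h2 h1),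
        Homog.comp (s := 0) h2 (Homog.comp (r := 0) h1 h2)⟩
    | skein => exact ⟨0, homog_pos.add (homog_neg.smul _), (homog_id _).smul _⟩
    | tok_tok => exact ⟨0, homog_tok.comp homog_tok, (homog_id _).smul _⟩
    | tok_pos =>
      have h1 := homog_tok.tensor (homog_id (K := K) (S := QSig) [Arrow.up])
      have h2 := (homog_id (K := K) (S := QSig) [Arrow.up]).tensor homog_tok
      exact ⟨1, Homog.comp (r := 1) h1 homog_pos, Homog.comp (s := 1) homog_pos h2⟩
    | tok_bubble =>
      exact ⟨1, homog_cup.comp ((homog_tok.tensor (homog_id _)).comp homog_rightCap), .zero _⟩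
    | bubble => exact ⟨0, homog_cup.comp homog_rightCap, .zero _⟩
    | zigzag_up =>
      have h1 := homog_cup.tensor (homog_id (K := K) (S := QSig) [Arrow.up])
      have h2 := (homog_id (K := K) (S := QSig) [Arrow.up]).tensor homog_cap
      exact ⟨0, Homog.comp (r := 0) h1 h2, homog_id _⟩
    | zigzag_down =>
      have h1 := (homog_id (K := K) (S := QSig) [Arrow.down]).tensor homog_cup
      have h2 := homog_cap.tensor (homog_id (K := K) (S := QSig) [Arrow.down])
      exact ⟨0, Homog.comp (r := 0) h1 h2, homog_id _⟩

open QSig AQSig Diagram in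
/-- The presentation of the quantum affine isomeric supercategory. -/
def AQPres (z : K) : Presentation Arrow K where
  sig := AQSig
  Rel := AQRel z
  homog h := by
    have hd : (dot : Diagram AQSig K _ _).Homog 1 := Homog.gen (S := AQSig) (none : Option QGen)
    have hl : ∀ {X Y : List Arrow} {f : Diagram QSig K X Y} {r : ZMod 2}, f.Homog r →
        (ofQ f).Homog r := fun h =>
          Presentation.homog_lift (S := QSig) (S' := AQSig) (φ := (some : QGen → Option QGen))
            (hd := fun _ => rfl) (hc := fun _ => rfl) (fun _ => rfl) h
    cases h with
    | ofQ h =>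
      obtain ⟨r, h1, h2⟩ := (QPres z).homog h
      exact ⟨r, hl h1, hl h2⟩
    | dot_dot => exact ⟨0, hd.comp hd, (homog_id _).smul _⟩
    | dot_pos =>
      have h1 := (homog_id (K := K) (S := AQSig) [Arrow.up]).tensor hd
      have h2 := hd.tensor (homog_id (K := K) (S := AQSig) [Arrow.up])
      exact ⟨1, Homog.comp (r := 1) h1 (hl homog_pos), Homog.comp (s := 1) (hl homog_pos) h2⟩
    | dot_bubble =>
      exact ⟨1, (hl homog_cup).comp ((hd.tensor (homog_id _)).comp (hl homog_rightCap)), .zero _⟩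

/-- The quantum isomeric supercategory `Q(z)`. -/
abbrev Qcat (z : K) : Type := (QPres z).Cat

/-- The quantum affine isomeric supercategory `AQ(z)`. -/
abbrev AQcat (z : K) : Type := (AQPres z).Cat

/-- The canonical monoidal superfunctor `Q(z) → AQ(z)`. -/
def QtoAQ [NeZero (2 : K)] (z : K) : MonoidalSuperfunctor K (Qcat z) (AQcat z) :=
  Presentation.inclusion (P := QPres z) (P' := AQPres z) (some : QGen → Option QGen)
    (fun _ => rfl) (fun _ => rfl) (fun _ => rfl) (fun h => AQRel.ofQ h)

end Isomeric

/-! ## The quantized enveloping superalgebra -/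

noncomputable section QuantumGroup

/-- The index set `{±1, …, ±n}`. -/
abbrev Idx (n : ℕ) : Type := ↥((Finset.Icc (-(n : ℤ)) n).erase 0)

instance (n : ℕ) : InvolutiveNeg (Idx n) where
  neg i := ⟨-i.1, by
    have := i.2
    simp only [Finset.mem_erase, Finset.mem_Icc] at this ⊢
    omega⟩
  neg_neg i := Subtype.ext (neg_neg i.1)

@[simp] theorem Idx.coe_neg {n : ℕ} (i : Idx n) : ((-i : Idx n) : ℤ) = -(i : ℤ) := rfl

theorem Idx.ne_zero {n : ℕ} (i : Idx n) : (i : ℤ) ≠ 0 := (Finset.mem_erase.mp i.2).1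

/-- The parity of an index: positive indices are even, negative ones odd. -/
def par {n : ℕ} (i : Idx n) : ZMod 2 := if (0 : ℤ) < i then 0 else 1

/-- `φ(i, j) = δ_{|i|,|j|} sgn(j)`. -/
def phi {n : ℕ} (i j : Idx n) : ℤ := if (i : ℤ).natAbs = (j : ℤ).natAbs then Int.sign j else 0

variable {K : Type} [Field K] (q : K) {n : ℕ}

/-- The coefficient of `E_ij ⊗ E_kl` in
`Θ = ∑_{i,j} q^φ(i,j) E_ii ⊗ E_jj + (q - q⁻¹) ∑_{i<j} (-1)^p(i) (E_ji + E_{-j,-i}) ⊗ E_ij`. -/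
def theta (i j k l : Idx n) : K :=
  (if i = j ∧ k = l then q ^ phi i k else 0) +
    (if k < l ∧ ((i = l ∧ j = k) ∨ (i = -l ∧ j = -k)) then ksgn K (par k) 1 * (q - q⁻¹) else 0)

/-- The generators of the quantized enveloping superalgebra: pairs `i ≤ j`. -/
abbrev UGen (n : ℕ) : Type := {x : Idx n × Idx n // x.1 ≤ x.2}

variable (K) in
/-- The free generator `u_ij`, with `u_ij = 0` for `i > j`. -/
def freeU (i j : Idx n) : FreeAlgebra K (UGen n) :=
  if h : i ≤ j then FreeAlgebra.ι K ⟨(i, j), h⟩ else 0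

variable (n) in
/-- The defining relations of the quantized enveloping superalgebra of type Q: the relations
`u_ii u_{-i,-i} = 1`, and `L¹² L¹³ Θ²³ = Θ²³ L¹³ L¹²` for `L = ∑ u_ij ⊗ E_ij`, where `u_ij` and `E_ij`
have parity `p(i) + p(j)`. The latter is written through the coefficients of `E_ac ⊗ E_bd`, the
product being `(x ⊗ y)(x' ⊗ y') = (-1)^(|y||x'|) xx' ⊗ yy'`:
`L¹² L¹³ Θ²³` is the sum of `(-1)^((p(b)+p(l))(p(a)+p(c))) θ_{jc,ld} u_aj u_bl ⊗ E_ac ⊗ E_bd`, and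
`Θ²³ L¹³ L¹²` is the sum of `(-1)^((p(b)+p(l))(p(j)+p(c))) θ_{aj,bl} u_ld u_jc ⊗ E_ac ⊗ E_bd`. -/
inductive UqRel : FreeAlgebra K (UGen n) → FreeAlgebra K (UGen n) → Prop
  | diag (i : Idx n) : UqRel (freeU K i i * freeU K (-i) (-i)) 1
  | rll (a b c d : Idx n) : UqRel
      (∑ j, ∑ l, (ksgn K (par b + par l) (par a + par c) * theta q j c l d) •
        (freeU K a j * freeU K b l))
      (∑ j, ∑ l, (ksgn K (par b + par l) (par j + par c) * theta q a j b l) •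
        (freeU K l d * freeU K j c))

variable (n) in
/-- The quantized enveloping superalgebra `U_q(𝔮_n)`. -/
abbrev Uq : Type := RingQuot (UqRel q n)

namespace Uq

/-- The generators `u_ij` of `U_q`. -/
def u (i j : Idx n) : Uq q n := RingQuot.mkAlgHom K (UqRel q n) (freeU K i j)

/-- The part of parity `r` of `U_q`: the span of the products of generators `u_ij` whose total
parity is `r`, the parity of `u_ij` being `p(i) + p(j)`. -/
def gr (r : ZMod 2) : Submodule K (Uq q n) :=
  Submodule.span K {x | ∃ w : List (Idx n × Idx n),
    x = (w.map fun y => u q y.1 y.2).prod ∧ (w.map fun y => par y.1 + par y.2).sum = r}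

theorem u_mem_gr (i j : Idx n) : u q i j ∈ gr q (par i + par j) :=
  Submodule.subset_span ⟨[(i, j)], by simp, by simp⟩

theorem u_of_lt {i j : Idx n} (h : j < i) : u q i j = 0 := by
  simp [u, freeU, not_le.mpr h]

theorem u_diag (i : Idx n) : u q i i * u q (-i) (-i) = 1 := by
  rw [u, u, ← map_mul, ← map_one (RingQuot.mkAlgHom K (UqRel q n))]
  exact RingQuot.mkAlgHom_rel K (UqRel.diag i)

theorem u_rll (a b c d : Idx n) :
    ∑ j, ∑ l, (ksgn K (par b + par l) (par a + par c) * theta q j c l d) • (u q a j * u q b l) =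
      ∑ j, ∑ l, (ksgn K (par b + par l) (par j + par c) * theta q a j b l) •
        (u q l d * u q j c) := by
  have := RingQuot.mkAlgHom_rel K (UqRel.rll (q := q) a b c d)
  simp only [map_sum, map_smul, map_mul] at this
  exact this

end Uq

/-- A supermodule over `U_q(𝔮_n)`. -/
structure SMod (q : K) (n : ℕ) where
  carrier : Type u
  [addCommGroup : AddCommGroup carrier]
  [module : Module K carrier]
  [superspace : Superspace K carrier]
  ρ : Uq q n →ₐ[K] Module.End K carrier
  ρ_mem {r s : ZMod 2} {x : Uq q n} {m : carrier} : x ∈ Uq.gr q r → m ∈ Par K carrier s →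
    ρ x m ∈ Par K carrier (r + s)

namespace SMod

variable {q}

instance : CoeSort (SMod.{u} q n) (Type u) := ⟨SMod.carrier⟩

attribute [instance] addCommGroup module superspace

/-- The homomorphisms `f : M → N` of parity `r`: linear maps of parity `r` with
`f (x m) = (-1)^(r |x|) x f(m)`. -/
def homPar (M : SMod.{u} q n) (N : SMod.{v} q n) (r : ZMod 2) : Submodule K (M →ₗ[K] N) where
  carrier := {f | (∀ s, ∀ m ∈ Par K M s, f m ∈ Par K N (r + s)) ∧
    ∀ s, ∀ x ∈ Uq.gr q s, ∀ m : M, f (M.ρ x m) = ksgn K r s • N.ρ x (f m)}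
  add_mem' := by
    rintro f g ⟨h1, h2⟩ ⟨h3, h4⟩
    refine ⟨fun s m hm => add_mem (h1 s m hm) (h3 s m hm), fun s x hx m => ?_⟩
    simp [h2 s x hx, h4 s x hx]
  zero_mem' := ⟨fun s m _ => zero_mem _, fun s x _ m => by simp⟩
  smul_mem' := by
    rintro a f ⟨h1, h2⟩
    refine ⟨fun s m hm => Submodule.smul_mem _ a (h1 s m hm), fun s x hx m => ?_⟩
    simp only [LinearMap.smul_apply, h2 s x hx, map_smul, smul_comm a]

theorem homPar_disjoint (M : SMod.{u} q n) (N : SMod.{v} q n) :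
    Disjoint (homPar M N 0) (homPar M N 1) := by
  rw [Submodule.disjoint_def]
  intro f h0 h1
  refine ext_par (K := K) fun s m hm => ?_
  have hd := Submodule.disjoint_def.mp (Superspace.isCompl (K := K) (M := N)).disjoint
  have a0 := h0.1 s m hm
  have a1 := h1.1 s m hm
  rcases zmod2_cases s with rfl | rfl
  · exact hd _ a0 a1
  · exact hd _ a1 a0

/-- The homomorphisms `M → N`, even and odd: sums `f = f₀ + f₁` with `f_r` of parity `r`. -/
def Hom (M : SMod.{u} q n) (N : SMod.{v} q n) : Submodule K (M →ₗ[K] N) :=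
  homPar M N 0 ⊔ homPar M N 1

theorem homPar_id (M : SMod.{u} q n) : LinearMap.id ∈ homPar M M 0 :=
  ⟨fun s m hm => by simpa using hm, fun s x _ m => by simp⟩

theorem homPar_comp {M N P : SMod.{u} q n} {r s : ZMod 2} {f : M →ₗ[K] N} {g : N →ₗ[K] P}
    (hf : f ∈ homPar M N r) (hg : g ∈ homPar N P s) : g.comp f ∈ homPar M P (r + s) := by
  refine ⟨fun t m hm => ?_, fun t x hx m => ?_⟩
  · have := hg.1 _ _ (hf.1 t m hm)
    rwa [← add_assoc, add_comm s r] at this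
  · simp only [LinearMap.comp_apply]
    rw [hf.2 t x hx m, map_smul, hg.2 t x hx, smul_smul, ksgn_add_left]

theorem hom_comp {M N P : SMod.{u} q n} {f : M →ₗ[K] N} {g : N →ₗ[K] P}
    (hf : f ∈ Hom M N) (hg : g ∈ Hom N P) : g.comp f ∈ Hom M P := by
  refine sup01_induction (homPar M N) (motive := fun f => g.comp f ∈ Hom M P)
    (fun r f hf => ?_) (fun a b ha hb => ?_) hf
  · refine sup01_induction (homPar N P) (motive := fun g => g.comp f ∈ Hom M P)
      (fun s g hg => ?_) (fun a b ha hb => ?_) hg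
    · exact le_sup01 (homPar M P) _ (homPar_comp hf hg)
    · rw [LinearMap.add_comp]; exact add_mem ha hb
  · rw [LinearMap.comp_add]; exact add_mem ha hb

instance : Category (SMod.{u} q n) where
  Hom M N := ↥(Hom M N)
  id M := ⟨LinearMap.id, le_sup01 (homPar M M) 0 (homPar_id M)⟩
  comp f g := ⟨g.1.comp f.1, hom_comp f.2 g.2⟩

/-- The linear map underlying a morphism. -/
def lin {M N : SMod.{u} q n} (f : M ⟶ N) : M →ₗ[K] N := f.1

theorem lin_ext {M N : SMod.{u} q n} {f g : M ⟶ N} (h : lin f = lin g) : f = g := Subtype.ext h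

instance : Preadditive (SMod.{u} q n) where
  homGroup M N := inferInstanceAs (AddCommGroup ↥(Hom M N))
  add_comp _ _ _ _ _ _ := lin_ext (LinearMap.comp_add _ _ _)
  comp_add _ _ _ _ _ _ := lin_ext (LinearMap.add_comp _ _ _)

instance : Linear K (SMod.{u} q n) where
  homModule M N := inferInstanceAs (Module K ↥(Hom M N))
  smul_comp _ _ _ _ _ _ := lin_ext (LinearMap.comp_smul _ _ _)
  comp_smul _ _ _ _ _ _ := lin_ext (LinearMap.smul_comp _ _ _)

/-- The supercategory of `U_q(𝔮_n)`-supermodules. -/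
instance : Supercategory K (SMod.{u} q n) where
  hom M N := Superspace.ofDisjoint (homPar M N) (homPar_disjoint M N)
  id_mem M := homPar_id M
  comp_mem hf hg := homPar_comp hf hg

/-- The operator by which `u_ij` acts. -/
def act (M : SMod.{u} q n) (i j : Idx n) : Module.End K M := M.ρ (Uq.u q i j)

end SMod

/-! ### Constructing supermodules from operators -/

section Signs

/-- The sign `(-1)^(r s)` as an integer. -/
def isgn (r s : ZMod 2) : ℤ := if r = 1 ∧ s = 1 then -1 else 1

theorem ksgn_cast (r s : ZMod 2) : ksgn K r s = (isgn r s : K) := by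
  unfold ksgn isgn; split_ifs <;> simp

variable {M : Type*} [AddCommGroup M] [Module K M] [Superspace K M]

variable (K M) in
/-- The power `inv^r` of the parity involution: `m ↦ (-1)^(r |m|) m`. -/
def invP (r : ZMod 2) : Module.End K M := if r = 0 then 1 else inv K M

theorem invP_zero : invP K M 0 = 1 := if_pos rfl
theorem invP_one : invP K M 1 = inv K M := if_neg one_ne_zero

theorem invP_of_mem (r : ZMod 2) {s : ZMod 2} {m : M} (h : m ∈ Par K M s) :
    invP K M r m = ksgn K r s • m := by
  rcases zmod2_cases r with rfl | rfl
  · simp [invP_zero]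
  · rw [invP_one, inv_of_mem h, ksgn_comm]

theorem inv_mul_inv : inv K M * inv K M = 1 := LinearMap.ext inv_inv

theorem invP_add (r s : ZMod 2) : invP K M (r + s) = invP K M r * invP K M s := by
  rcases zmod2_cases r with rfl | rfl <;> rcases zmod2_cases s with rfl | rfl <;>
    simp [invP_zero, invP_one, inv_mul_inv, show (1 + 1 : ZMod 2) = 0 from rfl]

theorem invP_mul_self (r : ZMod 2) : invP K M r * invP K M r = 1 := by
  rw [← invP_add, zmod2_add_self, invP_zero]

/-- The operator `A` has parity `r`. -/
def HasPar (A : Module.End K M) (r : ZMod 2) : Prop :=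
  ∀ s, invP K M s * A = ksgn K r s • (A * invP K M s)

theorem hasPar_of_inv {A : Module.End K M} {r : ZMod 2}
    (h : inv K M * A = ksgn K r 1 • (A * inv K M)) : HasPar A r := by
  intro s
  rcases zmod2_cases s with rfl | rfl
  · simp [invP_zero]
  · rwa [invP_one]

theorem hasPar_of_mem {A : Module.End K M} {r : ZMod 2}
    (h : ∀ s, ∀ m ∈ Par K M s, A m ∈ Par K M (r + s)) : HasPar A r := by
  intro t
  refine ext_par (K := K) fun s m hm => ?_
  simp only [Module.End.mul_apply, LinearMap.smul_apply]
  rw [invP_of_mem t (h s m hm), invP_of_mem t hm, map_smul, smul_smul, ksgn_add_right,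
    ksgn_comm t r]

theorem HasPar.mem [NeZero (2 : K)] {A : Module.End K M} {r : ZMod 2} (h : HasPar A r)
    {s : ZMod 2} {m : M} (hm : m ∈ Par K M s) : A m ∈ Par K M (r + s) := by
  refine mem_of_inv (K := K) ?_
  have := LinearMap.congr_fun (h 1) m
  simp only [Module.End.mul_apply, LinearMap.smul_apply, invP_one] at this
  rw [this, inv_of_mem hm, map_smul, smul_smul, ksgn_add_left]

theorem HasPar.mul {A B : Module.End K M} {r s : ZMod 2} (hA : HasPar A r) (hB : HasPar B s) :
    HasPar (A * B) (r + s) := by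
  intro t
  rw [← mul_assoc, hA t, smul_mul_assoc, mul_assoc, hB t, mul_smul_comm, smul_smul, mul_assoc,
    ksgn_add_left]

theorem hasPar_one : HasPar (1 : Module.End K M) 0 := fun t => by simp

theorem hasPar_invP (r : ZMod 2) : HasPar (invP K M r) 0 := fun t => by
  rw [ksgn_zero_left, one_smul, ← invP_add, ← invP_add, add_comm]

end Signs

section RLL

variable {R : Type*} [Ring R] [Algebra K R]

/-- The matrix of `X ⊗ 1`, indexed by pairs. -/
def mat1 (X : Matrix (Idx n) (Idx n) R) : Matrix (Idx n × Idx n) (Idx n × Idx n) R :=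
  fun x y => if x.2 = y.2 then X x.1 y.1 else 0

variable (K) in
/-- The matrix of `1 ⊗ X`, indexed by pairs, with the sign for passing the first factor. -/
def mat2 (X : Matrix (Idx n) (Idx n) R) : Matrix (Idx n × Idx n) (Idx n × Idx n) R :=
  fun x y => if x.1 = y.1 then ksgn K (par x.2 + par y.2) (par x.1) • X x.2 y.2 else 0

variable (n R) in
/-- The matrix of `Θ` on `V ⊗ V`, indexed by pairs. -/
def matTheta : Matrix (Idx n × Idx n) (Idx n × Idx n) R :=
  fun x y => algebraMap K R (ksgn K (par x.2 + par y.2) (par y.1) * theta q x.1 y.1 x.2 y.2)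

theorem mat1_mul_mat2 (X Y : Matrix (Idx n) (Idx n) R) (a b c d : Idx n) :
    (mat1 X * mat2 K Y) (a, b) (c, d) = ksgn K (par b + par d) (par c) • (X a c * Y b d) := by
  simp [Matrix.mul_apply, Fintype.sum_prod_type, mat1, mat2]

theorem mat2_mul_mat1 (X Y : Matrix (Idx n) (Idx n) R) (a b c d : Idx n) :
    (mat2 K Y * mat1 X) (a, b) (c, d) = ksgn K (par b + par d) (par a) • (Y b d * X a c) := by
  simp [Matrix.mul_apply, Fintype.sum_prod_type, mat1, mat2]

theorem mat1_mul (X Y : Matrix (Idx n) (Idx n) R) : mat1 (X * Y) = mat1 X * mat1 Y := by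
  ext ⟨a, b⟩ ⟨c, d⟩
  by_cases h : b = d <;> simp [Matrix.mul_apply, Fintype.sum_prod_type, mat1, h]

theorem mat2_mul (X Y : Matrix (Idx n) (Idx n) R) : mat2 K (X * Y) = mat2 K X * mat2 K Y := by
  ext ⟨a, b⟩ ⟨c, d⟩
  by_cases h : a = c
  · subst h
    rw [Matrix.mul_apply, Fintype.sum_prod_type, Finset.sum_eq_single a]
    · simp only [mat2, ↓reduceIte, Matrix.mul_apply, Finset.smul_sum, smul_mul_smul_comm,
        ← ksgn_add_left]
      refine Finset.sum_congr rfl fun k _ => ?_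
      rw [show par b + par k + (par k + par d) = par b + par d by
        rw [add_assoc, ← add_assoc (par k), zmod2_add_self, zero_add]]
    · intro k _ hk
      simp [mat2, hk]
    · simp
  · simp [Matrix.mul_apply, Fintype.sum_prod_type, mat2, h]

theorem mat1_one : mat1 (1 : Matrix (Idx n) (Idx n) R) = 1 := by
  ext ⟨a, b⟩ ⟨c, d⟩
  by_cases h : b = d <;> by_cases h' : a = c <;> simp [mat1, Matrix.one_apply, h, h']

theorem mat2_one : mat2 K (1 : Matrix (Idx n) (Idx n) R) = 1 := by
  ext ⟨a, b⟩ ⟨c, d⟩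
  by_cases h : b = d <;> by_cases h' : a = c <;> simp [mat2, Matrix.one_apply, h, h',
    zmod2_add_self]

variable (K) in
/-- The relation `X¹² X¹³ Θ²³ = Θ²³ X¹³ X¹²`. -/
def RLL (X : Matrix (Idx n) (Idx n) R) : Prop :=
  mat1 X * mat2 K X * matTheta q n R = matTheta q n R * (mat2 K X * mat1 X)

theorem rll_iff (X : Matrix (Idx n) (Idx n) R) : RLL K q X ↔ ∀ a b c d : Idx n,
    ∑ j, ∑ l, (ksgn K (par b + par l) (par j) * ksgn K (par l + par d) (par c) *
      theta q j c l d) • (X a j * X b l) =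
    ∑ j, ∑ l, (ksgn K (par b + par l) (par j) * ksgn K (par l + par d) (par j) *
      theta q a j b l) • (X l d * X j c) := by
  rw [RLL, ← Matrix.ext_iff]
  simp only [Prod.forall]
  refine forall₄_congr fun a b c d => ?_
  rw [Matrix.mul_apply, Matrix.mul_apply]
  simp only [Fintype.sum_prod_type, mat1_mul_mat2, mat2_mul_mat1, matTheta]
  refine Eq.congr (Finset.sum_congr rfl fun j _ => Finset.sum_congr rfl fun l _ => ?_)
    (Finset.sum_congr rfl fun j _ => Finset.sum_congr rfl fun l _ => ?_)
  · rw [← Algebra.commutes, ← Algebra.smul_def, smul_smul]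
    congr 1; ring
  · rw [← Algebra.smul_def, smul_smul]
    congr 1; ring

theorem theta_eq_zero {i j k l : Idx n} (h : par i + par j ≠ par k + par l) :
    theta q i j k l = 0 := by
  have hneg : ∀ m : Idx n, par (-m) = par m + 1 := by
    intro m
    have := m.ne_zero
    rcases lt_or_gt_of_ne this with h | h
    · rw [par, if_pos (by simpa using h), par, if_neg (by omega)]; rfl
    · rw [par, if_neg (by simp; omega), par, if_pos h]; rfl
  have e1 : ∀ a b : ZMod 2, a + b = b + a := by decide
  have e2 : ∀ a b : ZMod 2, (b + 1) + (a + 1) = a + b := by decide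
  rw [theta, if_neg, if_neg, add_zero]
  · rintro ⟨-, ⟨rfl, rfl⟩ | ⟨rfl, rfl⟩⟩
    · exact h (e1 _ _)
    · exact h (by rw [hneg, hneg]; exact e2 _ _)
  · rintro ⟨rfl, rfl⟩
    exact h (by rw [zmod2_add_self, zmod2_add_self])

end RLL

/-- The matrix of the operators by which `L = ∑ u_ij ⊗ E_ij` acts on `M ⊗ V`, if `u_ij` acts on `M` by
the operator `A i j`: `L (m ⊗ v_j) = ∑_i (-1)^((p(i)+p(j))|m|) u_ij m ⊗ v_i`. -/
def lmat {M : Type*} [AddCommGroup M] [Module K M] [Superspace K M]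
    (A : Idx n → Idx n → Module.End K M) : Matrix (Idx n) (Idx n) (Module.End K M) :=
  fun i j => A i j * invP K M (par i + par j)

theorem rll_lmat_iff {M : Type*} [AddCommGroup M] [Module K M] [Superspace K M]
    {A : Idx n → Idx n → Module.End K M} (hA : ∀ i j, HasPar (A i j) (par i + par j)) :
    RLL K q (lmat A) ↔ ∀ a b c d : Idx n,
      ∑ j, ∑ l, (ksgn K (par b + par l) (par a + par c) * theta q j c l d) • (A a j * A b l) =
        ∑ j, ∑ l, (ksgn K (par b + par l) (par j + par c) * theta q a j b l) •
          (A l d * A j c) := by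
  rw [rll_iff]
  refine forall₄_congr fun a b c d => ?_
  have key : ∀ i j k l : Idx n, lmat A i j * lmat A k l =
      ksgn K (par i + par j) (par k + par l) •
        ((A i j * A k l) * invP K M (par i + par j + (par k + par l))) := by
    intro i j k l
    rw [show lmat A i j * lmat A k l = A i j * invP K M (par i + par j) *
      (A k l * invP K M (par k + par l)) from rfl, mul_assoc, ← mul_assoc (invP K M _), hA k l, smul_mul_assoc, mul_smul_comm,
      mul_assoc, ← invP_add, ← mul_assoc, ksgn_comm]
  set D := ksgn K (par b + par d) (par c) • invP K M (par a + par c + (par b + par d)) with hD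
  have hDD : D * D = 1 := by
    rw [hD, smul_mul_smul_comm, ksgn_mul_self, invP_mul_self, one_smul]
  have h1 : ∑ j, ∑ l, (ksgn K (par b + par l) (par j) * ksgn K (par l + par d) (par c) *
      theta q j c l d) • (lmat A a j * lmat A b l) =
      (∑ j, ∑ l, (ksgn K (par b + par l) (par a + par c) * theta q j c l d) • (A a j * A b l)) *
        D := by
    simp only [Finset.sum_mul]
    refine Finset.sum_congr rfl fun j _ => Finset.sum_congr rfl fun l _ => ?_
    by_cases h : par j + par c = par l + par d
    · rw [key, hD, smul_mul_smul_comm, smul_smul]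
      have e : ∀ a b c d j l : ZMod 2, j + c = l + d → isgn (b + l) j * isgn (l + d) c *
        isgn (a + j) (b + l) = isgn (b + l) (a + c) * isgn (b + d) c := by decide
      have e' : ∀ a b c d j l : ZMod 2, j + c = l + d → a + j + (b + l) = a + c + (b + d) := by
        decide
      rw [e' _ _ _ _ _ _ h]
      congr 1
      have := congrArg (Int.cast : ℤ → K) (e (par a) (par b) (par c) (par d) (par j) (par l) h)
      push_cast [← ksgn_cast] at this
      linear_combination (theta q j c l d) * this
    · rw [theta_eq_zero q h]; simp
  have h2 : ∑ j, ∑ l, (ksgn K (par b + par l) (par j) * ksgn K (par l + par d) (par j) *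
      theta q a j b l) • (lmat A l d * lmat A j c) =
      (∑ j, ∑ l, (ksgn K (par b + par l) (par j + par c) * theta q a j b l) • (A l d * A j c)) *
        D := by
    simp only [Finset.sum_mul]
    refine Finset.sum_congr rfl fun j _ => Finset.sum_congr rfl fun l _ => ?_
    by_cases h : par a + par j = par b + par l
    · rw [key, hD, smul_mul_smul_comm, smul_smul]
      have e : ∀ a b c d j l : ZMod 2, a + j = b + l → isgn (b + l) j * isgn (l + d) j *
        isgn (l + d) (j + c) = isgn (b + l) (j + c) * isgn (b + d) c := by decide
      have e' : ∀ a b c d j l : ZMod 2, a + j = b + l → l + d + (j + c) = a + c + (b + d) := by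
        decide
      rw [e' _ _ _ _ _ _ h]
      congr 1
      have := congrArg (Int.cast : ℤ → K) (e (par a) (par b) (par c) (par d) (par j) (par l) h)
      push_cast [← ksgn_cast] at this
      linear_combination (theta q a j b l) * this
    · rw [theta_eq_zero q h]; simp
  rw [h1, h2]
  exact ⟨fun h => by simpa [mul_assoc, hDD] using congrArg (· * D) h, fun h => by rw [h]⟩

namespace SMod

variable {q}

theorem act_hasPar (M : SMod.{u} q n) (i j : Idx n) : HasPar (M.act i j) (par i + par j) :=
  hasPar_of_mem fun _ _ hm => M.ρ_mem (Uq.u_mem_gr q i j) hm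

theorem act_of_lt (M : SMod.{u} q n) {i j : Idx n} (h : j < i) : M.act i j = 0 := by
  rw [act, Uq.u_of_lt q h, map_zero]

theorem act_diag (M : SMod.{u} q n) (i : Idx n) : M.act i i * M.act (-i) (-i) = 1 := by
  rw [act, act, ← map_mul, Uq.u_diag, map_one]

theorem rll_act (M : SMod.{u} q n) : RLL K q (lmat M.act) := by
  rw [rll_lmat_iff q M.act_hasPar]
  intro a b c d
  have := congrArg M.ρ (Uq.u_rll q a b c d)
  simp only [map_sum, map_smul, map_mul] at this
  exact this

variable [NeZero (2 : K)]

/-- A supermodule over `U_q(𝔮_n)` on a superspace `M`, given by operators `A i j` by which the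
generators `u_ij` act. -/
def ofOps (q : K) (M : Type u) [AddCommGroup M] [Module K M] [Superspace K M]
    (A : Idx n → Idx n → Module.End K M) (hpar : ∀ i j, HasPar (A i j) (par i + par j))
    (htri : ∀ i j, j < i → A i j = 0) (hdiag : ∀ i, A i i * A (-i) (-i) = 1)
    (hrll : RLL K q (lmat A)) : SMod.{u} q n :=
  let f : FreeAlgebra K (UGen n) →ₐ[K] Module.End K M := FreeAlgebra.lift K fun x => A x.1.1 x.1.2
  have hf : ∀ i j, f (freeU K i j) = A i j := fun i j => by
    unfold freeU
    split_ifs with h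
    · exact FreeAlgebra.lift_ι_apply _ _
    · rw [map_zero, htri i j (not_le.mp h)]
  have hrel : ∀ ⦃x y⦄, UqRel q n x y → f x = f y := fun x y h => by
    cases h with
    | diag i => rw [map_mul, map_one, hf, hf, hdiag]
    | rll a b c d =>
      simp only [map_sum, map_smul, map_mul, hf]
      exact (rll_lmat_iff q hpar).mp hrll a b c d
  { carrier := M
    ρ := RingQuot.liftAlgHom K ⟨f, hrel⟩
    ρ_mem := by
      intro r s x m hx hm
      refine HasPar.mem ?_ hm
      refine Submodule.span_induction ?_ ?_ ?_ ?_ hx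
      · rintro _ ⟨w, rfl, rfl⟩
        clear hx
        induction w with
        | nil => simpa using hasPar_one
        | cons y w ih =>
          simp only [List.map_cons, List.prod_cons, List.sum_cons, map_mul]
          refine HasPar.mul ?_ ih
          rw [Uq.u, RingQuot.liftAlgHom_mkAlgHom_apply]
          exact (hf y.1 y.2) ▸ hpar y.1 y.2
      · intro t; simp
      · intro x y _ _ hx hy t
        simp only [map_add, mul_add, add_mul, smul_add, hx t, hy t]
      · intro a x _ hx t
        simp only [map_smul, mul_smul_comm, smul_mul_assoc, hx t, smul_comm a] }

theorem ofOps_act (M : Type u) [AddCommGroup M] [Module K M] [Superspace K M]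
    (A : Idx n → Idx n → Module.End K M) (hpar htri hdiag hrll) (i j : Idx n) :
    (ofOps q M A hpar htri hdiag hrll).act i j = A i j := by
  change RingQuot.liftAlgHom K _ (RingQuot.mkAlgHom K (UqRel q n) (freeU K i j)) = A i j
  rw [RingQuot.liftAlgHom_mkAlgHom_apply]
  unfold freeU
  split_ifs with h
  · exact FreeAlgebra.lift_ι_apply _ _
  · rw [map_zero, htri i j (not_le.mp h)]

/-- A linear map of parity `r` that supercommutes with the generators is a homomorphism. -/
theorem mem_homPar {M : SMod.{u} q n} {N : SMod.{v} q n} {r : ZMod 2} {f : M →ₗ[K] N}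
    (h1 : ∀ s, ∀ m ∈ Par K M s, f m ∈ Par K N (r + s))
    (h2 : ∀ i j m, f (M.act i j m) = ksgn K r (par i + par j) • N.act i j (f m)) :
    f ∈ homPar M N r := by
  refine ⟨h1, fun s x hx => ?_⟩
  refine Submodule.span_induction ?_ ?_ ?_ ?_ hx
  · rintro _ ⟨w, rfl, rfl⟩
    clear hx
    induction w with
    | nil => simp
    | cons y w ih =>
      intro m
      simp only [List.map_cons, List.prod_cons, List.sum_cons, map_mul, Module.End.mul_apply]
      rw [ksgn_add_right, mul_smul, ← map_smul, ← ih]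
      exact h2 y.1 y.2 _
  · simp
  · intro x y _ _ hx hy m
    simp only [map_add, LinearMap.add_apply, smul_add, hx m, hy m]
  · intro a x _ hx m
    simp only [map_smul, LinearMap.smul_apply, hx m, smul_comm a]

end SMod

/-! ### Tensor products -/

section HasParLemmas

variable {M : Type*} [AddCommGroup M] [Module K M] [Superspace K M]

theorem HasPar.smul {A : Module.End K M} {r : ZMod 2} (h : HasPar A r) (a : K) :
    HasPar (a • A) r := fun t => by rw [mul_smul_comm, h t, smul_mul_assoc, smul_comm]

theorem HasPar.add {A B : Module.End K M} {r : ZMod 2} (hA : HasPar A r) (hB : HasPar B r) :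
    HasPar (A + B) r := fun t => by rw [mul_add, hA t, hB t, add_mul, smul_add]

theorem hasPar_zero (r : ZMod 2) : HasPar (0 : Module.End K M) r := fun t => by simp

theorem HasPar.sum {ι : Type*} {s : Finset ι} {A : ι → Module.End K M} {r : ZMod 2}
    (h : ∀ k, HasPar (A k) r) : HasPar (∑ k ∈ s, A k) r := by
  classical
  induction s using Finset.induction_on with
  | empty => simpa using hasPar_zero r
  | insert k s hk ih => rw [Finset.sum_insert hk]; exact (h k).add ih

theorem par_add_par (r s t : ZMod 2) : r + s + (s + t) = r + t := by
  rw [add_assoc, ← add_assoc s, zmod2_add_self, zero_add]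

end HasParLemmas

section TensorSpaces

variable [NeZero (2 : K)] {W : Type*} [AddCommGroup W] [Module K W] [Superspace K W]
  {M : Type*} [AddCommGroup M] [Module K M] [Superspace K M]

theorem map_inv_inv (x : W ⊗[K] M) :
    TensorProduct.map (inv K W) (inv K M) (TensorProduct.map (inv K W) (inv K M) x) = x := by
  induction x using TensorProduct.induction_on with
  | zero => simp
  | tmul w m => simp [inv_inv]
  | add x y hx hy => rw [map_add, map_add, hx, hy]

/-- The tensor product of superspaces, with `|w ⊗ m| = |w| + |m|`. -/
instance tensorSuperspace : Superspace K (W ⊗[K] M) :=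
  Superspace.ofInvolution (TensorProduct.map (inv K W) (inv K M)) map_inv_inv

theorem inv_tensor : inv K (W ⊗[K] M) = TensorProduct.map (inv K W) (inv K M) :=
  inv_ofInvolution _ map_inv_inv

theorem tmul_mem {r s : ZMod 2} {w : W} {m : M} (hw : w ∈ Par K W r) (hm : m ∈ Par K M s) :
    w ⊗ₜ[K] m ∈ Par K (W ⊗[K] M) (r + s) := by
  refine mem_of_inv (K := K) ?_
  rw [inv_tensor, TensorProduct.map_tmul, inv_of_mem hw, inv_of_mem hm, TensorProduct.smul_tmul_smul,
    ksgn_add_left]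

theorem invP_tensor (r : ZMod 2) :
    invP K (W ⊗[K] M) r = TensorProduct.map (invP K W r) (invP K M r) := by
  rcases zmod2_cases r with rfl | rfl
  · rw [invP_zero, invP_zero, invP_zero]; exact TensorProduct.map_id.symm
  · rw [invP_one, invP_one, invP_one, inv_tensor]

theorem map_mul_map (A A' : Module.End K W) (B B' : Module.End K M) :
    (TensorProduct.map A B * TensorProduct.map A' B' : Module.End K (W ⊗[K] M)) =
      TensorProduct.map (A * A') (B * B') := (TensorProduct.map_comp _ _ _ _).symm

theorem map_one_one : (TensorProduct.map (1 : Module.End K W) (1 : Module.End K M)) = 1 :=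
  TensorProduct.map_id

theorem HasPar.map {A : Module.End K W} {B : Module.End K M} {r s : ZMod 2} (hA : HasPar A r)
    (hB : HasPar B s) : HasPar (TensorProduct.map A B : Module.End K (W ⊗[K] M)) (r + s) := by
  intro t
  rw [invP_tensor, map_mul_map, hA t, hB t, map_mul_map, TensorProduct.map_smul_left,
    TensorProduct.map_smul_right, smul_smul, ksgn_add_left]

variable (K W M) in
/-- The symmetry of superspaces: `w ⊗ m ↦ (-1)^(|w||m|) m ⊗ w`. -/
def superFlip : W ⊗[K] M →ₗ[K] M ⊗[K] W :=
  (TensorProduct.comm K W M).toLinearMap ∘ₗ ((2 : K)⁻¹ • (1 + TensorProduct.map (inv K W) 1 +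
    TensorProduct.map 1 (inv K M) - TensorProduct.map (inv K W) (inv K M)))

theorem superFlip_tmul {r s : ZMod 2} {w : W} {m : M} (hw : w ∈ Par K W r) (hm : m ∈ Par K M s) :
    superFlip K W M (w ⊗ₜ m) = ksgn K r s • (m ⊗ₜ w) := by
  have h2 : (2 : K) ≠ 0 := NeZero.ne 2
  have key : (2 : K)⁻¹ * (1 + ksgn K r 1 + ksgn K s 1 - ksgn K r 1 * ksgn K s 1) = ksgn K r s := by
    rcases zmod2_cases r with rfl | rfl <;> rcases zmod2_cases s with rfl | rfl <;>
      simp <;> field_simp <;> norm_num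
  simp only [superFlip, LinearMap.comp_apply, LinearMap.smul_apply, LinearMap.sub_apply,
    LinearMap.add_apply, Module.End.one_apply, TensorProduct.map_tmul, inv_of_mem hw, inv_of_mem hm,
    ← TensorProduct.smul_tmul', TensorProduct.tmul_smul, LinearEquiv.coe_coe, map_smul, map_sub, map_add,
    TensorProduct.comm_tmul]
  rw [← key]
  module

theorem ext_par_tensor {N : Type*} [AddCommGroup N] [Module K N] {f g : W ⊗[K] M →ₗ[K] N}
    (h : ∀ r s, ∀ w ∈ Par K W r, ∀ m ∈ Par K M s, f (w ⊗ₜ m) = g (w ⊗ₜ m)) : f = g :=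
  TensorProduct.ext (ext_par (K := K) fun r w hw => ext_par (K := K) fun s m hm => h r s w hw m hm)

theorem superFlip_superFlip : superFlip K M W ∘ₗ superFlip K W M = LinearMap.id := by
  refine ext_par_tensor fun r s w hw m hm => ?_
  rw [LinearMap.comp_apply, superFlip_tmul hw hm, map_smul, superFlip_tmul hm hw, smul_smul,
    ksgn_comm s r, ksgn_mul_self, one_smul, LinearMap.id_apply]

end TensorSpaces

section RLLProducts

variable {R : Type*} [Ring R] [Algebra K R]

theorem RLL.map {R' : Type*} [Ring R'] [Algebra K R'] (f : R →ₐ[K] R')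
    {X : Matrix (Idx n) (Idx n) R} (h : RLL K q X) : RLL K q (X.map f) := by
  rw [rll_iff] at h ⊢
  intro a b c d
  simpa only [map_sum, map_smul, map_mul, Matrix.map_apply] using congrArg f (h a b c d)

theorem RLL.mul {X Y : Matrix (Idx n) (Idx n) R} (hX : RLL K q X) (hY : RLL K q Y)
    (h : ∀ a b c d, X a c * Y b d = ksgn K (par a + par c) (par b + par d) • (Y b d * X a c)) :
    RLL K q (X * Y) := by
  have h1 : mat1 X * mat2 K Y = mat2 K Y * mat1 X := by
    ext ⟨a, b⟩ ⟨c, d⟩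
    rw [mat1_mul_mat2, mat2_mul_mat1, h, smul_smul, ksgn_comm (par a + par c), ← ksgn_add_right,
      add_comm (par a), ← add_assoc, zmod2_add_self, zero_add]
  have h2 : mat1 Y * mat2 K X = mat2 K X * mat1 Y := by
    ext ⟨a, b⟩ ⟨c, d⟩
    rw [mat1_mul_mat2, mat2_mul_mat1, h, smul_smul, ← ksgn_add_right,
      ← add_assoc, zmod2_add_self, zero_add]
  rw [RLL] at hX hY ⊢
  rw [mat1_mul, mat2_mul]
  calc mat1 X * mat1 Y * (mat2 K X * mat2 K Y) * matTheta q n R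
      = mat1 X * (mat1 Y * mat2 K X) * mat2 K Y * matTheta q n R := by simp only [mul_assoc]
    _ = mat1 X * mat2 K X * (mat1 Y * mat2 K Y * matTheta q n R) := by
        rw [h2]; simp only [mul_assoc]
    _ = (mat1 X * mat2 K X * matTheta q n R) * (mat2 K Y * mat1 Y) := by
        rw [hY]; simp only [mul_assoc]
    _ = matTheta q n R * (mat2 K X * (mat1 X * mat2 K Y) * mat1 Y) := by
        rw [hX]; simp only [mul_assoc]
    _ = _ := by rw [h1]; simp only [mul_assoc]

end RLLProducts

namespace SMod

variable {q} [NeZero (2 : K)]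

/-- The operator by which `u_ij` acts on `W ⊗ M`, through the comultiplication
`Δ(u_ij) = ∑_k (-1)^((p(i)+p(k))(p(k)+p(j))) u_ik ⊗ u_kj`, where
`(x ⊗ y)(w ⊗ m) = (-1)^(|y||w|) x w ⊗ y m`. -/
def tensorAct (W : SMod.{u} q n) (M : SMod.{v} q n) (i j : Idx n) : Module.End K (W ⊗[K] M) :=
  ∑ k, ksgn K (par i + par k) (par k + par j) •
    TensorProduct.map (W.act i k * invP K W (par k + par j)) (M.act k j)

theorem tensorAct_hasPar (W : SMod.{u} q n) (M : SMod.{v} q n) (i j : Idx n) :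
    HasPar (tensorAct W M i j) (par i + par j) := by
  refine HasPar.sum fun k => HasPar.smul ?_ _
  have := ((W.act_hasPar i k).mul (hasPar_invP (par k + par j))).map (M.act_hasPar k j)
  rwa [add_zero, par_add_par] at this

theorem lmat_tensorAct (W : SMod.{u} q n) (M : SMod.{v} q n) :
    lmat (tensorAct W M) =
      lmat (fun i j => (TensorProduct.map (W.act i j) 1 : Module.End K (W ⊗[K] M))) *
        (lmat M.act).map (Module.End.lTensorAlgHom K M W) := by
  ext1 i j
  rw [Matrix.mul_apply]
  simp only [lmat, tensorAct, Finset.sum_mul, Matrix.map_apply]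
  refine Finset.sum_congr rfl fun k _ => ?_
  change _ = _ * TensorProduct.map (1 : Module.End K W) (M.act k j * invP K M (par k + par j))
  rw [invP_tensor, invP_tensor, smul_mul_assoc, map_mul_map, map_mul_map, map_mul_map,
    mul_assoc (W.act i k), ← invP_add, one_mul, mul_one]
  rw [← mul_assoc, M.act_hasPar k j, smul_mul_assoc, mul_assoc, ← invP_add,
    TensorProduct.map_smul_right, par_add_par, add_comm (par k + par j) (par i + par j),
    add_comm (par k) (par j), par_add_par, ksgn_comm (par i + par k), add_comm (par j) (par k)]

end SMod

namespace SMod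

variable {q} [NeZero (2 : K)]

theorem tensorAct_of_lt (W : SMod.{u} q n) (M : SMod.{v} q n) (i j : Idx n) (h : j < i) :
    tensorAct W M i j = 0 := by
  refine Finset.sum_eq_zero fun k _ => ?_
  rcases lt_or_ge k i with hk | hk
  · rw [W.act_of_lt hk, zero_mul, TensorProduct.map_zero_left, smul_zero]
  · rw [M.act_of_lt (lt_of_lt_of_le h hk), TensorProduct.map_zero_right, smul_zero]

theorem tensorAct_self (W : SMod.{u} q n) (M : SMod.{v} q n) (i : Idx n) :
    tensorAct W M i i = TensorProduct.map (W.act i i) (M.act i i) := by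
  rw [tensorAct, Finset.sum_eq_single i]
  · simp [zmod2_add_self, invP_zero]
  · intro k _ hk
    rcases lt_or_gt_of_ne hk with hk | hk
    · rw [W.act_of_lt hk, zero_mul, TensorProduct.map_zero_left, smul_zero]
    · rw [M.act_of_lt hk, TensorProduct.map_zero_right, smul_zero]
  · simp

theorem rll_tensorAct (W : SMod.{u} q n) (M : SMod.{v} q n) : RLL K q (lmat (tensorAct W M)) := by
  have hpar : ∀ i j, HasPar (TensorProduct.map (W.act i j) 1 : Module.End K (W ⊗[K] M))
      (par i + par j) := fun i j => by
    have := (W.act_hasPar i j).map (hasPar_one (K := K) (M := M))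
    rwa [add_zero] at this
  rw [lmat_tensorAct]
  refine RLL.mul q ?_ (M.rll_act.map q _) ?_
  · rw [rll_lmat_iff q hpar]
    intro a b c d
    have := (rll_lmat_iff q W.act_hasPar).mp W.rll_act a b c d
    have := congrArg (Module.End.rTensorAlgHom K W M) this
    simp only [map_sum, map_smul, map_mul] at this
    exact this
  · intro a b c d
    change TensorProduct.map (W.act a c) 1 * invP K (W ⊗[K] M) _ *
      TensorProduct.map (1 : Module.End K W) (M.act b d * invP K M (par b + par d)) =
      _ • (TensorProduct.map (1 : Module.End K W) (M.act b d * invP K M (par b + par d)) *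
        (TensorProduct.map (W.act a c) 1 * invP K (W ⊗[K] M) _))
    rw [invP_tensor, map_mul_map, map_mul_map, map_mul_map, one_mul, one_mul, mul_one,
      ← mul_assoc, M.act_hasPar b d, smul_mul_assoc, mul_assoc, mul_assoc, ← invP_add, ← invP_add,
      TensorProduct.map_smul_right, add_comm (par a + par c), ksgn_comm (par b + par d)]

/-- The tensor product of `U_q(𝔮_n)`-supermodules. -/
def tensor (W : SMod.{u} q n) (M : SMod.{v} q n) : SMod.{max u v} q n :=
  ofOps q (W ⊗[K] M) (tensorAct W M) (tensorAct_hasPar W M) (tensorAct_of_lt W M)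
    (fun i => by
      rw [tensorAct_self, tensorAct_self, map_mul_map, W.act_diag, M.act_diag, map_one_one])
    (rll_tensorAct W M)

theorem tensor_act (W : SMod.{u} q n) (M : SMod.{v} q n) (i j : Idx n) :
    (tensor W M).act i j = tensorAct W M i j := ofOps_act _ _ _ _ _ _ i j

/-- The action of `u_ij` on a tensor product of vectors. -/
theorem tensor_act_tmul (W : SMod.{u} q n) (M : SMod.{v} q n) (i j : Idx n) {r : ZMod 2} {w : W}
    (hw : w ∈ Par K W r) (m : M) : tensorAct W M i j (w ⊗ₜ m) =
      ∑ k, (ksgn K (par i + par k) (par k + par j) * ksgn K (par k + par j) r) •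
        (W.act i k w ⊗ₜ[K] M.act k j m) := by
  rw [tensorAct, LinearMap.sum_apply]
  refine Finset.sum_congr rfl fun k _ => ?_
  rw [LinearMap.smul_apply, TensorProduct.map_tmul, Module.End.mul_apply, invP_of_mem _ hw,
    map_smul, ← TensorProduct.smul_tmul', smul_smul]

/-- The map `1 ⊗ f : W ⊗ M ⟶ W ⊗ N`, `w ⊗ m ↦ (-1)^(|f||w|) w ⊗ f(m)`, for `f` of parity `r`. -/
def whisker (W : SMod.{u} q n) {M N : SMod.{v} q n} (r : ZMod 2) (f : M →ₗ[K] N) :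
    W ⊗[K] M →ₗ[K] W ⊗[K] N := TensorProduct.map (invP K W r) f

theorem whisker_mem (W : SMod.{u} q n) {M N : SMod.{v} q n} {r : ZMod 2} {f : M →ₗ[K] N}
    (hf : f ∈ homPar M N r) : whisker W r f ∈ homPar (tensor W M) (tensor W N) r := by
  have hinv : ∀ t, f ∘ₗ invP K M t = ksgn K r t • (invP K N t ∘ₗ f) := fun t => by
    refine ext_par (K := K) fun s m hm => ?_
    simp only [LinearMap.comp_apply, LinearMap.smul_apply]
    rw [invP_of_mem t hm, invP_of_mem t (hf.1 s m hm), map_smul, smul_smul, ksgn_add_right,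
      ksgn_comm t r, ksgn_mul_self_assoc]
  have hact : ∀ i j, f ∘ₗ M.act i j = ksgn K r (par i + par j) • (N.act i j ∘ₗ f) := fun i j =>
    LinearMap.ext fun m => hf.2 _ _ (Uq.u_mem_gr q i j) m
  refine mem_homPar (fun s x hx => ?_) fun i j x => ?_
  · refine mem_of_inv (K := K) (M := W ⊗[K] N) ?_
    have h1 : TensorProduct.map (inv K W) (inv K N) ∘ₗ whisker W r f =
        ksgn K r 1 • (whisker W r f ∘ₗ TensorProduct.map (inv K W) (inv K M)) := by
      rw [whisker, ← TensorProduct.map_comp, ← TensorProduct.map_comp, ← invP_one, ← invP_one,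
        ← invP_one, hinv 1, TensorProduct.map_smul_right, smul_smul, ksgn_mul_self, one_smul,
        ← Module.End.mul_eq_comp, ← Module.End.mul_eq_comp, ← invP_add, ← invP_add, add_comm]
    have h3 : ∀ y : W ⊗[K] M, TensorProduct.map (inv K W) (inv K M) y = ksgn K s 1 • y →
        TensorProduct.map (inv K W) (inv K N) (whisker W r f y) =
          ksgn K (r + s) 1 • whisker W r f y := fun y hy => by
      have h2 := LinearMap.congr_fun h1 y
      rw [LinearMap.smul_apply, LinearMap.comp_apply, LinearMap.comp_apply, hy, map_smul,
        smul_smul] at h2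
      rw [h2, ksgn_add_left]
    rw [inv_tensor]
    exact h3 x ((LinearMap.congr_fun inv_tensor.symm x).trans (inv_of_mem hx))
  · rw [tensor_act, tensor_act]
    have h1 : whisker W r f ∘ₗ tensorAct W M i j =
        ksgn K r (par i + par j) • (tensorAct W N i j ∘ₗ whisker W r f) := by
      have key : ∀ k, whisker W r f ∘ₗ (ksgn K (par i + par k) (par k + par j) •
          TensorProduct.map (W.act i k * invP K W (par k + par j)) (M.act k j)) =
          ksgn K r (par i + par j) • ((ksgn K (par i + par k) (par k + par j) •
          TensorProduct.map (W.act i k * invP K W (par k + par j)) (N.act k j)) ∘ₗ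
          whisker W r f) := fun k => by
        simp only [whisker, LinearMap.smul_comp, LinearMap.comp_smul, ← TensorProduct.map_comp]
        rw [hact, ← Module.End.mul_eq_comp, ← Module.End.mul_eq_comp, ← mul_assoc,
          W.act_hasPar i k r, smul_mul_assoc, mul_assoc, ← invP_add, mul_assoc, ← invP_add,
          TensorProduct.map_smul_left, TensorProduct.map_smul_right, add_comm r]
        simp only [smul_smul]
        congr 1
        rw [← par_add_par (par i) (par k) (par j), ksgn_add_right r (par i + par k),
          ksgn_comm r (par i + par k)]
        ring
      refine LinearMap.ext fun y => ?_
      simp only [tensorAct, LinearMap.comp_apply, LinearMap.smul_apply, LinearMap.sum_apply, map_sum,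
        Finset.smul_sum]
      exact Finset.sum_congr rfl fun k _ => LinearMap.congr_fun (key k) y
    exact LinearMap.congr_fun h1 x

/-- The component of parity `r` of a linear map between superspaces. -/
def linPart {M : Type u} [AddCommGroup M] [Module K M] [Superspace K M]
    {N : Type v} [AddCommGroup N] [Module K N] [Superspace K N] (r : ZMod 2) :
    (M →ₗ[K] N) →ₗ[K] (M →ₗ[K] N) where
  toFun f := (2 : K)⁻¹ • (f + ksgn K r 1 • (inv K N ∘ₗ f ∘ₗ inv K M))
  map_add' f g := by ext; simp; module
  map_smul' a f := by ext; simp; module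

theorem linPart_of_mem {M : SMod.{u} q n} {N : SMod.{v} q n} {r : ZMod 2} {f : M →ₗ[K] N}
    (hf : f ∈ homPar M N r) (s : ZMod 2) : linPart s f = if s = r then f else 0 := by
  have h2 : (2 : K) ≠ 0 := NeZero.ne 2
  have h : inv K N ∘ₗ f ∘ₗ inv K M = ksgn K r 1 • f := by
    refine ext_par (K := K) fun t m hm => ?_
    simp only [LinearMap.comp_apply, LinearMap.smul_apply]
    rw [inv_of_mem hm, map_smul, map_smul, inv_of_mem (hf.1 t m hm), smul_smul, ksgn_add_left,
      mul_comm, mul_assoc, ksgn_mul_self, mul_one]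
  change (2 : K)⁻¹ • (f + ksgn K s 1 • (inv K N ∘ₗ f ∘ₗ inv K M)) = _
  rw [h, smul_smul]
  rcases zmod2_cases r with rfl | rfl <;> rcases zmod2_cases s with rfl | rfl <;>
    simp [← two_smul K f, smul_smul, h2]

/-- The map `1 ⊗ f = 1 ⊗ f₀ + 1 ⊗ f₁` for a linear map `f = f₀ + f₁`, with `f_r` of parity `r`. -/
def whiskerLin (W : SMod.{u} q n) (M N : SMod.{v} q n) :
    (M →ₗ[K] N) →ₗ[K] (W ⊗[K] M →ₗ[K] W ⊗[K] N) where
  toFun f := whisker W 0 (linPart 0 f) + whisker W 1 (linPart 1 f)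
  map_add' f g := by simp only [whisker, map_add, TensorProduct.map_add_right]; abel
  map_smul' a f := by simp [whisker, map_smul, TensorProduct.map_smul_right]

theorem whiskerLin_of_mem (W : SMod.{u} q n) {M N : SMod.{v} q n} {r : ZMod 2} {f : M →ₗ[K] N}
    (hf : f ∈ homPar M N r) : whiskerLin W M N f = whisker W r f := by
  change whisker W 0 (linPart 0 f) + whisker W 1 (linPart 1 f) = _
  rw [linPart_of_mem hf, linPart_of_mem hf]
  rcases zmod2_cases r with rfl | rfl <;> simp [whisker, TensorProduct.map_zero_right]

theorem whiskerLin_mem (W : SMod.{u} q n) {M N : SMod.{v} q n} {f : M →ₗ[K] N}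
    (hf : f ∈ Hom M N) : whiskerLin W M N f ∈ Hom (tensor W M) (tensor W N) := by
  refine sup01_induction (homPar M N)
    (motive := fun f => whiskerLin W M N f ∈ Hom (tensor W M) (tensor W N))
    (fun r f hf => ?_) (fun a b ha hb => ?_) hf
  · rw [whiskerLin_of_mem W hf]
    exact le_sup01 (homPar (tensor W M) (tensor W N)) r (whisker_mem W hf)
  · rw [map_add]; exact add_mem ha hb

theorem whiskerLin_comp (W : SMod.{u} q n) {M N P : SMod.{v} q n} {f : M →ₗ[K] N} {g : N →ₗ[K] P}
    (hf : f ∈ Hom M N) (hg : g ∈ Hom N P) :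
    whiskerLin W M P (g ∘ₗ f) = whiskerLin W N P g ∘ₗ whiskerLin W M N f := by
  refine sup01_induction (homPar M N)
    (motive := fun f => whiskerLin W M P (g ∘ₗ f) = whiskerLin W N P g ∘ₗ whiskerLin W M N f)
    (fun r f hf => ?_) (fun a b ha hb => ?_) hf
  · refine sup01_induction (homPar N P)
      (motive := fun g => whiskerLin W M P (g ∘ₗ f) = whiskerLin W N P g ∘ₗ whiskerLin W M N f)
      (fun s g hg => ?_) (fun a b ha hb => ?_) hg
    · rw [whiskerLin_of_mem W hf, whiskerLin_of_mem W hg, whiskerLin_of_mem W (homPar_comp hf hg),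
        whisker, whisker, whisker, ← TensorProduct.map_comp, add_comm, invP_add,
        Module.End.mul_eq_comp]
    · rw [LinearMap.add_comp, map_add, map_add, ha, hb, LinearMap.add_comp]
  · rw [LinearMap.comp_add, map_add, map_add, ha, hb, LinearMap.comp_add]

/-- The endosuperfunctor `M ↦ W ⊗ M`, `f ↦ 1 ⊗ f` of tensoring on the left with `W`. -/
def translate (W : SMod.{0} q n) : SEnd K (SMod.{u} q n) where
  obj M := tensor W M
  map {M N} f := ⟨whiskerLin W M N f.1, whiskerLin_mem W f.2⟩
  map_id M := Subtype.ext ((whiskerLin_of_mem W (homPar_id M)).trans (by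
    rw [whisker, invP_zero]; exact TensorProduct.map_id))
  map_comp f g := Subtype.ext (whiskerLin_comp W f.2 g.2)
  map_add f g := Subtype.ext (map_add (whiskerLin W _ _) f.1 g.1)
  map_smul a f := Subtype.ext (map_smul (whiskerLin W _ _) a f.1)
  map_mem {M N r f} hf := by
    have hf' : f.1 ∈ homPar M N r := hf
    change whiskerLin W M N f.1 ∈ homPar (tensor W M) (tensor W N) r
    rw [whiskerLin_of_mem W hf']
    exact whisker_mem W hf'

end SMod

/-! ### Inverting the matrix of `L`, duals -/

section Inverse

variable {R : Type*} [Ring R]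

/-- The inverse of an upper triangular matrix whose diagonal entries at `i` and at `-i` are inverse
to each other. -/
def triInv (X : Matrix (Idx n) (Idx n) R) : Matrix (Idx n) (Idx n) R :=
  Matrix.diagonal (fun i => X (-i) (-i)) *
    ∑ k ∈ Finset.range (2 * n + 1), (1 - X * Matrix.diagonal fun i => X (-i) (-i)) ^ k

theorem pow_upper {N : Matrix (Idx n) (Idx n) R} (hN : ∀ i j, j ≤ i → N i j = 0) (k : ℕ)
    (i j : Idx n) (h : (j : ℤ) < i + k) : (N ^ k) i j = 0 := by
  induction k generalizing i with
  | zero => rw [pow_zero, Matrix.one_apply_ne]; rintro rfl; simp at h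
  | succ k ih =>
    rw [pow_succ', Matrix.mul_apply]
    refine Finset.sum_eq_zero fun m _ => ?_
    rcases le_or_gt m i with hm | hm
    · rw [hN _ _ hm, zero_mul]
    · have hm' : (i : ℤ) < m := hm
      rw [ih m (by push_cast at h; omega), mul_zero]

theorem pow_eq_zero_of_upper {N : Matrix (Idx n) (Idx n) R} (hN : ∀ i j, j ≤ i → N i j = 0) :
    N ^ (2 * n + 1) = 0 := by
  ext i j
  refine pow_upper hN _ i j ?_
  have hi := Finset.mem_Icc.mp (Finset.mem_erase.mp i.2).2
  have hj := Finset.mem_Icc.mp (Finset.mem_erase.mp j.2).2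
  push_cast
  omega

theorem upper_aux {X : Matrix (Idx n) (Idx n) R} (htri : ∀ i j, j < i → X i j = 0)
    (hdiag : ∀ i, X i i * X (-i) (-i) = 1) (i j : Idx n) (h : j ≤ i) :
    (1 - X * Matrix.diagonal fun i => X (-i) (-i)) i j = 0 := by
  rw [Matrix.sub_apply, Matrix.mul_diagonal]
  rcases h.lt_or_eq with h | rfl
  · rw [htri i j h, zero_mul, Matrix.one_apply_ne h.ne', sub_zero]
  · rw [hdiag, Matrix.one_apply_eq, sub_self]

theorem mul_triInv {X : Matrix (Idx n) (Idx n) R} (htri : ∀ i j, j < i → X i j = 0)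
    (hdiag : ∀ i, X i i * X (-i) (-i) = 1) : X * triInv X = 1 := by
  set D := Matrix.diagonal fun i => X (-i) (-i) with hD
  have hN : ∀ i j, j ≤ i → (1 - X * D) i j = 0 := upper_aux htri hdiag
  rw [triInv, ← hD, ← mul_assoc]
  nth_rw 1 [← sub_sub_cancel 1 (X * D)]
  rw [mul_neg_geom_sum, pow_eq_zero_of_upper hN, sub_zero]

theorem triInv_mul {X : Matrix (Idx n) (Idx n) R} (htri : ∀ i j, j < i → X i j = 0)
    (hdiag : ∀ i, X i i * X (-i) (-i) = 1) : triInv X * X = 1 := by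
  set D := Matrix.diagonal fun i => X (-i) (-i) with hD
  have hN : ∀ i j, j ≤ i → (1 - D * X) i j = 0 := by
    intro i j h
    rw [Matrix.sub_apply, hD, Matrix.diagonal_mul]
    rcases h.lt_or_eq with h | rfl
    · rw [htri i j h, mul_zero, Matrix.one_apply_ne h.ne', sub_zero]
    · have := hdiag (-j)
      rw [neg_neg] at this
      rw [this, Matrix.one_apply_eq, sub_self]
  have hl : (∑ k ∈ Finset.range (2 * n + 1), (1 - D * X) ^ k) * D * X = 1 := by
    rw [mul_assoc]
    nth_rw 2 [← sub_sub_cancel 1 (D * X)]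
    rw [geom_sum_mul_neg, pow_eq_zero_of_upper hN, sub_zero]
  rw [← left_inv_eq_right_inv hl (mul_triInv htri hdiag), hl]

theorem triInv_upper {X : Matrix (Idx n) (Idx n) R} (htri : ∀ i j, j < i → X i j = 0)
    (hdiag : ∀ i, X i i * X (-i) (-i) = 1) {i j : Idx n} (h : j < i) : triInv X i j = 0 := by
  have hN := upper_aux htri hdiag
  rw [triInv, Matrix.diagonal_mul, Matrix.sum_apply, Finset.sum_eq_zero, mul_zero]
  intro k _
  have h' : (j : ℤ) < i := h
  exact pow_upper hN k i j (by omega)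

theorem triInv_diag {X : Matrix (Idx n) (Idx n) R} (htri : ∀ i j, j < i → X i j = 0)
    (hdiag : ∀ i, X i i * X (-i) (-i) = 1) (i : Idx n) : triInv X i i = X (-i) (-i) := by
  have hN := upper_aux htri hdiag
  rw [triInv, Matrix.diagonal_mul, Matrix.sum_apply, Finset.sum_eq_single 0, pow_zero,
    Matrix.one_apply_eq, mul_one]
  · intro k _ hk
    exact pow_upper hN k i i (by have := Nat.pos_of_ne_zero hk; omega)
  · simp

theorem triInv_hasPar {M : Type*} [AddCommGroup M] [Module K M] [Superspace K M]
    {X : Matrix (Idx n) (Idx n) (Module.End K M)} (h : ∀ i j, HasPar (X i j) (par i + par j))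
    (i j : Idx n) : HasPar (triInv X i j) (par i + par j) := by
  have hneg : ∀ i : Idx n, HasPar (X (-i) (-i)) 0 := fun i => by
    have := h (-i) (-i)
    rwa [zmod2_add_self] at this
  have hmul : ∀ {Y Z : Matrix (Idx n) (Idx n) (Module.End K M)},
      (∀ i j, HasPar (Y i j) (par i + par j)) → (∀ i j, HasPar (Z i j) (par i + par j)) →
      ∀ i j, HasPar ((Y * Z) i j) (par i + par j) := fun hY hZ i j => by
    rw [Matrix.mul_apply]
    refine HasPar.sum fun k => ?_
    have := (hY i k).mul (hZ k j)
    rwa [par_add_par] at this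
  have hdiag : ∀ {d : Idx n → Module.End K M}, (∀ i, HasPar (d i) 0) →
      ∀ i j, HasPar (Matrix.diagonal d i j) (par i + par j) := fun hd i j => by
    by_cases hij : i = j
    · subst hij; rw [Matrix.diagonal_apply_eq, zmod2_add_self]; exact hd i
    · rw [Matrix.diagonal_apply_ne _ hij]; exact hasPar_zero _
  have hone : ∀ i j : Idx n, HasPar ((1 : Matrix (Idx n) (Idx n) (Module.End K M)) i j)
      (par i + par j) := by
    rw [← Matrix.diagonal_one]
    exact hdiag fun _ => hasPar_one
  refine hmul (hdiag hneg) (fun i j => ?_) i j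
  rw [Matrix.sum_apply]
  refine HasPar.sum fun k => ?_
  induction k generalizing i j with
  | zero => rw [pow_zero]; exact hone i j
  | succ k ih =>
    rw [pow_succ]
    refine hmul ih (fun i j => ?_) i j
    rw [Matrix.sub_apply, sub_eq_add_neg]
    refine (hone i j).add ?_
    rw [← neg_one_smul K]
    exact (hmul h (hdiag hneg) i j).smul _

end Inverse

namespace SMod

variable {q}

theorem lmat_act_of_lt (M : SMod.{u} q n) (i j : Idx n) (h : j < i) : lmat M.act i j = 0 := by
  rw [lmat, M.act_of_lt h, zero_mul]

theorem lmat_act_self (M : SMod.{u} q n) (i : Idx n) : lmat M.act i i = M.act i i := by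
  rw [lmat, zmod2_add_self, invP_zero, mul_one]

theorem lmat_act_diag (M : SMod.{u} q n) (i : Idx n) :
    lmat M.act i i * lmat M.act (-i) (-i) = 1 := by
  rw [lmat_act_self, lmat_act_self, M.act_diag]

theorem lmat_act_hasPar (M : SMod.{u} q n) (i j : Idx n) :
    HasPar (lmat M.act i j) (par i + par j) := by
  have := (M.act_hasPar i j).mul (hasPar_invP (par i + par j))
  rwa [add_zero] at this

/-- The operator `S(u_ij)` on `M`, where the antipode `S` is determined by
`∑ S(u_ij) ⊗ E_ij = L⁻¹`. -/
def antipodeAct (M : SMod.{u} q n) (i j : Idx n) : Module.End K M :=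
  triInv (lmat M.act) i j * invP K M (par i + par j)

/-- The antipode is characterized by `∑_k (-1)^((p(i)+p(k))(p(k)+p(j))) S(u_ik) u_kj = δ_ij`. -/
theorem antipodeAct_mul (M : SMod.{u} q n) (i j : Idx n) :
    ∑ k, ksgn K (par i + par k) (par k + par j) • (antipodeAct M i k * M.act k j) =
      if i = j then 1 else 0 := by
  have h := congrFun (congrFun (triInv_mul M.lmat_act_of_lt M.lmat_act_diag) i) j
  rw [Matrix.mul_apply, Matrix.one_apply] at h
  have h2 : ∀ k, ksgn K (par i + par k) (par k + par j) • (antipodeAct M i k * M.act k j) =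
      triInv (lmat M.act) i k * lmat M.act k j * invP K M (par i + par j) := fun k => by
    rw [antipodeAct, lmat, mul_assoc, M.act_hasPar k j, mul_smul_comm, smul_smul,
      ksgn_comm (par k + par j), ksgn_mul_self, one_smul, mul_assoc, mul_assoc, ← invP_add,
      (by decide : ∀ a b c : ZMod 2, c + b + (a + b) = a + c) (par i) (par j) (par k)]
  rw [Finset.sum_congr rfl fun k _ => h2 k, ← Finset.sum_mul, h]
  split_ifs with hij
  · rw [hij, zmod2_add_self, invP_zero, mul_one]
  · rw [zero_mul]

variable [NeZero (2 : K)]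

/-- The dual of a superspace: `|f| = r` if `f` vanishes on vectors of parity `r + 1`. -/
instance dualSuperspace {M : Type u} [AddCommGroup M] [Module K M] [Superspace K M] :
    Superspace K (Module.Dual K M) :=
  Superspace.ofInvolution (inv K M).dualMap fun f => LinearMap.ext fun m =>
    congrArg f (inv_inv m)

theorem inv_dual {M : Type u} [AddCommGroup M] [Module K M] [Superspace K M] :
    inv K (Module.Dual K M) = (inv K M).dualMap :=
  inv_ofInvolution (inv K M).dualMap fun f => LinearMap.ext fun m => congrArg f (inv_inv m)

theorem invP_dual {M : Type u} [AddCommGroup M] [Module K M] [Superspace K M] (r : ZMod 2) :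
    invP K (Module.Dual K M) r = (invP K M r).dualMap := by
  rcases zmod2_cases r with rfl | rfl
  · rw [invP_zero, invP_zero]; rfl
  · rw [invP_one, invP_one, inv_dual]

theorem dualMap_mul {M : Type u} [AddCommGroup M] [Module K M] (A B : Module.End K M) :
    (A.dualMap * B.dualMap : Module.End K (Module.Dual K M)) = (B * A).dualMap := rfl

/-- The operator by which `u_ij` acts on the dual of `M`:
`(x f)(m) = (-1)^(|x||f|) f(S(x) m)` for `x = u_ij`. -/
def dualAct (M : SMod.{u} q n) (i j : Idx n) : Module.End K (Module.Dual K M) :=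
  (antipodeAct M i j).dualMap * invP K (Module.Dual K M) (par i + par j)

theorem antipodeAct_hasPar (M : SMod.{u} q n) (i j : Idx n) :
    HasPar (antipodeAct M i j) (par i + par j) := by
  have := (triInv_hasPar M.lmat_act_hasPar i j).mul (hasPar_invP (par i + par j))
  rwa [add_zero] at this

theorem dualAct_hasPar (M : SMod.{u} q n) (i j : Idx n) :
    HasPar (dualAct M i j) (par i + par j) := by
  have h : HasPar ((antipodeAct M i j).dualMap : Module.End K (Module.Dual K M))
      (par i + par j) := fun t => by
    have := congrArg LinearMap.dualMap (antipodeAct_hasPar M i j t)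
    rw [← dualMap_mul] at this
    rw [invP_dual, dualMap_mul]
    have h2 : ((antipodeAct M i j) * invP K M t).dualMap =
        ksgn K (par i + par j) t • ((invP K M t * antipodeAct M i j).dualMap) := by
      rw [antipodeAct_hasPar M i j t]
      ext f m
      simp [← mul_assoc]
    rw [h2, dualMap_mul]
  have := h.mul (hasPar_invP (par i + par j))
  rwa [add_zero] at this

theorem dualAct_of_lt (M : SMod.{u} q n) (i j : Idx n) (h : j < i) : dualAct M i j = 0 := by
  rw [dualAct, antipodeAct, triInv_upper M.lmat_act_of_lt M.lmat_act_diag h, zero_mul]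
  exact LinearMap.ext fun f => LinearMap.ext fun m => map_zero (invP K (Module.Dual K M) _ f)

theorem dualAct_diag (M : SMod.{u} q n) (i : Idx n) : dualAct M i i * dualAct M (-i) (-i) = 1 := by
  have h : ∀ i, dualAct M i i = (M.act (-i) (-i)).dualMap := fun i => by
    rw [dualAct, antipodeAct, zmod2_add_self, invP_zero, invP_zero, mul_one, mul_one,
      triInv_diag M.lmat_act_of_lt M.lmat_act_diag, lmat_act_self]
  rw [h, h, neg_neg, dualMap_mul, M.act_diag]
  rfl

theorem rll_dualAct (M : SMod.{u} q n) : RLL K q (lmat (dualAct M)) := by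
  have hl : ∀ i j, lmat (dualAct M) i j = (antipodeAct M i j).dualMap := fun i j => by
    rw [lmat, dualAct, mul_assoc, invP_mul_self, mul_one]
  set X := triInv (lmat M.act) with hX
  have hpar : ∀ i j, HasPar (X i j) (par i + par j) := triInv_hasPar M.lmat_act_hasPar
  have hlX : lmat M.act * X = 1 := mul_triInv M.lmat_act_of_lt M.lmat_act_diag
  have hXl : X * lmat M.act = 1 := triInv_mul M.lmat_act_of_lt M.lmat_act_diag
  have hrel : matTheta q n _ * (mat1 X * mat2 K X) = mat2 K X * mat1 X * matTheta q n _ := by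
    have h := M.rll_act
    rw [RLL] at h
    have e1 : mat2 K X * mat1 X * (mat1 (lmat M.act) * mat2 K (lmat M.act)) = 1 := by
      rw [mul_assoc, ← mul_assoc (mat1 X), ← mat1_mul, hXl, mat1_one, one_mul, ← mat2_mul, hXl,
        mat2_one]
    have e2 : mat2 K (lmat M.act) * mat1 (lmat M.act) * (mat1 X * mat2 K X) = 1 := by
      rw [mul_assoc, ← mul_assoc (mat1 (lmat M.act)), ← mat1_mul, hlX, mat1_one, one_mul,
        ← mat2_mul, hlX, mat2_one]
    calc matTheta q n _ * (mat1 X * mat2 K X)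
        = mat2 K X * mat1 X * (mat1 (lmat M.act) * mat2 K (lmat M.act) * matTheta q n _) *
          (mat1 X * mat2 K X) := by rw [← mul_assoc (mat2 K X * mat1 X), e1, one_mul]
      _ = mat2 K X * mat1 X * matTheta q n _ *
          (mat2 K (lmat M.act) * mat1 (lmat M.act) * (mat1 X * mat2 K X)) := by
        rw [h]; simp only [mul_assoc]
      _ = _ := by rw [e2, mul_one]
  have key : ∀ i j k l, antipodeAct M i j * antipodeAct M k l =
      ksgn K (par i + par j) (par k + par l) •
        ((X i j * X k l) * invP K M (par i + par j + (par k + par l))) := by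
    intro i j k l
    rw [antipodeAct, antipodeAct, mul_assoc, ← mul_assoc (invP K M _), hpar k l, smul_mul_assoc,
      mul_smul_comm, mul_assoc, ← invP_add, ← mul_assoc, ksgn_comm]
  rw [rll_iff]
  intro a b c d
  have h := congrFun (congrFun hrel (a, b)) (c, d)
  rw [Matrix.mul_apply, Matrix.mul_apply] at h
  simp only [Fintype.sum_prod_type, mat1_mul_mat2, mat2_mul_mat1, matTheta] at h
  replace h := congrArg (· * invP K M (par a + par c + (par b + par d))) h
  simp only [Finset.sum_mul] at h
  have h1 : ∑ j, ∑ l, (ksgn K (par b + par l) (par j) * ksgn K (par l + par d) (par j) *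
      theta q a j b l) • (antipodeAct M j c * antipodeAct M l d) =
      ∑ j, ∑ l, (ksgn K (par b + par l) (par j) * ksgn K (par l + par d) (par c) *
      theta q j c l d) • (antipodeAct M b l * antipodeAct M a j) := by
    refine Eq.trans ?_ (h.trans ?_)
    · refine Finset.sum_congr rfl fun j _ => Finset.sum_congr rfl fun l _ => ?_
      by_cases hp : par a + par j = par b + par l
      · have e : ∀ j c l d : ZMod 2,
          isgn (l + d) j * isgn (j + c) (l + d) = isgn (l + d) c := by decide
        have e' : ∀ a b c d j l : ZMod 2, a + j = b + l → j + c + (l + d) = a + c + (b + d) := by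
          decide
        rw [key, e' _ _ _ _ _ _ hp, ← Algebra.smul_def, smul_smul, smul_smul, smul_mul_assoc]
        congr 1
        have := congrArg (Int.cast : ℤ → K) (e (par j) (par c) (par l) (par d))
        push_cast [← ksgn_cast] at this
        linear_combination (ksgn K (par b + par l) (par j) * theta q a j b l) * this
      · rw [theta_eq_zero q hp]; simp
    · refine Finset.sum_congr rfl fun j _ => Finset.sum_congr rfl fun l _ => ?_
      by_cases hp : par j + par c = par l + par d
      · have e : ∀ a b j l : ZMod 2,
          isgn (b + l) j * isgn (b + l) (a + j) = isgn (b + l) a := by decide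
        have e' : ∀ a b c d j l : ZMod 2, j + c = l + d → b + l + (a + j) = a + c + (b + d) := by
          decide
        rw [key, e' _ _ _ _ _ _ hp, ← Algebra.commutes, ← Algebra.smul_def, smul_smul, smul_smul,
          smul_mul_assoc]
        congr 1
        have := congrArg (Int.cast : ℤ → K) (e (par a) (par b) (par j) (par l))
        push_cast [← ksgn_cast] at this
        linear_combination (-(ksgn K (par l + par d) (par c) * theta q j c l d)) * this
      · rw [theta_eq_zero q hp]; simp
  have h2 := congrArg (Module.Dual.transpose (R := K)) h1
  simp only [map_sum, map_smul] at h2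
  simp only [hl, dualMap_mul]
  exact h2.symm

/-- The dual of a `U_q(𝔮_n)`-supermodule. -/
def dual (M : SMod.{u} q n) : SMod.{u} q n :=
  ofOps q (Module.Dual K M) (dualAct M) (dualAct_hasPar M) (dualAct_of_lt M) (dualAct_diag M)
    (rll_dualAct M)

theorem dual_act (M : SMod.{u} q n) (i j : Idx n) : (dual M).act i j = dualAct M i j :=
  ofOps_act _ _ _ _ _ _ i j

end SMod

section VSpace

variable (K n) in
/-- The underlying vector space of the vector supermodule `V`, with basis `v_i` for
`i ∈ {±1, …, ±n}`. -/
abbrev VSp : Type := Idx n → K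

variable (K) in
/-- The basis vector `v_i`. -/
def vec (i : Idx n) : VSp K n := Pi.single i 1

variable (K) in
/-- The matrix unit `E_ij`, with `E_ij v_k = δ_jk v_i`. -/
def matUnit (i j : Idx n) : Module.End K (VSp K n) :=
  (LinearMap.proj j : VSp K n →ₗ[K] K).smulRight (vec K i)

theorem matUnit_vec (i j k : Idx n) : matUnit K i j (vec K k) = if j = k then vec K i else 0 := by
  by_cases h : j = k
  · subst h; simp [matUnit, vec]
  · simp [matUnit, vec, h]

theorem vec_ext {N : Type*} [AddCommGroup N] [Module K N] {f g : VSp K n →ₗ[K] N}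
    (h : ∀ i, f (vec K i) = g (vec K i)) : f = g :=
  LinearMap.pi_ext' fun i => LinearMap.ext_ring (h i)

theorem matUnit_mul (i j k l : Idx n) :
    matUnit K i j * matUnit K k l = if j = k then matUnit K i l else 0 := by
  refine vec_ext fun m => ?_
  rw [Module.End.mul_apply, matUnit_vec]
  split_ifs with h1 h2 h2 <;> simp [matUnit_vec, h1, h2]

theorem sum_matUnit : ∑ i, matUnit K (n := n) i i = 1 := by
  refine vec_ext fun m => ?_
  simp [LinearMap.sum_apply, matUnit_vec]

variable [NeZero (2 : K)]

theorem vspInv_inv (v : VSp K n) : (∑ i, ksgn K (par i) 1 • matUnit K i i)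
    ((∑ i, ksgn K (par i) 1 • matUnit K i i) v) = v := by
  have : (∑ i, ksgn K (par i) 1 • matUnit K (n := n) i i) *
      (∑ i, ksgn K (par i) 1 • matUnit K i i) = 1 := by
    simp only [Finset.sum_mul, Finset.mul_sum, smul_mul_smul_comm, matUnit_mul, smul_ite,
      smul_zero, Finset.sum_ite_eq', Finset.mem_univ, if_true, ksgn_mul_self, one_smul]
    exact sum_matUnit
  exact LinearMap.congr_fun this v

/-- The vector `v_i` is even for `i > 0` and odd for `i < 0`: the parity involution sends `v_i` to
`(-1)^p(i) v_i`. -/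
instance : Superspace K (VSp K n) :=
  Superspace.ofInvolution (∑ i, ksgn K (par i) 1 • matUnit K i i) vspInv_inv

end VSpace

/-! ### The vector supermodule -/

section YangBaxter

/-- The sign of an index. -/
def sg (K : Type) [Field K] (i : Idx n) : K := if (0 : ℤ) < i then 1 else -1

theorem sg_eq (i : Idx n) : ksgn K (par i) 1 = sg K i := by
  by_cases h : (0 : ℤ) < i <;> simp [sg, par, h]

theorem sg_neg (i : Idx n) : sg K (-i) = -sg K i := by
  have := i.ne_zero
  rcases lt_or_gt_of_ne this with h | h
  · simp [sg, h, not_lt.mpr h.le]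
  · simp [sg, h, not_lt.mpr h.le]

theorem sg_mul_self (i : Idx n) : sg K i * sg K i = 1 := by
  unfold sg; split_ifs <;> simp

theorem par_neg (i : Idx n) : par (-i) = par i + 1 := by
  have := i.ne_zero
  rcases lt_or_gt_of_ne this with h | h
  · rw [par, if_pos (by simpa using h), par, if_neg (by omega)]; rfl
  · rw [par, if_neg (by simp; omega), par, if_pos h]; rfl

/-- The sign `(-1)^(p(i)p(j))`. -/
def eps (K : Type) [Field K] (i j : Idx n) : K := ksgn K (par i) (par j)

theorem eps_neg_left (i j : Idx n) : eps K (-i) j = sg K j * eps K i j := by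
  rw [eps, par_neg, ksgn_add_left, ksgn_comm 1, sg_eq, mul_comm]; rfl

theorem eps_neg_right (i j : Idx n) : eps K i (-j) = sg K i * eps K i j := by
  rw [eps, par_neg, ksgn_add_right, sg_eq, mul_comm]; rfl

theorem eps_comm (i j : Idx n) : eps K i j = eps K j i := ksgn_comm _ _

theorem eps_mul_self (i j : Idx n) : eps K i j * eps K i j = 1 := ksgn_mul_self _ _

theorem eps_self (i : Idx n) : eps K i i = sg K i := by
  by_cases h : (0 : ℤ) < i <;> simp [eps, sg, par, h]

theorem phi_neg_left (i j : Idx n) : phi (-i) j = phi i j := by simp [phi]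

theorem phi_neg_right (i j : Idx n) : phi i (-j) = -phi i j := by
  simp only [phi, Idx.coe_neg, Int.natAbs_neg, Int.sign_neg]; split_ifs <;> simp

theorem theta_sum {N : Type*} [AddCommGroup N] [Module K N] (f : Idx n → Idx n → N)
    (e c : Idx n) : ∑ k, ∑ a, theta q k e a c • f k a = q ^ phi e c • f e c +
      ((if e < c then ((q - q⁻¹) * sg K e) • f c e else 0) +
        if -e < c then ((q - q⁻¹) * -sg K e) • f (-c) (-e) else 0) := by
  have h : ∀ k a : Idx n, theta q k e a c • f k a =
      (if k = e then if a = c then q ^ phi e c • f e c else 0 else 0) +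
      ((if k = c then if a = e then if e < c then ((q - q⁻¹) * sg K e) • f c e else 0 else 0
        else 0) +
      (if k = -c then if a = -e then if -e < c then ((q - q⁻¹) * -sg K e) • f (-c) (-e) else 0
        else 0 else 0)) := by
    intro k a
    have hc := c.ne_zero
    have hcc : c ≠ -c := fun h => hc (by have := congrArg Subtype.val h; simp at this; omega)
    have e1 : (k = e ∧ a = c) ↔ (k = e ∧ a = c) := Iff.rfl
    rw [theta, add_smul]
    congr 1
    · by_cases h1 : k = e <;> by_cases h2 : a = c <;> simp [h1, h2]
    · by_cases h1 : k = c
      · subst h1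
        by_cases h2 : a = e
        · subst h2
          by_cases h3 : a < k <;> simp [h3, hcc, sg_eq, mul_comm]
        · simp [hcc, h2, Ne.symm h2]
      · by_cases h1' : k = -c
        · subst h1'
          by_cases h2 : a = -e
          · subst h2
            by_cases h3 : -e < c <;> simp [h3, hcc.symm, sg_eq, sg_neg, mul_comm]
          · have : e ≠ -a := fun h => h2 (by rw [h, neg_neg])
            simp [hcc.symm, h2, this]
        · simp [h1, h1']
  simp only [h, Finset.sum_add_distrib, Finset.sum_ite_irrel, Finset.sum_const_zero,
    Finset.sum_ite_eq', Finset.mem_univ, if_true]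

variable (K n) in
/-- A model of `V ⊗ V ⊗ V`. -/
abbrev V3 : Type := Idx n × Idx n → VSp K n

variable (K) in
/-- The basis vector `v_a ⊗ v_b ⊗ v_c`. -/
def bas (a b c : Idx n) : V3 K n := Pi.single (b, c) (vec K a)

theorem bas_ext {N : Type*} [AddCommGroup N] [Module K N] {f g : V3 K n →ₗ[K] N}
    (h : ∀ a b c, f (bas K a b c) = g (bas K a b c)) : f = g :=
  LinearMap.pi_ext' fun x => vec_ext fun a => h a x.1 x.2

/-- The operator with prescribed values on the basis. -/
def opOf (g : Idx n → Idx n → Idx n → V3 K n) : Module.End K (V3 K n) :=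
  ∑ a, ∑ b, ∑ c, ((LinearMap.proj a : VSp K n →ₗ[K] K) ∘ₗ
    (LinearMap.proj (b, c) : V3 K n →ₗ[K] VSp K n)).smulRight (g a b c)

theorem opOf_bas (g : Idx n → Idx n → Idx n → V3 K n) (a b c : Idx n) :
    opOf g (bas K a b c) = g a b c := by
  have h : ∀ a' b' c', (bas K a b c) (b', c') a' = if a' = a then if b' = b then if c' = c then
      (1 : K) else 0 else 0 else 0 := by
    intro a' b' c'
    by_cases hb : b' = b <;> by_cases hc : c' = c <;> by_cases ha : a' = a <;>
      simp [bas, vec, ha, hb, hc]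
  simp only [opOf, LinearMap.sum_apply, LinearMap.smulRight_apply, LinearMap.comp_apply,
    LinearMap.proj_apply, h, ite_smul, one_smul, zero_smul, Finset.sum_ite_irrel,
    Finset.sum_const_zero, Finset.sum_ite_eq', Finset.mem_univ, if_true]

/-- The braiding on the first two factors. -/
def T1 : Module.End K (V3 K n) := opOf fun a b c =>
  (eps K a b * q ^ phi a b) • bas K b a c + ((if a < b then (q - q⁻¹) • bas K a b c else 0) +
    if -a < b then ((q - q⁻¹) * sg K b) • bas K (-a) (-b) c else 0)

/-- The braiding on the last two factors. -/
def T2 : Module.End K (V3 K n) := opOf fun a b c =>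
  (eps K b c * q ^ phi b c) • bas K a c b + ((if b < c then (q - q⁻¹) • bas K a b c else 0) +
    if -b < c then ((q - q⁻¹) * sg K c) • bas K a (-b) (-c) else 0)

variable (K n) in
/-- The symmetry of the first two factors. -/
def P1 : Module.End K (V3 K n) := opOf fun a b c => eps K a b • bas K b a c

variable (K n) in
/-- The symmetry of the last two factors. -/
def P2 : Module.End K (V3 K n) := opOf fun a b c => eps K b c • bas K a c b

variable (K n) in
/-- The odd operator `J` on the first factor. -/
def J1 : Module.End K (V3 K n) := opOf fun a b c => sg K a • bas K (-a) b c

variable (K n) in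
/-- The odd operator `J` on the second factor. -/
def J2 : Module.End K (V3 K n) := opOf fun a b c => (sg K a * sg K b) • bas K a (-b) c

variable (K n) in
/-- The odd operator `J` on the third factor. -/
def J3 : Module.End K (V3 K n) := opOf fun a b c =>
  (sg K a * sg K b * sg K c) • bas K a b (-c)

theorem T1_bas (a b c : Idx n) : T1 q (bas K a b c) = (eps K a b * q ^ phi a b) • bas K b a c +
    ((if a < b then (q - q⁻¹) • bas K a b c else 0) +
    if -a < b then ((q - q⁻¹) * sg K b) • bas K (-a) (-b) c else 0) := opOf_bas _ _ _ _
theorem T2_bas (a b c : Idx n) : T2 q (bas K a b c) = (eps K b c * q ^ phi b c) • bas K a c b +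
    ((if b < c then (q - q⁻¹) • bas K a b c else 0) +
    if -b < c then ((q - q⁻¹) * sg K c) • bas K a (-b) (-c) else 0) := opOf_bas _ _ _ _
theorem P1_bas (a b c : Idx n) : P1 K n (bas K a b c) = eps K a b • bas K b a c :=
  opOf_bas _ _ _ _
theorem P2_bas (a b c : Idx n) : P2 K n (bas K a b c) = eps K b c • bas K a c b :=
  opOf_bas _ _ _ _
theorem J1_bas (a b c : Idx n) : J1 K n (bas K a b c) = sg K a • bas K (-a) b c :=
  opOf_bas _ _ _ _
theorem J2_bas (a b c : Idx n) : J2 K n (bas K a b c) = (sg K a * sg K b) • bas K a (-b) c :=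
  opOf_bas _ _ _ _
theorem J3_bas (a b c : Idx n) : J3 K n (bas K a b c) =
    (sg K a * sg K b * sg K c) • bas K a b (-c) := opOf_bas _ _ _ _

theorem op_congr {A B : Module.End K (V3 K n)} (h : ∀ a b c, A (bas K a b c) = B (bas K a b c))
    (x : V3 K n) : A x = B x := LinearMap.congr_fun (bas_ext h) x

theorem sg_cases (i : Idx n) : sg K i = 1 ∨ sg K i = -1 := by
  unfold sg; split_ifs <;> simp

theorem T1_J1 (x : V3 K n) : T1 q (J1 K n x) = J2 K n (T1 q x) := by
  refine op_congr (A := T1 q * J1 K n) (B := J2 K n * T1 q) (fun a b c => ?_) x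
  rw [Module.End.mul_apply, Module.End.mul_apply, J1_bas, map_smul, T1_bas, T1_bas]
  simp only [map_add, map_smul, apply_ite (J2 K n), map_zero, J2_bas, neg_neg, eps_neg_left,
    phi_neg_left, sg_neg]
  rcases sg_cases (K := K) b with hb | hb <;>
    by_cases h1 : a < b <;> by_cases h2 : -a < b <;> simp only [h1, h2, hb, if_true, if_false] <;>
    module

theorem T2_J2 (x : V3 K n) : T2 q (J2 K n x) = J3 K n (T2 q x) := by
  refine op_congr (A := T2 q * J2 K n) (B := J3 K n * T2 q) (fun a b c => ?_) x
  rw [Module.End.mul_apply, Module.End.mul_apply, J2_bas, map_smul, T2_bas, T2_bas]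
  simp only [map_add, map_smul, apply_ite (J3 K n), map_zero, J3_bas, neg_neg, eps_neg_left,
    phi_neg_left, sg_neg]
  rcases sg_cases (K := K) c with hb | hb <;>
    by_cases h1 : b < c <;> by_cases h2 : -b < c <;> simp only [h1, h2, hb, if_true, if_false] <;>
    module

theorem T1_J3 (x : V3 K n) : T1 q (J3 K n x) = J3 K n (T1 q x) := by
  refine op_congr (A := T1 q * J3 K n) (B := J3 K n * T1 q) (fun a b c => ?_) x
  rw [Module.End.mul_apply, Module.End.mul_apply, J3_bas, map_smul, T1_bas, T1_bas]
  simp only [map_add, map_smul, apply_ite (J3 K n), map_zero, J3_bas, sg_neg]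
  by_cases h1 : a < b <;> by_cases h2 : -a < b <;> simp only [h1, h2, if_true, if_false] <;>
    module

theorem T2_J1 (x : V3 K n) : T2 q (J1 K n x) = J1 K n (T2 q x) := by
  refine op_congr (A := T2 q * J1 K n) (B := J1 K n * T2 q) (fun a b c => ?_) x
  rw [Module.End.mul_apply, Module.End.mul_apply, J1_bas, map_smul, T2_bas, T2_bas]
  simp only [map_add, map_smul, apply_ite (J1 K n), map_zero, J1_bas]
  by_cases h1 : b < c <;> by_cases h2 : -b < c <;> simp only [h1, h2, if_true, if_false] <;>
    module

theorem P1_P1 (x : V3 K n) : P1 K n (P1 K n x) = x := by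
  refine op_congr (A := P1 K n * P1 K n) (B := 1) (fun a b c => ?_) x
  rw [Module.End.mul_apply, P1_bas, map_smul, P1_bas, smul_smul, eps_comm b a, eps_mul_self,
    one_smul, Module.End.one_apply]

theorem P2_P2 (x : V3 K n) : P2 K n (P2 K n x) = x := by
  refine op_congr (A := P2 K n * P2 K n) (B := 1) (fun a b c => ?_) x
  rw [Module.End.mul_apply, P2_bas, map_smul, P2_bas, smul_smul, eps_comm c b, eps_mul_self,
    one_smul, Module.End.one_apply]

theorem P_braid (x : V3 K n) :
    P1 K n (P2 K n (P1 K n x)) = P2 K n (P1 K n (P2 K n x)) := by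
  refine op_congr (A := P1 K n * (P2 K n * P1 K n)) (B := P2 K n * (P1 K n * P2 K n))
    (fun a b c => ?_) x
  simp only [Module.End.mul_apply, P1_bas, P2_bas, map_smul]
  module

theorem T1_P2_P1 (x : V3 K n) : T1 q (P2 K n (P1 K n x)) = P2 K n (P1 K n (T2 q x)) := by
  refine op_congr (A := T1 q * (P2 K n * P1 K n)) (B := P2 K n * (P1 K n * T2 q))
    (fun a b c => ?_) x
  simp only [Module.End.mul_apply, P1_bas, P2_bas, T1_bas, T2_bas, map_smul, map_add,
    apply_ite (P1 K n), apply_ite (P2 K n), map_zero, eps_neg_right]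
  rcases sg_cases (K := K) a with ha | ha <;>
  by_cases h1 : b < c <;> by_cases h2 : -b < c <;> simp only [h1, h2, ha, if_true, if_false] <;>
    module

theorem T2_P1_P2 (x : V3 K n) : T2 q (P1 K n (P2 K n x)) = P1 K n (P2 K n (T1 q x)) := by
  refine op_congr (A := T2 q * (P1 K n * P2 K n)) (B := P1 K n * (P2 K n * T1 q))
    (fun a b c => ?_) x
  simp only [Module.End.mul_apply, P1_bas, P2_bas, T1_bas, T2_bas, map_smul, map_add,
    apply_ite (P1 K n), apply_ite (P2 K n), map_zero, eps_neg_left]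
  rcases sg_cases (K := K) c with ha | ha <;>
  by_cases h1 : a < b <;> by_cases h2 : -a < b <;> simp only [h1, h2, ha, if_true, if_false] <;>
    module

/-- `q^{δ_ab}`. -/
def qd (a b : Idx n) : K := if a = b then q else 1
/-- `q^{-δ_ab}`. -/
def qdi (a b : Idx n) : K := if a = b then q⁻¹ else 1

theorem qpow_pos {a b : Idx n} (ha : (0 : ℤ) < a) (hb : (0 : ℤ) < b) :
    q ^ phi a b = qd q a b := by
  by_cases h : a = b
  · subst h; simp [phi, qd, Int.sign_eq_one_of_pos ha]
  · have : (a : ℤ).natAbs ≠ (b : ℤ).natAbs := fun h' => h (Subtype.ext (by omega))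
    simp [phi, qd, h, this]

theorem qpow_neg {a b : Idx n} (ha : (0 : ℤ) < a) (hb : (0 : ℤ) < b) :
    q ^ (-phi a b) = qdi q a b := by
  by_cases h : a = b
  · subst h; simp [phi, qdi, Int.sign_eq_one_of_pos ha]
  · have : (a : ℤ).natAbs ≠ (b : ℤ).natAbs := fun h' => h (Subtype.ext (by omega))
    simp [phi, qdi, h, this]

theorem eps_pos {a b : Idx n} (hb : (0 : ℤ) < b) : eps K a b = 1 := by
  simp [eps, par, hb]
theorem sg_pos {a : Idx n} (ha : (0 : ℤ) < a) : sg K a = 1 := if_pos ha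
theorem neg_lt_pos {a b : Idx n} (ha : (0 : ℤ) < a) (hb : (0 : ℤ) < b) : -a < b := by
  change -(a : ℤ) < b; omega
theorem not_pos_lt_neg {a b : Idx n} (ha : (0 : ℤ) < a) (hb : (0 : ℤ) < b) : ¬ a < -b := by
  change ¬ (a : ℤ) < -b; omega
theorem neg_lt_neg_idx {a b : Idx n} : -a < -b ↔ b < a := by
  change -(a : ℤ) < -b ↔ (b : ℤ) < a; omega

section Rules

variable {a b c : Idx n} (ha : (0 : ℤ) < a) (hb : (0 : ℤ) < b) (hc : (0 : ℤ) < c) (e : Idx n)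

theorem T1_pp (ha : (0 : ℤ) < a) (hb : (0 : ℤ) < b) : T1 q (bas K a b e) =
    qd q a b • bas K b a e + ((if a < b then (q - q⁻¹) • bas K a b e else 0) +
      (q - q⁻¹) • bas K (-a) (-b) e) := by
  simp [T1_bas, qpow_pos q ha hb, eps_pos hb, sg_pos hb, neg_lt_pos ha hb]

theorem T1_np (ha : (0 : ℤ) < a) (hb : (0 : ℤ) < b) : T1 q (bas K (-a) b e) =
    qd q a b • bas K b (-a) e + ((q - q⁻¹) • bas K (-a) b e +
      (if a < b then (q - q⁻¹) • bas K a (-b) e else 0)) := by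
  simp [T1_bas, phi_neg_left, qpow_pos q ha hb, eps_pos hb, sg_pos hb, neg_lt_pos ha hb]

theorem T1_pn (ha : (0 : ℤ) < a) (hb : (0 : ℤ) < b) : T1 q (bas K a (-b) e) =
    qdi q a b • bas K (-b) a e - (if b < a then (q - q⁻¹) • bas K (-a) b e else 0) := by
  by_cases h : b < a <;>
  simp [T1_bas, phi_neg_right, qpow_neg q ha hb, eps_neg_right, eps_pos hb, sg_neg, sg_pos hb,
    sg_pos ha, not_pos_lt_neg ha hb, neg_lt_neg_idx, h] <;> module

theorem T1_nn (ha : (0 : ℤ) < a) (hb : (0 : ℤ) < b) : T1 q (bas K (-a) (-b) e) =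
    -(qdi q a b • bas K (-b) (-a) e) + (if b < a then (q - q⁻¹) • bas K (-a) (-b) e else 0) := by
  by_cases h : b < a <;>
  simp [T1_bas, phi_neg_right, phi_neg_left, qpow_neg q ha hb, eps_neg_right,
    eps_pos hb, sg_neg, sg_pos ha, not_pos_lt_neg ha hb, neg_lt_neg_idx, h]

theorem T2_pp (ha : (0 : ℤ) < a) (hb : (0 : ℤ) < b) : T2 q (bas K e a b) =
    qd q a b • bas K e b a + ((if a < b then (q - q⁻¹) • bas K e a b else 0) +
      (q - q⁻¹) • bas K e (-a) (-b)) := by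
  simp [T2_bas, qpow_pos q ha hb, eps_pos hb, sg_pos hb, neg_lt_pos ha hb]

theorem T2_np (ha : (0 : ℤ) < a) (hb : (0 : ℤ) < b) : T2 q (bas K e (-a) b) =
    qd q a b • bas K e b (-a) + ((q - q⁻¹) • bas K e (-a) b +
      (if a < b then (q - q⁻¹) • bas K e a (-b) else 0)) := by
  simp [T2_bas, phi_neg_left, qpow_pos q ha hb, eps_pos hb, sg_pos hb, neg_lt_pos ha hb]

theorem T2_pn (ha : (0 : ℤ) < a) (hb : (0 : ℤ) < b) : T2 q (bas K e a (-b)) =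
    qdi q a b • bas K e (-b) a - (if b < a then (q - q⁻¹) • bas K e (-a) b else 0) := by
  by_cases h : b < a <;>
  simp [T2_bas, phi_neg_right, qpow_neg q ha hb, eps_neg_right, eps_pos hb, sg_neg, sg_pos hb,
    sg_pos ha, not_pos_lt_neg ha hb, neg_lt_neg_idx, h] <;> module

theorem T2_nn (ha : (0 : ℤ) < a) (hb : (0 : ℤ) < b) : T2 q (bas K e (-a) (-b)) =
    -(qdi q a b • bas K e (-b) (-a)) + (if b < a then (q - q⁻¹) • bas K e (-a) (-b) else 0) := by
  by_cases h : b < a <;>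
  simp [T2_bas, phi_neg_right, phi_neg_left, qpow_neg q ha hb, eps_neg_right,
    eps_pos hb, sg_neg, sg_pos ha, not_pos_lt_neg ha hb, neg_lt_neg_idx, h]

end Rules

theorem pos_or_neg (a : Idx n) : (0 : ℤ) < a ∨ ∃ b : Idx n, (0 : ℤ) < b ∧ a = -b := by
  have := a.ne_zero
  by_cases h : (0 : ℤ) < a
  · exact Or.inl h
  · exact Or.inr ⟨-a, by rw [Idx.coe_neg]; omega, (neg_neg a).symm⟩

variable {q}

theorem order_cases (a b : Idx n) : (a < b ∧ ¬ b < a ∧ a ≠ b ∧ b ≠ a) ∨ a = b ∨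
    (b < a ∧ ¬ a < b ∧ a ≠ b ∧ b ≠ a) := by
  rcases lt_trichotomy a b with h | h | h
  · exact Or.inl ⟨h, h.not_gt, h.ne, h.ne'⟩
  · exact Or.inr (Or.inl h)
  · exact Or.inr (Or.inr ⟨h, h.not_gt, h.ne', h.ne⟩)

theorem T1_T1 (hq : q ≠ 0) (x : V3 K n) : T1 q (T1 q x) = (q - q⁻¹) • T1 q x + x := by
  refine op_congr (A := T1 q * T1 q) (B := (q - q⁻¹) • T1 q + 1) (fun a b c => ?_) x
  rw [Module.End.mul_apply, LinearMap.add_apply, LinearMap.smul_apply, Module.End.one_apply]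
  rcases pos_or_neg a with ha | ⟨a, ha, rfl⟩ <;> rcases pos_or_neg b with hb | ⟨b, hb, rfl⟩ <;>
    rcases order_cases a b with ⟨h1, h2, h3, h4⟩ | rfl | ⟨h1, h2, h3, h4⟩ <;>
    simp only [T1_pp q _ ha hb, T1_pp q _ hb ha, T1_np q _ ha hb, T1_np q _ hb ha,
      T1_pn q _ ha hb, T1_pn q _ hb ha, T1_nn q _ ha hb, T1_nn q _ hb ha, map_add, map_sub,
      map_smul, map_neg, qd, qdi, *, lt_irrefl, if_true, if_false, map_zero] <;>
    (match_scalars <;> field_simp <;> ring)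

theorem T2_T2 (hq : q ≠ 0) (x : V3 K n) : T2 q (T2 q x) = (q - q⁻¹) • T2 q x + x := by
  have h : ∀ x : V3 K n, T2 q x = P1 K n (P2 K n (T1 q (P2 K n (P1 K n x)))) := fun x => by
    rw [T1_P2_P1, P2_P2, P1_P1]
  rw [h (T2 q x), ← T1_P2_P1, T1_T1 hq, map_add, map_add, map_smul, map_smul, ← h, P2_P2, P1_P1]

theorem T1_J2 (hq : q ≠ 0) (x : V3 K n) : T1 q (J2 K n x) =
    J1 K n (T1 q x) - (q - q⁻¹) • J1 K n x + (q - q⁻¹) • J2 K n x := by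
  have h1 : T1 q (T1 q x - (q - q⁻¹) • x) = x := by
    rw [map_sub, map_smul, T1_T1 hq, add_sub_cancel_left]
  have h2 := T1_J1 q (T1 q x - (q - q⁻¹) • x)
  rw [h1] at h2
  rw [← h2, T1_T1 hq, map_sub, map_smul]
  module

theorem T2_J3 (hq : q ≠ 0) (x : V3 K n) : T2 q (J3 K n x) =
    J2 K n (T2 q x) - (q - q⁻¹) • J2 K n x + (q - q⁻¹) • J3 K n x := by
  have h1 : T2 q (T2 q x - (q - q⁻¹) • x) = x := by
    rw [map_sub, map_smul, T2_T2 hq, add_sub_cancel_left]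
  have h2 := T2_J2 q (T2 q x - (q - q⁻¹) • x)
  rw [h1] at h2
  rw [← h2, T2_T2 hq, map_sub, map_smul]
  module

variable (q) in
/-- The difference of the two sides of the braid relation. -/
def braidDefect (x : V3 K n) : V3 K n := T1 q (T2 q (T1 q x)) - T2 q (T1 q (T2 q x))

theorem braidDefect_J1 (x : V3 K n) : braidDefect q (J1 K n x) = J3 K n (braidDefect q x) := by
  simp only [braidDefect, T1_J1, T2_J2, T1_J3, T2_J1, map_sub]

theorem braidDefect_J2 (hq : q ≠ 0) (x : V3 K n) :
    braidDefect q (J2 K n x) = J2 K n (braidDefect q x) := by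
  simp only [braidDefect, T1_J1, T2_J2, T1_J3, T2_J1, T1_J2 hq, T2_J3 hq, map_sub, map_add,
    map_smul]
  module

theorem braidDefect_J3 (hq : q ≠ 0) (x : V3 K n) :
    braidDefect q (J3 K n x) = J1 K n (braidDefect q x) := by
  simp only [braidDefect, T1_J1, T2_J2, T1_J3, T2_J1, T1_J2 hq, T2_J3 hq, map_sub, map_add,
    map_smul, T1_T1 hq, T2_T2 hq]
  module

theorem braidDefect_pos (hq : q ≠ 0) {a b c : Idx n} (ha : (0 : ℤ) < a) (hb : (0 : ℤ) < b)
    (hc : (0 : ℤ) < c) : braidDefect q (bas K a b c) = 0 := by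
  rcases order_cases a b with ⟨h1, h2, h3, h4⟩ | h1 | ⟨h1, h2, h3, h4⟩ <;>
    rcases order_cases b c with ⟨h5, h6, h7, h8⟩ | h5 | ⟨h5, h6, h7, h8⟩ <;>
    rcases order_cases a c with ⟨h9, h10, h11, h12⟩ | h9 | ⟨h9, h10, h11, h12⟩ <;>
    first
    | (exfalso; order)
    | (subst_vars
       simp only [braidDefect, T1_pp, T1_np, T1_pn, T1_nn, T2_pp, T2_np, T2_pn, T2_nn, map_add,
         map_sub, map_smul, map_neg, qd, qdi, *, lt_irrefl, if_true, if_false, map_zero]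
       match_scalars <;> field_simp <;> ring)

/-- The braid relation. -/
theorem braid (hq : q ≠ 0) (x : V3 K n) : T1 q (T2 q (T1 q x)) = T2 q (T1 q (T2 q x)) := by
  have hs : ∀ a : Idx n, sg K a ≠ 0 := fun a => by
    rcases sg_cases (K := K) a with h | h <;> simp [h]
  have e1 : ∀ a b c : Idx n, braidDefect q (bas K a b c) = 0 → braidDefect q (bas K (-a) b c) = 0 := by
    intro a b c h
    have := braidDefect_J1 (q := q) (bas K a b c)
    rw [J1_bas, h, map_zero] at this
    simpa only [braidDefect, map_smul, ← smul_sub, smul_eq_zero, hs, false_or] using this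
  have e2 : ∀ a b c : Idx n, braidDefect q (bas K a b c) = 0 → braidDefect q (bas K a (-b) c) = 0 := by
    intro a b c h
    have := braidDefect_J2 hq (bas K a b c)
    rw [J2_bas, h, map_zero] at this
    simpa only [braidDefect, map_smul, ← smul_sub, smul_eq_zero, mul_eq_zero, hs, false_or,
      or_self] using this
  have e3 : ∀ a b c : Idx n, braidDefect q (bas K a b c) = 0 → braidDefect q (bas K a b (-c)) = 0 := by
    intro a b c h
    have := braidDefect_J3 hq (bas K a b c)
    rw [J3_bas, h, map_zero] at this
    simpa only [braidDefect, map_smul, ← smul_sub, smul_eq_zero, mul_eq_zero, hs, false_or,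
      or_self] using this
  refine op_congr (A := T1 q * (T2 q * T1 q)) (B := T2 q * (T1 q * T2 q)) (fun a b c => ?_) x
  refine sub_eq_zero.mp (show braidDefect q (bas K a b c) = 0 from ?_)
  rcases pos_or_neg a with ha | ⟨a, ha, rfl⟩ <;> rcases pos_or_neg b with hb | ⟨b, hb, rfl⟩ <;>
    rcases pos_or_neg c with hc | ⟨c, hc, rfl⟩
  · exact braidDefect_pos hq ha hb hc
  · exact e3 _ _ _ (braidDefect_pos hq ha hb hc)
  · exact e2 _ _ _ (braidDefect_pos hq ha hb hc)
  · exact e2 _ _ _ (e3 _ _ _ (braidDefect_pos hq ha hb hc))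
  · exact e1 _ _ _ (braidDefect_pos hq ha hb hc)
  · exact e1 _ _ _ (e3 _ _ _ (braidDefect_pos hq ha hb hc))
  · exact e1 _ _ _ (e2 _ _ _ (braidDefect_pos hq ha hb hc))
  · exact e1 _ _ _ (e2 _ _ _ (e3 _ _ _ (braidDefect_pos hq ha hb hc)))

end YangBaxter

section VectorModule

variable [NeZero (2 : K)]

theorem inv_vec (i : Idx n) : inv K (VSp K n) (vec K i) = ksgn K (par i) 1 • vec K i := by
  rw [show inv K (VSp K n) = ∑ i, ksgn K (par i) 1 • matUnit K i i from
      inv_ofInvolution _ vspInv_inv,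
    LinearMap.sum_apply, Finset.sum_eq_single i]
  · rw [LinearMap.smul_apply, matUnit_vec, if_pos rfl]
  · intro k _ hk
    rw [LinearMap.smul_apply, matUnit_vec, if_neg hk, smul_zero]
  · simp

theorem vec_mem (i : Idx n) : vec K i ∈ Par K (VSp K n) (par i) := mem_of_inv (inv_vec i)

theorem matUnit_hasPar (i j : Idx n) : HasPar (matUnit K i j) (par i + par j) := by
  refine fun t => vec_ext fun k => ?_
  rw [Module.End.mul_apply, LinearMap.smul_apply, Module.End.mul_apply,
    invP_of_mem t (vec_mem k), map_smul, matUnit_vec]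
  split_ifs with h
  · subst h
    rw [invP_of_mem t (vec_mem i), smul_smul, ksgn_comm (par i + par j), ← ksgn_add_right,
      add_assoc, zmod2_add_self, add_zero]
  · simp

/-- The operator by which `u_ij` acts on `V`: the operator `Θ_ij`, where `Θ = ∑ Θ_ij ⊗ E_ij`. -/
def vectorAct (i j : Idx n) : Module.End K (VSp K n) :=
  ∑ k, ∑ l, theta q k l i j • matUnit K k l

theorem vectorAct_hasPar (i j : Idx n) : HasPar (vectorAct q i j) (par i + par j) := by
  refine HasPar.sum fun k => HasPar.sum fun l => ?_
  by_cases h : par k + par l = par i + par j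
  · rw [← h]; exact (matUnit_hasPar k l).smul _
  · rw [theta_eq_zero q h, zero_smul]; exact hasPar_zero _

theorem vectorAct_of_lt (i j : Idx n) (h : j < i) : vectorAct q i j = 0 := by
  refine Finset.sum_eq_zero fun k _ => Finset.sum_eq_zero fun l _ => ?_
  simp [theta, h.ne', h.not_gt]

theorem vectorAct_vec (i j e : Idx n) : vectorAct q i j (vec K e) =
    ∑ k, theta q k e i j • vec K k := by
  simp [vectorAct, LinearMap.sum_apply, matUnit_vec]

theorem vectorAct_self (i e : Idx n) : vectorAct q i i (vec K e) = q ^ phi e i • vec K e := by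
  rw [vectorAct_vec, Finset.sum_eq_single e]
  · simp [theta]
  · intro k _ hk
    simp [theta, hk]
  · simp

theorem vectorAct_diag (hq : q ≠ 0) (i : Idx n) :
    vectorAct q i i * vectorAct q (-i) (-i) = 1 := by
  refine vec_ext fun e => ?_
  rw [Module.End.mul_apply, vectorAct_self, map_smul, vectorAct_self, smul_smul, phi_neg_right,
    ← zpow_add₀ hq, neg_add_cancel, zpow_zero, one_smul, Module.End.one_apply]

variable (K n) in
/-- Matrices of operators on `V`, as operators on `V ⊗ V ⊗ V`. -/
def matOp : Matrix (Idx n × Idx n) (Idx n × Idx n) (Module.End K (VSp K n)) ≃+*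
    Module.End K (V3 K n) := (endVecRingEquivMatrixEnd (Idx n × Idx n) K (VSp K n)).symm

theorem matOp_bas (X : Matrix (Idx n × Idx n) (Idx n × Idx n) (Module.End K (VSp K n)))
    (e c d : Idx n) : matOp K n X (bas K e c d) = fun x => X x (c, d) (vec K e) := by
  funext x
  change ∑ y, X x y ((bas K e c d : V3 K n) y) = _
  rw [Finset.sum_eq_single (c, d)]
  · simp [bas]
  · intro y _ hy
    simp [bas, hy]
  · simp

theorem bas_apply (e c d : Idx n) (x : Idx n × Idx n) :
    bas K e c d x = if x.2 = d then if x.1 = c then vec K e else 0 else 0 := by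
  rcases x with ⟨a, b⟩
  by_cases h1 : a = c <;> by_cases h2 : b = d <;> simp [bas, h1, h2]

theorem lmat_vectorAct_vec (a c e : Idx n) : lmat (vectorAct q) a c (vec K e) =
    ∑ k, theta q k e a c • (ksgn K (par e) (par a + par c) • vec K k) := by
  rw [lmat, Module.End.mul_apply, invP_of_mem _ (vec_mem e), map_smul, vectorAct_vec,
    Finset.smul_sum]
  refine Finset.sum_congr rfl fun k _ => ?_
  rw [smul_comm, ksgn_comm]

theorem matOp_mat1 (x : V3 K n) :
    matOp K n (mat1 (lmat (vectorAct q))) x = P1 K n (T1 q x) := by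
  refine op_congr (A := matOp K n (mat1 (lmat (vectorAct q)))) (B := P1 K n * T1 q)
    (fun e c d => ?_) x
  have h : matOp K n (mat1 (lmat (vectorAct q))) (bas K e c d) =
      ∑ k, ∑ a, theta q k e a c • (ksgn K (par e) (par a + par c) • bas K k a d) := by
    rw [matOp_bas]
    funext x
    simp only [Finset.sum_apply, Pi.smul_apply, bas_apply, mat1]
    rw [Finset.sum_comm, Finset.sum_eq_single x.1]
    · by_cases h : x.2 = d <;> simp [h, lmat_vectorAct_vec]
    · intro a _ ha
      simp [Ne.symm ha]
    · simp
  rw [h, theta_sum, Module.End.mul_apply, T1_bas]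
  simp only [map_add, map_smul, apply_ite (P1 K n), map_zero, P1_bas, eps_neg_left, eps_neg_right,
    par_neg, ksgn_add_right, sg_eq, ← eps.eq_def, eps_self]
  rw [sg_neg, eps_comm c e]
  rcases sg_cases (K := K) e with he | he <;> rcases sg_cases (K := K) c with hc | hc <;>
    by_cases h1 : e < c <;> by_cases h2 : -e < c <;>
    simp only [h1, h2, he, hc, if_true, if_false] <;> module

theorem matOp_mat2 (x : V3 K n) :
    matOp K n (mat2 K (lmat (vectorAct q))) x = P2 K n (P1 K n (T1 q (P2 K n x))) := by
  refine op_congr (A := matOp K n (mat2 K (lmat (vectorAct q))))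
    (B := P2 K n * (P1 K n * (T1 q * P2 K n))) (fun e c d => ?_) x
  have h : matOp K n (mat2 K (lmat (vectorAct q))) (bas K e c d) =
      ∑ k, ∑ b, theta q k e b d • ((ksgn K (par b + par d) (par c) *
        ksgn K (par e) (par b + par d)) • bas K k c b) := by
    rw [matOp_bas]
    funext x
    simp only [Finset.sum_apply, Pi.smul_apply, bas_apply, mat2]
    rw [Finset.sum_comm, Finset.sum_eq_single x.2]
    · by_cases h : x.1 = c
      · simp only [h, if_true, LinearMap.smul_apply, lmat_vectorAct_vec, Finset.smul_sum]
        refine Finset.sum_congr rfl fun k _ => ?_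
        module
      · simp [h]
    · intro a _ ha
      simp [Ne.symm ha]
    · simp
  rw [h, theta_sum]
  simp only [Module.End.mul_apply, P2_bas, map_smul, T1_bas]
  simp only [map_add, map_smul, apply_ite (P1 K n), apply_ite (P2 K n), map_zero, P1_bas, P2_bas,
    eps_neg_left, eps_neg_right, par_neg, ksgn_add_right, ksgn_add_left, ksgn_comm 1, sg_eq,
    ← eps.eq_def, eps_self, sg_neg]
  rw [eps_comm d e, eps_comm d c, eps_comm e c]
  rcases sg_cases (K := K) e with he | he <;> rcases sg_cases (K := K) c with hc | hc <;>
    rcases sg_cases (K := K) d with hd | hd <;>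
    by_cases h1 : e < d <;> by_cases h2 : -e < d <;>
    simp only [h1, h2, he, hc, hd, if_true, if_false] <;> module

theorem matOp_matTheta (x : V3 K n) : matOp K n (matTheta q n _) x = P2 K n (T2 q x) := by
  refine op_congr (A := matOp K n (matTheta q n _)) (B := P2 K n * T2 q) (fun e c d => ?_) x
  have h : matOp K n (matTheta q n _) (bas K e c d) =
      ∑ a, ∑ b, theta q a c b d • (ksgn K (par b + par d) (par c) • bas K e a b) := by
    rw [matOp_bas]
    funext x
    simp only [Finset.sum_apply, Pi.smul_apply, bas_apply, matTheta, Module.algebraMap_end_apply]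
    rw [Finset.sum_eq_single x.1, Finset.sum_eq_single x.2]
    · simp only [if_true]; module
    · intro a _ ha
      simp [Ne.symm ha]
    · simp
    · intro a _ ha
      simp [Ne.symm ha]
    · simp
  rw [h, theta_sum, Module.End.mul_apply, T2_bas]
  simp only [map_add, map_smul, apply_ite (P2 K n), map_zero, P2_bas,
    eps_neg_left, eps_neg_right, par_neg, ksgn_add_right, ksgn_add_left, ksgn_comm 1, sg_eq,
    ← eps.eq_def, eps_self, sg_neg]
  rw [eps_comm d c]
  rcases sg_cases (K := K) c with hc | hc <;>
    rcases sg_cases (K := K) d with hd | hd <;>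
    by_cases h1 : c < d <;> by_cases h2 : -c < d <;>
    simp only [h1, h2, hc, hd, if_true, if_false] <;> module

theorem rll_vectorAct (hq : q ≠ 0) : RLL K q (lmat (vectorAct q (n := n))) := by
  refine (matOp K n).injective (LinearMap.ext fun x => ?_)
  simp only [map_mul, Module.End.mul_apply, matOp_mat1, matOp_mat2, matOp_matTheta]
  rw [P2_P2, T1_P2_P1, ← braid hq, T1_P2_P1, ← P_braid (P1 K n _), P1_P1, T2_P1_P2, P_braid]

variable (n) in
/-- The vector supermodule `V`: the generator `u_ij` acts by `Θ_ij`, where `Θ = ∑ Θ_ij ⊗ E_ij`. -/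
def SMod.vector (hq : q ≠ 0) : SMod.{0} q n :=
  SMod.ofOps q (VSp K n) (vectorAct q) (vectorAct_hasPar q) (vectorAct_of_lt q)
    (vectorAct_diag q hq) (rll_vectorAct q hq)

end VectorModule

/-! ### The affine action -/

section Affine

variable {q} [NeZero (2 : K)]

/-- The operator on `M ⊗ V` given by `m ⊗ v_j ↦ ∑_i X_ij m ⊗ v_i`. -/
def matrixOp {M : Type*} [AddCommGroup M] [Module K M]
    (X : Matrix (Idx n) (Idx n) (Module.End K M)) : Module.End K (M ⊗[K] VSp K n) :=
  ∑ i, ∑ j, TensorProduct.map (X i j) (matUnit K i j)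

theorem matrixOp_mul {M : Type*} [AddCommGroup M] [Module K M]
    (X Y : Matrix (Idx n) (Idx n) (Module.End K M)) :
    matrixOp (X * Y) = matrixOp X * matrixOp Y := by
  have h : ∀ (Z : Matrix (Idx n) (Idx n) (Module.End K M)) (m : M) (k : Idx n),
      matrixOp Z (m ⊗ₜ vec K k) = ∑ i, Z i k m ⊗ₜ vec K i := fun Z m k => by
    rw [matrixOp, LinearMap.sum_apply]
    refine Finset.sum_congr rfl fun i _ => ?_
    rw [LinearMap.sum_apply, Finset.sum_eq_single k]
    · rw [TensorProduct.map_tmul, matUnit_vec, if_pos rfl]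
    · intro j _ hj
      rw [TensorProduct.map_tmul, matUnit_vec, if_neg hj, TensorProduct.tmul_zero]
    · simp
  refine TensorProduct.ext (LinearMap.ext fun m => vec_ext fun k => ?_)
  change matrixOp (X * Y) (m ⊗ₜ vec K k) = matrixOp X (matrixOp Y (m ⊗ₜ vec K k))
  rw [h, h, map_sum]
  simp only [h, Matrix.mul_apply, LinearMap.sum_apply, Module.End.mul_apply, TensorProduct.sum_tmul]
  exact Finset.sum_comm

theorem matrixOp_one {M : Type*} [AddCommGroup M] [Module K M] :
    matrixOp (1 : Matrix (Idx n) (Idx n) (Module.End K M)) = 1 := by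
  have : ∀ i : Idx n, ∑ j, TensorProduct.map ((1 : Matrix (Idx n) (Idx n) (Module.End K M)) i j)
      (matUnit K i j) = TensorProduct.map 1 (matUnit K i i) := fun i => by
    rw [Finset.sum_eq_single i, Matrix.one_apply_eq]
    · intro j _ hj
      rw [Matrix.one_apply_ne hj.symm, TensorProduct.map_zero_left]
    · simp
  simp only [matrixOp, this]
  rw [show (1 : Module.End K (M ⊗[K] VSp K n)) = TensorProduct.map 1 1 from
    TensorProduct.map_id.symm, ← sum_matUnit]
  exact (map_sum (TensorProduct.mapBilinear (.id K) M (VSp K n) M (VSp K n) 1) _ _).symm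

namespace SMod

/-- The operator on `M ⊗ V` by which `L = ∑ u_ij ⊗ E_ij` acts:
`L (m ⊗ v_j) = ∑_i (-1)^((p(i)+p(j))|m|) u_ij m ⊗ v_i`. It is invertible. -/
def lEquiv (M : SMod.{u} q n) : M ⊗[K] VSp K n ≃ₗ[K] M ⊗[K] VSp K n :=
  LinearEquiv.ofLinearMap (matrixOp (lmat M.act)) (matrixOp (triInv (lmat M.act)))
    ((matrixOp_mul _ _).symm.trans
      ((congrArg matrixOp (mul_triInv M.lmat_act_of_lt M.lmat_act_diag)).trans matrixOp_one))
    ((matrixOp_mul _ _).symm.trans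
      ((congrArg matrixOp (triInv_mul M.lmat_act_of_lt M.lmat_act_diag)).trans matrixOp_one))

/-- The isomorphism `flip : M ⊗ V → V ⊗ M`, `m ⊗ v ↦ (-1)^(|m||v|) v ⊗ m`. -/
def flipEquiv (M : SMod.{u} q n) : M ⊗[K] VSp K n ≃ₗ[K] VSp K n ⊗[K] M :=
  LinearEquiv.ofLinearMap (superFlip K M (VSp K n)) (superFlip K (VSp K n) M)
    superFlip_superFlip superFlip_superFlip

/-- The isomorphism `T_MV = flip ∘ L : M ⊗ V → V ⊗ M`. -/
def braiding (M : SMod.{u} q n) : M ⊗[K] VSp K n ≃ₗ[K] VSp K n ⊗[K] M :=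
  M.lEquiv.trans M.flipEquiv

end SMod

variable (K n) in
/-- The odd operator `J v_i = (-1)^p(i) v_{-i}` on `V`. -/
def jMap : Module.End K (VSp K n) := ∑ i, ksgn K (par i) 1 • matUnit K (-i) i

namespace SMod

/-- The operator `K_M = T_MV ∘ (1 ⊗ J) ∘ T_MV⁻¹` on `V ⊗ M`, where
`(1 ⊗ J) (m ⊗ v) = (-1)^|m| m ⊗ J v`. -/
def kappa (M : SMod.{u} q n) : VSp K n ⊗[K] M →ₗ[K] VSp K n ⊗[K] M :=
  M.braiding.toLinearMap ∘ₗ TensorProduct.map (inv K M) (jMap K n) ∘ₗ M.braiding.symm.toLinearMap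

end SMod

variable (n) in
/-- The supermodule by which an arrow acts: `V` for `↑` and the dual `V*` for `↓`. -/
def arrowModule (hq : q ≠ 0) : Arrow → SMod.{0} q n
  | .up => SMod.vector q n hq
  | .down => (SMod.vector q n hq).dual

variable (n) in
/-- The endosuperfunctor by which a word `a b c …` acts: `M ↦ A ⊗ (B ⊗ (C ⊗ … M))`, where
`A, B, C, …` are the supermodules of the letters. -/
def actObj (hq : q ≠ 0) : List Arrow → SEnd K (SMod.{u} q n)
  | [] => Superfunctor.id K _
  | a :: X => (actObj hq X).comp (arrowModule n hq a).translate

/-- The `M`-component of the image of a diagram `X ⟶ Y` under a monoidal superfunctor `R` that sends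
each word to the endosuperfunctor by which it acts. -/
def component (hq : q ≠ 0) {P : Presentation Arrow K}
    {R : MonoidalSuperfunctor K P.Cat (SEnd K (SMod.{u} q n))} {X Y : List Arrow}
    (hX : R.obj ⟨X⟩ = actObj n hq X) (hY : R.obj ⟨Y⟩ = actObj n hq Y) (f : Diagram P.sig K X Y)
    (M : SMod.{u} q n) : (actObj n hq X).obj M →ₗ[K] (actObj n hq Y).obj M :=
  SMod.lin (Superfunctor.app
    (eqToHom hX.symm ≫ R.map (Presentation.mor (P := P) f) ≫ eqToHom hY) M)

variable (K) in
/-- The vector `v_i* ∈ V*` of the dual basis. -/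
def dvec (i : Idx n) : Module.Dual K (VSp K n) := LinearMap.proj i

variable (q) in
/-- The value on `v_i ⊗ v_j*` of the negative right crossing `V ⊗ V* → V* ⊗ V`. -/
def negRightVec (i j : Idx n) : Module.Dual K (VSp K n) ⊗[K] VSp K n :=
  (ksgn K (par i) (par j) * q ^ (-phi i j)) • (dvec K j ⊗ₜ vec K i) -
    (if i = j then ∑ k, if i < k then
      ((q - q⁻¹) * ksgn K (par i + par k) 1 *
        q ^ (2 * (i : ℤ).natAbs - 2 * (k : ℤ).natAbs : ℤ)) • (dvec K k ⊗ₜ vec K k) else 0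
      else 0) -
    (if i = -j then ∑ k, if j < k then
      ((q - q⁻¹) * ksgn K (par k) 1 *
        q ^ (2 * (i : ℤ).natAbs - 2 * (k : ℤ).natAbs : ℤ)) • (dvec K k ⊗ₜ vec K (-k)) else 0
      else 0)

open QSig in
/-- The action of `Q(z)` by tensoring on the left with `V` and `V*`: the object `↑` acts by `V ⊗ -`,
the object `↓` by `V* ⊗ -`, and a generating morphism `f` by `F(f) ⊗ 1_M`, where `F` sends the
crossings to `T_VV`, its inverse, and the map given by `negRightVec`, the cap to the evaluation, the
cup to the coevaluation, and the Clifford token to `J`. -/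
structure IsTensorAction (hq : q ≠ 0) {z : K}
    (R : MonoidalSuperfunctor K (Qcat z) (SEnd K (SMod.{u} q n))) : Prop where
  obj (X : List Arrow) : R.obj ⟨X⟩ = actObj n hq X
  pos (M : SMod.{u} q n) (v w : VSp K n) (m : M) :
    component hq (obj _) (obj _) pos M (v ⊗ₜ[K] (w ⊗ₜ[K] m) : VSp K n ⊗[K] (VSp K n ⊗[K] M)) =
      TensorProduct.assoc K (VSp K n) (VSp K n) M
        ((SMod.vector q n hq).braiding (v ⊗ₜ[K] w : VSp K n ⊗[K] VSp K n) ⊗ₜ[K] m)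
  neg (M : SMod.{u} q n) (v w : VSp K n) (m : M) :
    component hq (obj _) (obj _) neg M (v ⊗ₜ[K] (w ⊗ₜ[K] m) : VSp K n ⊗[K] (VSp K n ⊗[K] M)) =
      TensorProduct.assoc K (VSp K n) (VSp K n) M
        ((SMod.vector q n hq).braiding.symm (v ⊗ₜ[K] w : VSp K n ⊗[K] VSp K n) ⊗ₜ[K] m)
  negRight (M : SMod.{u} q n) (i j : Idx n) (m : M) :
    component hq (obj _) (obj _) negRight M
        (vec K i ⊗ₜ[K] (dvec K j ⊗ₜ[K] m) : VSp K n ⊗[K] (Module.Dual K (VSp K n) ⊗[K] M)) =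
      TensorProduct.assoc K (Module.Dual K (VSp K n)) (VSp K n) M (negRightVec q i j ⊗ₜ[K] m)
  cap (M : SMod.{u} q n) (f : Module.Dual K (VSp K n)) (v : VSp K n) (m : M) :
    component hq (obj _) (obj _) cap M
        (f ⊗ₜ[K] (v ⊗ₜ[K] m) : Module.Dual K (VSp K n) ⊗[K] (VSp K n ⊗[K] M)) = f v • m
  cup (M : SMod.{u} q n) (m : M) :
    component hq (obj _) (obj _) cup M m =
      (∑ i, vec K i ⊗ₜ[K] (dvec K i ⊗ₜ[K] m) : VSp K n ⊗[K] (Module.Dual K (VSp K n) ⊗[K] M))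
  tok (M : SMod.{u} q n) (v : VSp K n) (m : M) :
    component hq (obj _) (obj _) tok M (v ⊗ₜ[K] m : VSp K n ⊗[K] M) =
      (jMap K n v ⊗ₜ[K] m : VSp K n ⊗[K] M)

/-- `F` sends the open Clifford token to the supernatural transformation with components `K_M`. -/
def SendsDotToKappa (hq : q ≠ 0) {z : K}
    (F : MonoidalSuperfunctor K (AQcat z) (SEnd K (SMod.{u} q n))) : Prop :=
  ∃ h : F.obj ⟨[Arrow.up]⟩ = actObj n hq [Arrow.up], ∀ M : SMod.{u} q n,
    component hq h h AQSig.dot M = M.kappa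

end Affine

/-! ### The ground field `ℂ(q)` -/

/-- The ground field `ℂ(q)`. -/
abbrev Cq : Type := RatFunc ℂ

/-- The indeterminate `q`. -/
def qq : Cq := RatFunc.X

theorem qq_ne_zero : qq ≠ 0 := RatFunc.X_ne_zero

/-- The parameter `z = q - q⁻¹`. -/
def zz : Cq := qq - qq⁻¹

end QuantumGroup

end QIso

/-!
The supercategories `Q(z)` and `AQ(z)` are presented by generators and relations, so a monoidal
superfunctor out of them is the same thing as a choice of homogeneous values of the generators for
which the relations hold (`interpFunctor`), and it is determined by these values
(`MonoidalSuperfunctor.ext_of_gen`). Uniqueness follows, as the components of the values of the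
generators are prescribed. For existence the prescribed maps have to be supernatural transformations
between functors of supermodules, and to satisfy the relations. The action of `AQ(z)` is constructed
first; the action of `Q(z)` is its restriction.

The computations are made with the operators `t_ij` on a supermodule `M` that are the entries of the
braiding `T_MV`: `m ⊗ v_j ↦ ∑_i v_i ⊗ t_ij m`. They differ from the `u_ij` by parity involutions,
which absorb most signs: homomorphisms are the intertwiners of the `t_ij` (`SMod.mem_homPar_iff`),
tensor products of supermodules give products of matrices (`SMod.tm_tensor`), duals give transposes
of the entries of the inverse matrix (`SMod.tm_dual`), and the relation `L¹² L¹³ Θ²³ = Θ²³ L¹³ L¹²`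
becomes `SMod.rtt`. The last says that `T_MV` is a homomorphism (`SMod.braidMap_intertwines`).

* Upward crossings. On `V ⊗ V` the braid relation and the quadratic relation are transported from a
  coordinate model (`onLeft_braidMap_vecTm_braid`, `braidMap_vecTm_skein`).
* Sideways crossings. The positive left crossing `λ_+` is the mate of `T_VV`. In coordinates it is
  triangular, and its inverse is the map prescribed for `ρ_-`, by a telescoping sum of powers of `q`
  (`triangular_inverse`). The skein relation shows that `λ_+` is the braiding of `V*` with `V` plus
  a cap followed by a cup, so it is a homomorphism, and hence so is `ρ_-`.
* Closed bubbles. The image of `∑_i v_i ⊗ v_i*` under `ρ_-` is `∑_k γ_k v_k* ⊗ v_k`, and the `γ_k`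
  sum to zero (`sum_bubbleCoef`). With a token the bubble vanishes because `J` is off-diagonal.
* The open Clifford token. The maps `K_M` are conjugates of `1 ⊗ J` by the braiding of `M` with `V`.
  Therefore `K_M² = -1` (`kap_kap`); naturality of the braiding makes them supernatural (`kap_map`);
  and since the braiding of `W ⊗ M` is composed of those of `W` and `M`, the operator `K_{W ⊗ M}` is
  conjugate to `1 ⊗ K_M` (`kap_tensorMat`), which for `W = V` is the relation with the crossing.
* The bubble with an open token. By `kap_tensorMat` for `W = V*` it equals, up to signs, the sum
  over `e` of `∑_a γ_a t_{a,-e} s_ea`, where the `s_ij` are the entries of the inverse braiding. It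
  vanishes by the quantum trace identity `∑_a γ_a t_ad s_ea = δ_de γ_d` (`SMod.sum_bubble`), which
  is obtained from `SMod.rtt` by contracting with the `γ_a` and inverting `λ_+`.

A relation between diagrams is verified on components: `val hq M f` is the `M`-component of the
value of the diagram `f`, and the whiskered generators have the expected values on iterated tensor
products (`val_tensor_id`, `val_id_tensor`).
-/

namespace QIso

/-! ### The universal property of a presented strict monoidal supercategory -/

section Interpretation

open StrictMonoidalSupercategory

variable {K : Type} [Field K]

section EqToHom

variable {D : Type*} [Category D] [Preadditive D] [Linear K D] [Supercategory K D]

theorem eqToHom_mem {X Y : D} (h : X = Y) : eqToHom h ∈ Par K (X ⟶ Y) 0 := by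
  subst h; exact Supercategory.id_mem X

theorem eqToHom_comp_mem {X X' Y Y' : D} (h : X' = X) (h' : Y = Y') {f : X ⟶ Y} {r : ZMod 2}
    (hf : f ∈ Par K (X ⟶ Y) r) : eqToHom h ≫ f ≫ eqToHom h' ∈ Par K (X' ⟶ Y') r := by
  subst h h'; simpa using hf

variable [StrictMonoidalSupercategory K D]

theorem eqToHom_tensorHom {X X₁ Y Y₁ X' X₁' Y' Y₁' : D} (hX : X₁ = X) (hY : Y = Y₁)
    (hX' : X₁' = X') (hY' : Y' = Y₁') (f : X ⟶ Y) (g : X' ⟶ Y') :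
    tensorHom (K := K) (eqToHom hX ≫ f ≫ eqToHom hY) (eqToHom hX' ≫ g ≫ eqToHom hY') =
      eqToHom (congrArg₂ (tensorObj K) hX hX') ≫ tensorHom (K := K) f g ≫
        eqToHom (congrArg₂ (tensorObj K) hY hY') := by
  subst hX hY hX' hY'; simp

end EqToHom

variable {A : Type} {D : Type v} [Category.{w} D] [Preadditive D] [Linear K D]
  [Supercategory K D] [StrictMonoidalSupercategory K D]

variable (K) in
/-- A monoid homomorphism from words to the objects of a strict monoidal supercategory. Its laws are
propositional equalities, so that the value of a diagram involves transports `eqToHom`. -/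
structure WordMap (A : Type) (D : Type v) [Category.{w} D] [Preadditive D] [Linear K D]
    [Supercategory K D] [StrictMonoidalSupercategory K D] where
  obj : List A → D
  nil : obj [] = unit K
  append (X Y : List A) : obj (X ++ Y) = tensorObj K (obj X) (obj Y)

variable (o : WordMap K A D) {S : Signature A} (γ : ∀ g : S.Gen, o.obj (S.dom g) ⟶ o.obj (S.cod g))

/-- The value of a diagram in a strict monoidal supercategory, given the values of the generating
objects and morphisms. -/
def interp : ∀ {X Y : List A}, Diagram S K X Y → (o.obj X ⟶ o.obj Y)
  | _, _, .gen g => γ g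
  | _, _, .eqTo h => eqToHom (congrArg o.obj h)
  | _, _, .comp f g => interp f ≫ interp g
  | _, _, .tensor f g => eqToHom (o.append _ _) ≫ tensorHom (K := K) (interp f) (interp g) ≫
      eqToHom (o.append _ _).symm
  | _, _, .zero => 0
  | _, _, .add f g => interp f + interp g
  | _, _, .smul a f => a • interp f

variable {γ}

/-- The value of a homogeneous diagram has the parity of the diagram; the interchange law of
`interp_eq_of_eqv` depends on this. -/
theorem interp_mem (hγ : ∀ g, γ g ∈ Par K _ (S.parity g)) {X Y : List A} {f : Diagram S K X Y}
    {r : ZMod 2} (h : f.Homog r) : interp o γ f ∈ Par K (o.obj X ⟶ o.obj Y) r := by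
  induction h with
  | gen g => exact hγ g
  | eqTo h => exact eqToHom_mem _
  | comp _ _ h1 h2 => exact Supercategory.comp_mem h1 h2
  | tensor _ _ h1 h2 => exact eqToHom_comp_mem _ _ (tensor_mem h1 h2)
  | zero r => exact zero_mem _
  | add _ _ h1 h2 => exact add_mem h1 h2
  | smul a _ h1 => exact Submodule.smul_mem _ a h1

/-- The unit law for an object that is only propositionally equal to the unit, such as the image of
the empty word. -/
theorem tensorHom_id_of_eq_unit {U X Y : D} (h : U = unit K) (f : X ⟶ Y) :
    tensorHom (K := K) (𝟙 U) f = eqToHom (by rw [h, unit_tensorObj]) ≫ f ≫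
      eqToHom (by rw [h, unit_tensorObj]) := by
  subst h; exact unit_tensorHom f

theorem tensorHom_of_eq_unit_id {U X Y : D} (h : U = unit K) (f : X ⟶ Y) :
    tensorHom (K := K) f (𝟙 U) = eqToHom (by rw [h, tensorObj_unit]) ≫ f ≫
      eqToHom (by rw [h, tensorObj_unit]) := by
  subst h; exact tensorHom_unit f

variable {P : Presentation A K} {γ : ∀ g : P.sig.Gen, o.obj (P.sig.dom g) ⟶ o.obj (P.sig.cod g)}

open Presentation in
theorem interp_eq_of_eqv (hγ : ∀ g, γ g ∈ Par K _ (P.sig.parity g))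
    (hrel : ∀ {X Y : List A} {f g : Diagram P.sig K X Y}, P.Rel f g → interp o γ f = interp o γ g)
    {X Y : List A} {f g : Diagram P.sig K X Y} (h : Eqv P f g) : interp o γ f = interp o γ g := by
  induction h with
  | rel h => exact hrel h
  | refl f => rfl
  | symm _ h => exact h.symm
  | trans _ _ h h' => exact h.trans h'
  | comp_congr _ _ h h' => simp only [interp, h, h']
  | tensor_congr _ _ h h' => simp only [interp, h, h']
  | add_congr _ _ h h' => simp only [interp, h, h']
  | smul_congr a _ h => simp only [interp, h]
  | add_comm f g => exact _root_.add_comm _ _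
  | add_assoc f g h => exact _root_.add_assoc _ _ _
  | zero_add f => exact _root_.zero_add _
  | neg_add f => simp [interp]
  | smul_add a f g => exact _root_.smul_add _ _ _
  | add_smul a b f => exact _root_.add_smul _ _ _
  | mul_smul a b f => exact SemigroupAction.mul_smul _ _ _
  | one_smul f => exact _root_.one_smul _ _
  | id_comp f => simp [interp]
  | comp_id f => simp [interp]
  | comp_assoc f g h => simp [interp]
  | comp_add f g g' => simp [interp]
  | add_comp f f' g => simp [interp]
  | comp_smul a f g => simp [interp]
  | smul_comp a f g => simp [interp]
  | tensor_add f g g' => simp [interp, StrictMonoidalSupercategory.tensor_add]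
  | add_tensor f f' g => simp [interp, StrictMonoidalSupercategory.add_tensor]
  | tensor_smul a f g => simp [interp, StrictMonoidalSupercategory.tensor_smul]
  | smul_tensor a f g => simp [interp, StrictMonoidalSupercategory.smul_tensor]
  | tensor_id X Y => simp [interp, StrictMonoidalSupercategory.tensor_id]
  | interchange f' g' hf hg =>
    simp only [interp, Category.assoc, eqToHom_trans_assoc, eqToHom_refl, Category.id_comp]
    rw [← Category.assoc (tensorHom _ _), StrictMonoidalSupercategory.interchange _ _ _ _
      (interp_mem o hγ hf) (interp_mem o hγ hg)]
    simp
  | unit_tensor f =>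
    simp only [interp, eqToHom_refl, tensorHom_id_of_eq_unit o.nil]
    simp
  | tensor_unit f =>
    simp only [interp, eqToHom_refl, tensorHom_of_eq_unit_id o.nil]
    simp
  | @tensor_assoc X Y X' Y' X'' Y'' f g h =>
    simp only [interp]
    have h1 := eqToHom_tensorHom (K := K) (o.append X X') (o.append Y Y').symm rfl rfl
      (tensorHom (K := K) (interp o γ f) (interp o γ g)) (interp o γ h)
    have h2 := eqToHom_tensorHom (K := K) rfl rfl (o.append X' X'') (o.append Y' Y'').symm
      (interp o γ f) (tensorHom (K := K) (interp o γ g) (interp o γ h))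
    simp only [eqToHom_refl, Category.id_comp, Category.comp_id] at h1 h2
    rw [h1, h2, StrictMonoidalSupercategory.tensorHom_assoc]
    simp

variable [NeZero (2 : K)]

/-- The monoidal superfunctor out of a presented strict monoidal supercategory given by values of
the generators that satisfy the relations. -/
def interpFunctor (hγ : ∀ g, γ g ∈ Par K _ (P.sig.parity g))
    (hrel : ∀ {X Y : List A} {f g : Diagram P.sig K X Y}, P.Rel f g →
      interp o γ f = interp o γ g) : MonoidalSuperfunctor K P.Cat D where
  obj X := o.obj X.word
  map {X Y} := Quotient.lift (interp o γ) fun _ _ h => interp_eq_of_eqv o hγ hrel h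
  map_id _ := eqToHom_refl _ _
  map_comp f g := by
    obtain ⟨f, rfl⟩ := Presentation.cls_surj f; obtain ⟨g, rfl⟩ := Presentation.cls_surj g
    rfl
  map_add f g := by
    obtain ⟨f, rfl⟩ := Presentation.cls_surj f; obtain ⟨g, rfl⟩ := Presentation.cls_surj g
    rfl
  map_smul a f := by
    obtain ⟨f, rfl⟩ := Presentation.cls_surj f
    rfl
  map_mem := by
    rintro _ _ _ _ ⟨f, hf, rfl⟩
    exact interp_mem o hγ hf
  obj_unit := o.nil
  obj_tensor X Y := o.append X.word Y.word
  map_tensor f g := by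
    obtain ⟨f, rfl⟩ := Presentation.cls_surj f; obtain ⟨g, rfl⟩ := Presentation.cls_surj g
    rfl

/-- Monoidal superfunctors out of a presented supercategory are equal if they agree on objects and
on the generating morphisms. -/
theorem MonoidalSuperfunctor.ext_of_gen {F G : MonoidalSuperfunctor K P.Cat D}
    (hobj : ∀ X, F.obj X = G.obj X)
    (hgen : ∀ g : P.sig.Gen, F.map (Presentation.mor (P := P) (.gen g)) = eqToHom (hobj _) ≫
      G.map (Presentation.mor (P := P) (.gen g)) ≫ eqToHom (hobj _).symm) : F = G := by
  have key : ∀ {X Y : List A} (f : Diagram P.sig K X Y),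
      F.map (Presentation.mor (P := P) f) = eqToHom (hobj _) ≫
        G.map (Presentation.mor (P := P) f) ≫ eqToHom (hobj _).symm := by
    intro X Y f
    induction f with
    | gen g => exact hgen g
    | @eqTo X Y h =>
      subst h
      have e : Presentation.mor (P := P) (Diagram.eqTo (rfl : X = X)) = 𝟙 _ := rfl
      simp [e]
    | comp f g hf hg =>
      have e : Presentation.mor (P := P) (f.comp g) = Presentation.mor f ≫ Presentation.mor g := rfl
      rw [e, F.map_comp, G.map_comp, hf, hg]
      simp
    | tensor f g hf hg =>
      have e : Presentation.mor (P := P) (f.tensor g) =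
        tensorHom (K := K) (Presentation.mor f) (Presentation.mor g) := rfl
      rw [e, F.map_tensor, G.map_tensor, hf, hg, eqToHom_tensorHom]
      simp only [Category.assoc, eqToHom_trans, eqToHom_trans_assoc]
    | @zero X Y =>
      have e : Presentation.mor (P := P) (Diagram.zero (X := X) (Y := Y)) =
        (0 : K) • (0 : (⟨X⟩ : P.Cat) ⟶ ⟨Y⟩) := (zero_smul K _).symm
      rw [e, F.map_smul, G.map_smul]
      simp
    | add f g hf hg =>
      have e : Presentation.mor (P := P) (f.add g) = Presentation.mor f + Presentation.mor g := rfl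
      rw [e, F.map_add, G.map_add, hf, hg]
      simp
    | smul a f hf =>
      have e : Presentation.mor (P := P) (f.smul a) = a • Presentation.mor f := rfl
      rw [e, F.map_smul, G.map_smul, hf]
      simp
  have h : F.toFunctor = G.toFunctor := by
    refine CategoryTheory.Functor.ext hobj fun X Y f => ?_
    obtain ⟨f, rfl⟩ := Presentation.cls_surj f
    exact key f
  obtain ⟨⟨F, _, _, _⟩, _, _, _⟩ := F
  obtain ⟨⟨G, _, _, _⟩, _, _, _⟩ := G
  obtain rfl : F = G := h
  rfl

end Interpretation

noncomputable section

variable {K : Type} [Field K] {q : K} {n : ℕ} [NeZero (2 : K)]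

/-! ### Homomorphisms of supermodules through matrices of operators -/

section OpMat

variable {M N P : Type*} [AddCommGroup M] [Module K M] [Superspace K M] [AddCommGroup N]
    [Module K N] [Superspace K N] [AddCommGroup P] [Module K P] [Superspace K P]

theorem map_invP {r : ZMod 2} {f : M →ₗ[K] N}
    (hf : ∀ m, f (inv K M m) = ksgn K r 1 • inv K N (f m)) (t : ZMod 2) (m : M) :
    f (invP K M t m) = ksgn K r t • invP K N t (f m) := by
  rcases zmod2_cases t with rfl | rfl
  · simp [invP_zero]
  · simp [invP_one, hf]

theorem inv_tmul (w : M) (m : N) : inv K (M ⊗[K] N) (w ⊗ₜ m) = inv K M w ⊗ₜ inv K N m := by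
  rw [inv_tensor, TensorProduct.map_tmul]

variable (K n M) in
/-- Matrices of operators, indexed by `{±1, …, ±n}`. -/
abbrev OpMat : Type _ := Matrix (Idx n) (Idx n) (Module.End K M)

/-- The map `f` has parity `r` (in the form of its commutation with the parity involutions) and
intertwines the matrices of operators `T` and `T'` up to the sign `(-1)^(r p(i))` in row `i`. -/
structure Intertwines (T : OpMat K n M) (T' : OpMat K n N) (r : ZMod 2) (f : M →ₗ[K] N) : Prop where
  inv (m : M) : f (inv K M m) = ksgn K r 1 • QIso.inv K N (f m)
  comm (i j : Idx n) (m : M) : f (T i j m) = ksgn K r (par i) • T' i j (f m)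

theorem Intertwines.comp {T : OpMat K n M} {T' : OpMat K n N} {T'' : OpMat K n P} {r s : ZMod 2}
    {f : M →ₗ[K] N} {g : N →ₗ[K] P} (hf : Intertwines T T' r f) (hg : Intertwines T' T'' s g) :
    Intertwines T T'' (r + s) (g ∘ₗ f) where
  inv m := by
    rw [LinearMap.comp_apply, hf.inv, map_smul, hg.inv, smul_smul, ksgn_add_left,
      LinearMap.comp_apply]
  comm i j m := by
    rw [LinearMap.comp_apply, hf.comm, map_smul, hg.comm, smul_smul, ksgn_add_left,
      LinearMap.comp_apply]

/-- A linear inverse of an even intertwiner is an even intertwiner. -/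
theorem Intertwines.of_inverse {T : OpMat K n M} {T' : OpMat K n N} {f : M →ₗ[K] N} {g : N →ₗ[K] M}
    (hf : Intertwines T T' 0 f) (hgf : ∀ m, g (f m) = m) (hfg : ∀ m, f (g m) = m) :
    Intertwines T' T 0 g where
  inv m := by
    have := hf.inv (g m)
    rw [hfg, ksgn_zero_left, one_smul] at this
    rw [← this, hgf, ksgn_zero_left, one_smul]
  comm i j m := by
    have := hf.comm i j (g m)
    rw [hfg, ksgn_zero_left, one_smul] at this
    rw [← this, hgf, ksgn_zero_left, one_smul]

/-- The matrix of operators on a tensor product: the matrix product of `T` and `T'`, whose entries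
act on different factors. -/
def tensorMat (T : OpMat K n M) (T' : OpMat K n N) : OpMat K n (M ⊗[K] N) := fun i j =>
  ∑ k, TensorProduct.map (T i k) (T' k j)

theorem tensorMat_tmul (T : OpMat K n M) (T' : OpMat K n N) (i j : Idx n) (m : M) (x : N) :
    tensorMat T T' i j (m ⊗ₜ x) = ∑ k, T i k m ⊗ₜ T' k j x := by
  simp [tensorMat, LinearMap.sum_apply]

/-- An intertwiner out of a tensor product can be tested on pure tensors. -/
theorem intertwines_tensor {T : OpMat K n M} {T' : OpMat K n N} {T'' : OpMat K n P} {r : ZMod 2}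
    {f : M ⊗[K] N →ₗ[K] P}
    (h1 : ∀ m x, f (inv K M m ⊗ₜ inv K N x) = ksgn K r 1 • inv K P (f (m ⊗ₜ x)))
    (h2 : ∀ i j m x, ∑ k, f (T i k m ⊗ₜ T' k j x) = ksgn K r (par i) • T'' i j (f (m ⊗ₜ x))) :
    Intertwines (tensorMat T T') T'' r f where
  inv x := by
    have : f ∘ₗ inv K (M ⊗[K] N) = ksgn K r 1 • (inv K P ∘ₗ f) :=
      TensorProduct.ext' fun w m => (congrArg f (inv_tmul w m)).trans (h1 w m)
    exact LinearMap.congr_fun this x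
  comm i j x := by
    have : f ∘ₗ tensorMat T T' i j = ksgn K r (par i) • (T'' i j ∘ₗ f) :=
      TensorProduct.ext' fun w m => by
        rw [LinearMap.comp_apply, tensorMat_tmul, map_sum, h2]; rfl
    exact LinearMap.congr_fun this x

theorem Intertwines.map_id {T : OpMat K n M} {T' : OpMat K n N} {r : ZMod 2} {f : M →ₗ[K] N}
    (hf : Intertwines T T' r f) (X : OpMat K n P) :
    Intertwines (tensorMat T X) (tensorMat T' X) r
      (TensorProduct.map f (LinearMap.id : P →ₗ[K] P)) := by
  refine intertwines_tensor (fun a m => ?_) fun i j a m => ?_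
  · rw [TensorProduct.map_tmul, TensorProduct.map_tmul, hf.inv, inv_tmul, TensorProduct.smul_tmul']
    rfl
  · rw [TensorProduct.map_tmul, tensorMat_tmul, Finset.smul_sum]
    refine Finset.sum_congr rfl fun k _ => ?_
    rw [TensorProduct.map_tmul, hf.comm, TensorProduct.smul_tmul']
    rfl

theorem intertwines_assoc (T : OpMat K n M) (T' : OpMat K n N) (T'' : OpMat K n P) :
    Intertwines (tensorMat (tensorMat T T') T'') (tensorMat T (tensorMat T' T'')) 0
      (TensorProduct.assoc K M N P).toLinearMap where
  inv x := by
    have : (TensorProduct.assoc K M N P).toLinearMap ∘ₗ QIso.inv K ((M ⊗[K] N) ⊗[K] P) =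
        ksgn K 0 1 • (QIso.inv K (M ⊗[K] (N ⊗[K] P)) ∘ₗ
          (TensorProduct.assoc K M N P).toLinearMap) :=
      TensorProduct.ext_threefold fun a b m => by
        simp only [LinearMap.comp_apply, inv_tmul, LinearEquiv.coe_coe, TensorProduct.assoc_tmul,
          ksgn_zero_left, one_smul]
    exact LinearMap.congr_fun this x
  comm i j x := by
    have : (TensorProduct.assoc K M N P).toLinearMap ∘ₗ tensorMat (tensorMat T T') T'' i j =
        ksgn K 0 (par i) • (tensorMat T (tensorMat T' T'') i j ∘ₗ
          (TensorProduct.assoc K M N P).toLinearMap) :=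
      TensorProduct.ext_threefold fun a b m => by
        simp only [LinearMap.comp_apply, LinearEquiv.coe_coe, TensorProduct.assoc_tmul,
          ksgn_zero_left, one_smul, tensorMat_tmul, TensorProduct.sum_tmul, TensorProduct.tmul_sum,
          map_sum]
        exact Finset.sum_comm
    exact LinearMap.congr_fun this x

end OpMat

namespace SMod

/-- The matrix of operators `t_ij` with `T_MV (m ⊗ v_j) = ∑_i v_i ⊗ t_ij m`. -/
def tm (M : SMod.{u} q n) : OpMat K n M := fun i j => invP K M (par i) * lmat M.act i j

/-- The matrix of operators `s_ij` with `T_MV⁻¹ (v_j ⊗ m) = ∑_i s_ij m ⊗ v_i`. -/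
def sm (M : SMod.{u} q n) : OpMat K n M := fun i j => triInv (lmat M.act) i j * invP K M (par j)

theorem tm_eq (M : SMod.{u} q n) :
    M.tm = Matrix.diagonal (fun i => invP K M (par i)) * lmat M.act := by
  ext1 i j; rw [Matrix.diagonal_mul]; rfl

theorem sm_eq (M : SMod.{u} q n) :
    M.sm = triInv (lmat M.act) * Matrix.diagonal (fun i => invP K M (par i)) := by
  ext1 i j; rw [Matrix.mul_diagonal]; rfl

theorem diagonal_invP_mul_self (M : SMod.{u} q n) :
    (Matrix.diagonal (fun i : Idx n => invP K M (par i)) : OpMat K n M) *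
      Matrix.diagonal (fun i => invP K M (par i)) = 1 := by
  simp [Matrix.diagonal_mul_diagonal, invP_mul_self]

theorem tm_mul_sm (M : SMod.{u} q n) : M.tm * M.sm = 1 := by
  rw [tm_eq, sm_eq, mul_assoc, ← mul_assoc (lmat M.act),
    mul_triInv M.lmat_act_of_lt M.lmat_act_diag, one_mul, diagonal_invP_mul_self]

theorem sm_mul_tm (M : SMod.{u} q n) : M.sm * M.tm = 1 := by
  rw [tm_eq, sm_eq, mul_assoc, ← mul_assoc (Matrix.diagonal _), diagonal_invP_mul_self, one_mul,
    triInv_mul M.lmat_act_of_lt M.lmat_act_diag]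

theorem act_eq_tm (M : SMod.{u} q n) (i j : Idx n) (m : M) :
    M.act i j m = invP K M (par i) (M.tm i j (invP K M (par i + par j) m)) := by
  rw [tm, lmat, ← Module.End.mul_apply, ← Module.End.mul_apply, ← mul_assoc, ← mul_assoc,
    invP_mul_self, one_mul, mul_assoc, invP_mul_self, mul_one]

/-- Homomorphisms of supermodules are the intertwiners of the operators `t_ij`. The sign in the
definition of a homomorphism, which involves the parity `p(i) + p(j)` of `u_ij`, is replaced by one
that involves the row only. -/
theorem mem_homPar_iff {M : SMod.{u} q n} {N : SMod.{v} q n} {r : ZMod 2} {f : M →ₗ[K] N} :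
    f ∈ homPar M N r ↔ Intertwines M.tm N.tm r f := by
  constructor
  · intro hf
    have h1 : ∀ m, f (inv K M m) = ksgn K r 1 • inv K N (f m) := by
      have : f ∘ₗ inv K M = ksgn K r 1 • (inv K N ∘ₗ f) := by
        refine ext_par (K := K) fun s m hm => ?_
        simp only [LinearMap.comp_apply, LinearMap.smul_apply]
        rw [inv_of_mem hm, inv_of_mem (hf.1 s m hm), map_smul, smul_smul, ksgn_add_left,
          ksgn_mul_self_assoc]
      exact LinearMap.congr_fun this
    refine ⟨h1, fun i j m => ?_⟩
    simp only [tm, lmat, Module.End.mul_apply]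
    rw [map_invP h1, act, hf.2 _ _ (Uq.u_mem_gr q i j), map_invP h1]
    simp only [map_smul, smul_smul]
    rw [ksgn_mul_self, mul_one]
    rfl
  · rintro ⟨h1, h2⟩
    refine mem_homPar (fun s m hm => mem_of_inv (K := K) ?_) fun i j m => ?_
    · have := h1 m
      rw [inv_of_mem hm, map_smul] at this
      rw [ksgn_add_left, mul_smul, this, smul_smul, ksgn_mul_self, one_smul]
    · rw [act_eq_tm, map_invP h1, h2, map_invP h1, map_smul, map_smul, smul_smul, ksgn_mul_self,
        one_smul, map_smul, act_eq_tm N]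

/-- The form of `mem_homPar_iff` in which the matrices of operators may be replaced by equal ones.
-/
theorem mem_homPar_of {M : SMod.{u} q n} {N : SMod.{v} q n} {r : ZMod 2} {f : M →ₗ[K] N}
    {T : OpMat K n M} {T' : OpMat K n N} (hM : M.tm = T) (hN : N.tm = T')
    (h : Intertwines T T' r f) : f ∈ homPar M N r := by
  subst hM hN; exact mem_homPar_iff.mpr h

/-- The comultiplication in terms of the operators `t_ij`, where it has no signs. -/
theorem tm_tensor (W : SMod.{u} q n) (M : SMod.{v} q n) :
    (tensor W M).tm = tensorMat W.tm M.tm := by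
  ext1 i j
  have h1 : (tensor W M).act = tensorAct W M := funext₂ (tensor_act W M)
  have h := congrFun (congrFun (lmat_tensorAct W M) i) j
  rw [Matrix.mul_apply] at h
  rw [tm, h1]
  refine (congrArg (invP K (W ⊗[K] M) (par i) * ·) h).trans ?_
  rw [tensorMat, Finset.mul_sum]
  refine Finset.sum_congr rfl fun k _ => ?_
  change invP K (W ⊗[K] M) (par i) * (TensorProduct.map (W.act i k) 1 *
    invP K (W ⊗[K] M) (par i + par k) * TensorProduct.map (1 : Module.End K W) (lmat M.act k j)) = _
  rw [invP_tensor, invP_tensor, map_mul_map, map_mul_map, map_mul_map, one_mul, mul_one,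
    ← mul_assoc (invP K M (par i)), ← invP_add, ← add_assoc, zmod2_add_self, zero_add]
  rfl

/-- The operators `t_ij` on the dual are the transposes of the entries of the inverse matrix. -/
theorem tm_dual (M : SMod.{u} q n) (i j : Idx n) : (dual M).tm i j = (M.sm i j).dualMap := by
  have h1 : (dual M).act = dualAct M := funext₂ (dual_act M)
  rw [tm, h1]
  change invP K (Module.Dual K M) (par i) * (dualAct M i j * invP K (Module.Dual K M) _) = _
  rw [dualAct, mul_assoc, invP_mul_self, mul_one, invP_dual, dualMap_mul, antipodeAct, mul_assoc,
    ← invP_add, sm]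
  congr 3
  rw [add_comm (par i), add_assoc, zmod2_add_self, add_zero]

theorem tm_hasPar (M : SMod.{u} q n) (i j : Idx n) : HasPar (M.tm i j) (par i + par j) := by
  have := (hasPar_invP (par i)).mul (M.lmat_act_hasPar i j)
  rwa [zero_add] at this

theorem superFlip_vec_right (M : SMod.{u} q n) (m : M) (i : Idx n) :
    superFlip K M (VSp K n) (m ⊗ₜ vec K i) = vec K i ⊗ₜ invP K M (par i) m := by
  have : superFlip K M (VSp K n) ∘ₗ (TensorProduct.mk K M (VSp K n)).flip (vec K i) =
      (TensorProduct.mk K (VSp K n) M (vec K i)) ∘ₗ invP K M (par i) :=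
    ext_par (K := K) fun r m hm => by
      simp [superFlip_tmul hm (vec_mem i), invP_of_mem _ hm, ksgn_comm]
  exact LinearMap.congr_fun this m

theorem superFlip_vec_left (M : SMod.{u} q n) (m : M) (i : Idx n) :
    superFlip K (VSp K n) M (vec K i ⊗ₜ m) = invP K M (par i) m ⊗ₜ vec K i := by
  have : superFlip K (VSp K n) M ∘ₗ (TensorProduct.mk K (VSp K n) M (vec K i)) =
      (TensorProduct.mk K M (VSp K n)).flip (vec K i) ∘ₗ invP K M (par i) :=
    ext_par (K := K) fun r m hm => by
      simp [superFlip_tmul (vec_mem i) hm, invP_of_mem _ hm]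
  exact LinearMap.congr_fun this m

end SMod

theorem matrixOp_tmul {M : Type*} [AddCommGroup M] [Module K M]
    (Z : Matrix (Idx n) (Idx n) (Module.End K M)) (m : M) (k : Idx n) :
    matrixOp Z (m ⊗ₜ vec K k) = ∑ i, Z i k m ⊗ₜ vec K i := by
  rw [matrixOp, LinearMap.sum_apply]
  refine Finset.sum_congr rfl fun i _ => ?_
  rw [LinearMap.sum_apply, Finset.sum_eq_single k]
  · rw [TensorProduct.map_tmul, matUnit_vec, if_pos rfl]
  · intro j _ hj
    rw [TensorProduct.map_tmul, matUnit_vec, if_neg hj, TensorProduct.tmul_zero]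
  · simp

section Braidings

variable {M N : Type*} [AddCommGroup M] [Module K M] [AddCommGroup N] [Module K N]

/-- The map `m ⊗ v_j ↦ ∑_i v_i ⊗ t_ij m`. -/
def braidMap (T : OpMat K n M) : M ⊗[K] VSp K n →ₗ[K] VSp K n ⊗[K] M :=
  (TensorProduct.comm K M (VSp K n)).toLinearMap ∘ₗ matrixOp T

/-- The map `v_j ⊗ m ↦ ∑_i s_ij m ⊗ v_i`. -/
def braidInv (S : OpMat K n M) : VSp K n ⊗[K] M →ₗ[K] M ⊗[K] VSp K n :=
  matrixOp S ∘ₗ (TensorProduct.comm K (VSp K n) M).toLinearMap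

theorem braidMap_tmul (T : OpMat K n M) (m : M) (j : Idx n) :
    braidMap T (m ⊗ₜ vec K j) = ∑ i, vec K i ⊗ₜ T i j m := by
  simp [braidMap, matrixOp_tmul]

theorem braidInv_tmul (S : OpMat K n M) (m : M) (j : Idx n) :
    braidInv S (vec K j ⊗ₜ m) = ∑ i, S i j m ⊗ₜ vec K i := by
  simp [braidInv, matrixOp_tmul]

theorem braidInv_braidMap {T S : OpMat K n M} (h : S * T = 1) (x : M ⊗[K] VSp K n) :
    braidInv S (braidMap T x) = x := by
  have := LinearMap.congr_fun ((matrixOp_mul S T).symm.trans ((congrArg matrixOp h).trans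
    matrixOp_one)) x
  simpa [braidInv, braidMap] using this

theorem braidMap_braidInv {T S : OpMat K n M} (h : T * S = 1) (x : VSp K n ⊗[K] M) :
    braidMap T (braidInv S x) = x := by
  have := LinearMap.congr_fun ((matrixOp_mul T S).symm.trans ((congrArg matrixOp h).trans
    matrixOp_one)) (TensorProduct.comm K (VSp K n) M x)
  have h2 := congrArg (TensorProduct.comm K M (VSp K n)) this
  simpa [braidInv, braidMap] using h2

theorem ext_vec_left {f g : VSp K n ⊗[K] M →ₗ[K] N}
    (h : ∀ i m, f (vec K i ⊗ₜ m) = g (vec K i ⊗ₜ m)) :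
    f = g :=
  TensorProduct.ext (vec_ext fun i => LinearMap.ext fun m => h i m)

theorem ext_vec_right {f g : M ⊗[K] VSp K n →ₗ[K] N}
    (h : ∀ m i, f (m ⊗ₜ vec K i) = g (m ⊗ₜ vec K i)) :
    f = g :=
  TensorProduct.ext (LinearMap.ext fun m => vec_ext fun i => h m i)

end Braidings

namespace SMod

theorem braiding_eq (M : SMod.{u} q n) : M.braiding.toLinearMap = braidMap M.tm := by
  refine ext_vec_right fun m j => ?_
  rw [braidMap_tmul]
  change superFlip K M (VSp K n) (matrixOp (lmat M.act) (m ⊗ₜ vec K j)) = _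
  rw [matrixOp_tmul, map_sum]
  exact Finset.sum_congr rfl fun i _ => superFlip_vec_right M _ i

theorem braiding_symm_eq (M : SMod.{u} q n) : M.braiding.symm.toLinearMap = braidInv M.sm := by
  refine ext_vec_left fun j m => ?_
  rw [braidInv_tmul]
  change matrixOp (triInv (lmat M.act)) (superFlip K (VSp K n) M (vec K j ⊗ₜ m)) = _
  rw [superFlip_vec_left, matrixOp_tmul]
  rfl

end SMod

section RTT

variable (q) in
/-- The coefficient of `v_y` in `t_ai v_b`, for the operators `t_ai` on the vector supermodule: the
coefficient of `v_a ⊗ v_y` in `T_VV (v_b ⊗ v_i)`. -/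
def tcoef (b i a y : Idx n) : K :=
  theta q y b a i * (ksgn K (par b) (par a + par i) * ksgn K (par a) (par y))

variable (q n) in
/-- The matrix of the operators `t_ij` on the vector supermodule. -/
def vecTm : OpMat K n (VSp K n) := fun i j => invP K (VSp K n) (par i) * lmat (vectorAct q) i j

theorem vecTm_vec (a i b : Idx n) : vecTm q n a i (vec K b) = ∑ y, tcoef q b i a y • vec K y := by
  rw [vecTm, Module.End.mul_apply, lmat_vectorAct_vec, map_sum]
  refine Finset.sum_congr rfl fun y _ => ?_
  rw [map_smul, map_smul, invP_of_mem _ (vec_mem y), smul_smul, smul_smul, tcoef, mul_assoc]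

theorem tm_vector (hq : q ≠ 0) : (SMod.vector q n hq).tm = vecTm q n := by
  have h1 : (SMod.vector q n hq).act = vectorAct q := funext₂ fun i j =>
    SMod.ofOps_act _ _ _ _ _ _ i j
  ext1 i j
  rw [SMod.tm, h1]
  rfl

/-- The defining relation of `U_q(𝔮_n)` in terms of the operators `t_ij`: it has no signs beyond
those in the coefficients `tcoef`. -/
theorem SMod.rtt (M : SMod.{u} q n) (a b e y : Idx n) :
    ∑ c, ∑ i, tcoef q c i a y • (M.tm i e * M.tm c b) =
      ∑ c, ∑ i, tcoef q b e c i • (M.tm y i * M.tm a c) := by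
  have key : ∀ i j k l : Idx n, M.tm i j * M.tm k l = ksgn K (par i + par j) (par k) •
      (invP K M (par i + par k) * (lmat M.act i j * lmat M.act k l)) := fun i j k l => by
    have h := M.lmat_act_hasPar i j (par k)
    have h' : lmat M.act i j * invP K M (par k) =
        ksgn K (par i + par j) (par k) • (invP K M (par k) * lmat M.act i j) := by
      rw [h, smul_smul, ksgn_mul_self, one_smul]
    rw [tm, tm, mul_assoc, ← mul_assoc (lmat M.act i j), h', smul_mul_assoc, mul_smul_comm,
      mul_assoc, ← mul_assoc, ← invP_add]
  -- Both sides are the two sides of the relation for `u_ij`, multiplied by one and the same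
  -- invertible operator.
  have hr := (rll_iff q (lmat M.act)).mp M.rll_act y a b e
  have h1 : ∑ c, ∑ i, tcoef q c i a y • (M.tm i e * M.tm c b) =
      (ksgn K (par a) (par y) • invP K M (par a + par y)) * ∑ j, ∑ l,
      (ksgn K (par a + par l) (par j) * ksgn K (par l + par e) (par j) *
      theta q y j a l) • (lmat M.act l e * lmat M.act j b) := by
    simp only [Finset.mul_sum]
    refine Finset.sum_congr rfl fun c _ => Finset.sum_congr rfl fun i _ => ?_
    by_cases h : par y + par c = par a + par i
    · have e1 : ∀ y c a i : ZMod 2, y + c = a + i → i + c = a + y := by decide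
      rw [key, e1 _ _ _ _ h, smul_mul_smul_comm, smul_smul, tcoef, ksgn_comm (par c)]
      congr 1
      ring
    · rw [tcoef, theta_eq_zero q h]; simp
  have h2 : ∑ c, ∑ i, tcoef q b e c i • (M.tm y i * M.tm a c) =
      (ksgn K (par a) (par y) • invP K M (par a + par y)) * ∑ j, ∑ l,
      (ksgn K (par a + par l) (par j) * ksgn K (par l + par e) (par b) *
      theta q j b l e) • (lmat M.act y j * lmat M.act a l) := by
    rw [Finset.sum_comm]
    simp only [Finset.mul_sum]
    refine Finset.sum_congr rfl fun j _ => Finset.sum_congr rfl fun l _ => ?_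
    by_cases h : par j + par b = par l + par e
    · have e1 : ∀ y a j l e b : ZMod 2, j + b = l + e → isgn b (l + e) * isgn l j *
        isgn (y + j) a = isgn a y * isgn (a + l) j * isgn (l + e) b := by decide
      rw [key, smul_mul_smul_comm, smul_smul, tcoef, add_comm (par y) (par a)]
      congr 1
      have := congrArg (Int.cast : ℤ → K) (e1 (par y) (par a) (par j) (par l) (par e) (par b) h)
      push_cast [← ksgn_cast] at this
      linear_combination (theta q j b l e) * this
    · rw [tcoef, theta_eq_zero q h]; simp
  rw [h1, h2, hr]

end RTT

/-! ### The operator `J`, the braidings and the operators `K_M` -/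

theorem jMap_vec (i : Idx n) : jMap K n (vec K i) = sg K i • vec K (-i) := by
  rw [jMap, LinearMap.sum_apply, Finset.sum_eq_single i]
  · rw [LinearMap.smul_apply, matUnit_vec, if_pos rfl, sg_eq]
  · intro j _ hj
    rw [LinearMap.smul_apply, matUnit_vec, if_neg hj, smul_zero]
  · simp

theorem jMap_jMap (v : VSp K n) : jMap K n (jMap K n v) = -v := by
  have : jMap K n ∘ₗ jMap K n = -LinearMap.id := vec_ext fun i => by
    simp [jMap_vec, smul_smul, sg_neg, sg_mul_self]
  exact LinearMap.congr_fun this v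

theorem inv_vec' (i : Idx n) : inv K (VSp K n) (vec K i) = sg K i • vec K i := by
  rw [inv_vec, sg_eq]

theorem theta_neg_neg (i j k l : Idx n) : theta q (-i) (-j) k l = theta q i j k l := by
  simp only [theta, phi_neg_left, neg_eq_iff_eq_neg, neg_neg]
  congr 1
  simp only [or_comm]

/-- The operator `J` is an odd endomorphism of `V`: this is the symmetry
`Θ_{-i,-j;k,l} = Θ_{ij;kl}` of the coefficients of `Θ`. -/
theorem jMap_intertwines : Intertwines (vecTm q n) (vecTm q n) 1 (jMap K n) where
  inv v := by
    have : jMap K n ∘ₗ QIso.inv K (VSp K n) =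
        ksgn K 1 1 • (QIso.inv K (VSp K n) ∘ₗ jMap K n) := vec_ext fun i => by
      simp [jMap_vec, inv_vec', smul_smul, sg_neg]
    exact LinearMap.congr_fun this v
  comm a i v := by
    have : jMap K n ∘ₗ vecTm q n a i = ksgn K 1 (par a) • (vecTm q n a i ∘ₗ jMap K n) :=
      vec_ext fun b => by
        rw [LinearMap.comp_apply, LinearMap.smul_apply, LinearMap.comp_apply, jMap_vec, map_smul,
          vecTm_vec, vecTm_vec, map_sum, Finset.smul_sum, Finset.smul_sum]
        refine (Equiv.sum_comp (Equiv.neg (Idx n)) _).symm.trans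
          (Finset.sum_congr rfl fun y _ => ?_)
        rw [map_smul, jMap_vec, Equiv.neg_apply, neg_neg, smul_smul, smul_smul, smul_smul]
        congr 1
        have e0 : theta q (-y) b a i = theta q y (-b) a i := by
          rw [← theta_neg_neg, neg_neg]
        rw [tcoef, tcoef, e0]
        by_cases h : par y + par (-b) = par a + par i
        · have e : ∀ y b a i : ZMod 2, y + (b + 1) = a + i → isgn b (a + i) * isgn a (y + 1) *
            isgn (y + 1) 1 = isgn 1 a * isgn b 1 * (isgn (b + 1) (a + i) * isgn a y) := by decide
          rw [par_neg] at h
          have := congrArg (Int.cast : ℤ → K) (e (par y) (par b) (par a) (par i) h)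
          push_cast [← ksgn_cast] at this
          rw [← sg_eq, ← sg_eq, par_neg, par_neg]
          linear_combination (theta q y (-b) a i) * this
        · rw [theta_eq_zero q h]; simp
    exact LinearMap.congr_fun this v

/-- The map `f` applied to the first two factors of a triple tensor product. -/
def onLeft {A B C D : Type*} [AddCommGroup A] [Module K A] [AddCommGroup B] [Module K B]
    [AddCommGroup C] [Module K C] [AddCommGroup D] [Module K D] (f : A ⊗[K] B →ₗ[K] C ⊗[K] D)
    (M : Type*) [AddCommGroup M] [Module K M] : A ⊗[K] (B ⊗[K] M) →ₗ[K] C ⊗[K] (D ⊗[K] M) :=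
  (TensorProduct.assoc K C D M).toLinearMap ∘ₗ TensorProduct.map f LinearMap.id ∘ₗ
    (TensorProduct.assoc K A B M).symm.toLinearMap

section OnLeft

variable {A B C D E F M : Type*} [AddCommGroup A] [Module K A] [AddCommGroup B] [Module K B]
    [AddCommGroup C] [Module K C] [AddCommGroup D] [Module K D]
    [AddCommGroup E] [Module K E] [AddCommGroup F] [Module K F]
    [AddCommGroup M] [Module K M]

theorem onLeft_tmul (f : A ⊗[K] B →ₗ[K] C ⊗[K] D) (a : A) (b : B) (m : M) :
    onLeft f M (a ⊗ₜ (b ⊗ₜ m)) = TensorProduct.assoc K C D M (f (a ⊗ₜ b) ⊗ₜ m) := by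
  simp [onLeft]

theorem onLeft_comp (f : A ⊗[K] B →ₗ[K] C ⊗[K] D) (g : C ⊗[K] D →ₗ[K] E ⊗[K] F) :
    onLeft g M ∘ₗ onLeft f M = onLeft (g ∘ₗ f) M :=
  TensorProduct.ext (LinearMap.ext fun a => TensorProduct.ext' fun b m => by simp [onLeft])

theorem onLeft_id : onLeft (LinearMap.id : A ⊗[K] B →ₗ[K] A ⊗[K] B) M = LinearMap.id :=
  TensorProduct.ext (LinearMap.ext fun a => TensorProduct.ext' fun b m => by simp [onLeft])

end OnLeft

section Braidings

variable {M N W : Type*} [AddCommGroup M] [Module K M] [Superspace K M] [AddCommGroup N]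
    [Module K N] [Superspace K N] [AddCommGroup W] [Module K W] [Superspace K W]

/-- Naturality of the braiding with `V`. -/
theorem braidMap_map {T : OpMat K n M} {T' : OpMat K n N} {r : ZMod 2} {g : M →ₗ[K] N}
    (hg : Intertwines T T' r g) (x : M ⊗[K] VSp K n) :
    braidMap T' (TensorProduct.map g LinearMap.id x) =
      TensorProduct.map (invP K (VSp K n) r) g (braidMap T x) := by
  have : braidMap T' ∘ₗ TensorProduct.map g LinearMap.id =
      TensorProduct.map (invP K (VSp K n) r) g ∘ₗ braidMap T := ext_vec_right fun m j => by
    simp only [LinearMap.comp_apply, TensorProduct.map_tmul, LinearMap.id_apply, braidMap_tmul,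
      map_sum, invP_of_mem r (vec_mem _), hg.comm, TensorProduct.tmul_smul,
      TensorProduct.smul_tmul', smul_smul, ksgn_mul_self, one_smul]
  exact LinearMap.congr_fun this x

/-- The braiding of `W ⊗ M` with `V` is composed of the braidings of `W` and of `M` with `V`. -/
theorem braidMap_tensorMat (T : OpMat K n W) (T' : OpMat K n M) (x : W ⊗[K] (M ⊗[K] VSp K n)) :
    braidMap (tensorMat T T') ((TensorProduct.assoc K W M (VSp K n)).symm x) =
      onLeft (braidMap T) M (TensorProduct.map LinearMap.id (braidMap T') x) := by
  have : braidMap (tensorMat T T') ∘ₗ (TensorProduct.assoc K W M (VSp K n)).symm.toLinearMap =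
      onLeft (braidMap T) M ∘ₗ TensorProduct.map LinearMap.id (braidMap T') := by
    refine TensorProduct.ext (LinearMap.ext fun w => ext_vec_right fun m j => ?_)
    change braidMap (tensorMat T T') ((TensorProduct.assoc K W M (VSp K n)).symm
      (w ⊗ₜ (m ⊗ₜ vec K j))) = onLeft (braidMap T) M
        (TensorProduct.map LinearMap.id (braidMap T') (w ⊗ₜ (m ⊗ₜ vec K j)))
    simp only [TensorProduct.assoc_symm_tmul, braidMap_tmul, tensorMat_tmul, TensorProduct.map_tmul,
      LinearMap.id_apply, TensorProduct.tmul_sum, map_sum, onLeft_tmul, TensorProduct.sum_tmul,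
      TensorProduct.assoc_tmul]
    exact Finset.sum_comm
  exact LinearMap.congr_fun this x

/-- The operator `K_M`, for the matrices of operators `T` and `S` of the braiding of `M` with `V`
and of its inverse. The odd map `1 ⊗ J` is `m ⊗ v ↦ (-1)^|m| m ⊗ J v`, whence the involution of `M`.
-/
def kap (T S : OpMat K n M) : VSp K n ⊗[K] M →ₗ[K] VSp K n ⊗[K] M :=
  braidMap T ∘ₗ TensorProduct.map (inv K M) (jMap K n) ∘ₗ braidInv S

theorem kap_braidMap {T S : OpMat K n M} (h : S * T = 1) (x : M ⊗[K] VSp K n) :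
    kap T S (braidMap T x) = braidMap T (TensorProduct.map (inv K M) (jMap K n) x) := by
  simp [kap, braidInv_braidMap h]

theorem braidMap_surjective {T S : OpMat K n M} (h : T * S = 1) :
    Function.Surjective (braidMap T) := fun x => ⟨braidInv S x, braidMap_braidInv h x⟩

theorem kap_kap {T S : OpMat K n M} (h : S * T = 1) (h' : T * S = 1) (x : VSp K n ⊗[K] M) :
    kap T S (kap T S x) = -x := by
  obtain ⟨x, rfl⟩ := braidMap_surjective h' x
  rw [kap_braidMap h, kap_braidMap h]
  have : TensorProduct.map (inv K M) (jMap K n) ∘ₗ TensorProduct.map (inv K M) (jMap K n) =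
      -LinearMap.id := TensorProduct.ext' fun m v => by
    simp [inv_inv, jMap_jMap, TensorProduct.tmul_neg]
  rw [← map_neg]
  exact congrArg _ (LinearMap.congr_fun this x)

/-- Naturality of `K_M`. -/
theorem kap_map {T S : OpMat K n M} {T' S' : OpMat K n N} (h : S * T = 1) (h1 : T * S = 1)
    (h' : S' * T' = 1) {r : ZMod 2}
    {g : M →ₗ[K] N} (hg : Intertwines T T' r g) (x : VSp K n ⊗[K] M) :
    TensorProduct.map (invP K (VSp K n) r) g (kap T S x) = ksgn K 1 r •
      kap T' S' (TensorProduct.map (invP K (VSp K n) r) g x) := by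
  obtain ⟨x, rfl⟩ := braidMap_surjective h1 x
  rw [kap_braidMap h, ← braidMap_map hg, ← braidMap_map hg, kap_braidMap h', ← map_smul]
  congr 1
  have : TensorProduct.map g (LinearMap.id (R := K) (M := VSp K n)) ∘ₗ
      TensorProduct.map (inv K M) (jMap K n) =
      ksgn K 1 r • (TensorProduct.map (inv K N) (jMap K n) ∘ₗ TensorProduct.map g LinearMap.id) :=
    TensorProduct.ext' fun m v => by
      simp [hg.inv, TensorProduct.smul_tmul', ksgn_comm]
  exact LinearMap.congr_fun this x

/-- The operator `K_{W ⊗ M}` is conjugate to `1 ⊗ K_M` by the braiding of `W` with `V`. -/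
theorem kap_tensorMat {T : OpMat K n W} {T' S' : OpMat K n M} {S'' : OpMat K n (W ⊗[K] M)}
    (h' : S' * T' = 1) (h1' : T' * S' = 1) (h : S'' * tensorMat T T' = 1)
    (x : W ⊗[K] (VSp K n ⊗[K] M)) :
    kap (tensorMat T T') S'' (onLeft (braidMap T) M x) =
      onLeft (braidMap T) M (TensorProduct.map (inv K W) (kap T' S') x) := by
  obtain ⟨x, rfl⟩ : ∃ y, TensorProduct.map LinearMap.id (braidMap T') y = x := by
    refine ⟨TensorProduct.map LinearMap.id (braidInv S') x, ?_⟩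
    rw [← LinearMap.comp_apply, ← TensorProduct.map_comp,
      show braidMap T' ∘ₗ braidInv S' = LinearMap.id from
        LinearMap.ext (braidMap_braidInv h1'), LinearMap.id_comp, TensorProduct.map_id]
    rfl
  rw [← braidMap_tensorMat, kap_braidMap h]
  have e1 : TensorProduct.map (inv K (W ⊗[K] M)) (jMap K n) ∘ₗ
      (TensorProduct.assoc K W M (VSp K n)).symm.toLinearMap =
      (TensorProduct.assoc K W M (VSp K n)).symm.toLinearMap ∘ₗ
        TensorProduct.map (inv K W) (TensorProduct.map (inv K M) (jMap K n)) :=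
    TensorProduct.ext (LinearMap.ext fun w => TensorProduct.ext' fun m v => by simp [inv_tmul])
  have e2 : TensorProduct.map (inv K W) (kap T' S') ∘ₗ
      TensorProduct.map LinearMap.id (braidMap T') = TensorProduct.map LinearMap.id (braidMap T') ∘ₗ
        TensorProduct.map (inv K W) (TensorProduct.map (inv K M) (jMap K n)) := by
    rw [← TensorProduct.map_comp, ← TensorProduct.map_comp,
      show kap T' S' ∘ₗ braidMap T' = braidMap T' ∘ₗ TensorProduct.map (inv K M) (jMap K n) from
        LinearMap.ext (kap_braidMap h')]
    rfl
  have e1' := LinearMap.congr_fun e1 x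
  have e2' := LinearMap.congr_fun e2 x
  simp only [LinearMap.comp_apply, LinearEquiv.coe_coe] at e1' e2'
  rw [e1', e2', braidMap_tensorMat]

end Braidings

namespace SMod

/-- The braiding of a supermodule with the vector supermodule is a homomorphism: this is the
defining relation of `U_q(𝔮_n)`. -/
theorem braidMap_intertwines (M : SMod.{u} q n) :
    Intertwines (tensorMat M.tm (vecTm q n)) (tensorMat (vecTm q n) M.tm) 0 (braidMap M.tm) where
  inv x := by
    have : braidMap M.tm ∘ₗ QIso.inv K (M ⊗[K] VSp K n) =
        ksgn K 0 1 • (QIso.inv K (VSp K n ⊗[K] M) ∘ₗ braidMap M.tm) := ext_vec_right fun m j => by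
      rw [ksgn_zero_left, one_smul, LinearMap.comp_apply, LinearMap.comp_apply, inv_tmul, inv_vec,
        TensorProduct.tmul_smul, map_smul, braidMap_tmul, braidMap_tmul, map_sum, Finset.smul_sum]
      refine Finset.sum_congr rfl fun i _ => ?_
      have h := LinearMap.congr_fun (M.tm_hasPar i j 1) m
      simp only [invP_one, Module.End.mul_apply, LinearMap.smul_apply] at h
      rw [inv_tmul, inv_vec, h, TensorProduct.tmul_smul, TensorProduct.smul_tmul',
        TensorProduct.smul_tmul', smul_smul, ksgn_add_left,
        mul_right_comm, ksgn_mul_self, one_mul]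
    exact LinearMap.congr_fun this x
  comm i j x := by
    have : braidMap M.tm ∘ₗ tensorMat M.tm (vecTm q n) i j =
        ksgn K 0 (par i) • (tensorMat (vecTm q n) M.tm i j ∘ₗ braidMap M.tm) :=
      ext_vec_right fun m d => by
        rw [ksgn_zero_left, one_smul, LinearMap.comp_apply, LinearMap.comp_apply]
        simp only [braidMap_tmul, tensorMat_tmul, map_sum, vecTm_vec, TensorProduct.tmul_sum,
          TensorProduct.sum_tmul, TensorProduct.tmul_smul, ← TensorProduct.smul_tmul', map_smul,
          Finset.smul_sum]
        have sw : ∀ F : Idx n → Idx n → Idx n → VSp K n ⊗[K] M,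
            ∑ k, ∑ y, ∑ a, F k y a = ∑ a, ∑ k, ∑ y, F k y a := fun F => by
          exact (Finset.sum_congr rfl fun k _ => Finset.sum_comm).trans Finset.sum_comm
        have pull : ∀ (a : Idx n) (F : Idx n → Idx n → M),
            ∑ k, ∑ y, vec K a ⊗ₜ[K] F k y = vec K a ⊗ₜ[K] ∑ k, ∑ y, F k y := fun a F => by
          simp only [TensorProduct.tmul_sum]
        refine (sw _).trans ((Finset.sum_congr rfl fun a _ => ?_).trans (sw _).symm)
        simp only [← TensorProduct.tmul_smul]
        have h3 := LinearMap.congr_fun (M.rtt i d j a) m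
        simp only [LinearMap.sum_apply, LinearMap.smul_apply, Module.End.mul_apply] at h3
        exact (pull a _).trans ((congrArg (vec K a ⊗ₜ[K] ·) h3.symm).trans (pull a _).symm)
    exact LinearMap.congr_fun this x

end SMod

/-! ### The dual of the vector supermodule, caps and cups -/

theorem dvec_vec (i j : Idx n) : dvec K i (vec K j) = if i = j then 1 else 0 := by
  simp [dvec, vec, Pi.single_apply]

theorem sum_dvec (f : Module.Dual K (VSp K n)) : ∑ i, f (vec K i) • dvec K i = f :=
  vec_ext fun j => by simp [LinearMap.sum_apply, dvec_vec]

theorem sum_vec (x : VSp K n) : ∑ i, dvec K i x • vec K i = x := by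
  have : ∑ i, (dvec K i).smulRight (vec K i) = (LinearMap.id : VSp K n →ₗ[K] VSp K n) :=
    vec_ext fun j => by simp [LinearMap.sum_apply, dvec_vec]
  simpa [LinearMap.sum_apply] using LinearMap.congr_fun this x

theorem dual_ext {N : Type*} [AddCommGroup N] [Module K N]
    {f g : Module.Dual K (VSp K n) →ₗ[K] N} (h : ∀ i, f (dvec K i) = g (dvec K i)) : f = g := by
  refine LinearMap.ext fun x => ?_
  rw [← sum_dvec x]
  simp [h]

theorem inv_dvec (i : Idx n) :
    inv K (Module.Dual K (VSp K n)) (dvec K i) = sg K i • dvec K i := by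
  rw [SMod.inv_dual]
  refine vec_ext fun j => ?_
  rw [LinearMap.dualMap_apply, inv_vec', map_smul, LinearMap.smul_apply, dvec_vec]
  split_ifs with h
  · rw [h]
  · simp

variable (q n) in
/-- The matrix of operators of the inverse of the braiding `T_VV`. -/
def vecSm : OpMat K n (VSp K n) := fun i j =>
  triInv (lmat (vectorAct q)) i j * invP K (VSp K n) (par j)

variable (q n) in
/-- The matrix of the operators `t_ij` on the dual of the vector supermodule. -/
def dualTm : OpMat K n (Module.Dual K (VSp K n)) := fun i j => (vecSm q n i j).dualMap

theorem sm_vector (hq : q ≠ 0) : (SMod.vector q n hq).sm = vecSm q n := by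
  have h1 : (SMod.vector q n hq).act = vectorAct q := funext₂ fun i j =>
    SMod.ofOps_act _ _ _ _ _ _ i j
  ext1 i j
  rw [SMod.sm, h1]
  rfl

theorem tm_dual_vector (hq : q ≠ 0) : (SMod.vector q n hq).dual.tm = dualTm q n := by
  ext1 i j
  rw [SMod.tm_dual, sm_vector]
  rfl

theorem vecTm_mul_vecSm (hq : q ≠ 0) : vecTm q n * vecSm q n = 1 :=
  (congrArg₂ (fun A B : OpMat K n (VSp K n) => A * B) (tm_vector hq) (sm_vector hq)).symm.trans
    (SMod.tm_mul_sm _)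

theorem vecSm_mul_vecTm (hq : q ≠ 0) : vecSm q n * vecTm q n = 1 :=
  (congrArg₂ (fun A B : OpMat K n (VSp K n) => A * B) (sm_vector hq) (tm_vector hq)).symm.trans
    (SMod.sm_mul_tm _)

theorem sum_mul_apply {M : Type*} [AddCommGroup M] [Module K M] {A B : OpMat K n M} (h : A * B = 1)
    (i j : Idx n) (m : M) : ∑ k, A i k (B k j m) = if i = j then m else 0 := by
  have := LinearMap.congr_fun (congrFun (congrFun h i) j) m
  rw [Matrix.mul_apply, LinearMap.sum_apply, Matrix.one_apply] at this
  rw [show ∑ k, A i k (B k j m) = ∑ k, (A i k * B k j) m from rfl, this]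
  split_ifs <;> rfl

section CapCup

variable (K n) (M : Type*) [AddCommGroup M] [Module K M]

/-- The evaluation `f ⊗ v ⊗ m ↦ f(v) m`. -/
def capMap : Module.Dual K (VSp K n) ⊗[K] (VSp K n ⊗[K] M) →ₗ[K] M :=
  (TensorProduct.lid K M).toLinearMap ∘ₗ
    TensorProduct.map (contractLeft K (VSp K n)) LinearMap.id ∘ₗ
      (TensorProduct.assoc K (Module.Dual K (VSp K n)) (VSp K n) M).symm.toLinearMap

/-- The coevaluation `m ↦ ∑_i v_i ⊗ v_i* ⊗ m`. -/
def cupMap : M →ₗ[K] VSp K n ⊗[K] (Module.Dual K (VSp K n) ⊗[K] M) :=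
  ∑ i, TensorProduct.mk K _ _ (vec K i) ∘ₗ TensorProduct.mk K _ _ (dvec K i)

variable {K n M}

theorem capMap_tmul (f : Module.Dual K (VSp K n)) (v : VSp K n) (m : M) :
    capMap K n M (f ⊗ₜ (v ⊗ₜ m)) = f v • m := by
  simp [capMap, contractLeft_apply]

theorem capMap_assoc (x : Module.Dual K (VSp K n) ⊗[K] VSp K n) (m : M) :
    capMap K n M (TensorProduct.assoc K _ _ M (x ⊗ₜ m)) = contractLeft K (VSp K n) x • m := by
  simp [capMap]

theorem cupMap_apply (m : M) : cupMap K n M m = ∑ i, vec K i ⊗ₜ (dvec K i ⊗ₜ m) := by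
  simp [cupMap, LinearMap.sum_apply]

theorem ext_dual_vec {N : Type*} [AddCommGroup N] [Module K N]
    {f g : Module.Dual K (VSp K n) ⊗[K] (VSp K n ⊗[K] M) →ₗ[K] N}
    (h : ∀ a b m, f (dvec K a ⊗ₜ (vec K b ⊗ₜ m)) = g (dvec K a ⊗ₜ (vec K b ⊗ₜ m))) : f = g :=
  TensorProduct.ext (dual_ext fun a => TensorProduct.ext (vec_ext fun b => LinearMap.ext fun m =>
    h a b m))

variable [Superspace K M]

/-- The evaluation is a homomorphism: this is `∑_k S(u_ik) u_kj = δ_ij`. -/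
theorem capMap_intertwines (hq : q ≠ 0) (T : OpMat K n M) :
    Intertwines (tensorMat (dualTm q n) (tensorMat (vecTm q n) T)) T 0 (capMap K n M) where
  inv x := by
    have : capMap K n M ∘ₗ QIso.inv K (Module.Dual K (VSp K n) ⊗[K] (VSp K n ⊗[K] M)) =
        ksgn K 0 1 • (QIso.inv K M ∘ₗ capMap K n M) :=
      ext_dual_vec fun a b m => by
        rw [ksgn_zero_left, one_smul, LinearMap.comp_apply, LinearMap.comp_apply, inv_tmul,
          inv_tmul, inv_dvec, inv_vec', ← TensorProduct.smul_tmul', map_smul,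
          ← TensorProduct.smul_tmul', TensorProduct.tmul_smul, map_smul, capMap_tmul, capMap_tmul,
          map_smul, dvec_vec]
        split_ifs with h
        · rw [h, smul_smul, sg_mul_self, one_smul]
        · simp
    exact LinearMap.congr_fun this x
  comm i j x := by
    have : capMap K n M ∘ₗ tensorMat (dualTm q n) (tensorMat (vecTm q n) T) i j =
        ksgn K 0 (par i) • (T i j ∘ₗ capMap K n M) :=
      TensorProduct.ext (LinearMap.ext fun f => TensorProduct.ext' fun v m => by
        change capMap K n M (tensorMat (dualTm q n) (tensorMat (vecTm q n) T) i j
          (f ⊗ₜ (v ⊗ₜ m))) = ksgn K 0 (par i) • T i j (capMap K n M (f ⊗ₜ (v ⊗ₜ m)))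
        simp only [ksgn_zero_left, one_smul, tensorMat_tmul, TensorProduct.tmul_sum, map_sum,
          capMap_tmul, dualTm, LinearMap.dualMap_apply]
        rw [Finset.sum_comm]
        simp only [← Finset.sum_smul, ← map_sum, sum_mul_apply (vecSm_mul_vecTm hq),
          apply_ite f, map_zero, ite_smul, zero_smul, map_smul]
        simp)
    exact LinearMap.congr_fun this x

/-- The transpose of an operator moves through `∑_a v_a ⊗ v_a*`. -/
theorem sum_vec_tmul_dualMap (A B : Module.End K (VSp K n)) :
    ∑ a, A (vec K a) ⊗ₜ[K] B.dualMap (dvec K a) = ∑ a, A (B (vec K a)) ⊗ₜ[K] dvec K a := by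
  have h1 : ∀ a, B.dualMap (dvec K a) = ∑ b, dvec K a (B (vec K b)) • dvec K b := fun a =>
    (sum_dvec _).symm
  have h2 : ∀ b, A (B (vec K b)) = ∑ a, dvec K a (B (vec K b)) • A (vec K a) := fun b => by
    simp only [← map_smul, ← map_sum, sum_vec]
  simp only [h1, h2, TensorProduct.tmul_sum, TensorProduct.sum_tmul, TensorProduct.tmul_smul,
    TensorProduct.smul_tmul']
  exact Finset.sum_comm

/-- The superspace `V ⊗ (V* ⊗ M)`. -/
@[reducible] instance tensorDualSuperspace :
    Superspace K (VSp K n ⊗[K] (Module.Dual K (VSp K n) ⊗[K] M)) :=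
  tensorSuperspace (W := VSp K n) (M := Module.Dual K (VSp K n) ⊗[K] M)

/-- The coevaluation is a homomorphism: this is `∑_k u_ik S(u_kj) = δ_ij`. -/
theorem cupMap_intertwines (hq : q ≠ 0) (T : OpMat K n M) :
    Intertwines T (tensorMat (vecTm q n) (tensorMat (dualTm q n) T)) 0 (cupMap K n M) where
  inv m := by
    have h : ∀ i : Idx n, QIso.inv K (VSp K n ⊗[K] (Module.Dual K (VSp K n) ⊗[K] M))
        (vec K i ⊗ₜ (dvec K i ⊗ₜ m)) = vec K i ⊗ₜ (dvec K i ⊗ₜ QIso.inv K M m) := fun i => by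
      rw [inv_tmul (M := VSp K n) (N := Module.Dual K (VSp K n) ⊗[K] M), inv_tmul, inv_vec',
        inv_dvec, ← TensorProduct.smul_tmul', ← TensorProduct.smul_tmul', TensorProduct.tmul_smul,
        smul_smul, sg_mul_self, one_smul]
    rw [ksgn_zero_left, one_smul, cupMap_apply, cupMap_apply, map_sum]
    exact Finset.sum_congr rfl fun i _ => (h i).symm
  comm i j m := by
    rw [ksgn_zero_left, one_smul, cupMap_apply, cupMap_apply, map_sum]
    simp only [tensorMat_tmul, TensorProduct.tmul_sum]
    have h : ∀ k l, ∑ a, vecTm q n i k (vec K a) ⊗ₜ[K] (dualTm q n k l (dvec K a) ⊗ₜ[K] T l j m) =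
        ∑ a, vecTm q n i k (vecSm q n k l (vec K a)) ⊗ₜ[K] (dvec K a ⊗ₜ[K] T l j m) := fun k l => by
      have := congrArg (fun y => TensorProduct.assoc K _ _ M (y ⊗ₜ[K] T l j m))
        (sum_vec_tmul_dualMap (vecTm q n i k) (vecSm q n k l))
      simpa only [TensorProduct.sum_tmul, map_sum, TensorProduct.assoc_tmul, dualTm] using this
    have sw : ∀ F : Idx n → Idx n → Idx n → VSp K n ⊗[K] (Module.Dual K (VSp K n) ⊗[K] M),
        ∑ a, ∑ k, ∑ l, F a k l = ∑ k, ∑ l, ∑ a, F a k l := fun F =>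
      Finset.sum_comm.trans (Finset.sum_congr rfl fun k _ => Finset.sum_comm)
    rw [sw]
    simp only [h]
    rw [← sw fun a k l => vecTm q n i k (vecSm q n k l (vec K a)) ⊗ₜ[K]
      (dvec K a ⊗ₜ[K] T l j m)]
    refine Finset.sum_congr rfl fun a _ => ?_
    rw [Finset.sum_comm]
    simp only [← TensorProduct.sum_tmul, sum_mul_apply (vecTm_mul_vecSm hq), TensorProduct.ite_tmul]
    simp

end CapCup

/-! ### The braiding of the vector supermodule with itself and with its dual -/

section Mates

variable {M : Type*} [AddCommGroup M] [Module K M]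

/-- The mate `f ⊗ v ↦ ∑_i (f ⊗ 1)(B (v ⊗ v_i)) ⊗ v_i*` of an operator `B` on `V ⊗ V`. -/
def mate (B : VSp K n ⊗[K] VSp K n →ₗ[K] VSp K n ⊗[K] VSp K n) :
    Module.Dual K (VSp K n) ⊗[K] VSp K n →ₗ[K] VSp K n ⊗[K] Module.Dual K (VSp K n) :=
  ∑ i, (TensorProduct.mk K (VSp K n) (Module.Dual K (VSp K n))).flip (dvec K i) ∘ₗ
    capMap K n (VSp K n) ∘ₗ TensorProduct.map LinearMap.id
      (B ∘ₗ (TensorProduct.mk K (VSp K n) (VSp K n)).flip (vec K i))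

theorem mate_tmul (B : VSp K n ⊗[K] VSp K n →ₗ[K] VSp K n ⊗[K] VSp K n)
    (f : Module.Dual K (VSp K n)) (v : VSp K n) :
    mate B (f ⊗ₜ v) = ∑ i, capMap K n (VSp K n) (f ⊗ₜ B (v ⊗ₜ vec K i)) ⊗ₜ dvec K i := by
  simp [mate, LinearMap.sum_apply]

/-- The mate of `B`, tensored with `M`, is composed of a cup, `B` and a cap. -/
theorem onLeft_mate (B : VSp K n ⊗[K] VSp K n →ₗ[K] VSp K n ⊗[K] VSp K n)
    (x : Module.Dual K (VSp K n) ⊗[K] (VSp K n ⊗[K] M)) : onLeft (mate B) M x =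
      capMap K n (VSp K n ⊗[K] (Module.Dual K (VSp K n) ⊗[K] M)) (TensorProduct.map LinearMap.id
        (onLeft B (Module.Dual K (VSp K n) ⊗[K] M))
          (TensorProduct.map LinearMap.id (TensorProduct.map LinearMap.id (cupMap K n M)) x)) := by
  have h : ∀ (f : Module.Dual K (VSp K n)) (i : Idx n) (m : M) (y : VSp K n ⊗[K] VSp K n),
      TensorProduct.assoc K (VSp K n) (Module.Dual K (VSp K n)) M
        ((capMap K n (VSp K n) (f ⊗ₜ y) ⊗ₜ dvec K i) ⊗ₜ m) =
      capMap K n (VSp K n ⊗[K] (Module.Dual K (VSp K n) ⊗[K] M)) (f ⊗ₜ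
        TensorProduct.assoc K (VSp K n) (VSp K n) (Module.Dual K (VSp K n) ⊗[K] M)
          (y ⊗ₜ (dvec K i ⊗ₜ m))) := fun f i m y => by
    induction y using TensorProduct.induction_on with
    | zero => simp
    | tmul u w => simp [capMap_tmul, ← TensorProduct.smul_tmul']
    | add y y' h h' => simp only [TensorProduct.tmul_add, map_add, TensorProduct.add_tmul, h, h']
  induction x using TensorProduct.induction_on with
  | zero => simp only [map_zero]
  | add x y hx hy => simp only [map_add, hx, hy]
  | tmul f x =>
    induction x using TensorProduct.induction_on with
    | zero => simp only [TensorProduct.tmul_zero, map_zero]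
    | add x y hx hy => simp only [TensorProduct.tmul_add, map_add, hx, hy]
    | tmul v m =>
      refine (onLeft_tmul (mate B) f v m).trans ?_
      simp only [TensorProduct.map_tmul, LinearMap.id_apply, cupMap_apply, TensorProduct.tmul_sum,
        map_sum, mate_tmul, TensorProduct.sum_tmul, h]
      exact Finset.sum_congr rfl fun i _ => by rw [onLeft_tmul]

theorem mate_vec (a b : Idx n) : mate (braidMap (vecTm q n)) (dvec K a ⊗ₜ vec K b) =
    ∑ i, ∑ y, tcoef q b i a y • vec K y ⊗ₜ dvec K i := by
  rw [mate_tmul]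
  refine Finset.sum_congr rfl fun i _ => ?_
  rw [braidMap_tmul, TensorProduct.tmul_sum, map_sum]
  simp only [capMap_tmul, dvec_vec, ite_smul, one_smul, zero_smul, Finset.sum_ite_eq,
    Finset.mem_univ, if_true, vecTm_vec, TensorProduct.sum_tmul, TensorProduct.smul_tmul']

/-- The sum `∑_i v_i ⊗ v_i*`. -/
def coev (K : Type) [Field K] (n : ℕ) : VSp K n ⊗[K] Module.Dual K (VSp K n) :=
  ∑ i, vec K i ⊗ₜ dvec K i

theorem cupMap_eq_assoc (m : M) :
    cupMap K n M m = TensorProduct.assoc K _ _ M (coev K n ⊗ₜ m) := by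
  simp [coev, cupMap_apply, TensorProduct.sum_tmul]

/-- The mate of the inverse of `T_VV` is the braiding of `V*` with `V`. -/
theorem mate_braidInv (x : Module.Dual K (VSp K n) ⊗[K] VSp K n) :
    mate (braidInv (vecSm q n)) x = braidMap (dualTm q n) x := by
  have : mate (braidInv (vecSm q n)) = braidMap (dualTm q n) := ext_vec_right fun f b => by
    rw [mate_tmul, braidMap_tmul]
    have h1 : ∀ i, capMap K n (VSp K n) (f ⊗ₜ braidInv (vecSm q n) (vec K b ⊗ₜ vec K i)) =
        ∑ c, f (vecSm q n c b (vec K i)) • vec K c := fun i => by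
      rw [braidInv_tmul, TensorProduct.tmul_sum, map_sum]
      exact Finset.sum_congr rfl fun c _ => capMap_tmul _ _ _
    have h2 : ∀ c, dualTm q n c b f = ∑ i, f (vecSm q n c b (vec K i)) • dvec K i := fun c =>
      (sum_dvec _).symm
    simp only [h1, h2, TensorProduct.sum_tmul, TensorProduct.tmul_sum, TensorProduct.tmul_smul,
      TensorProduct.smul_tmul']
    exact Finset.sum_comm
  exact LinearMap.congr_fun this x

end Mates

/-! ### The Hecke-type relations of the braiding of `V` with itself -/

/-- The braiding of `V` with itself in coordinates. -/
theorem braidMap_vecTm (a b : Idx n) : braidMap (vecTm q n) (vec K a ⊗ₜ vec K b) =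
    (eps K a b * q ^ phi a b) • vec K b ⊗ₜ vec K a +
      ((if a < b then (q - q⁻¹) • vec K a ⊗ₜ[K] vec K b else 0) +
        if -a < b then ((q - q⁻¹) * sg K b) • vec K (-a) ⊗ₜ[K] vec K (-b) else 0) := by
  have h : braidMap (vecTm q n) (vec K a ⊗ₜ vec K b) = ∑ y, ∑ i, theta q y a i b •
      ((ksgn K (par a) (par i + par b) * ksgn K (par i) (par y)) • vec K i ⊗ₜ[K] vec K y) := by
    rw [braidMap_tmul, Finset.sum_comm]
    refine Finset.sum_congr rfl fun i _ => ?_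
    rw [vecTm_vec, TensorProduct.tmul_sum]
    refine Finset.sum_congr rfl fun y _ => ?_
    rw [TensorProduct.tmul_smul, tcoef, ← smul_smul]
  refine (h.trans (theta_sum q (fun y i => (ksgn K (par a) (par i + par b) *
    ksgn K (par i) (par y)) • vec K i ⊗ₜ[K] vec K y) a b)).trans ?_
  simp only [par_neg, ksgn_add_right, ksgn_add_left, sg_eq, ← eps.eq_def, eps_self, ksgn_comm 1]
  rw [eps_comm b a]
  have h1 : eps K a b = 1 ∨ eps K a b = -1 := by
    rw [eps, ksgn]; split_ifs <;> simp
  rcases sg_cases (K := K) a with ha | ha <;> rcases sg_cases (K := K) b with hb | hb <;>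
    rcases h1 with h1 | h1 <;> by_cases h2 : a < b <;> by_cases h3 : -a < b <;>
    simp only [h1, h2, h3, ha, hb, ksgn_one_one, if_true,
      if_false] <;>
    module

section Unfold

variable {N M : Type*} [AddCommGroup N] [Module K N] [AddCommGroup M] [Module K M]

/-- The linear map `v_a ⊗ v_b ⊗ v_c ↦ v_a ⊗ w_bc` on the coordinate model `V3` of `V ⊗ V ⊗ V`, on
which `T1` and `T2` are the braidings of adjacent factors. -/
def unfoldMap (w : Idx n × Idx n → N) : V3 K n →ₗ[K] VSp K n ⊗[K] N :=
  LinearMap.lsum K (fun _ => VSp K n) K fun x => (TensorProduct.mk K (VSp K n) N).flip (w x)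

theorem unfoldMap_bas (w : Idx n × Idx n → N) (a b c : Idx n) :
    unfoldMap w (bas K a b c) = vec K a ⊗ₜ w (b, c) := by
  rw [unfoldMap, bas, LinearMap.lsum_piSingle]
  rfl

theorem braidMap_vecTm_unfold (x : V3 K n) :
    unfoldMap (fun y => vec K y.1) (T1 q x) = braidMap (vecTm q n)
      (unfoldMap (fun y => vec K y.1) x) := by
  have : unfoldMap (fun y => vec K y.1) ∘ₗ T1 q =
      braidMap (vecTm q n) ∘ₗ unfoldMap (K := K) (fun y : Idx n × Idx n => vec K y.1) :=
    bas_ext fun a b c => by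
      rw [LinearMap.comp_apply, LinearMap.comp_apply, unfoldMap_bas, braidMap_vecTm, T1_bas]
      simp only [map_add, map_smul, apply_ite (unfoldMap _), unfoldMap_bas, map_zero]
  exact LinearMap.congr_fun this x

/-- The quadratic relation of the braiding of `V` with itself; the third tensor factor of the model
plays no role and is forgotten. -/
theorem braidMap_vecTm_sq (hq : q ≠ 0) (x : VSp K n ⊗[K] VSp K n) :
    braidMap (vecTm q n) (braidMap (vecTm q n) x) = (q - q⁻¹) • braidMap (vecTm q n) x + x := by
  have : braidMap (vecTm q n) ∘ₗ braidMap (vecTm q n) =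
      (q - q⁻¹) • braidMap (vecTm q n) + LinearMap.id :=
    ext_vec_left fun a v => by
      refine LinearMap.congr_fun (f := (braidMap (vecTm q n) ∘ₗ braidMap (vecTm q n)) ∘ₗ
        TensorProduct.mk K _ _ (vec K a)) (g := ((q - q⁻¹) • braidMap (vecTm q n) +
          LinearMap.id) ∘ₗ TensorProduct.mk K _ _ (vec K a)) (vec_ext fun b => ?_) v
      change braidMap (vecTm q n) (braidMap (vecTm q n) (vec K a ⊗ₜ vec K b)) =
        (q - q⁻¹) • braidMap (vecTm q n) (vec K a ⊗ₜ vec K b) + vec K a ⊗ₜ vec K b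
      have h := congrArg (unfoldMap (fun y : Idx n × Idx n => vec K y.1)) (T1_T1 hq (bas K a b a))
      simpa only [map_add, map_smul, braidMap_vecTm_unfold, unfoldMap_bas] using h
  exact LinearMap.congr_fun this x

/-- The skein relation: the quadratic relation, divided by `T_VV`. -/
theorem braidMap_vecTm_skein (hq : q ≠ 0) (x : VSp K n ⊗[K] VSp K n) :
    braidMap (vecTm q n) x = braidInv (vecSm q n) x + (q - q⁻¹) • x := by
  have h := braidMap_vecTm_sq hq (braidInv (vecSm q n) x)
  rw [braidMap_braidInv (vecTm_mul_vecSm hq)] at h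
  rw [h, add_comm]

theorem ext_vec_three {f g : VSp K n ⊗[K] (VSp K n ⊗[K] (VSp K n ⊗[K] M)) →ₗ[K] N}
    (h : ∀ a b c m, f (vec K a ⊗ₜ (vec K b ⊗ₜ (vec K c ⊗ₜ m))) =
      g (vec K a ⊗ₜ (vec K b ⊗ₜ (vec K c ⊗ₜ m)))) : f = g := by
  refine ext_vec_left fun a x => LinearMap.congr_fun
    (f := f ∘ₗ TensorProduct.mk K _ _ (vec K a)) (g := g ∘ₗ TensorProduct.mk K _ _ (vec K a)) ?_ x
  refine ext_vec_left fun b x => LinearMap.congr_fun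
    (f := f ∘ₗ TensorProduct.mk K (VSp K n) (VSp K n ⊗[K] (VSp K n ⊗[K] M)) (vec K a) ∘ₗ
      TensorProduct.mk K (VSp K n) (VSp K n ⊗[K] M) (vec K b))
    (g := g ∘ₗ TensorProduct.mk K (VSp K n) (VSp K n ⊗[K] (VSp K n ⊗[K] M)) (vec K a) ∘ₗ
      TensorProduct.mk K (VSp K n) (VSp K n ⊗[K] M) (vec K b)) ?_ x
  exact ext_vec_left fun c m => h a b c m

theorem unfoldMap_T1 (m : M) (x : V3 K n) :
    unfoldMap (fun y => vec K y.1 ⊗ₜ (vec K y.2 ⊗ₜ[K] m)) (T1 q x) =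
      onLeft (braidMap (vecTm q n)) (VSp K n ⊗[K] M)
        (unfoldMap (fun y => vec K y.1 ⊗ₜ (vec K y.2 ⊗ₜ[K] m)) x) := by
  have : unfoldMap (fun y => vec K y.1 ⊗ₜ (vec K y.2 ⊗ₜ[K] m)) ∘ₗ T1 q =
      onLeft (braidMap (vecTm q n)) (VSp K n ⊗[K] M) ∘ₗ
        unfoldMap (fun y : Idx n × Idx n => vec K y.1 ⊗ₜ (vec K y.2 ⊗ₜ[K] m)) :=
    bas_ext fun a b c => by
      rw [LinearMap.comp_apply, LinearMap.comp_apply, unfoldMap_bas, onLeft_tmul, braidMap_vecTm,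
        T1_bas]
      simp only [map_add, map_smul, apply_ite (unfoldMap _), unfoldMap_bas, map_zero,
        TensorProduct.add_tmul, TensorProduct.ite_tmul, TensorProduct.smul_tmul',
        TensorProduct.assoc_tmul, apply_ite (TensorProduct.assoc K _ _ _)]
  exact LinearMap.congr_fun this x

theorem unfoldMap_T2 (m : M) (x : V3 K n) :
    unfoldMap (fun y => vec K y.1 ⊗ₜ (vec K y.2 ⊗ₜ[K] m)) (T2 q x) =
      TensorProduct.map LinearMap.id (onLeft (braidMap (vecTm q n)) M)
        (unfoldMap (fun y => vec K y.1 ⊗ₜ (vec K y.2 ⊗ₜ[K] m)) x) := by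
  have : unfoldMap (fun y => vec K y.1 ⊗ₜ (vec K y.2 ⊗ₜ[K] m)) ∘ₗ T2 q =
      TensorProduct.map LinearMap.id (onLeft (braidMap (vecTm q n)) M) ∘ₗ
        unfoldMap (fun y : Idx n × Idx n => vec K y.1 ⊗ₜ (vec K y.2 ⊗ₜ[K] m)) :=
    bas_ext fun a b c => by
      rw [LinearMap.comp_apply, LinearMap.comp_apply, unfoldMap_bas, TensorProduct.map_tmul,
        onLeft_tmul, braidMap_vecTm, T2_bas]
      simp only [map_add, map_smul, apply_ite (unfoldMap _), unfoldMap_bas, map_zero,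
        TensorProduct.add_tmul, TensorProduct.ite_tmul, ← TensorProduct.smul_tmul',
        TensorProduct.tmul_smul, TensorProduct.tmul_add, TensorProduct.tmul_ite,
        TensorProduct.assoc_tmul, apply_ite (TensorProduct.assoc K _ _ _), LinearMap.id_apply]
  exact LinearMap.congr_fun this x

/-- The braid relation of the braiding of `V` with itself. -/
theorem onLeft_braidMap_vecTm_braid (hq : q ≠ 0)
    (x : VSp K n ⊗[K] (VSp K n ⊗[K] (VSp K n ⊗[K] M))) :
    onLeft (braidMap (vecTm q n)) (VSp K n ⊗[K] M)
      (TensorProduct.map LinearMap.id (onLeft (braidMap (vecTm q n)) M)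
        (onLeft (braidMap (vecTm q n)) (VSp K n ⊗[K] M) x)) =
    TensorProduct.map LinearMap.id (onLeft (braidMap (vecTm q n)) M)
      (onLeft (braidMap (vecTm q n)) (VSp K n ⊗[K] M) (TensorProduct.map LinearMap.id
        (onLeft (braidMap (vecTm q n)) M) x)) := by
  have : onLeft (braidMap (vecTm q n)) (VSp K n ⊗[K] M) ∘ₗ
      TensorProduct.map LinearMap.id (onLeft (braidMap (vecTm q n)) M) ∘ₗ
        onLeft (braidMap (vecTm q n)) (VSp K n ⊗[K] M) =
      TensorProduct.map LinearMap.id (onLeft (braidMap (vecTm q n)) M) ∘ₗ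
        onLeft (braidMap (vecTm q n)) (VSp K n ⊗[K] M) ∘ₗ
          TensorProduct.map LinearMap.id (onLeft (braidMap (vecTm q n)) M) :=
    ext_vec_three fun a b c m => by
      have h := congrArg (unfoldMap (fun y : Idx n × Idx n => vec K y.1 ⊗ₜ[K] (vec K y.2 ⊗ₜ[K] m)))
        (braid hq (bas K a b c))
      simpa only [unfoldMap_T1, unfoldMap_T2, unfoldMap_bas, LinearMap.comp_apply] using h
  exact LinearMap.congr_fun this x

end Unfold

/-! ### Telescoping sums of powers of `q` -/

/-- A telescoping sum. Each summand is the difference of consecutive values of `q ^ (-|2 * k - 1|)`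
at `k` and `k + 1`; the summand at `0` vanishes, as these values agree there. -/
theorem zpow_telescope (hq : q ≠ 0) (i l : ℤ) (h : i < l) :
    ∑ k ∈ Finset.Ioo i l, (q - q⁻¹) * (Int.sign k : K) * q ^ (-(2 * |k|)) =
      q ^ (-|2 * i + 1|) - q ^ (-|2 * l - 1|) := by
  induction l, (show i + 1 ≤ l from h) using Int.leInduction with
  | base =>
    rw [show 2 * (i + 1) - 1 = 2 * i + 1 by ring, sub_self]
    refine Finset.sum_eq_zero fun k hk => ?_
    rw [Finset.mem_Ioo] at hk
    omega
  | succ l hl ih =>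
    rw [show Finset.Ioo i (l + 1) = insert l (Finset.Ioo i l) by ext k; simp; omega,
      Finset.sum_insert (by simp), ih (by omega)]
    rcases lt_trichotomy l 0 with h0 | rfl | h0
    · rw [Int.sign_eq_neg_one_of_neg h0, abs_of_neg h0, abs_of_neg (by omega : 2 * (l + 1) - 1 < 0),
        abs_of_neg (by omega : 2 * l - 1 < 0), show -(2 * -l) = 2 * l by ring,
        show -(-(2 * (l + 1) - 1)) = 2 * l + 1 by ring, show -(-(2 * l - 1)) = 2 * l - 1 by ring,
        zpow_add₀ hq, zpow_sub₀ hq]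
      push_cast
      field_simp
      ring
    · simp
    · rw [Int.sign_eq_one_of_pos h0, abs_of_pos h0, abs_of_pos (by omega : 0 < 2 * (l + 1) - 1),
        abs_of_pos (by omega : 0 < 2 * l - 1), show -(2 * (l + 1) - 1) = -(2 * l) - 1 by ring,
        show -(2 * l - 1) = -(2 * l) + 1 by ring, zpow_add₀ hq, zpow_sub₀ hq]
      push_cast
      field_simp
      ring

/-- Sums over the nonzero integers of absolute value at most `n` as sums over intervals. -/
theorem sum_idx_Ioo {N : Type*} [AddCommMonoid N] (f : ℤ → N) (h0 : f 0 = 0) (i l : ℤ)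
    (hi : -n ≤ i + 1) (hl : l ≤ n + 1) :
    ∑ k : Idx n, (if i < k ∧ (k : ℤ) < l then f k else 0) = ∑ k ∈ Finset.Ioo i l, f k := by
  rw [Finset.sum_coe_sort ((Finset.Icc (-(n : ℤ)) n).erase 0)
    (fun k => if i < k ∧ k < l then f k else 0), ← Finset.sum_filter]
  refine Finset.sum_subset_zero_on_sdiff (fun k hk => ?_) (fun k hk => ?_) fun _ _ => rfl
  · simp at hk ⊢; omega
  · have : k = 0 := by simp at hk; omega
    rw [this, h0]

theorem sg_eq_sign (i : Idx n) : sg K i = (Int.sign i : K) := by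
  have := i.ne_zero
  by_cases h : (0 : ℤ) < i
  · rw [sg, if_pos h, Int.sign_eq_one_of_pos h]; simp
  · rw [sg, if_neg h, Int.sign_eq_neg_one_of_neg (by omega)]; simp

/-- A telescoping sum over the indices between `i` and `l`. -/
theorem sum_sg_zpow (hq : q ≠ 0) (i : Idx n) (l : ℤ) (h : (i : ℤ) < l) (hl : l ≤ n + 1) :
    ∑ k : Idx n, (if i < k ∧ (k : ℤ) < l then
      (q - q⁻¹) * sg K k * q ^ (-(2 * |(k : ℤ)|)) else 0) =
      q ^ (-(2 * |(i : ℤ)|) - Int.sign i) - q ^ (-|2 * l - 1|) := by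
  have hi := i.2
  have hi0 := i.ne_zero
  simp only [Finset.mem_erase, Finset.mem_Icc] at hi
  have e : |2 * (i : ℤ) + 1| = 2 * |(i : ℤ)| + Int.sign i := by
    rcases lt_or_gt_of_ne hi0 with h | h
    · rw [Int.sign_eq_neg_one_of_neg h, abs_of_neg h, abs_of_neg (by omega)]; ring
    · rw [Int.sign_eq_one_of_pos h, abs_of_pos h, abs_of_pos (by omega)]
  rw [show -(2 * |(i : ℤ)|) - Int.sign i = -|2 * (i : ℤ) + 1| by rw [e]; ring,
    ← zpow_telescope hq i l h, ← sum_idx_Ioo _ (by simp) i l (by omega) hl]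
  refine Finset.sum_congr rfl fun k _ => ?_
  simp only [sg_eq_sign, ← Subtype.coe_lt_coe]

/-! ### The crossings of `V` and `V*` in coordinates -/

theorem Idx.ne_neg (a : Idx n) : a ≠ -a := fun h => a.ne_zero (by
  have := congrArg Subtype.val h; simp at this; omega)

/-- A sum against the coefficients of `Θ` with the other two indices fixed than in `theta_sum`. -/
theorem theta_sum_right {N : Type*} [AddCommGroup N] [Module K N] (f : Idx n → Idx n → N)
    (a b : Idx n) : ∑ i, ∑ y, theta q y b a i • f i y = q ^ phi b a • f a b +
      ((if a = b then ∑ i, if a < i then ((q - q⁻¹) * sg K a) • f i i else 0 else 0) +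
        if b = -a then ∑ i, if a < i then ((q - q⁻¹) * sg K a) • f i (-i) else 0 else 0) := by
  have h : ∀ i y : Idx n, theta q y b a i • f i y =
      (if i = a then if y = b then q ^ phi b a • f a b else 0 else 0) +
      ((if y = i then if a = b then if a < i then ((q - q⁻¹) * sg K a) • f i i else 0 else 0
        else 0) +
      (if y = -i then if b = -a then if a < i then ((q - q⁻¹) * sg K a) • f i (-i) else 0 else 0
        else 0)) := by
    intro i y
    have hc := i.ne_neg
    rw [theta, add_smul]
    congr 1
    · by_cases h1 : y = b <;> by_cases h2 : i = a
      · simp [h1, h2]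
      · simp [h2, Ne.symm h2]
      · simp [h1]
      · simp [h1]
    · by_cases h1 : y = i
      · subst h1
        by_cases h3 : a < y
        · rcases eq_or_ne a b with rfl | h2
          · simp [h3, hc, sg_eq, mul_comm]
          · simp [h2, h2.symm, hc]
        · simp [h3, hc]
      · by_cases h1' : y = -i
        · subst h1'
          by_cases h2 : b = -a <;> by_cases h3 : a < i <;>
            simp [h2, h3, hc.symm, sg_eq, mul_comm]
        · simp [h1, h1']
  simp only [h, Finset.sum_add_distrib, Finset.sum_ite_irrel, Finset.sum_const_zero,
    Finset.sum_ite_eq', Finset.mem_univ, if_true]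

variable (q n) in
/-- The positive left crossing `V* ⊗ V → V ⊗ V*`: the mate of the braiding. -/
def posLeftMap : Module.Dual K (VSp K n) ⊗[K] VSp K n →ₗ[K] VSp K n ⊗[K] Module.Dual K (VSp K n) :=
  mate (braidMap (vecTm q n))

theorem posLeftMap_vec (a b : Idx n) : posLeftMap q n (dvec K a ⊗ₜ vec K b) =
    (eps K a b * q ^ phi b a) • vec K b ⊗ₜ dvec K a +
      ((if a = b then ∑ i, if a < i then (q - q⁻¹) • vec K i ⊗ₜ[K] dvec K i else 0 else 0) +
        if b = -a then ∑ i, if a < i then ((q - q⁻¹) * sg K i) • vec K (-i) ⊗ₜ[K] dvec K i else 0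
          else 0) := by
  have h : posLeftMap q n (dvec K a ⊗ₜ vec K b) = ∑ i, ∑ y, theta q y b a i •
      ((ksgn K (par b) (par a + par i) * ksgn K (par a) (par y)) • vec K y ⊗ₜ[K] dvec K i) := by
    rw [posLeftMap, mate_vec]
    refine Finset.sum_congr rfl fun i _ => Finset.sum_congr rfl fun y _ => ?_
    rw [tcoef, smul_smul]
  refine (h.trans (theta_sum_right (fun i y => (ksgn K (par b) (par a + par i) *
    ksgn K (par a) (par y)) • vec K y ⊗ₜ[K] dvec K i) a b)).trans ?_
  have hs : ∀ i : Idx n, eps K a i * eps K a i = 1 := fun i => eps_mul_self a i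
  have e1 : ∀ i : Idx n, sg K a * (ksgn K (par a) (par a + par i) * ksgn K (par a) (par i)) = 1 :=
    fun i => by
      rw [ksgn_add_right, mul_assoc, ksgn_mul_self, mul_one]
      change sg K a * eps K a a = 1
      rw [eps_self, sg_mul_self]
  have e2 : ∀ i : Idx n, sg K a * (ksgn K (par (-a)) (par a + par i) *
      ksgn K (par a) (par (-i))) = sg K i := fun i => by
    rw [ksgn_add_right]
    change sg K a * (eps K (-a) a * eps K (-a) i * eps K a (-i)) = _
    rw [eps_neg_left, eps_neg_left, eps_neg_right, eps_self]
    linear_combination (sg K a * sg K a * sg K a * sg K a * sg K i) * hs i +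
      (sg K i * (sg K a * sg K a + 1)) * sg_mul_self (K := K) a
  congr 1
  · rw [smul_smul]
    congr 1
    rw [ksgn_add_right, mul_comm]
    change eps K b a * eps K b a * eps K a b * _ = _
    rw [eps_mul_self, one_mul]
  congr 1
  · split_ifs with hab
    · subst hab
      refine Finset.sum_congr rfl fun i _ => ?_
      rw [smul_smul, mul_assoc, e1, mul_one]
    · rfl
  · split_ifs with hab
    · subst hab
      refine Finset.sum_congr rfl fun i _ => ?_
      rw [smul_smul, mul_assoc, e2]
    · rfl

variable (q n) in
/-- The negative right crossing `V ⊗ V* → V* ⊗ V`, with values `negRightVec` on the basis. -/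
def negRightMap : VSp K n ⊗[K] Module.Dual K (VSp K n) →ₗ[K] Module.Dual K (VSp K n) ⊗[K] VSp K n :=
  ∑ i, ∑ j, (LinearMap.mul' K K ∘ₗ TensorProduct.map (dvec K i)
    (Module.Dual.eval K (VSp K n) (vec K j))).smulRight (negRightVec q i j)

theorem negRightMap_vec (i j : Idx n) :
    negRightMap q n (vec K i ⊗ₜ dvec K j) = negRightVec q i j := by
  simp [negRightMap, LinearMap.sum_apply, dvec_vec]

/-- The crossings `λ_+` and `ρ_-` are triangular on the spans of the `v_{±i} ⊗ v_i*`; the two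
triangular matrices are inverse to each other. -/
theorem triangular_inverse (hq : q ≠ 0) {N : Type*} [AddCommGroup N] [Module K N] (E : Idx n → N)
    (i : Idx n) :
    (sg K i * q ^ (-Int.sign (i : ℤ))) • ((sg K i * q ^ Int.sign (i : ℤ)) • E i +
      ∑ l, if i < l then (q - q⁻¹) • E l else 0) -
    ∑ k, (if i < k then ((q - q⁻¹) * (sg K i * sg K k) *
      q ^ (2 * (i : ℤ).natAbs - 2 * (k : ℤ).natAbs : ℤ)) •
        ((sg K k * q ^ Int.sign (k : ℤ)) • E k + ∑ l, if k < l then (q - q⁻¹) • E l else 0)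
      else 0) = E i := by
  -- The coefficient of `E l` for `i < l`: the terms with an index strictly between telescope.
  have h1 : ∀ l : Idx n, i < l → sg K i * q ^ (-Int.sign (i : ℤ)) * (q - q⁻¹) -
      (q - q⁻¹) * (sg K i * sg K l) * q ^ (2 * (i : ℤ).natAbs - 2 * (l : ℤ).natAbs : ℤ) *
        (sg K l * q ^ Int.sign (l : ℤ)) - ∑ k : Idx n, (if i < k ∧ k < l then
      (q - q⁻¹) * (sg K i * sg K k) *
      q ^ (2 * (i : ℤ).natAbs - 2 * (k : ℤ).natAbs : ℤ) * (q - q⁻¹) else 0) = 0 := fun l hl => by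
    have hl2 := l.2
    simp only [Finset.mem_erase, Finset.mem_Icc] at hl2
    have h := sum_sg_zpow hq i l hl (by omega)
    have e : |2 * (l : ℤ) - 1| = 2 * |(l : ℤ)| - Int.sign l := by
      rcases lt_or_gt_of_ne l.ne_zero with h | h
      · rw [Int.sign_eq_neg_one_of_neg h, abs_of_neg h, abs_of_neg (by omega)]; ring
      · rw [Int.sign_eq_one_of_pos h, abs_of_pos h, abs_of_pos (by omega)]
    have e2 : ∑ k : Idx n, (if i < k ∧ k < l then (q - q⁻¹) * (sg K i * sg K k) *
        q ^ (2 * (i : ℤ).natAbs - 2 * (k : ℤ).natAbs : ℤ) * (q - q⁻¹) else 0) =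
        (q - q⁻¹) * sg K i * q ^ (2 * |(i : ℤ)|) * ∑ k : Idx n, (if i < k ∧ (k : ℤ) < l then
      (q - q⁻¹) * sg K k * q ^ (-(2 * |(k : ℤ)|)) else 0) := by
      rw [Finset.mul_sum]
      refine Finset.sum_congr rfl fun k _ => ?_
      simp only [Subtype.coe_lt_coe, Int.natCast_natAbs, zpow_sub₀ hq, zpow_neg, mul_ite, mul_zero]
      split_ifs
      · field_simp
      · rfl
    rw [e2, h, e]
    simp only [Int.natCast_natAbs, neg_sub, zpow_sub₀ hq, zpow_neg]
    have := sg_mul_self (K := K) l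
    field_simp
    linear_combination (sg K i * q ^ Int.sign (i : ℤ) * q ^ (2 * |(i : ℤ)|) *
      q ^ Int.sign (l : ℤ) * (1 - q ^ 2)) * this
  have h2 : ∑ k, (if i < k then ((q - q⁻¹) * (sg K i * sg K k) *
      q ^ (2 * (i : ℤ).natAbs - 2 * (k : ℤ).natAbs : ℤ)) •
        ((sg K k * q ^ Int.sign (k : ℤ)) • E k + ∑ l, if k < l then (q - q⁻¹) • E l else 0)
      else 0) = ∑ l, ((if i < l then (q - q⁻¹) * (sg K i * sg K l) *
        q ^ (2 * (i : ℤ).natAbs - 2 * (l : ℤ).natAbs : ℤ) *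
          (sg K l * q ^ Int.sign (l : ℤ)) else 0) +
        ∑ k : Idx n, (if i < k ∧ k < l then (q - q⁻¹) * (sg K i * sg K k) *
      q ^ (2 * (i : ℤ).natAbs - 2 * (k : ℤ).natAbs : ℤ) * (q - q⁻¹) else 0)) • E l := by
    simp only [add_smul, Finset.sum_add_distrib, Finset.sum_smul]
    rw [Finset.sum_comm (f := fun l k => (if i < k ∧ k < l then (q - q⁻¹) * (sg K i * sg K k) *
      q ^ (2 * (i : ℤ).natAbs - 2 * (k : ℤ).natAbs : ℤ) * (q - q⁻¹) else 0) • E l),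
      ← Finset.sum_add_distrib]
    refine Finset.sum_congr rfl fun k _ => ?_
    by_cases hk : i < k
    · simp only [hk, if_true, true_and, smul_add, smul_smul, Finset.smul_sum, smul_ite, smul_zero,
        ite_smul, zero_smul]
    · simp [hk]
  have h3 : ∀ l, ((if i < l then (q - q⁻¹) * (sg K i * sg K l) *
        q ^ (2 * (i : ℤ).natAbs - 2 * (l : ℤ).natAbs : ℤ) *
          (sg K l * q ^ Int.sign (l : ℤ)) else 0) +
        ∑ k : Idx n, (if i < k ∧ k < l then (q - q⁻¹) * (sg K i * sg K k) *
      q ^ (2 * (i : ℤ).natAbs - 2 * (k : ℤ).natAbs : ℤ) * (q - q⁻¹) else 0)) =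
      if i < l then sg K i * q ^ (-Int.sign (i : ℤ)) * (q - q⁻¹) else 0 := fun l => by
    by_cases hl : i < l
    · have := h1 l hl
      simp only [hl, if_true]
      linear_combination -this
    · have : ∀ k : Idx n, ¬ (i < k ∧ k < l) := fun k hk => hl (hk.1.trans hk.2)
      simp [hl, this]
  have h4 : sg K i * q ^ (-Int.sign (i : ℤ)) * (sg K i * q ^ Int.sign (i : ℤ)) = 1 := by
    rw [zpow_neg]
    have := sg_mul_self (K := K) i
    field_simp
    linear_combination this
  rw [h2, smul_add, smul_smul, h4, one_smul, Finset.smul_sum]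
  simp only [h3, smul_ite, smul_zero, ite_smul, zero_smul, smul_smul, add_sub_cancel_right]

/-! ### The crossings of `V` and `V*` are inverse to each other -/

theorem phi_self (i : Idx n) : phi i i = Int.sign i := by simp [phi]

theorem negRightMap_self (i : Idx n) : negRightMap q n (vec K i ⊗ₜ dvec K i) =
    (sg K i * q ^ (-Int.sign (i : ℤ))) • (dvec K i ⊗ₜ vec K i) -
      ∑ k, (if i < k then ((q - q⁻¹) * (sg K i * sg K k) *
        q ^ (2 * (i : ℤ).natAbs - 2 * (k : ℤ).natAbs : ℤ)) • (dvec K k ⊗ₜ vec K k) else 0) := by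
  rw [negRightMap_vec, negRightVec, if_pos rfl, if_neg i.ne_neg]
  refine (sub_zero (G := Module.Dual K (VSp K n) ⊗[K] VSp K n) _).trans ?_
  rw [phi_self, show ksgn K (par i) (par i) = sg K i from eps_self i]
  simp only [ksgn_add_left, sg_eq]

theorem negRightMap_neg (j : Idx n) : negRightMap q n (sg K j • vec K (-j) ⊗ₜ dvec K j) =
    (sg K j * q ^ (-Int.sign (j : ℤ))) • (dvec K j ⊗ₜ vec K (-j)) -
      ∑ k, (if j < k then ((q - q⁻¹) * (sg K j * sg K k) *
        q ^ (2 * (j : ℤ).natAbs - 2 * (k : ℤ).natAbs : ℤ)) • (dvec K k ⊗ₜ vec K (-k)) else 0) := by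
  have e : ksgn K (par (-j)) (par j) = 1 := by
    change eps K (-j) j = 1
    rw [eps_neg_left, eps_self, sg_mul_self]
  rw [map_smul, negRightMap_vec, negRightVec, if_neg j.ne_neg.symm, if_pos rfl]
  refine (congrArg (fun x : Module.Dual K (VSp K n) ⊗[K] VSp K n => sg K j • (x - _))
    (sub_zero _)).trans ((smul_sub (A := Module.Dual K (VSp K n) ⊗[K] VSp K n) _ _ _).trans ?_)
  rw [phi_neg_left, phi_self, e, one_mul, smul_smul, Finset.smul_sum]
  congr 1
  refine Finset.sum_congr rfl fun k _ => ?_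
  rw [smul_ite, smul_smul, smul_zero, sg_eq, Idx.coe_neg, Int.natAbs_neg]
  congr 2
  ring

theorem posLeftMap_self (k : Idx n) : posLeftMap q n (dvec K k ⊗ₜ vec K k) =
    (sg K k * q ^ Int.sign (k : ℤ)) • (vec K k ⊗ₜ dvec K k) +
      ∑ l, if k < l then (q - q⁻¹) • (vec K l ⊗ₜ dvec K l) else 0 := by
  rw [posLeftMap_vec, if_pos rfl, if_neg k.ne_neg, add_zero, phi_self, eps_self]

theorem posLeftMap_neg (k : Idx n) : posLeftMap q n (dvec K k ⊗ₜ vec K (-k)) =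
    (sg K k * q ^ Int.sign (k : ℤ)) • (sg K k • vec K (-k) ⊗ₜ dvec K k) +
      ∑ l, if k < l then (q - q⁻¹) • (sg K l • vec K (-l) ⊗ₜ dvec K l) else 0 := by
  rw [posLeftMap_vec, if_neg k.ne_neg, if_pos rfl, zero_add, phi_neg_left, phi_self, smul_smul,
    eps_neg_right, eps_self, mul_right_comm (sg K k)]
  simp only [smul_smul]

/-- The crossings `λ_+` and `ρ_-` are inverse to each other. -/
theorem posLeftMap_negRightMap (hq : q ≠ 0) (x : VSp K n ⊗[K] Module.Dual K (VSp K n)) :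
    posLeftMap q n (negRightMap q n x) = x := by
  have h1 : ∀ i j : Idx n, posLeftMap q n (negRightMap q n (vec K i ⊗ₜ dvec K j)) =
      vec K i ⊗ₜ dvec K j := fun i j => by
    by_cases hij : i = j
    · subst hij
      rw [negRightMap_self]
      simp only [map_sub, map_smul, map_sum, apply_ite (posLeftMap q n), map_zero, posLeftMap_self]
      exact triangular_inverse hq (fun l => vec K l ⊗ₜ[K] dvec K l) i
    by_cases hij' : i = -j
    · subst hij'
      have h : posLeftMap q n (negRightMap q n (sg K j • vec K (-j) ⊗ₜ dvec K j)) =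
          sg K j • vec K (-j) ⊗ₜ dvec K j := by
        rw [negRightMap_neg]
        simp only [map_sub, map_smul, map_sum, apply_ite (posLeftMap q n), map_zero, posLeftMap_neg]
        exact triangular_inverse hq (fun l => sg K l • vec K (-l) ⊗ₜ[K] dvec K l) j
      have h' := congrArg (sg K j • ·) h
      simpa only [map_smul, smul_smul, sg_mul_self, one_smul] using h'
    · have hphi : phi i j = 0 := by
        rw [phi, if_neg]
        intro h
        rcases Int.natAbs_eq_natAbs_iff.mp h with h | h
        · exact hij (Subtype.ext h)
        · exact hij' (Subtype.ext h)
      rw [negRightMap_vec, negRightVec, if_neg hij, if_neg hij']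
      refine (congrArg (posLeftMap q n) ((sub_zero
        (G := Module.Dual K (VSp K n) ⊗[K] VSp K n) _).trans (sub_zero _))).trans ?_
      rw [map_smul, posLeftMap_vec, if_neg (Ne.symm hij), if_neg hij', add_zero, add_zero,
        smul_smul, hphi, neg_zero, zpow_zero, mul_one, mul_one]
      change (eps K i j * eps K j i) • _ = _
      rw [eps_comm j i, eps_mul_self, one_smul]
  have h2 : posLeftMap q n ∘ₗ negRightMap q n = LinearMap.id :=
    TensorProduct.ext (vec_ext fun i => dual_ext fun j => h1 i j)
  exact LinearMap.congr_fun h2 x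

theorem negRightMap_posLeftMap (hq : q ≠ 0) (x : Module.Dual K (VSp K n) ⊗[K] VSp K n) :
    negRightMap q n (posLeftMap q n x) = x := by
  have hs : Function.Surjective (posLeftMap q n) := fun y => ⟨_, posLeftMap_negRightMap hq y⟩
  have hf : Module.finrank K (Module.Dual K (VSp K n) ⊗[K] VSp K n) =
      Module.finrank K (VSp K n ⊗[K] Module.Dual K (VSp K n)) :=
    (TensorProduct.comm K (Module.Dual K (VSp K n)) (VSp K n)).finrank_eq
  exact (LinearMap.injective_iff_surjective_of_finrank_eq_finrank hf).mpr hs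
    (posLeftMap_negRightMap hq _)

/-! ### Bubbles -/

/-- The coefficients of the image `∑_k γ_k v_k* ⊗ v_k` of `∑_i v_i ⊗ v_i*` under the negative right
crossing. -/
def bubbleCoef (q : K) (k : Idx n) : K := sg K k * q ^ (-Int.sign (k : ℤ)) -
  ∑ i : Idx n, if i < k then (q - q⁻¹) * (sg K i * sg K k) *
    q ^ (2 * (i : ℤ).natAbs - 2 * (k : ℤ).natAbs : ℤ) else 0

theorem negRightMap_coev : negRightMap q n (coev K n) =
    ∑ k, bubbleCoef q k • (dvec K k ⊗ₜ vec K k) := by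
  have h : ∀ k : Idx n, bubbleCoef q k • (dvec K k ⊗ₜ[K] vec K k) =
      (sg K k * q ^ (-Int.sign (k : ℤ))) • (dvec K k ⊗ₜ[K] vec K k) -
      ∑ i, (if i < k then ((q - q⁻¹) * (sg K i * sg K k) *
        q ^ (2 * (i : ℤ).natAbs - 2 * (k : ℤ).natAbs : ℤ)) • (dvec K k ⊗ₜ[K] vec K k) else 0) :=
    fun k => by
      refine (sub_smul (M := Module.Dual K (VSp K n) ⊗[K] VSp K n) _ _ _).trans ?_
      simp only [Finset.sum_smul, ite_smul, zero_smul]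
  rw [coev, map_sum]
  refine (Finset.sum_congr rfl fun i _ => negRightMap_self i).trans
    (Eq.trans ?_ (Finset.sum_congr rfl fun k _ => (h k).symm))
  refine (Finset.sum_sub_distrib (G := Module.Dual K (VSp K n) ⊗[K] VSp K n) _ _).trans
    (Eq.trans ?_
      (Finset.sum_sub_distrib (G := Module.Dual K (VSp K n) ⊗[K] VSp K n) _ _).symm)
  rw [Finset.sum_comm]

/-- The closed bubble vanishes: the sum of the `γ_k` telescopes to the sum over `i` of a function
that is odd under `i ↦ -i`. -/
theorem sum_bubbleCoef (hq : q ≠ 0) : ∑ k : Idx n, bubbleCoef q k = 0 := by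
  have h1 : ∑ k : Idx n, bubbleCoef q k =
      ∑ i : Idx n, sg K i * q ^ (2 * |(i : ℤ)| - (2 * n + 1)) := by
    simp only [bubbleCoef, Finset.sum_sub_distrib]
    rw [Finset.sum_comm, ← Finset.sum_sub_distrib]
    refine Finset.sum_congr rfl fun i _ => ?_
    have hi2 := i.2
    simp only [Finset.mem_erase, Finset.mem_Icc] at hi2
    have h := sum_sg_zpow hq i (n + 1) (by omega) le_rfl
    have e2 : ∑ k : Idx n, (if i < k then (q - q⁻¹) * (sg K i * sg K k) *
        q ^ (2 * (i : ℤ).natAbs - 2 * (k : ℤ).natAbs : ℤ) else 0) =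
        sg K i * q ^ (2 * |(i : ℤ)|) * ∑ k : Idx n, (if i < k ∧ (k : ℤ) < n + 1 then
      (q - q⁻¹) * sg K k * q ^ (-(2 * |(k : ℤ)|)) else 0) := by
      rw [Finset.mul_sum]
      refine Finset.sum_congr rfl fun k _ => ?_
      have hk2 := k.2
      simp only [Finset.mem_erase, Finset.mem_Icc] at hk2
      have : (k : ℤ) < n + 1 := by omega
      simp only [this, and_true, Int.natCast_natAbs, zpow_sub₀ hq, zpow_neg, mul_ite, mul_zero]
      split_ifs
      · field_simp
      · rfl
    rw [e2, h, abs_of_pos (by omega : (0 : ℤ) < 2 * (n + 1) - 1),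
      show -(2 * ((n : ℤ) + 1) - 1) = -(2 * n + 1) by ring]
    simp only [zpow_sub₀ hq, zpow_neg]
    field_simp
    ring
  have h2 : ∑ i : Idx n, sg K i * q ^ (2 * |(i : ℤ)| - (2 * n + 1)) =
      -∑ i : Idx n, sg K i * q ^ (2 * |(i : ℤ)| - (2 * n + 1)) := by
    rw [← Finset.sum_neg_distrib]
    refine (Equiv.sum_comp (Equiv.neg (Idx n)) _).symm.trans (Finset.sum_congr rfl fun i _ => ?_)
    rw [Equiv.neg_apply, sg_neg, Idx.coe_neg, abs_neg, neg_mul]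
  have h3 : (2 : K) * ∑ i : Idx n, sg K i * q ^ (2 * |(i : ℤ)| - (2 * n + 1)) = 0 := by
    rw [two_mul]; nth_rw 1 [h2]; exact neg_add_cancel _
  rw [h1]
  exact (mul_eq_zero.mp h3).resolve_left (NeZero.ne 2)

theorem contractLeft_negRightMap_coev (hq : q ≠ 0) :
    contractLeft K (VSp K n) (negRightMap q n (coev K n)) = 0 := by
  simp only [negRightMap_coev, map_sum, map_smul, contractLeft_apply, dvec_vec, if_true,
    smul_eq_mul, mul_one, sum_bubbleCoef hq]

/-- The bubble with a closed Clifford token vanishes: `ρ_-` maps the vectors `v_{-i} ⊗ v_i*`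
into the span of the `v_k* ⊗ v_{-k}`, on which the evaluation is zero. -/
theorem contractLeft_negRightMap_token :
    contractLeft K (VSp K n) (negRightMap q n (TensorProduct.map (jMap K n) LinearMap.id
      (coev K n))) = 0 := by
  have h : TensorProduct.map (jMap K n) LinearMap.id (coev K n) =
      ∑ i, sg K i • vec K (-i) ⊗ₜ[K] dvec K i := by
    simp [coev, jMap_vec, TensorProduct.smul_tmul']
  have h0 : ∀ i : Idx n, dvec K i (vec K (-i)) = 0 := fun i => by
    rw [dvec_vec, if_neg i.ne_neg]
  rw [h, map_sum, map_sum]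
  refine Finset.sum_eq_zero fun i _ => ?_
  rw [negRightMap_neg]
  simp [contractLeft_apply, h0, apply_ite (contractLeft K (VSp K n))]

section Skein

/-- The braidings of `V*` with `V`, positive and negative, differ by a cap followed by a cup. -/
theorem braidMap_dualTm (hq : q ≠ 0) (x : Module.Dual K (VSp K n) ⊗[K] VSp K n) :
    braidMap (dualTm q n) x =
      posLeftMap q n x - ((q - q⁻¹) * contractLeft K (VSp K n) x) • coev K n := by
  induction x using TensorProduct.induction_on with
  | zero => simp
  | add x y hx hy => rw [map_add, map_add, map_add, hx, hy]; module
  | tmul f v =>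
    rw [← mate_braidInv, posLeftMap, mate_tmul, mate_tmul, contractLeft_apply]
    have h : ∀ i, braidInv (vecSm q n) (v ⊗ₜ vec K i) =
        braidMap (vecTm q n) (v ⊗ₜ vec K i) - (q - q⁻¹) • (v ⊗ₜ vec K i) := fun i => by
      rw [braidMap_vecTm_skein hq, add_sub_cancel_right]
    simp only [h, TensorProduct.tmul_sub, map_sub, map_smul, capMap_tmul,
      TensorProduct.sub_tmul, Finset.sum_sub_distrib, coev, Finset.smul_sum,
      TensorProduct.smul_tmul', smul_eq_mul]

theorem braidMap_dualTm_negRightMap_coev (hq : q ≠ 0) :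
    braidMap (dualTm q n) (negRightMap q n (coev K n)) = coev K n := by
  rw [braidMap_dualTm hq, posLeftMap_negRightMap hq, contractLeft_negRightMap_coev hq, mul_zero,
    zero_smul, sub_zero]

/-- The right cap absorbs the braiding of `V*` with `V`. -/
theorem contractLeft_negRightMap_braidMap (hq : q ≠ 0) (x : Module.Dual K (VSp K n) ⊗[K] VSp K n) :
    contractLeft K (VSp K n) (negRightMap q n (braidMap (dualTm q n) x)) =
      contractLeft K (VSp K n) x := by
  rw [braidMap_dualTm hq, map_sub, negRightMap_posLeftMap hq, map_sub, map_smul, map_smul,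
    contractLeft_negRightMap_coev hq, smul_zero, sub_zero]

/-- The identity `∑_a γ_a T_VV^{(a,i)}_{(a,y)} = δ_iy` for the matrix coefficients of the
braiding. -/
theorem sum_bubbleCoef_tcoef (hq : q ≠ 0) (i y : Idx n) :
    ∑ a, bubbleCoef q a * tcoef q a i a y = if i = y then 1 else 0 := by
  have h := posLeftMap_negRightMap hq (coev K n)
  rw [negRightMap_coev, map_sum] at h
  simp only [map_smul, posLeftMap, mate_vec, coev] at h
  have h2 := congrArg (LinearMap.mul' K K ∘ₗ TensorProduct.map (dvec K y)
    (Module.Dual.eval K (VSp K n) (vec K i))) h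
  simpa [dvec_vec, eq_comm] using h2

end Skein

/-! ### The crossings are homomorphisms -/

section Homs

theorem Intertwines.add {M N : Type*} [AddCommGroup M] [Module K M] [Superspace K M]
    [AddCommGroup N] [Module K N] [Superspace K N] {T : OpMat K n M} {T' : OpMat K n N}
    {r : ZMod 2} {f g : M →ₗ[K] N} (hf : Intertwines T T' r f) (hg : Intertwines T T' r g) :
    Intertwines T T' r (f + g) where
  inv m := by simp only [LinearMap.add_apply, hf.inv, hg.inv, map_add, smul_add]
  comm i j m := by simp only [LinearMap.add_apply, hf.comm, hg.comm, map_add, smul_add]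

theorem Intertwines.smul {M N : Type*} [AddCommGroup M] [Module K M] [Superspace K M]
    [AddCommGroup N] [Module K N] [Superspace K N] {T : OpMat K n M} {T' : OpMat K n N}
    {r : ZMod 2} {f : M →ₗ[K] N} (hf : Intertwines T T' r f) (a : K) :
    Intertwines T T' r (a • f) where
  inv m := by simp only [LinearMap.smul_apply, hf.inv, map_smul, smul_comm a]
  comm i j m := by simp only [LinearMap.smul_apply, hf.comm, map_smul, smul_comm a]

theorem Intertwines.onLeft {A B C D M : Type*} [AddCommGroup A] [Module K A] [Superspace K A]
    [AddCommGroup B] [Module K B] [Superspace K B] [AddCommGroup C] [Module K C] [Superspace K C]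
    [AddCommGroup D] [Module K D] [Superspace K D] [AddCommGroup M] [Module K M] [Superspace K M]
    {X : OpMat K n A} {Y : OpMat K n B} {Z : OpMat K n C} {W : OpMat K n D}
    {f : A ⊗[K] B →ₗ[K] C ⊗[K] D} (hf : Intertwines (tensorMat X Y) (tensorMat Z W) 0 f)
    (T : OpMat K n M) : Intertwines (tensorMat X (tensorMat Y T)) (tensorMat Z (tensorMat W T)) 0
      (QIso.onLeft f M) := by
  have h1 := (intertwines_assoc X Y T).of_inverse
    (g := (TensorProduct.assoc K A B M).symm.toLinearMap)
    (fun m => (TensorProduct.assoc K A B M).symm_apply_apply m)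
    (fun m => (TensorProduct.assoc K A B M).apply_symm_apply m)
  have := (h1.comp (hf.map_id T)).comp (intertwines_assoc Z W T)
  rwa [add_zero, add_zero] at this

theorem braidMap_vecTm_intertwines (hq : q ≠ 0) : Intertwines (tensorMat (vecTm q n) (vecTm q n))
    (tensorMat (vecTm q n) (vecTm q n)) 0 (braidMap (vecTm q n)) := by
  have h := SMod.braidMap_intertwines (SMod.vector q n hq)
  rw [tm_vector] at h
  exact h

theorem braidMap_dualTm_intertwines (hq : q ≠ 0) :
    Intertwines (tensorMat (dualTm q n) (vecTm q n)) (tensorMat (vecTm q n) (dualTm q n)) 0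
      (braidMap (dualTm q n)) := by
  have h := SMod.braidMap_intertwines (SMod.vector q n hq).dual
  rw [tm_dual_vector] at h
  exact h

variable {M : Type*} [AddCommGroup M] [Module K M]

theorem onLeft_posLeftMap (hq : q ≠ 0) (x : Module.Dual K (VSp K n) ⊗[K] (VSp K n ⊗[K] M)) :
    onLeft (posLeftMap q n) M x = onLeft (braidMap (dualTm q n)) M x +
      (q - q⁻¹) • cupMap K n M (capMap K n M x) := by
  induction x using TensorProduct.induction_on with
  | zero => simp
  | add x y hx hy => simp only [map_add, hx, hy]; module
  | tmul f x =>
    induction x using TensorProduct.induction_on with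
    | zero => simp
    | add x y hx hy => simp only [TensorProduct.tmul_add, map_add, hx, hy]; module
    | tmul v m =>
      have h : posLeftMap q n (f ⊗ₜ v) = braidMap (dualTm q n) (f ⊗ₜ v) +
          ((q - q⁻¹) * f v) • coev K n := by
        rw [braidMap_dualTm hq, contractLeft_apply, sub_add_cancel]
      rw [onLeft_tmul, onLeft_tmul, h, TensorProduct.add_tmul, map_add, capMap_tmul,
        cupMap_eq_assoc, TensorProduct.tmul_smul, map_smul, smul_smul, ← TensorProduct.smul_tmul',
        map_smul]

variable [Superspace K M]

theorem onLeft_posLeftMap_intertwines (hq : q ≠ 0) (T : OpMat K n M) :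
    Intertwines (tensorMat (dualTm q n) (tensorMat (vecTm q n) T))
      (tensorMat (vecTm q n) (tensorMat (dualTm q n) T)) 0 (onLeft (posLeftMap q n) M) := by
  have h := (((capMap_intertwines hq T).comp (cupMap_intertwines hq T)).smul (q - q⁻¹))
  rw [add_zero] at h
  have h2 := ((braidMap_dualTm_intertwines hq).onLeft T).add h
  rwa [← show onLeft (posLeftMap q n) M = onLeft (braidMap (dualTm q n)) M + (q - q⁻¹) •
    (cupMap K n M ∘ₗ capMap K n M) from LinearMap.ext (onLeft_posLeftMap hq)] at h2

theorem onLeft_negRightMap_posLeftMap (hq : q ≠ 0)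
    (x : Module.Dual K (VSp K n) ⊗[K] (VSp K n ⊗[K] M)) :
    onLeft (negRightMap q n) M (onLeft (posLeftMap q n) M x) = x := by
  have h := LinearMap.congr_fun (onLeft_comp (M := M) (posLeftMap q n) (negRightMap q n)) x
  rw [show negRightMap q n ∘ₗ posLeftMap q n = LinearMap.id from
    LinearMap.ext (negRightMap_posLeftMap hq), onLeft_id] at h
  exact h

theorem onLeft_posLeftMap_negRightMap (hq : q ≠ 0)
    (x : VSp K n ⊗[K] (Module.Dual K (VSp K n) ⊗[K] M)) :
    onLeft (posLeftMap q n) M (onLeft (negRightMap q n) M x) = x := by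
  have h := LinearMap.congr_fun (onLeft_comp (M := M) (negRightMap q n) (posLeftMap q n)) x
  rw [show posLeftMap q n ∘ₗ negRightMap q n = LinearMap.id from
    LinearMap.ext (posLeftMap_negRightMap hq), onLeft_id] at h
  exact h

/-- The negative right crossing is a homomorphism, being the inverse of one. -/
theorem onLeft_negRightMap_intertwines (hq : q ≠ 0) (T : OpMat K n M) :
    Intertwines (tensorMat (vecTm q n) (tensorMat (dualTm q n) T))
      (tensorMat (dualTm q n) (tensorMat (vecTm q n) T)) 0 (onLeft (negRightMap q n) M) :=
  (onLeft_posLeftMap_intertwines hq T).of_inverse (onLeft_negRightMap_posLeftMap hq)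
    (onLeft_posLeftMap_negRightMap hq)

end Homs

/-- The operators `K_M` are odd homomorphisms. -/
theorem SMod.kap_intertwines (M : SMod.{u} q n) :
    Intertwines (tensorMat (vecTm q n) M.tm) (tensorMat (vecTm q n) M.tm) 1 (kap M.tm M.sm) := by
  have h1 : Intertwines (tensorMat (vecTm q n) M.tm) (tensorMat M.tm (vecTm q n)) 0
      (braidInv M.sm) := M.braidMap_intertwines.of_inverse (braidInv_braidMap M.sm_mul_tm)
        (braidMap_braidInv M.tm_mul_sm)
  have h2 : Intertwines (tensorMat M.tm (vecTm q n)) (tensorMat M.tm (vecTm q n)) 1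
      (TensorProduct.map (inv K M) (jMap K n)) := by
    refine intertwines_tensor (fun m v => ?_) fun i j m v => ?_
    · rw [TensorProduct.map_tmul, TensorProduct.map_tmul, inv_tmul, jMap_intertwines (q := q).inv]
      exact TensorProduct.tmul_smul _ _ _
    · rw [TensorProduct.map_tmul, tensorMat_tmul, Finset.smul_sum]
      refine Finset.sum_congr rfl fun k _ => ?_
      have h := LinearMap.congr_fun (M.tm_hasPar i k 1) m
      simp only [invP_one, Module.End.mul_apply, LinearMap.smul_apply] at h
      rw [TensorProduct.map_tmul, jMap_intertwines.comm, h]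
      refine (TensorProduct.smul_tmul_smul _ _ _ _).trans ?_
      rw [ksgn_add_left, ksgn_comm 1 (par k), mul_assoc, ksgn_mul_self, mul_one, ksgn_comm]
  have := (h1.comp h2).comp M.braidMap_intertwines
  rwa [zero_add, add_zero] at this

/-! ### The bubble with an open Clifford token -/

section Bubble

variable {M : Type*} [AddCommGroup M] [Module K M]

theorem capMap_onLeft_negRightMap_cupMap (hq : q ≠ 0) (m : M) :
    capMap K n M (onLeft (negRightMap q n) M (cupMap K n M m)) = 0 := by
  rw [cupMap_eq_assoc]
  simp only [onLeft, LinearMap.comp_apply, LinearEquiv.coe_coe, LinearEquiv.symm_apply_apply,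
    TensorProduct.map_tmul, LinearMap.id_apply]
  rw [capMap_assoc, contractLeft_negRightMap_coev hq, zero_smul]

theorem capMap_onLeft_negRightMap_token (m : M) :
    capMap K n M (onLeft (negRightMap q n) M (TensorProduct.map (jMap K n) LinearMap.id
      (cupMap K n M m))) = 0 := by
  have h : TensorProduct.map (jMap K n) LinearMap.id (cupMap K n M m) =
      TensorProduct.assoc K _ _ M (TensorProduct.map (jMap K n) LinearMap.id (coev K n) ⊗ₜ m) := by
    simp [coev, cupMap_apply, TensorProduct.sum_tmul]
  rw [h]
  simp only [onLeft, LinearMap.comp_apply, LinearEquiv.coe_coe, LinearEquiv.symm_apply_apply,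
    TensorProduct.map_tmul, LinearMap.id_apply]
  rw [capMap_assoc, contractLeft_negRightMap_token, zero_smul]

theorem capMap_onLeft_negRightMap_braidMap (hq : q ≠ 0)
    (x : Module.Dual K (VSp K n) ⊗[K] (VSp K n ⊗[K] M)) :
    capMap K n M (onLeft (negRightMap q n) M (onLeft (braidMap (dualTm q n)) M x)) =
      capMap K n M x := by
  obtain ⟨y, rfl⟩ := (TensorProduct.assoc K (Module.Dual K (VSp K n)) (VSp K n) M).surjective x
  induction y using TensorProduct.induction_on with
  | zero => simp
  | add x y hx hy => simp only [map_add, hx, hy]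
  | tmul y m =>
    simp only [onLeft, LinearMap.comp_apply, LinearEquiv.coe_coe, LinearEquiv.symm_apply_apply,
      TensorProduct.map_tmul, LinearMap.id_apply, capMap_assoc,
      contractLeft_negRightMap_braidMap hq]

end Bubble

namespace SMod

variable (M : SMod.{u} q n)

/-- A contraction of the defining relation of `U_q(𝔮_n)`: multiplied by `γ_a` and `s_ba` and summed
over `a` and `b`, one side collapses to `t_ye` by `sum_bubbleCoef_tcoef`, and the remaining factor
`t_yi` of the other side is cancelled by the inverse matrix. -/
theorem sum_tcoef_bubble (hq : q ≠ 0) (e i : Idx n) (m : M) :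
    ∑ b, ∑ c, tcoef q b e c i • ∑ a, bubbleCoef q a • M.tm a c (M.sm b a m) =
      if i = e then m else 0 := by
  have h1 : ∀ y : Idx n, ∑ i, M.tm y i (∑ b, ∑ c, tcoef q b e c i •
      ∑ a, bubbleCoef q a • M.tm a c (M.sm b a m)) = M.tm y e m := fun y => by
    have h : ∀ a : Idx n, ∑ i, tcoef q a i a y • M.tm i e m =
        ∑ b, ∑ c, ∑ i, tcoef q b e c i • M.tm y i (M.tm a c (M.sm b a m)) := fun a => by
      have h2 : ∀ b, ∑ c, ∑ i, tcoef q c i a y • M.tm i e (M.tm c b (M.sm b a m)) =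
          ∑ c, ∑ i, tcoef q b e c i • M.tm y i (M.tm a c (M.sm b a m)) := fun b => by
        have := LinearMap.congr_fun (M.rtt a b e y) (M.sm b a m)
        simpa only [LinearMap.sum_apply, LinearMap.smul_apply, Module.End.mul_apply] using this
      simp only [← h2]
      rw [Finset.sum_comm]
      refine Eq.symm ?_
      have h3 : ∀ c, ∑ b, ∑ i, tcoef q c i a y • M.tm i e (M.tm c b (M.sm b a m)) =
          ∑ i, tcoef q c i a y • M.tm i e (if c = a then m else 0) := fun c => by
        rw [Finset.sum_comm]
        refine Finset.sum_congr rfl fun i _ => ?_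
        rw [← Finset.smul_sum, ← map_sum, sum_mul_apply M.tm_mul_sm]
      simp only [h3]
      rw [Finset.sum_eq_single a]
      · simp
      · intro c _ hc; simp [hc]
      · simp
    have h4 := Finset.sum_congr (s₁ := Finset.univ) rfl fun a (_ : a ∈ Finset.univ) =>
      congrArg (bubbleCoef q a • ·) (h a)
    simp only [Finset.smul_sum, smul_smul] at h4
    rw [Finset.sum_comm] at h4
    simp only [← Finset.sum_smul, sum_bubbleCoef_tcoef hq, ite_smul, one_smul, zero_smul,
      Finset.sum_ite_eq', Finset.mem_univ, if_true] at h4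
    rw [h4]
    simp only [map_sum, map_smul, Finset.smul_sum, smul_smul]
    rw [Finset.sum_comm]
    rw [Finset.sum_comm (f := fun a b => ∑ c, ∑ i, (bubbleCoef q a * tcoef q b e c i) •
      M.tm y i (M.tm a c (M.sm b a m)))]
    refine Finset.sum_congr rfl fun b _ => ?_
    rw [Finset.sum_comm]
    rw [Finset.sum_comm (f := fun a c => ∑ i, (bubbleCoef q a * tcoef q b e c i) •
      M.tm y i (M.tm a c (M.sm b a m)))]
    refine Finset.sum_congr rfl fun c _ => ?_
    rw [Finset.sum_comm]
    refine Finset.sum_congr rfl fun a _ => Finset.sum_congr rfl fun i _ => ?_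
    rw [mul_comm]
  have h2 := Finset.sum_congr (s₁ := Finset.univ) rfl fun y (_ : y ∈ Finset.univ) =>
    congrArg (M.sm i y) (h1 y)
  have h3 : ∀ X : Idx n → M, ∑ y, M.sm i y (∑ k, M.tm y k (X k)) = X i := fun X => by
    simp only [map_sum]
    rw [Finset.sum_comm]
    simp only [sum_mul_apply M.sm_mul_tm, Finset.sum_ite_eq, Finset.mem_univ, if_true]
  exact (h3 _).symm.trans (h2.trans (sum_mul_apply M.sm_mul_tm i e m))

/-- If the operators `Q_bc` satisfy the contracted relation of `sum_tcoef_bubble`, then `λ_+` maps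
`∑ v_c* ⊗ v_b ⊗ Q_bc` to the cup. -/
theorem onLeft_posLeftMap_sum {M : Type*} [AddCommGroup M] [Module K M] {Q : Idx n → Idx n → M}
    {m : M} (hQ : ∀ e i, ∑ b, ∑ c, tcoef q b e c i • Q b c = if i = e then m else 0) :
    onLeft (posLeftMap q n) M (∑ c, ∑ b, dvec K c ⊗ₜ (vec K b ⊗ₜ Q b c)) = cupMap K n M m := by
  rw [cupMap_apply]
  have h : ∀ c b (x : M), onLeft (posLeftMap q n) M (dvec K c ⊗ₜ (vec K b ⊗ₜ x)) =
      ∑ i, ∑ y, vec K y ⊗ₜ (dvec K i ⊗ₜ (tcoef q b i c y • x)) := fun c b x => by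
    rw [onLeft_tmul, posLeftMap, mate_vec]
    simp only [TensorProduct.sum_tmul, map_sum, TensorProduct.assoc_tmul,
      ← TensorProduct.smul_tmul', map_smul, TensorProduct.tmul_smul]
  have h' : ∀ i : Idx n, vec K i ⊗ₜ[K] (dvec K i ⊗ₜ[K] m) =
      ∑ y, vec K y ⊗ₜ[K] (dvec K i ⊗ₜ[K] (if y = i then m else 0)) := fun i => by
    rw [Finset.sum_eq_single i]
    · rw [if_pos rfl]
    · intro y _ hy; rw [if_neg hy, TensorProduct.tmul_zero, TensorProduct.tmul_zero]
    · simp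
  have sw : ∀ F : Idx n → Idx n → Idx n → Idx n →
      VSp K n ⊗[K] (Module.Dual K (VSp K n) ⊗[K] M),
      ∑ c, ∑ b, ∑ i, ∑ y, F c b i y = ∑ i, ∑ y, ∑ b, ∑ c, F c b i y := fun F => by
    rw [Finset.sum_comm]
    refine Eq.trans ?_ (Eq.symm ((Finset.sum_congr rfl fun i _ => Finset.sum_comm).trans
      Finset.sum_comm))
    refine Finset.sum_congr rfl fun b _ => ?_
    rw [Finset.sum_comm]
    exact Finset.sum_congr rfl fun i _ => Finset.sum_comm
  simp only [map_sum, h, h', ← hQ, TensorProduct.tmul_sum]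
  exact sw _

/-- The quantum trace identity `∑_a γ_a t_ad s_ea = δ_de γ_d`: as `λ_+` is invertible, the operators
`Q_bc` of `onLeft_posLeftMap_sum` are determined, and so are those of `ρ_-` applied to the cup. -/
theorem sum_bubble (hq : q ≠ 0) (d e : Idx n) (m : M) :
    ∑ a, bubbleCoef q a • M.tm a d (M.sm e a m) = if d = e then bubbleCoef q d • m else 0 := by
  have h1 := onLeft_posLeftMap_sum (M.sum_tcoef_bubble hq · · m)
  have h2 := congrArg (onLeft (negRightMap q n) M) h1
  rw [onLeft_negRightMap_posLeftMap hq, cupMap_eq_assoc] at h2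
  -- Read off the coefficient of `v_d* ⊗ v_e`.
  have h3 := congrArg (fun x => capMap K n M (TensorProduct.map LinearMap.id
    (TensorProduct.map (matUnit K d e) LinearMap.id) x)) h2
  have h4 : ∀ (c b : Idx n) (x : M), capMap K n M (TensorProduct.map LinearMap.id
      (TensorProduct.map (matUnit K d e) LinearMap.id) (dvec K c ⊗ₜ[K] (vec K b ⊗ₜ[K] x))) =
        if e = b then (if c = d then x else 0) else 0 := fun c b x => by
    rw [TensorProduct.map_tmul, TensorProduct.map_tmul, capMap_tmul, matUnit_vec]
    rcases eq_or_ne e b with h | h <;> simp [dvec_vec, h]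
  have h5 : onLeft (negRightMap q n) M (TensorProduct.assoc K _ _ M (coev K n ⊗ₜ m)) =
      ∑ k, dvec K k ⊗ₜ[K] (vec K k ⊗ₜ[K] (bubbleCoef q k • m)) := by
    simp only [onLeft, LinearMap.comp_apply, LinearEquiv.coe_coe, LinearEquiv.symm_apply_apply,
      TensorProduct.map_tmul, LinearMap.id_apply, negRightMap_coev, TensorProduct.sum_tmul,
      map_sum, ← TensorProduct.smul_tmul', map_smul, TensorProduct.assoc_tmul,
      TensorProduct.tmul_smul]
  simp only [h5, map_sum, h4, Finset.sum_ite_eq, Finset.sum_ite_eq', Finset.mem_univ, if_true] at h3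
  rw [h3]
  by_cases h : d = e
  · rw [if_pos h, if_pos h.symm, h]
  · rw [if_neg h, if_neg (Ne.symm h)]

/-- A bubble with an open Clifford token vanishes. The cup is the braiding of `V*` with `V` applied
to `∑_k γ_k v_k* ⊗ v_k`; the braiding turns the token on `V* ⊗ M` into one on `M` and is then
absorbed by the right cap, and what remains is off-diagonal in the quantum trace identity. -/
theorem capMap_negRightMap_kap_cupMap (hq : q ≠ 0)
    {S : OpMat K n (Module.Dual K (VSp K n) ⊗[K] M)} (hS : S * tensorMat (dualTm q n) M.tm = 1)
    (m : M) : capMap K n M (onLeft (negRightMap q n) M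
      (kap (tensorMat (dualTm q n) M.tm) S (cupMap K n M m))) = 0 := by
  have h1 : cupMap K n M m = onLeft (braidMap (dualTm q n)) M
      (TensorProduct.assoc K _ _ M (negRightMap q n (coev K n) ⊗ₜ m)) := by
    rw [cupMap_eq_assoc]
    simp only [onLeft, LinearMap.comp_apply, LinearEquiv.coe_coe, LinearEquiv.symm_apply_apply,
      TensorProduct.map_tmul, LinearMap.id_apply, braidMap_dualTm_negRightMap_coev hq]
  rw [h1, kap_tensorMat M.sm_mul_tm M.tm_mul_sm hS, capMap_onLeft_negRightMap_braidMap hq,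
    negRightMap_coev]
  have h2 : ∀ k, capMap K n M (TensorProduct.map (inv K (Module.Dual K (VSp K n))) (kap M.tm M.sm)
      (dvec K k ⊗ₜ (vec K k ⊗ₜ m))) = -∑ e, inv K M (M.tm k (-e) (M.sm e k m)) := fun k => by
    have h := fun e => LinearMap.congr_fun (M.tm_hasPar k (-e) 1) (M.sm e k m)
    simp only [invP_one, Module.End.mul_apply, LinearMap.smul_apply] at h
    rw [TensorProduct.map_tmul, inv_dvec, kap]
    simp only [LinearMap.comp_apply, braidInv_tmul, map_sum, TensorProduct.map_tmul, jMap_vec,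
      TensorProduct.tmul_smul, map_smul, braidMap_tmul, ← TensorProduct.smul_tmul',
      TensorProduct.tmul_sum, capMap_tmul, dvec_vec, ite_smul, one_smul, zero_smul,
      h, Finset.smul_sum, ← Finset.sum_neg_distrib]
    refine Finset.sum_congr rfl fun e _ => ?_
    rw [ksgn_add_left, par_neg, ksgn_add_left, ksgn_one_one, sg_eq, sg_eq]
    simp [smul_smul, mul_comm]
  have h3 : ∀ e : Idx n, ∑ k, bubbleCoef q k • inv K M (M.tm k (-e) (M.sm e k m)) = 0 := fun e => by
    have := congrArg (inv K M) (M.sum_bubble hq (-e) e m)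
    rw [if_neg e.ne_neg.symm, map_zero, map_sum] at this
    simpa only [map_smul] using this
  simp only [TensorProduct.sum_tmul, map_sum, ← TensorProduct.smul_tmul', map_smul,
    TensorProduct.assoc_tmul, h2, smul_neg, Finset.sum_neg_distrib, Finset.smul_sum]
  rw [Finset.sum_comm]
  simp only [h3, Finset.sum_const_zero, neg_zero]

end SMod

/-! ### Naturality of the images of the generators -/

section Naturality

variable {A B C D M N : Type*} [AddCommGroup A] [Module K A] [Superspace K A]
    [AddCommGroup B] [Module K B] [Superspace K B] [AddCommGroup C] [Module K C] [Superspace K C]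
    [AddCommGroup D] [Module K D] [Superspace K D] [AddCommGroup M] [Module K M] [Superspace K M]
    [AddCommGroup N] [Module K N] [Superspace K N]

/-- The superfunctor `A ⊗ -` on a map of parity `s` is `1 ⊗ f` up to parity involutions. This
reduces the naturality of an even map that acts on the left factors to its commutation with the
involution. -/
theorem map_invP_eq (s : ZMod 2) (f : M →ₗ[K] N) (x : A ⊗[K] M) :
    TensorProduct.map (invP K A s) f x =
      invP K (A ⊗[K] N) s (TensorProduct.map LinearMap.id (invP K N s ∘ₗ f) x) := by
  rw [invP_tensor, ← LinearMap.comp_apply, ← TensorProduct.map_comp, ← LinearMap.comp_assoc,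
    ← Module.End.mul_eq_comp (invP K N s), invP_mul_self]
  rfl

theorem map_invP_map_invP_eq (s : ZMod 2) (f : M →ₗ[K] N) (x : A ⊗[K] (B ⊗[K] M)) :
    TensorProduct.map (invP K A s) (TensorProduct.map (invP K B s) f) x =
      invP K (A ⊗[K] (B ⊗[K] N)) s (TensorProduct.map LinearMap.id
        (TensorProduct.map LinearMap.id (invP K N s ∘ₗ f)) x) := by
  rw [map_invP_eq, show invP K (B ⊗[K] N) s ∘ₗ TensorProduct.map (invP K B s) f =
    TensorProduct.map LinearMap.id (invP K N s ∘ₗ f) from LinearMap.ext fun x => ?_]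
  rw [LinearMap.comp_apply, map_invP_eq, ← Module.End.mul_apply, invP_mul_self]
  rfl

theorem onLeft_map (φ : A ⊗[K] B →ₗ[K] C ⊗[K] D) (f : M →ₗ[K] N) (x : A ⊗[K] (B ⊗[K] M)) :
    onLeft φ N (TensorProduct.map LinearMap.id (TensorProduct.map LinearMap.id f) x) =
      TensorProduct.map LinearMap.id (TensorProduct.map LinearMap.id f) (onLeft φ M x) := by
  have h : onLeft φ N ∘ₗ TensorProduct.map LinearMap.id (TensorProduct.map LinearMap.id f) =
      TensorProduct.map LinearMap.id (TensorProduct.map LinearMap.id f) ∘ₗ onLeft φ M := by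
    refine TensorProduct.ext (LinearMap.ext fun a => TensorProduct.ext' fun b m => ?_)
    change onLeft φ N (TensorProduct.map LinearMap.id (TensorProduct.map LinearMap.id f)
      (a ⊗ₜ (b ⊗ₜ m))) = TensorProduct.map LinearMap.id (TensorProduct.map LinearMap.id f)
        (onLeft φ M (a ⊗ₜ (b ⊗ₜ m)))
    rw [TensorProduct.map_tmul, TensorProduct.map_tmul, onLeft_tmul, onLeft_tmul]
    generalize φ (a ⊗ₜ b) = y
    induction y using TensorProduct.induction_on with
    | zero => simp
    | add y z hy hz => simp only [TensorProduct.add_tmul, map_add] at hy hz ⊢; rw [hy, hz]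
    | tmul c d => simp
  exact LinearMap.congr_fun h x

/-- An operator on two tensor factors is natural in the remaining factor. -/
theorem Intertwines.onLeft_natural {φ : A ⊗[K] B →ₗ[K] C ⊗[K] D}
    {T : OpMat K n (A ⊗[K] (B ⊗[K] N))} {T' : OpMat K n (C ⊗[K] (D ⊗[K] N))}
    (h : Intertwines T T' 0 (QIso.onLeft φ N)) (s : ZMod 2) (f : M →ₗ[K] N)
    (x : A ⊗[K] (B ⊗[K] M)) :
    TensorProduct.map (invP K C s) (TensorProduct.map (invP K D s) f) (QIso.onLeft φ M x) =
      QIso.onLeft φ N (TensorProduct.map (invP K A s) (TensorProduct.map (invP K B s) f) x) := by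
  rw [map_invP_map_invP_eq, map_invP_map_invP_eq, map_invP h.inv, ksgn_zero_left, one_smul,
    onLeft_map]

theorem capMap_natural (hq : q ≠ 0) (T : OpMat K n N) (s : ZMod 2) (f : M →ₗ[K] N)
    (x : Module.Dual K (VSp K n) ⊗[K] (VSp K n ⊗[K] M)) :
    f (capMap K n M x) = capMap K n N (TensorProduct.map (invP K (Module.Dual K (VSp K n)) s)
      (TensorProduct.map (invP K (VSp K n) s) f) x) := by
  have h : ∀ g : M →ₗ[K] N, capMap K n N ∘ₗ TensorProduct.map LinearMap.id
      (TensorProduct.map LinearMap.id g) = g ∘ₗ capMap K n M := fun g =>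
    ext_dual_vec fun a b m => by
      simp only [LinearMap.comp_apply, TensorProduct.map_tmul, LinearMap.id_apply, capMap_tmul,
        map_smul]
  have h2 := map_invP (capMap_intertwines hq T).inv s (TensorProduct.map LinearMap.id
    (TensorProduct.map LinearMap.id (invP K N s ∘ₗ f)) x)
  have h3 := LinearMap.congr_fun (h (invP K N s ∘ₗ f)) x
  rw [LinearMap.comp_apply] at h3
  rw [h3, ksgn_zero_left, one_smul, LinearMap.comp_apply, LinearMap.comp_apply,
    ← Module.End.mul_apply, invP_mul_self] at h2
  exact h2.symm.trans (congrArg (capMap K n N) (map_invP_map_invP_eq s f x).symm)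

theorem cupMap_natural (hq : q ≠ 0) (T : OpMat K n N) (s : ZMod 2) (f : M →ₗ[K] N) (m : M) :
    TensorProduct.map (invP K (VSp K n) s)
      (TensorProduct.map (invP K (Module.Dual K (VSp K n)) s) f) (cupMap K n M m) =
        cupMap K n N (f m) := by
  rw [map_invP_map_invP_eq]
  have h : ∀ g : M →ₗ[K] N, TensorProduct.map LinearMap.id
      (TensorProduct.map LinearMap.id g) (cupMap K n M m) = cupMap K n N (g m) := fun g => by
    simp only [cupMap_apply, map_sum, TensorProduct.map_tmul, LinearMap.id_apply]
  have h2 := map_invP (cupMap_intertwines hq T).inv s (invP K N s (f m))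
  rw [ksgn_zero_left, one_smul, ← Module.End.mul_apply, invP_mul_self] at h2
  rw [h]
  exact h2.symm

theorem map_jMap_natural (s : ZMod 2) (f : M →ₗ[K] N) (x : VSp K n ⊗[K] M) :
    TensorProduct.map (invP K (VSp K n) s) f (TensorProduct.map (jMap K n) LinearMap.id x) =
      ksgn K 1 s • TensorProduct.map (jMap K n) LinearMap.id
        (TensorProduct.map (invP K (VSp K n) s) f x) := by
  have h : TensorProduct.map (invP K (VSp K n) s) f ∘ₗ TensorProduct.map (jMap K n) LinearMap.id =
      ksgn K 1 s • (TensorProduct.map (jMap K n) LinearMap.id ∘ₗ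
        TensorProduct.map (invP K (VSp K n) s) f) :=
    TensorProduct.ext' fun v m => by
      simp only [LinearMap.comp_apply, LinearMap.smul_apply, TensorProduct.map_tmul,
        LinearMap.id_apply, map_invP (jMap_intertwines (q := (0 : K))).inv,
        TensorProduct.smul_tmul', smul_smul, ksgn_mul_self, one_smul]
  exact LinearMap.congr_fun h x

end Naturality

namespace SMod

theorem lin_map_translate (W : SMod.{0} q n) {M N : SMod.{u} q n} {r : ZMod 2} {f : M ⟶ N}
    (hf : lin f ∈ homPar M N r) :
    lin (W.translate.map f) = TensorProduct.map (invP K W r) (lin f) :=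
  whiskerLin_of_mem W hf

theorem kappa_eq (M : SMod.{u} q n) : M.kappa = kap M.tm M.sm := by
  rw [kappa, kap, braiding_eq, braiding_symm_eq]

theorem tm_tensor_vector (hq : q ≠ 0) (M : SMod.{u} q n) :
    (tensor (SMod.vector q n hq) M).tm = tensorMat (vecTm q n) M.tm :=
  (tm_tensor _ _).trans (congrArg (tensorMat · M.tm) (tm_vector hq))

theorem tm_tensor_dual_vector (hq : q ≠ 0) (M : SMod.{u} q n) :
    (tensor (SMod.vector q n hq).dual M).tm = tensorMat (dualTm q n) M.tm :=
  (tm_tensor _ _).trans (congrArg (tensorMat · M.tm) (tm_dual_vector hq))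

end SMod

section NatTrans

variable {F F' G G' : SEnd K (SMod.{u} q n)}

/-- The supernatural transformation of parity `r` with given components. -/
def natOf (r : ZMod 2) (φ : ∀ M, F.obj M →ₗ[K] F'.obj M)
    (hφ : ∀ M, φ M ∈ SMod.homPar (F.obj M) (F'.obj M) r)
    (hnat : ∀ (M N : SMod.{u} q n) (s : ZMod 2) (f : M ⟶ N), SMod.lin f ∈ SMod.homPar M N s →
      ∀ x, SMod.lin (F'.map f) (φ M x) = ksgn K r s • φ N (SMod.lin (F.map f) x)) :
    F ⟶ F' :=
  ⟨fun M => ⟨φ M, le_sup01 _ r (hφ M)⟩, le_sup01 _ r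
    ⟨hφ, fun M N s f hf => SMod.lin_ext (LinearMap.ext fun x => hnat M N s f hf x)⟩⟩

theorem natOf_mem (r : ZMod 2) (φ : ∀ M, F.obj M →ₗ[K] F'.obj M)
    (hφ : ∀ M, φ M ∈ SMod.homPar (F.obj M) (F'.obj M) r)
    (hnat : ∀ (M N : SMod.{u} q n) (s : ZMod 2) (f : M ⟶ N), SMod.lin f ∈ SMod.homPar M N s →
      ∀ x, SMod.lin (F'.map f) (φ M x) = ksgn K r s • φ N (SMod.lin (F.map f) x)) :
    natOf r φ hφ hnat ∈ Par K (F ⟶ F') r :=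
  ⟨hφ, fun M N s f hf => SMod.lin_ext (LinearMap.ext fun x => hnat M N s f hf x)⟩

end NatTrans

section Generators

variable (hq : q ≠ 0)

theorem lin_map_actObj_one (a : Arrow) {M N : SMod.{u} q n} {s : ZMod 2} {f : M ⟶ N}
    (hf : SMod.lin f ∈ SMod.homPar M N s) : SMod.lin ((actObj n hq [a]).map f) =
      TensorProduct.map (invP K (arrowModule n hq a) s) (SMod.lin f) :=
  SMod.lin_map_translate (arrowModule n hq a) hf

theorem lin_map_actObj_two (a b : Arrow) {M N : SMod.{u} q n} {s : ZMod 2} {f : M ⟶ N}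
    (hf : SMod.lin f ∈ SMod.homPar M N s) : SMod.lin ((actObj n hq [a, b]).map f) =
      TensorProduct.map (invP K (arrowModule n hq a) s)
        (TensorProduct.map (invP K (arrowModule n hq b) s) (SMod.lin f)) := by
  have h := lin_map_actObj_one hq b hf
  refine (SMod.lin_map_translate (r := s) (arrowModule n hq a)
    (f := (actObj n hq [b]).map f) ?_).trans (congrArg _ h)
  exact (actObj n hq [b]).map_mem hf

theorem tm_up_up (M : SMod.{u} q n) : ((actObj n hq [.up, .up]).obj M).tm =
    tensorMat (vecTm q n) (tensorMat (vecTm q n) M.tm) :=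
  (SMod.tm_tensor_vector hq _).trans (congrArg _ (SMod.tm_tensor_vector hq M))

theorem tm_up_down (M : SMod.{u} q n) : ((actObj n hq [.up, .down]).obj M).tm =
    tensorMat (vecTm q n) (tensorMat (dualTm q n) M.tm) :=
  (SMod.tm_tensor_vector hq _).trans (congrArg _ (SMod.tm_tensor_dual_vector hq M))

theorem tm_down_up (M : SMod.{u} q n) : ((actObj n hq [.down, .up]).obj M).tm =
    tensorMat (dualTm q n) (tensorMat (vecTm q n) M.tm) :=
  (SMod.tm_tensor_dual_vector hq _).trans (congrArg _ (SMod.tm_tensor_vector hq M))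

theorem braidInv_vecSm_intertwines (hq : q ≠ 0) : Intertwines (tensorMat (vecTm q n) (vecTm q n))
    (tensorMat (vecTm q n) (vecTm q n)) 0 (braidInv (vecSm q n)) :=
  (braidMap_vecTm_intertwines hq).of_inverse (braidInv_braidMap (vecSm_mul_vecTm hq))
    (braidMap_braidInv (vecTm_mul_vecSm hq))

theorem actObj_append : ∀ X Y : List Arrow,
    actObj.{u} n hq (X ++ Y) = (actObj n hq Y).comp (actObj n hq X)
  | [], _ => rfl
  | a :: X, Y => congrArg (fun F : SEnd K (SMod.{u} q n) => F.comp (arrowModule n hq a).translate)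
      (actObj_append X Y)

/-- Words in `↑` and `↓`, acting by tensoring on the left with `V` and `V*`. -/
def actWords : WordMap K Arrow (SEnd K (SMod.{u} q n)) where
  obj := actObj n hq
  nil := rfl
  append := actObj_append hq

/-- The components of the images of the generators under the affine action. The ascriptions `( :)`
elaborate each map on the tensor product that the word acts by, before the two are unified. -/
def genMap (M : SMod.{u} q n) : ∀ g : AQSig.Gen,
    ((actWords.{u} (n := n) hq).obj (AQSig.dom g)).obj M →ₗ[K]
        ((actWords.{u} (n := n) hq).obj (AQSig.cod g)).obj M
  | some .pos => (onLeft (braidMap (vecTm q n)) M :)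
  | some .neg => (onLeft (braidInv (vecSm q n)) M :)
  | some .negRight => (onLeft (negRightMap q n) M :)
  | some .cap => (capMap K n M :)
  | some .cup => (cupMap K n M :)
  | some .tok => (TensorProduct.map (jMap K n) (LinearMap.id (M := M)) :)
  | none => (kap M.tm M.sm :)

theorem genMap_mem (M : SMod.{u} q n) : ∀ g : AQSig.Gen,
    genMap hq M g ∈ SMod.homPar (((actWords.{u} (n := n) hq).obj (AQSig.dom g)).obj M)
      (((actWords.{u} (n := n) hq).obj (AQSig.cod g)).obj M) (AQSig.parity g)
  | some .pos => SMod.mem_homPar_of (tm_up_up hq M) (tm_up_up hq M)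
      ((braidMap_vecTm_intertwines hq).onLeft M.tm)
  | some .neg => SMod.mem_homPar_of (tm_up_up hq M) (tm_up_up hq M)
      ((braidInv_vecSm_intertwines hq).onLeft M.tm)
  | some .negRight => SMod.mem_homPar_of (tm_up_down hq M) (tm_down_up hq M)
      (onLeft_negRightMap_intertwines hq M.tm)
  | some .cap => SMod.mem_homPar_of (tm_down_up hq M) rfl (capMap_intertwines hq M.tm)
  | some .cup => SMod.mem_homPar_of (M := M) (N := (actObj.{u} n hq [.up, .down]).obj M) (T := M.tm)
      (T' := tensorMat (vecTm q n) (tensorMat (dualTm q n) M.tm)) rfl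
      (tm_up_down hq M) (cupMap_intertwines hq M.tm)
  | some .tok => SMod.mem_homPar_of (SMod.tm_tensor_vector hq M) (SMod.tm_tensor_vector hq M)
      (jMap_intertwines.map_id M.tm)
  | none => SMod.mem_homPar_of (SMod.tm_tensor_vector hq M) (SMod.tm_tensor_vector hq M)
      M.kap_intertwines

/-- Naturality may be tested on explicit forms of the two maps that the superfunctors assign to `f`.
-/
theorem natural_of_eq {F F' : SEnd K (SMod.{u} q n)} {M N : SMod.{u} q n} {f : M ⟶ N}
    {A : F'.obj M →ₗ[K] F'.obj N} {B : F.obj M →ₗ[K] F.obj N} (hB : SMod.lin (F.map f) = B)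
    (hA : SMod.lin (F'.map f) = A) {φ : F.obj M →ₗ[K] F'.obj M} {ψ : F.obj N →ₗ[K] F'.obj N} {c : K}
    (h : ∀ x, A (φ x) = c • ψ (B x)) (x : F.obj M) :
    SMod.lin (F'.map f) (φ x) = c • ψ (SMod.lin (F.map f) x) := by
  rw [hA, hB, h]

theorem natural_of_eq_even {F F' : SEnd K (SMod.{u} q n)} {M N : SMod.{u} q n} {f : M ⟶ N}
    {A : F'.obj M →ₗ[K] F'.obj N} {B : F.obj M →ₗ[K] F.obj N} (hB : SMod.lin (F.map f) = B)
    (hA : SMod.lin (F'.map f) = A) {φ : F.obj M →ₗ[K] F'.obj M} {ψ : F.obj N →ₗ[K] F'.obj N}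
    {s : ZMod 2} (h : ∀ x, A (φ x) = ψ (B x)) (x : F.obj M) :
    SMod.lin (F'.map f) (φ x) = ksgn K 0 s • ψ (SMod.lin (F.map f) x) :=
  natural_of_eq hB hA (fun x => by rw [ksgn_zero_left, one_smul, h]) x

theorem genMap_natural {M N : SMod.{u} q n} {s : ZMod 2} {f : M ⟶ N}
    (hf : SMod.lin f ∈ SMod.homPar M N s) : ∀ (g : AQSig.Gen)
      (x : ((actWords.{u} (n := n) hq).obj (AQSig.dom g)).obj M),
    SMod.lin (((actWords hq).obj (AQSig.cod g)).map f) (genMap hq M g x) =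
      ksgn K (AQSig.parity g) s •
        genMap hq N g (SMod.lin (((actWords hq).obj (AQSig.dom g)).map f) x)
  | some .pos => natural_of_eq_even (lin_map_actObj_two hq .up .up hf)
      (lin_map_actObj_two hq .up .up hf)
      (((braidMap_vecTm_intertwines hq).onLeft N.tm).onLeft_natural s (SMod.lin f))
  | some .neg => natural_of_eq_even (lin_map_actObj_two hq .up .up hf)
      (lin_map_actObj_two hq .up .up hf)
      (((braidInv_vecSm_intertwines hq).onLeft N.tm).onLeft_natural s (SMod.lin f))
  | some .negRight => natural_of_eq_even (lin_map_actObj_two hq .up .down hf)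
      (lin_map_actObj_two hq .down .up hf)
      ((onLeft_negRightMap_intertwines hq N.tm).onLeft_natural s (SMod.lin f))
  | some .cap => natural_of_eq_even (F' := actObj n hq []) (lin_map_actObj_two hq .down .up hf) rfl
      (capMap_natural hq N.tm s (SMod.lin f))
  | some .cup => natural_of_eq_even (F := actObj n hq []) rfl (lin_map_actObj_two hq .up .down hf)
      (cupMap_natural hq N.tm s (SMod.lin f))
  | some .tok => natural_of_eq (lin_map_actObj_one hq .up hf) (lin_map_actObj_one hq .up hf)
      (map_jMap_natural s (SMod.lin f))
  | none => natural_of_eq (lin_map_actObj_one hq .up hf) (lin_map_actObj_one hq .up hf)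
      (kap_map M.sm_mul_tm M.tm_mul_sm N.sm_mul_tm (SMod.mem_homPar_iff.mp hf))

/-- The images of the generators under the affine action. -/
def genHom (g : AQSig.Gen) : (actWords.{u} (n := n) hq).obj (AQSig.dom g) ⟶
    (actWords.{u} (n := n) hq).obj (AQSig.cod g) :=
  natOf (AQSig.parity g) (genMap hq · g) (genMap_mem hq · g) fun _ _ _ _ hf =>
    genMap_natural hq hf g

theorem genHom_mem (g : AQSig.Gen) : genHom.{u} (n := n) hq g ∈ Par K _ (AQSig.parity g) :=
  natOf_mem _ _ _ _

end Generators

/-! ### Values of diagrams under the affine action -/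

section InterpTensor

open StrictMonoidalSupercategory

variable {A : Type} {D : Type v} [Category.{w} D] [Preadditive D] [Linear K D] [Supercategory K D]
  [StrictMonoidalSupercategory K D] (o : WordMap K A D) {S : Signature A}
  (γ : ∀ g : S.Gen, o.obj (S.dom g) ⟶ o.obj (S.cod g))

theorem interp_id_tensor (Z : List A) {X Y : List A} (f : Diagram S K X Y) :
    interp o γ (.tensor (.id Z) f) = eqToHom (o.append _ _) ≫
      tensorHom (K := K) (𝟙 (o.obj Z)) (interp o γ f) ≫ eqToHom (o.append _ _).symm := by
  exact rfl

theorem interp_tensor_id (Z : List A) {X Y : List A} (f : Diagram S K X Y) :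
    interp o γ (.tensor f (.id Z)) = eqToHom (o.append _ _) ≫
      tensorHom (K := K) (interp o γ f) (𝟙 (o.obj Z)) ≫ eqToHom (o.append _ _).symm := by
  exact rfl

end InterpTensor

section Values

open StrictMonoidalSupercategory

/-- The identity of `F M`, along an equality `F = F'`. For the functors given by words it is applied
to elements of one and the same iterated tensor product, which `HEq` expresses. -/
def castLin {F F' : SEnd K (SMod.{u} q n)} (h : F = F') (M : SMod.{u} q n) :
    F.obj M →ₗ[K] F'.obj M :=
  SMod.lin (Superfunctor.app (eqToHom h) M)

theorem castLin_apply {F F' : SEnd K (SMod.{u} q n)} (h : F = F') {M : SMod.{u} q n}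
    {x : F.obj M} {y : F'.obj M} (hxy : HEq x y) : castLin h M x = y := by
  subst h
  obtain rfl := eq_of_heq hxy
  rfl

theorem lin_app_tensorHom_id {F F' G P P' : SEnd K (SMod.{u} q n)} (α : F ⟶ F')
    (h : P = tensorObj K F G) (h' : tensorObj K F' G = P') (M : SMod.{u} q n) {x : P.obj M}
    {y : P'.obj M} {x' : F.obj (G.obj M)} {y' : F'.obj (G.obj M)} (hx : HEq x x') (hy : HEq y' y)
    (hα : SMod.lin (Superfunctor.app α (G.obj M)) x' = y') :
    SMod.lin (Superfunctor.app (eqToHom h ≫ tensorHom (K := K) α (𝟙 G) ≫ eqToHom h') M) x = y := by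
  have e := Category.id_comp (Superfunctor.app α (G.obj M))
  rw [← F.map_id] at e
  refine (LinearMap.congr_fun
    (congrArg (fun f => castLin h' M ∘ₗ SMod.lin f ∘ₗ castLin h M) e) x).trans ?_
  rw [LinearMap.comp_apply, LinearMap.comp_apply, castLin_apply h hx]
  exact castLin_apply h' ((heq_of_eq hα).trans hy)

theorem lin_app_id_tensorHom {F G G' P P' : SEnd K (SMod.{u} q n)} (β : G ⟶ G')
    (h : P = tensorObj K F G) (h' : tensorObj K F G' = P') (M : SMod.{u} q n) {x : P.obj M}
    {y : P'.obj M} {x' : F.obj (G.obj M)} {y' : F.obj (G'.obj M)} (hx : HEq x x') (hy : HEq y' y)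
    (hβ : SMod.lin (F.map (Superfunctor.app β M)) x' = y') :
    SMod.lin (Superfunctor.app (eqToHom h ≫ tensorHom (K := K) (𝟙 F) β ≫ eqToHom h') M) x = y := by
  refine (LinearMap.congr_fun
    (congrArg (fun f => castLin h' M ∘ₗ SMod.lin f ∘ₗ castLin h M)
      (Category.comp_id (F.map (Superfunctor.app β M)))) x).trans ?_
  rw [LinearMap.comp_apply, LinearMap.comp_apply, castLin_apply h hx]
  exact castLin_apply h' ((heq_of_eq hβ).trans hy)

variable (hq : q ≠ 0)

/-- The `M`-component of the value of a diagram under the affine action. -/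
def val (M : SMod.{u} q n) {X Y : List Arrow} (f : Diagram AQSig K X Y) :
    ((actWords hq).obj X).obj M →ₗ[K] ((actWords hq).obj Y).obj M :=
  SMod.lin (Superfunctor.app (interp (actWords hq) (genHom hq) f) M)

theorem interp_eq_of_val {X Y : List Arrow} {f g : Diagram AQSig K X Y}
    (h : ∀ (M : SMod.{u} q n) x, val hq M f x = val hq M g x) :
    interp (actWords.{u} (n := n) hq) (genHom hq) f = interp (actWords hq) (genHom hq) g :=
  Superfunctor.hom_ext fun M => SMod.lin_ext (LinearMap.ext (h M))

variable (M : SMod.{u} q n)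

open Diagram Arrow AQSig

theorem val_comp {X Y Z : List Arrow} (f : Diagram AQSig K X Y) (g : Diagram AQSig K Y Z)
    (x : ((actWords hq).obj X).obj M) : val hq M (comp f g) x = val hq M g (val hq M f x) := by
  exact rfl

theorem val_add {X Y : List Arrow} (f g : Diagram AQSig K X Y)
    (x : ((actWords hq).obj X).obj M) : val hq M (add f g) x = val hq M f x + val hq M g x := by
  exact rfl

theorem val_smul {X Y : List Arrow} (a : K) (f : Diagram AQSig K X Y)
    (x : ((actWords hq).obj X).obj M) : val hq M (smul a f) x = a • val hq M f x := by
  exact rfl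

theorem val_zero {X Y : List Arrow} (x : ((actWords hq).obj X).obj M) :
    val hq M (zero : Diagram AQSig K X Y) x = 0 := by
  exact rfl

theorem val_id {X : List Arrow} (x : ((actWords hq).obj X).obj M) :
    val hq M (Diagram.id X) x = x := by
  exact rfl

theorem val_gen (g : AQSig.Gen) : val hq M (gen (S := AQSig) g) = genMap hq M g := by
  exact rfl

theorem val_ofQ_gen (g : QGen) : val hq M (ofQ (gen (S := QSig) g)) = genMap hq M (some g) := by
  exact LinearMap.ext fun x => rfl

variable {M}

/-- The value of `f ⊗ 1_Z` at `M` is the value of `f` at `Z M`. -/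
theorem val_tensor_id {X Y Z : List Arrow} {f : Diagram AQSig K X Y}
    {x : ((actWords hq).obj (X ++ Z)).obj M} {y : ((actWords hq).obj (Y ++ Z)).obj M}
    {x' : ((actWords hq).obj X).obj (((actWords hq).obj Z).obj M)}
    {y' : ((actWords hq).obj Y).obj (((actWords hq).obj Z).obj M)} (hx : HEq x x') (hy : HEq y' y)
    (h : val hq (((actWords hq).obj Z).obj M) f x' = y') :
    val hq M (tensor f (Diagram.id Z)) x = y := by
  rw [val, interp_tensor_id]
  exact lin_app_tensorHom_id (interp (actWords.{u} (n := n) hq) (genHom hq) f)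
    ((actWords hq).append X Z) ((actWords hq).append Y Z).symm M hx hy h

theorem lin_map_actWords (a : Arrow) {X Y : List Arrow} {f : Diagram AQSig K X Y} {r : ZMod 2}
    (hf : f.Homog r) : SMod.lin (((actWords hq).obj [a]).map
      (Superfunctor.app (interp (actWords hq) (genHom hq) f) M)) =
      TensorProduct.map (invP K (arrowModule n hq a) r) (val hq M f) :=
  lin_map_actObj_one hq a ((interp_mem (actWords.{u} (n := n) hq) (genHom_mem hq) hf).1 M)

theorem lin_map_actWords_two (a b : Arrow) {X Y : List Arrow} {f : Diagram AQSig K X Y}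
    {r : ZMod 2} (hf : f.Homog r) : SMod.lin (((actWords hq).obj [a, b]).map
      (Superfunctor.app (interp (actWords hq) (genHom hq) f) M)) =
      TensorProduct.map (invP K (arrowModule n hq a) r)
        (TensorProduct.map (invP K (arrowModule n hq b) r) (val hq M f)) :=
  lin_map_actObj_two hq a b ((interp_mem (actWords.{u} (n := n) hq) (genHom_mem hq) hf).1 M)

/-- The value of `1_W ⊗ f` at `M` is the image under the superfunctor `W` of the value of `f`. -/
theorem val_id_tensor {W X Y : List Arrow} {f : Diagram AQSig K X Y}
    {x : ((actWords hq).obj (W ++ X)).obj M} {y : ((actWords hq).obj (W ++ Y)).obj M}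
    {x' : ((actWords hq).obj W).obj (((actWords hq).obj X).obj M)}
    {y' : ((actWords hq).obj W).obj (((actWords hq).obj Y).obj M)} (hx : HEq x x') (hy : HEq y' y)
    (h : SMod.lin (((actWords hq).obj W).map
      (Superfunctor.app (interp (actWords hq) (genHom hq) f) M)) x' = y') :
    val hq M (tensor (Diagram.id W) f) x = y := by
  rw [val, interp_id_tensor]
  exact lin_app_id_tensorHom (interp (actWords.{u} (n := n) hq) (genHom hq) f)
    ((actWords hq).append W X) ((actWords hq).append W Y).symm M hx hy h

-- The lemmas above are all that is needed of `val`; unfolding it would make the elaborator compare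
-- iterated tensor products through the quotient of diagrams.
attribute [irreducible] val

end Values

/-! ### Values of the whiskered generators -/

section Whiskering

variable (hq : q ≠ 0) (M : SMod.{u} q n)

open Diagram Arrow AQSig

theorem homog_ofQ {X Y : List Arrow} {f : Diagram QSig K X Y} {r : ZMod 2} (h : f.Homog r) :
    (ofQ f).Homog r :=
  Presentation.homog_lift (S := QSig) (S' := AQSig) (φ := (some : QGen → Option QGen))
    (hd := fun _ => rfl) (hc := fun _ => rfl) (fun _ => rfl) h

theorem homog_dot : (dot : Diagram AQSig K _ _).Homog 1 :=
  Homog.gen (S := AQSig) (none : Option QGen)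

theorem val_pos : val hq M (ofQ QSig.pos) = (onLeft (braidMap (vecTm q n)) M :
    VSp K n ⊗[K] (VSp K n ⊗[K] M) →ₗ[K] VSp K n ⊗[K] (VSp K n ⊗[K] M)) :=
  val_ofQ_gen hq M QGen.pos

theorem val_neg : val hq M (ofQ QSig.neg) = (onLeft (braidInv (vecSm q n)) M :
    VSp K n ⊗[K] (VSp K n ⊗[K] M) →ₗ[K] VSp K n ⊗[K] (VSp K n ⊗[K] M)) :=
  val_ofQ_gen hq M QGen.neg

theorem val_negRight : val hq M (ofQ QSig.negRight) = (onLeft (negRightMap q n) M :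
    VSp K n ⊗[K] (Module.Dual K (VSp K n) ⊗[K] M) →ₗ[K]
      Module.Dual K (VSp K n) ⊗[K] (VSp K n ⊗[K] M)) :=
  val_ofQ_gen hq M QGen.negRight

theorem val_cap : val hq M (ofQ QSig.cap) = (capMap K n M :
    Module.Dual K (VSp K n) ⊗[K] (VSp K n ⊗[K] M) →ₗ[K] M) :=
  val_ofQ_gen hq M QGen.cap

theorem val_cup : val hq M (ofQ QSig.cup) = (cupMap K n M :
    M →ₗ[K] VSp K n ⊗[K] (Module.Dual K (VSp K n) ⊗[K] M)) :=
  val_ofQ_gen hq M QGen.cup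

theorem val_tok : val hq M (ofQ QSig.tok) = (TensorProduct.map (jMap K n) LinearMap.id :
    VSp K n ⊗[K] M →ₗ[K] VSp K n ⊗[K] M) :=
  val_ofQ_gen hq M QGen.tok

theorem val_dot : val hq M dot = (kap M.tm M.sm : VSp K n ⊗[K] M →ₗ[K] VSp K n ⊗[K] M) :=
  val_gen hq M (none : Option QGen)

theorem val_pos_up (x : VSp K n ⊗[K] (VSp K n ⊗[K] (VSp K n ⊗[K] M))) :
    val hq M (tensor (ofQ QSig.pos) (Diagram.id [up])) x =
      onLeft (braidMap (vecTm q n)) (VSp K n ⊗[K] M) x :=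
  val_tensor_id hq HEq.rfl HEq.rfl
    (LinearMap.congr_fun (val_pos hq (((actWords hq).obj [up]).obj M)) x)

theorem val_up_pos (x : VSp K n ⊗[K] (VSp K n ⊗[K] (VSp K n ⊗[K] M))) :
    val hq M (tensor (Diagram.id [up]) (ofQ QSig.pos)) x =
      TensorProduct.map LinearMap.id (onLeft (braidMap (vecTm q n)) M) x := by
  have h := lin_map_actWords (M := M) (X := [up, up]) (Y := [up, up])
    (f := ofQ QSig.pos) hq up (homog_ofQ QSig.homog_pos)
  rw [invP_zero, val_pos] at h
  exact val_id_tensor hq HEq.rfl HEq.rfl (LinearMap.congr_fun h x)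

theorem val_down_pos (x : Module.Dual K (VSp K n) ⊗[K] (VSp K n ⊗[K] (VSp K n ⊗[K] M))) :
    val hq M (tensor (Diagram.id [down]) (ofQ QSig.pos)) x =
      TensorProduct.map LinearMap.id (onLeft (braidMap (vecTm q n)) M) x := by
  have h := lin_map_actWords (M := M) (X := [up, up]) (Y := [up, up])
    (f := ofQ QSig.pos) hq down (homog_ofQ QSig.homog_pos)
  rw [invP_zero, val_pos] at h
  exact val_id_tensor hq HEq.rfl HEq.rfl (LinearMap.congr_fun h x)

theorem val_down_pos_down (x : Module.Dual K (VSp K n) ⊗[K]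
    (VSp K n ⊗[K] (VSp K n ⊗[K] (Module.Dual K (VSp K n) ⊗[K] M)))) :
    val hq M (tensor (tensor (Diagram.id [down]) (ofQ QSig.pos)) (Diagram.id [down])) x =
      TensorProduct.map LinearMap.id
        (onLeft (braidMap (vecTm q n)) (Module.Dual K (VSp K n) ⊗[K] M)) x :=
  val_tensor_id hq HEq.rfl HEq.rfl (val_down_pos hq (((actWords hq).obj [down]).obj M) x)

theorem val_cap_up_down (x : Module.Dual K (VSp K n) ⊗[K]
    (VSp K n ⊗[K] (VSp K n ⊗[K] (Module.Dual K (VSp K n) ⊗[K] M)))) :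
    val hq M (tensor (ofQ QSig.cap) (Diagram.id [up, down])) x =
      capMap K n (VSp K n ⊗[K] (Module.Dual K (VSp K n) ⊗[K] M)) x :=
  val_tensor_id hq HEq.rfl HEq.rfl
    (LinearMap.congr_fun (val_cap hq (((actWords hq).obj [up, down]).obj M)) x)

theorem val_down_up_cup (x : Module.Dual K (VSp K n) ⊗[K] (VSp K n ⊗[K] M)) :
    val hq M (tensor (Diagram.id [down, up]) (ofQ QSig.cup)) x =
      TensorProduct.map LinearMap.id (TensorProduct.map LinearMap.id (cupMap K n M)) x := by
  have h := lin_map_actWords_two (M := M) (X := []) (Y := [up, down])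
    (f := ofQ QSig.cup) hq down up (homog_ofQ QSig.homog_cup)
  rw [invP_zero, invP_zero, val_cup] at h
  exact val_id_tensor hq HEq.rfl HEq.rfl (LinearMap.congr_fun h x)

theorem val_cap_down (x : Module.Dual K (VSp K n) ⊗[K]
    (VSp K n ⊗[K] (Module.Dual K (VSp K n) ⊗[K] M))) :
    val hq M (tensor (ofQ QSig.cap) (Diagram.id [down])) x =
      capMap K n (Module.Dual K (VSp K n) ⊗[K] M) x :=
  val_tensor_id hq HEq.rfl HEq.rfl
    (LinearMap.congr_fun (val_cap hq (((actWords hq).obj [down]).obj M)) x)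

theorem val_cup_up (x : VSp K n ⊗[K] M) :
    val hq M (tensor (ofQ QSig.cup) (Diagram.id [up])) x = cupMap K n (VSp K n ⊗[K] M) x :=
  val_tensor_id hq HEq.rfl HEq.rfl
    (LinearMap.congr_fun (val_cup hq (((actWords hq).obj [up]).obj M)) x)

theorem val_up_cap (x : VSp K n ⊗[K] (Module.Dual K (VSp K n) ⊗[K] (VSp K n ⊗[K] M))) :
    val hq M (tensor (Diagram.id [up]) (ofQ QSig.cap)) x =
      TensorProduct.map LinearMap.id (capMap K n M) x := by
  have h := lin_map_actWords (M := M) (X := [down, up]) (Y := [])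
    (f := ofQ QSig.cap) hq up (homog_ofQ QSig.homog_cap)
  rw [invP_zero, val_cap] at h
  exact val_id_tensor hq HEq.rfl HEq.rfl (LinearMap.congr_fun h x)

theorem val_down_cup (x : Module.Dual K (VSp K n) ⊗[K] M) :
    val hq M (tensor (Diagram.id [down]) (ofQ QSig.cup)) x =
      TensorProduct.map LinearMap.id (cupMap K n M) x := by
  have h := lin_map_actWords (M := M) (X := []) (Y := [up, down])
    (f := ofQ QSig.cup) hq down (homog_ofQ QSig.homog_cup)
  rw [invP_zero, val_cup] at h
  exact val_id_tensor hq HEq.rfl HEq.rfl (LinearMap.congr_fun h x)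

theorem val_tok_up (x : VSp K n ⊗[K] (VSp K n ⊗[K] M)) :
    val hq M (tensor (ofQ QSig.tok) (Diagram.id [up])) x =
      TensorProduct.map (jMap K n) LinearMap.id x :=
  val_tensor_id hq HEq.rfl HEq.rfl
    (LinearMap.congr_fun (val_tok hq (((actWords hq).obj [up]).obj M)) x)

theorem val_tok_down (x : VSp K n ⊗[K] (Module.Dual K (VSp K n) ⊗[K] M)) :
    val hq M (tensor (ofQ QSig.tok) (Diagram.id [down])) x =
      TensorProduct.map (jMap K n) LinearMap.id x :=
  val_tensor_id hq HEq.rfl HEq.rfl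
    (LinearMap.congr_fun (val_tok hq (((actWords hq).obj [down]).obj M)) x)

theorem val_up_tok (x : VSp K n ⊗[K] (VSp K n ⊗[K] M)) :
    val hq M (tensor (Diagram.id [up]) (ofQ QSig.tok)) x =
      TensorProduct.map (invP K (VSp K n) 1) (TensorProduct.map (jMap K n) LinearMap.id) x := by
  have h := lin_map_actWords (M := M) (X := [up]) (Y := [up])
    (f := ofQ QSig.tok) hq up (homog_ofQ QSig.homog_tok)
  rw [val_tok] at h
  exact val_id_tensor hq HEq.rfl HEq.rfl (LinearMap.congr_fun h x)

theorem val_dot_up (x : VSp K n ⊗[K] (VSp K n ⊗[K] M)) :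
    val hq M (tensor dot (Diagram.id [up])) x =
      kap (((actWords hq).obj [up]).obj M).tm (((actWords hq).obj [up]).obj M).sm x :=
  val_tensor_id hq HEq.rfl HEq.rfl
    (LinearMap.congr_fun (val_dot hq (((actWords hq).obj [up]).obj M)) x)

theorem val_dot_down (x : VSp K n ⊗[K] (Module.Dual K (VSp K n) ⊗[K] M)) :
    val hq M (tensor dot (Diagram.id [down])) x =
      kap (((actWords hq).obj [down]).obj M).tm (((actWords hq).obj [down]).obj M).sm x :=
  val_tensor_id hq HEq.rfl HEq.rfl
    (LinearMap.congr_fun (val_dot hq (((actWords hq).obj [down]).obj M)) x)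

theorem val_up_dot (x : VSp K n ⊗[K] (VSp K n ⊗[K] M)) :
    val hq M (tensor (Diagram.id [up]) dot) x =
      TensorProduct.map (invP K (VSp K n) 1) (kap M.tm M.sm) x := by
  have h := lin_map_actWords (M := M) (X := [up]) (Y := [up]) (f := dot) hq up homog_dot
  rw [val_dot] at h
  exact val_id_tensor hq HEq.rfl HEq.rfl (LinearMap.congr_fun h x)

end Whiskering

/-! ### The defining relations hold -/

theorem onLeft_braidMap_vecTm_skein {M : Type*} [AddCommGroup M] [Module K M] (hq : q ≠ 0)
    (x : VSp K n ⊗[K] (VSp K n ⊗[K] M)) :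
    onLeft (braidMap (vecTm q n)) M x + (-1 : K) • onLeft (braidInv (vecSm q n)) M x =
      (q - q⁻¹) • x := by
  have h : onLeft (braidMap (vecTm q n)) M = onLeft (braidInv (vecSm q n)) M +
      (q - q⁻¹) • LinearMap.id := TensorProduct.ext (LinearMap.ext fun v =>
    TensorProduct.ext' fun w m => by
      change onLeft (braidMap (vecTm q n)) M (v ⊗ₜ (w ⊗ₜ m)) =
        onLeft (braidInv (vecSm q n)) M (v ⊗ₜ (w ⊗ₜ m)) + (q - q⁻¹) • (v ⊗ₜ (w ⊗ₜ m))
      rw [onLeft_tmul, onLeft_tmul, braidMap_vecTm_skein hq, TensorProduct.add_tmul, map_add,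
        ← TensorProduct.smul_tmul', map_smul, TensorProduct.assoc_tmul])
  rw [h, LinearMap.add_apply, LinearMap.smul_apply, LinearMap.id_apply]
  module

theorem onLeft_braidMap_vecTm_token {M : Type*} [AddCommGroup M] [Module K M]
    (x : VSp K n ⊗[K] (VSp K n ⊗[K] M)) :
    onLeft (braidMap (vecTm q n)) M (TensorProduct.map (jMap K n) LinearMap.id x) =
      TensorProduct.map (invP K (VSp K n) 1) (TensorProduct.map (jMap K n) LinearMap.id)
        (onLeft (braidMap (vecTm q n)) M x) := by
  have h : onLeft (braidMap (vecTm q n)) M ∘ₗ TensorProduct.map (jMap K n) LinearMap.id =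
      TensorProduct.map (invP K (VSp K n) 1) (TensorProduct.map (jMap K n) LinearMap.id) ∘ₗ
        onLeft (braidMap (vecTm q n)) M :=
    TensorProduct.ext (LinearMap.ext fun v => TensorProduct.ext' fun w m => by
      change onLeft (braidMap (vecTm q n)) M (jMap K n v ⊗ₜ (w ⊗ₜ m)) =
        TensorProduct.map (invP K (VSp K n) 1) (TensorProduct.map (jMap K n) LinearMap.id)
          (onLeft (braidMap (vecTm q n)) M (v ⊗ₜ (w ⊗ₜ m)))
      have h := braidMap_map (jMap_intertwines (K := K) (n := n) (q := q)) (v ⊗ₜ w)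
      rw [TensorProduct.map_tmul, LinearMap.id_apply] at h
      rw [onLeft_tmul, onLeft_tmul, h]
      generalize braidMap (vecTm q n) (v ⊗ₜ w) = y
      induction y using TensorProduct.induction_on with
      | zero => simp
      | add y z hy hz => simp only [TensorProduct.add_tmul, map_add] at hy hz ⊢; rw [hy, hz]
      | tmul c d => simp)
  exact LinearMap.congr_fun h x

section Relations

variable (hq : q ≠ 0) (M : SMod.{u} q n)

open Diagram Arrow AQSig

variable {hq M} in
theorem val_comp_eq {X Y Z : List Arrow} {f : Diagram AQSig K X Y} {g : Diagram AQSig K Y Z}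
    {x : ((actWords hq).obj X).obj M} {y : ((actWords hq).obj Y).obj M}
    {z : ((actWords hq).obj Z).obj M} (hf : val hq M f x = y) (hg : val hq M g y = z) :
    val hq M (comp f g) x = z := by
  rw [val_comp, hf, hg]

variable {hq M} in
theorem val_add_eq {X Y : List Arrow} {f g : Diagram AQSig K X Y}
    {x : ((actWords hq).obj X).obj M} {y z : ((actWords hq).obj Y).obj M}
    (hf : val hq M f x = y) (hg : val hq M g x = z) : val hq M (add f g) x = y + z := by
  rw [val_add, hf, hg]

variable {hq M} in
theorem val_smul_eq {X Y : List Arrow} {f : Diagram AQSig K X Y} (a : K)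
    {x : ((actWords hq).obj X).obj M} {y : ((actWords hq).obj Y).obj M}
    (hf : val hq M f x = y) : val hq M (smul a f) x = a • y := by
  rw [val_smul, hf]

theorem val_pos_neg (x : VSp K n ⊗[K] (VSp K n ⊗[K] M)) :
    val hq M (ofQ (comp QSig.pos QSig.neg)) x = x :=
  val_comp_eq (LinearMap.congr_fun (val_pos hq M) x) <|
    (LinearMap.congr_fun (val_neg hq M) _).trans <| by
      have h := LinearMap.congr_fun (onLeft_comp (M := M) (braidMap (vecTm q n))
        (braidInv (vecSm q n))) x
      rw [show braidInv (vecSm q n) ∘ₗ braidMap (vecTm q n) = LinearMap.id from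
        LinearMap.ext (braidInv_braidMap (vecSm_mul_vecTm hq)), onLeft_id] at h
      exact h

theorem val_neg_pos (x : VSp K n ⊗[K] (VSp K n ⊗[K] M)) :
    val hq M (ofQ (comp QSig.neg QSig.pos)) x = x :=
  val_comp_eq (LinearMap.congr_fun (val_neg hq M) x) <|
    (LinearMap.congr_fun (val_pos hq M) _).trans <| by
      have h := LinearMap.congr_fun (onLeft_comp (M := M) (braidInv (vecSm q n))
        (braidMap (vecTm q n))) x
      rw [show braidMap (vecTm q n) ∘ₗ braidInv (vecSm q n) = LinearMap.id from
        LinearMap.ext (braidMap_braidInv (vecTm_mul_vecSm hq)), onLeft_id] at h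
      exact h

theorem val_posLeft (x : Module.Dual K (VSp K n) ⊗[K] (VSp K n ⊗[K] M)) :
    val hq M (ofQ QSig.posLeft) x = onLeft (posLeftMap q n) M x := by
  have h : val hq M (comp (tensor (Diagram.id [down, up]) (ofQ QSig.cup) :)
      (comp (Y := [down, up, up, down])
        (tensor (tensor (Diagram.id [down]) (ofQ QSig.pos) :) (Diagram.id [down]) :)
        (tensor (ofQ QSig.cap) (Diagram.id [up, down]) :))) x =
      capMap K n (VSp K n ⊗[K] (Module.Dual K (VSp K n) ⊗[K] M)) (TensorProduct.map LinearMap.id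
        (onLeft (braidMap (vecTm q n)) (Module.Dual K (VSp K n) ⊗[K] M))
        (TensorProduct.map LinearMap.id (TensorProduct.map LinearMap.id (cupMap K n M)) x)) :=
    val_comp_eq (val_down_up_cup hq M x) <|
      val_comp_eq (val_down_pos_down hq M _) (val_cap_up_down hq M _)
  exact h.trans (onLeft_mate (braidMap (vecTm q n)) x).symm

theorem val_rightCap (x : VSp K n ⊗[K] (Module.Dual K (VSp K n) ⊗[K] M)) :
    val hq M (ofQ QSig.rightCap) x = capMap K n M (onLeft (negRightMap q n) M x) :=
  val_comp_eq (LinearMap.congr_fun (val_negRight hq M) x) (LinearMap.congr_fun (val_cap hq M) _)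

theorem val_negRight_posLeft (x : VSp K n ⊗[K] (Module.Dual K (VSp K n) ⊗[K] M)) :
    val hq M (ofQ (comp QSig.negRight QSig.posLeft)) x = x :=
  val_comp_eq (LinearMap.congr_fun (val_negRight hq M) x) <|
    (val_posLeft hq M _).trans (onLeft_posLeftMap_negRightMap hq x)

theorem val_posLeft_negRight (x : Module.Dual K (VSp K n) ⊗[K] (VSp K n ⊗[K] M)) :
    val hq M (ofQ (comp QSig.posLeft QSig.negRight)) x = x :=
  val_comp_eq (val_posLeft hq M x) <|
    (LinearMap.congr_fun (val_negRight hq M) _).trans (onLeft_negRightMap_posLeftMap hq x)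

theorem val_braid (x : VSp K n ⊗[K] (VSp K n ⊗[K] (VSp K n ⊗[K] M))) :
    val hq M (comp (tensor (ofQ QSig.pos) (Diagram.id [up]) :)
      (comp (tensor (Diagram.id [up]) (ofQ QSig.pos) :)
        (tensor (ofQ QSig.pos) (Diagram.id [up]) :))) x =
    val hq M (comp (tensor (Diagram.id [up]) (ofQ QSig.pos) :)
      (comp (tensor (ofQ QSig.pos) (Diagram.id [up]) :)
        (tensor (Diagram.id [up]) (ofQ QSig.pos) :))) x :=
  (val_comp_eq (val_pos_up hq M x) <| val_comp_eq (val_up_pos hq M _) <|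
    (val_pos_up hq M _).trans (onLeft_braidMap_vecTm_braid hq x)).trans <| Eq.symm <|
  val_comp_eq (val_up_pos hq M x) <| val_comp_eq (val_pos_up hq M _) <| val_up_pos hq M _

theorem val_tok_tok (x : VSp K n ⊗[K] M) :
    val hq M (ofQ (comp QSig.tok QSig.tok)) x = -x :=
  val_comp_eq (LinearMap.congr_fun (val_tok hq M) x) <|
    (LinearMap.congr_fun (val_tok hq M) _).trans <| by
      have h : TensorProduct.map (jMap K n) LinearMap.id ∘ₗ
          TensorProduct.map (jMap K n) (LinearMap.id (R := K) (M := M)) = -LinearMap.id :=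
        TensorProduct.ext' fun v m => by
          simp [jMap_jMap, TensorProduct.neg_tmul]
      exact LinearMap.congr_fun h x

theorem val_bubble (m : M) : val hq M (ofQ (comp QSig.cup QSig.rightCap)) m = 0 :=
  val_comp_eq (LinearMap.congr_fun (val_cup hq M) m) <|
    (val_rightCap hq M _).trans (capMap_onLeft_negRightMap_cupMap hq m)

theorem val_tok_bubble (m : M) : val hq M (comp (ofQ QSig.cup)
    (comp (tensor (ofQ QSig.tok) (Diagram.id [down]) :) (ofQ QSig.rightCap))) m = 0 :=
  val_comp_eq (LinearMap.congr_fun (val_cup hq M) m) <| val_comp_eq (val_tok_down hq M _) <|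
    (val_rightCap hq M _).trans (capMap_onLeft_negRightMap_token m)

theorem val_zigzag_up (x : VSp K n ⊗[K] M) : val hq M
    (comp (tensor (ofQ QSig.cup) (Diagram.id [up]) :)
      (tensor (Diagram.id [up]) (ofQ QSig.cap) :)) x = x :=
  val_comp_eq (val_cup_up hq M x) <| (val_up_cap hq M _).trans <| by
    have h : TensorProduct.map LinearMap.id (capMap K n M) ∘ₗ cupMap K n (VSp K n ⊗[K] M) =
        LinearMap.id := TensorProduct.ext' fun v m => by
      simp only [LinearMap.comp_apply, cupMap_apply, map_sum, TensorProduct.map_tmul, capMap_tmul,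
        LinearMap.id_apply]
      simp only [← TensorProduct.smul_tmul, ← TensorProduct.sum_tmul]
      rw [sum_vec]
    exact LinearMap.congr_fun h x

theorem val_zigzag_down (x : Module.Dual K (VSp K n) ⊗[K] M) : val hq M
    (comp (tensor (Diagram.id [down]) (ofQ QSig.cup) :)
      (tensor (ofQ QSig.cap) (Diagram.id [down]) :)) x = x :=
  val_comp_eq (val_down_cup hq M x) <| (val_cap_down hq M _).trans <| by
    have h : capMap K n (Module.Dual K (VSp K n) ⊗[K] M) ∘ₗ
        TensorProduct.map LinearMap.id (cupMap K n M) = LinearMap.id :=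
      TensorProduct.ext' fun f m => by
      simp only [LinearMap.comp_apply, cupMap_apply, map_sum, TensorProduct.map_tmul, capMap_tmul,
        LinearMap.id_apply, TensorProduct.tmul_sum]
      simp only [TensorProduct.smul_tmul', ← TensorProduct.sum_tmul]
      rw [sum_dvec]
    exact LinearMap.congr_fun h x

theorem val_skein (x : VSp K n ⊗[K] (VSp K n ⊗[K] M)) :
    val hq M (add (ofQ QSig.pos) (smul (-1) (ofQ QSig.neg))) x = (q - q⁻¹) • x :=
  (val_add_eq (LinearMap.congr_fun (val_pos hq M) x)
    (val_smul_eq (-1) (LinearMap.congr_fun (val_neg hq M) x))).trans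
      (onLeft_braidMap_vecTm_skein hq x)

theorem val_dot_dot (x : VSp K n ⊗[K] M) : val hq M (comp dot dot) x = -x :=
  val_comp_eq (LinearMap.congr_fun (val_dot hq M) x) <|
    (LinearMap.congr_fun (val_dot hq M) _).trans (kap_kap M.sm_mul_tm M.tm_mul_sm x)

theorem val_tok_pos (x : VSp K n ⊗[K] (VSp K n ⊗[K] M)) :
    val hq M (comp (tensor (ofQ QSig.tok) (Diagram.id [up]) :) (ofQ QSig.pos)) x =
      val hq M (comp (ofQ QSig.pos) (tensor (Diagram.id [up]) (ofQ QSig.tok) :)) x :=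
  (val_comp_eq (val_tok_up hq M x) (LinearMap.congr_fun (val_pos hq M) _)).trans <|
    (onLeft_braidMap_vecTm_token x).trans
      (val_comp_eq (LinearMap.congr_fun (val_pos hq M) x) (val_up_tok hq M _)).symm

/-- The operator `K_{V ⊗ M}` is conjugate to `1 ⊗ K_M` by the crossing: the open Clifford token
passes over a crossing. -/
theorem kap_onLeft_braidMap_vecTm (x : VSp K n ⊗[K] (VSp K n ⊗[K] M)) :
    kap (SMod.tensor (SMod.vector q n hq) M).tm (SMod.tensor (SMod.vector q n hq) M).sm
      (onLeft (braidMap (vecTm q n)) M x) = onLeft (braidMap (vecTm q n)) M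
        (TensorProduct.map (invP K (VSp K n) 1) (kap M.tm M.sm) x) := by
  have e := SMod.tm_tensor_vector hq M
  have h := (SMod.tensor (SMod.vector q n hq) M).sm_mul_tm
  have h' := (congrArg ((SMod.tensor (SMod.vector q n hq) M).sm * ·) e).symm.trans h
  rw [invP_one]
  exact (congrArg (fun T => kap T (SMod.tensor (SMod.vector q n hq) M).sm
    (onLeft (braidMap (vecTm q n)) M x)) e).trans
      (kap_tensorMat M.sm_mul_tm M.tm_mul_sm h' x)

theorem val_dot_pos (x : VSp K n ⊗[K] (VSp K n ⊗[K] M)) :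
    val hq M (comp (tensor (Diagram.id [up]) dot :) (ofQ QSig.pos)) x =
      val hq M (comp (ofQ QSig.pos) (tensor dot (Diagram.id [up]) :)) x :=
  (val_comp_eq (val_up_dot hq M x) (LinearMap.congr_fun (val_pos hq M) _)).trans <|
    (kap_onLeft_braidMap_vecTm hq M x).symm.trans
      (val_comp_eq (LinearMap.congr_fun (val_pos hq M) x) (val_dot_up hq M _)).symm

theorem capMap_negRightMap_kap_dual_cupMap (m : M) : capMap K n M (onLeft (negRightMap q n) M
    (kap (SMod.tensor (SMod.vector q n hq).dual M).tm (SMod.tensor (SMod.vector q n hq).dual M).sm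
      (cupMap K n M m))) = 0 := by
  have e := SMod.tm_tensor_dual_vector hq M
  have h := (SMod.tensor (SMod.vector q n hq).dual M).sm_mul_tm
  have h' := (congrArg ((SMod.tensor (SMod.vector q n hq).dual M).sm * ·) e).symm.trans h
  exact (congrArg (fun T => capMap K n M (onLeft (negRightMap q n) M
    (kap T (SMod.tensor (SMod.vector q n hq).dual M).sm (cupMap K n M m)))) e).trans
      (SMod.capMap_negRightMap_kap_cupMap M hq h' m)

theorem val_dot_bubble (m : M) : val hq M (comp (ofQ QSig.cup)
    (comp (tensor dot (Diagram.id [down]) :) (ofQ QSig.rightCap))) m = 0 :=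
  val_comp_eq (LinearMap.congr_fun (val_cup hq M) m) <| val_comp_eq (val_dot_down hq M _) <|
    (val_rightCap hq M _).trans (capMap_negRightMap_kap_dual_cupMap hq M m)

end Relations

section RelationsHold

variable (hq : q ≠ 0)

open Diagram Arrow AQSig

theorem interp_eq_of_QRel {X Y : List Arrow} {f g : Diagram QSig K X Y}
    (h : QRel (q - q⁻¹) f g) : interp (actWords.{u} (n := n) hq) (genHom hq) (ofQ f) =
      interp (actWords hq) (genHom hq) (ofQ g) := by
  refine interp_eq_of_val hq fun M x => ?_
  cases h with
  | pos_neg => exact (val_pos_neg hq M x).trans (val_id hq M x).symm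
  | neg_pos => exact (val_neg_pos hq M x).trans (val_id hq M x).symm
  | negRight_posLeft => exact (val_negRight_posLeft hq M x).trans (val_id hq M x).symm
  | posLeft_negRight => exact (val_posLeft_negRight hq M x).trans (val_id hq M x).symm
  | braid => exact val_braid hq M x
  | skein =>
    exact (val_skein hq M x).trans (val_smul_eq (q - q⁻¹) (val_id hq M x)).symm
  | tok_tok =>
    exact (val_tok_tok hq M x).trans
      ((val_smul_eq (-1) (val_id hq M x)).trans (neg_one_smul K _)).symm
  | tok_pos => exact val_tok_pos hq M x
  | tok_bubble => exact (val_tok_bubble hq M x).trans (val_zero hq M x).symm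
  | bubble => exact (val_bubble hq M x).trans (val_zero hq M x).symm
  | zigzag_up => exact (val_zigzag_up hq M x).trans (val_id hq M x).symm
  | zigzag_down => exact (val_zigzag_down hq M x).trans (val_id hq M x).symm

theorem interp_eq_of_AQRel {X Y : List Arrow} {f g : Diagram AQSig K X Y}
    (h : AQRel (q - q⁻¹) f g) : interp (actWords.{u} (n := n) hq) (genHom hq) f =
      interp (actWords hq) (genHom hq) g := by
  cases h with
  | ofQ h => exact interp_eq_of_QRel hq h
  | dot_dot =>
    exact interp_eq_of_val hq fun M x => (val_dot_dot hq M x).trans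
      ((val_smul_eq (-1) (val_id hq M x)).trans (neg_one_smul K _)).symm
  | dot_pos => exact interp_eq_of_val hq fun M x => val_dot_pos hq M x
  | dot_bubble =>
    exact interp_eq_of_val hq fun M x => (val_dot_bubble hq M x).trans (val_zero hq M x).symm

end RelationsHold

/-! ### The action and the affine action -/

section Components

open Presentation

variable (hq : q ≠ 0) {P : Presentation Arrow K}
  {R R' : MonoidalSuperfunctor K P.Cat (SEnd K (SMod.{u} q n))} {X Y : List Arrow}

theorem eqToHom_comp_comp_eqToHom_of_heq {C : Type*} [Category C] {A B A' B' : C} (hA : A = A')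
    (hB : B = B') {φ : A ⟶ B} {α : A' ⟶ B'} (h : HEq φ α) :
    eqToHom hA.symm ≫ φ ≫ eqToHom hB = α := by
  subst hA hB
  obtain rfl := eq_of_heq h
  simp

theorem component_eq_lin_app (hX : R.obj ⟨X⟩ = actObj n hq X) (hY : R.obj ⟨Y⟩ = actObj n hq Y)
    {f : Diagram P.sig K X Y} {α : actObj n hq X ⟶ actObj n hq Y}
    (h : HEq (R.map (mor (P := P) f)) α) (M : SMod.{u} q n) :
    component hq hX hY f M = SMod.lin (Superfunctor.app α M) := by
  rw [component, eqToHom_comp_comp_eqToHom_of_heq hX hY h]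

/-- A monoidal superfunctor is determined on a diagram by the components of its value. -/
theorem map_eq_of_component (hX : R.obj ⟨X⟩ = actObj n hq X) (hY : R.obj ⟨Y⟩ = actObj n hq Y)
    (hX' : R'.obj ⟨X⟩ = actObj n hq X) (hY' : R'.obj ⟨Y⟩ = actObj n hq Y) {f : Diagram P.sig K X Y}
    (h : ∀ M, component hq hX hY f M = component hq hX' hY' f M) : R.map (mor (P := P) f) =
      eqToHom (hX.trans hX'.symm) ≫ R'.map (mor (P := P) f) ≫ eqToHom (hY'.trans hY.symm) := by
  have e : eqToHom hX.symm ≫ R.map (mor (P := P) f) ≫ eqToHom hY =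
      eqToHom hX'.symm ≫ R'.map (mor (P := P) f) ≫ eqToHom hY' :=
    Superfunctor.hom_ext fun M => SMod.lin_ext (h M)
  have e' := congrArg (fun t => eqToHom hX ≫ t ≫ eqToHom hY.symm) e
  simpa using e'

end Components

section Existence

/-- The monoidal superfunctor out of `AQ(z)` given by values of the generators that satisfy the
relations. -/
def interpAQ {z : K} {D : Type v} [Category.{w} D] [Preadditive D] [Linear K D] [Supercategory K D]
    [StrictMonoidalSupercategory K D] (o : WordMap K Arrow D)
    {γ : ∀ g : AQSig.Gen, o.obj (AQSig.dom g) ⟶ o.obj (AQSig.cod g)}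
    (hγ : ∀ g, γ g ∈ Par K _ (AQSig.parity g))
    (hrel : ∀ {X Y : List Arrow} {f g : Diagram AQSig K X Y}, AQRel z f g →
      interp o γ f = interp o γ g) : MonoidalSuperfunctor K (AQcat z) D :=
  interpFunctor (P := AQPres z) o hγ hrel

variable (hq : q ≠ 0)

/-- The affine action of `AQ(q - q⁻¹)` on `U_q(𝔮_n)`-supermodules. -/
def affineAction : MonoidalSuperfunctor K (AQcat (q - q⁻¹)) (SEnd K (SMod.{u} q n)) :=
  interpAQ (actWords hq) (genHom_mem hq) (interp_eq_of_AQRel hq)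

/-- The action of `Q(q - q⁻¹)` by tensoring on the left with `V` and `V*`. -/
def tensorAction : MonoidalSuperfunctor K (Qcat (q - q⁻¹)) (SEnd K (SMod.{u} q n)) :=
  (QtoAQ (q - q⁻¹)).comp (affineAction hq)

theorem affineAction_obj (X : List Arrow) :
    (affineAction.{u} (n := n) hq).obj ⟨X⟩ = actObj n hq X := rfl

theorem tensorAction_obj (X : List Arrow) :
    (tensorAction.{u} (n := n) hq).obj ⟨X⟩ = actObj n hq X := rfl

theorem affineAction_map {X Y : List Arrow} (f : Diagram AQSig K X Y) :
    (affineAction.{u} (n := n) hq).map (Presentation.mor (P := AQPres (q - q⁻¹)) f) =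
      interp (actWords hq) (genHom hq) f := rfl

theorem tensorAction_map {X Y : List Arrow} (f : Diagram QSig K X Y) :
    (tensorAction.{u} (n := n) hq).map (Presentation.mor (P := QPres (q - q⁻¹)) f) =
      interp (actWords hq) (genHom hq) (AQSig.ofQ f) := rfl

theorem component_affineAction {X Y : List Arrow} (f : Diagram AQSig K X Y) (M : SMod.{u} q n) :
    component (P := AQPres (q - q⁻¹)) hq (affineAction_obj hq X) (affineAction_obj hq Y) f M =
      val hq M f := by
  rw [val]
  exact component_eq_lin_app (P := AQPres (q - q⁻¹)) hq _ _ (heq_of_eq (affineAction_map hq f)) M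

theorem component_tensorAction {X Y : List Arrow} (f : Diagram QSig K X Y) (M : SMod.{u} q n) :
    component (P := QPres (q - q⁻¹)) hq (tensorAction_obj hq X) (tensorAction_obj hq Y) f M =
      val hq M (AQSig.ofQ f) := by
  rw [val]
  exact component_eq_lin_app (P := QPres (q - q⁻¹)) hq _ _ (heq_of_eq (tensorAction_map hq f)) M

theorem QtoAQ_comp_affineAction :
    (QtoAQ (q - q⁻¹)).comp (affineAction.{u} (n := n) hq) = tensorAction hq := rfl

-- From here on the actions enter only through their components.
attribute [irreducible] affineAction tensorAction

theorem component_affineAction_dot (M : SMod.{u} q n) :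
    component (P := AQPres (q - q⁻¹)) hq (affineAction_obj hq [.up]) (affineAction_obj hq [.up])
      AQSig.dot M = M.kappa := by
  rw [SMod.kappa_eq]
  exact (component_affineAction hq AQSig.dot M).trans (val_dot hq M)

theorem affineAction_sendsDotToKappa :
    SendsDotToKappa hq (affineAction.{u} (n := n) hq) :=
  ⟨affineAction_obj hq _, component_affineAction_dot hq⟩

end Existence

section TensorAction

variable (hq : q ≠ 0) (M : SMod.{u} q n)

theorem braiding_vector_tmul (v w : VSp K n) (m : M) : TensorProduct.assoc K (VSp K n) (VSp K n) M
    ((SMod.vector q n hq).braiding (v ⊗ₜ[K] w : VSp K n ⊗[K] VSp K n) ⊗ₜ[K] m) =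
      onLeft (braidMap (vecTm q n)) M (v ⊗ₜ[K] (w ⊗ₜ[K] m)) := by
  rw [onLeft_tmul]
  have e := LinearMap.congr_fun (SMod.braiding_eq (SMod.vector q n hq))
    (v ⊗ₜ[K] w : VSp K n ⊗[K] VSp K n)
  exact congrArg (fun x => TensorProduct.assoc K (VSp K n) (VSp K n) M (x ⊗ₜ[K] m)) (e.trans
    (congrArg (fun T => braidMap T (v ⊗ₜ[K] w : VSp K n ⊗[K] VSp K n)) (tm_vector hq)))

theorem braiding_symm_vector_tmul (v w : VSp K n) (m : M) :
    TensorProduct.assoc K (VSp K n) (VSp K n) M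
      ((SMod.vector q n hq).braiding.symm (v ⊗ₜ[K] w : VSp K n ⊗[K] VSp K n) ⊗ₜ[K] m) =
        onLeft (braidInv (vecSm q n)) M (v ⊗ₜ[K] (w ⊗ₜ[K] m)) := by
  rw [onLeft_tmul]
  have e := LinearMap.congr_fun (SMod.braiding_symm_eq (SMod.vector q n hq))
    (v ⊗ₜ[K] w : VSp K n ⊗[K] VSp K n)
  exact congrArg (fun x => TensorProduct.assoc K (VSp K n) (VSp K n) M (x ⊗ₜ[K] m)) (e.trans
    (congrArg (fun S => braidInv S (v ⊗ₜ[K] w : VSp K n ⊗[K] VSp K n)) (sm_vector hq)))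

theorem negRightVec_tmul (i j : Idx n) (m : M) :
    TensorProduct.assoc K (Module.Dual K (VSp K n)) (VSp K n) M (negRightVec q i j ⊗ₜ[K] m) =
      onLeft (negRightMap q n) M (vec K i ⊗ₜ[K] (dvec K j ⊗ₜ[K] m)) := by
  rw [onLeft_tmul, negRightMap_vec]

theorem tensorAction_pos : component (P := QPres (q - q⁻¹)) hq (tensorAction_obj hq _)
    (tensorAction_obj hq _) QSig.pos M = (onLeft (braidMap (vecTm q n)) M :
      VSp K n ⊗[K] (VSp K n ⊗[K] M) →ₗ[K] VSp K n ⊗[K] (VSp K n ⊗[K] M)) :=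
  (component_tensorAction hq _ M).trans (val_pos hq M)

theorem tensorAction_neg : component (P := QPres (q - q⁻¹)) hq (tensorAction_obj hq _)
    (tensorAction_obj hq _) QSig.neg M = (onLeft (braidInv (vecSm q n)) M :
      VSp K n ⊗[K] (VSp K n ⊗[K] M) →ₗ[K] VSp K n ⊗[K] (VSp K n ⊗[K] M)) :=
  (component_tensorAction hq _ M).trans (val_neg hq M)

theorem tensorAction_negRight : component (P := QPres (q - q⁻¹)) hq (tensorAction_obj hq _)
    (tensorAction_obj hq _) QSig.negRight M = (onLeft (negRightMap q n) M :
      VSp K n ⊗[K] (Module.Dual K (VSp K n) ⊗[K] M) →ₗ[K]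
        Module.Dual K (VSp K n) ⊗[K] (VSp K n ⊗[K] M)) :=
  (component_tensorAction hq _ M).trans (val_negRight hq M)

theorem tensorAction_cap : component (P := QPres (q - q⁻¹)) hq (tensorAction_obj hq _)
    (tensorAction_obj hq _) QSig.cap M = (capMap K n M :
      Module.Dual K (VSp K n) ⊗[K] (VSp K n ⊗[K] M) →ₗ[K] M) :=
  (component_tensorAction hq _ M).trans (val_cap hq M)

theorem tensorAction_cup : component (P := QPres (q - q⁻¹)) hq (tensorAction_obj hq _)
    (tensorAction_obj hq _) QSig.cup M = (cupMap K n M :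
      M →ₗ[K] VSp K n ⊗[K] (Module.Dual K (VSp K n) ⊗[K] M)) :=
  (component_tensorAction hq _ M).trans (val_cup hq M)

theorem tensorAction_tok : component (P := QPres (q - q⁻¹)) hq (tensorAction_obj hq _)
    (tensorAction_obj hq _) QSig.tok M = (TensorProduct.map (jMap K n) LinearMap.id :
      VSp K n ⊗[K] M →ₗ[K] VSp K n ⊗[K] M) :=
  (component_tensorAction hq _ M).trans (val_tok hq M)

theorem isTensorAction_tensorAction : IsTensorAction hq (tensorAction.{u} (n := n) hq) where
  obj := tensorAction_obj hq
  pos M v w m := (LinearMap.congr_fun (tensorAction_pos hq M) _).trans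
    (braiding_vector_tmul hq M v w m).symm
  neg M v w m := (LinearMap.congr_fun (tensorAction_neg hq M) _).trans
    (braiding_symm_vector_tmul hq M v w m).symm
  negRight M i j m := (LinearMap.congr_fun (tensorAction_negRight hq M) _).trans
    (negRightVec_tmul M i j m).symm
  cap M f v m := (LinearMap.congr_fun (tensorAction_cap hq M) _).trans (capMap_tmul f v m)
  cup M m := (LinearMap.congr_fun (tensorAction_cup hq M) m).trans (cupMap_apply m)
  tok M _ _ := LinearMap.congr_fun (tensorAction_tok hq M) _

end TensorAction

/-! ### Uniqueness -/

section Restriction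

variable {z : K} {D : Type v} [Category.{w} D] [Preadditive D] [Linear K D] [Supercategory K D]
  [StrictMonoidalSupercategory K D]

/-- The canonical superfunctor maps generators to generators; the diagram `ofQ` of a generator
differs from the generator by identities on both sides. -/
theorem QtoAQ_map_gen (g : QGen) :
    (QtoAQ z).map (Presentation.mor (P := QPres z) (.gen (S := QSig) g)) =
      Presentation.mor (P := AQPres z) (.gen (S := AQSig) (some g : Option QGen)) := by
  have h : Presentation.Eqv (AQPres z) (AQSig.ofQ (.gen (S := QSig) g))
      (.gen (S := AQSig) (some g : Option QGen)) :=
    (Presentation.Eqv.comp_id _).trans (Presentation.Eqv.id_comp _)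
  exact Presentation.cls_eq.mpr h

theorem QtoAQ_comp_map_gen (F : MonoidalSuperfunctor K (AQcat z) D) (g : QGen) :
    ((QtoAQ z).comp F).map (Presentation.mor (P := QPres z) (.gen (S := QSig) g)) =
      F.map (Presentation.mor (P := AQPres z) (.gen (S := AQSig) (some g : Option QGen))) :=
  congrArg (fun f => F.map f) (QtoAQ_map_gen g)

theorem MonoidalSuperfunctor.obj_eq_of_QtoAQ_comp {F F' : MonoidalSuperfunctor K (AQcat z) D}
    (h : (QtoAQ z).comp F = (QtoAQ z).comp F') (X : AQcat z) : F.obj X = F'.obj X :=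
  congrArg (fun G : MonoidalSuperfunctor K (Qcat z) D => G.obj ⟨X.word⟩) h

theorem MonoidalSuperfunctor.map_eq_of_eq {C : Type*} [Category C] [Preadditive C] [Linear K C]
    [Supercategory K C] [StrictMonoidalSupercategory K C] {G G' : MonoidalSuperfunctor K C D}
    (h : G = G') {X Y : C} (f : X ⟶ Y) (hX : G.obj X = G'.obj X) (hY : G'.obj Y = G.obj Y) :
    G.map f = eqToHom hX ≫ G'.map f ≫ eqToHom hY := by
  subst h
  simp

/-- A monoidal superfunctor on `AQ(z)` is determined by its restriction to `Q(z)` and the image of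
the open Clifford token. -/
theorem MonoidalSuperfunctor.ext_of_QtoAQ_comp {F F' : MonoidalSuperfunctor K (AQcat z) D}
    (h : (QtoAQ z).comp F = (QtoAQ z).comp F')
    (hd : F.map (Presentation.mor (P := AQPres z) AQSig.dot) =
      eqToHom (obj_eq_of_QtoAQ_comp h _) ≫ F'.map (Presentation.mor (P := AQPres z) AQSig.dot) ≫
        eqToHom (obj_eq_of_QtoAQ_comp h _).symm) : F = F' := by
  refine MonoidalSuperfunctor.ext_of_gen (P := AQPres z) (obj_eq_of_QtoAQ_comp h) fun g => ?_
  match g with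
  | some g =>
    have e := map_eq_of_eq h (Presentation.mor (P := QPres z) (.gen (S := QSig) g))
      (obj_eq_of_QtoAQ_comp h ⟨QSig.dom g⟩) (obj_eq_of_QtoAQ_comp h ⟨QSig.cod g⟩).symm
    rw [QtoAQ_comp_map_gen, QtoAQ_comp_map_gen] at e
    exact e
  | none => exact hd

end Restriction

section Uniqueness

attribute [local irreducible] component

theorem ext_tmul_tmul {A B M N : Type*} [AddCommGroup A] [Module K A] [AddCommGroup B] [Module K B]
    [AddCommGroup M] [Module K M] [AddCommGroup N] [Module K N] {f g : A ⊗[K] (B ⊗[K] M) →ₗ[K] N}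
    (h : ∀ a b m, f (a ⊗ₜ (b ⊗ₜ m)) = g (a ⊗ₜ (b ⊗ₜ m))) : f = g :=
  TensorProduct.ext (LinearMap.ext fun a => TensorProduct.ext' fun b m => h a b m)

theorem ext_vec_dvec {M N : Type*} [AddCommGroup M] [Module K M] [AddCommGroup N] [Module K N]
    {f g : VSp K n ⊗[K] (Module.Dual K (VSp K n) ⊗[K] M) →ₗ[K] N}
    (h : ∀ i j m, f (vec K i ⊗ₜ (dvec K j ⊗ₜ m)) = g (vec K i ⊗ₜ (dvec K j ⊗ₜ m))) : f = g :=
  TensorProduct.ext (vec_ext fun i => TensorProduct.ext (dual_ext fun j => LinearMap.ext fun m =>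
    h i j m))

variable {hq : q ≠ 0} {z : K}

/-- The components of an action by tensoring on the left are determined on the generators. -/
theorem IsTensorAction.component_gen {R R' : MonoidalSuperfunctor K (Qcat z)
    (SEnd K (SMod.{u} q n))}
    (h : IsTensorAction hq R) (h' : IsTensorAction hq R') (M : SMod.{u} q n) : ∀ g : QGen,
    component (P := QPres z) hq (h.obj (QSig.dom g)) (h.obj (QSig.cod g))
        (.gen (S := QSig) g) M =
      component (P := QPres z) hq (h'.obj (QSig.dom g)) (h'.obj (QSig.cod g))
        (.gen (S := QSig) g) M
  | .pos => ext_tmul_tmul (A := VSp K n) (B := VSp K n) (M := M)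
      fun v w m => (h.pos M v w m).trans (h'.pos M v w m).symm
  | .neg => ext_tmul_tmul (A := VSp K n) (B := VSp K n) (M := M)
      fun v w m => (h.neg M v w m).trans (h'.neg M v w m).symm
  | .negRight => ext_vec_dvec (M := M)
      fun i j m => (h.negRight M i j m).trans (h'.negRight M i j m).symm
  | .cap => ext_tmul_tmul (A := Module.Dual K (VSp K n)) (B := VSp K n) (M := M)
      fun f v m => (h.cap M f v m).trans (h'.cap M f v m).symm
  | .cup => LinearMap.ext fun m => (h.cup M m).trans (h'.cup M m).symm
  | .tok => TensorProduct.ext' (M := VSp K n) (N := M)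
      fun v m => (h.tok M v m).trans (h'.tok M v m).symm

theorem IsTensorAction.map_gen {R R' : MonoidalSuperfunctor K (Qcat z) (SEnd K (SMod.{u} q n))}
    (h : IsTensorAction hq R) (h' : IsTensorAction hq R') (g : QGen) :
    R.map (Presentation.mor (P := QPres z) (.gen (S := QSig) g)) =
      eqToHom ((h.obj (QSig.dom g)).trans (h'.obj (QSig.dom g)).symm) ≫
        R'.map (Presentation.mor (P := QPres z) (.gen (S := QSig) g)) ≫
          eqToHom ((h'.obj (QSig.cod g)).trans (h.obj (QSig.cod g)).symm) :=
  map_eq_of_component (P := QPres z) hq (h.obj (QSig.dom g)) (h.obj (QSig.cod g))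
    (h'.obj (QSig.dom g)) (h'.obj (QSig.cod g)) fun M => h.component_gen h' M g

theorem IsTensorAction.eq {R R' : MonoidalSuperfunctor K (Qcat z) (SEnd K (SMod.{u} q n))}
    (h : IsTensorAction hq R) (h' : IsTensorAction hq R') : R = R' :=
  MonoidalSuperfunctor.ext_of_gen (P := QPres z)
    (fun X => (h.obj X.word).trans (h'.obj X.word).symm) (h.map_gen h')

/-- An affine action is determined by the components of its restriction to `Q(z)` and of the image
of the open Clifford token. -/
theorem eq_of_isTensorAction_of_sendsDotToKappa
    {F F' : MonoidalSuperfunctor K (AQcat z) (SEnd K (SMod.{u} q n))}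
    (h : IsTensorAction hq ((QtoAQ z).comp F)) (h' : IsTensorAction hq ((QtoAQ z).comp F'))
    (hd : SendsDotToKappa hq F) (hd' : SendsDotToKappa hq F') : F = F' := by
  refine MonoidalSuperfunctor.ext_of_QtoAQ_comp (h.eq h') ?_
  obtain ⟨a, ha⟩ := hd
  obtain ⟨b, hb⟩ := hd'
  exact map_eq_of_component (P := AQPres z) hq a a b b fun M => (ha M).trans (hb M).symm

end Uniqueness

end

end QIso

theorem mainTheorem5 (n : ℕ) :
    (∃! R : QIso.MonoidalSuperfunctor QIso.Cq (QIso.Qcat QIso.zz)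
        (QIso.SEnd QIso.Cq (QIso.SMod.{u} QIso.qq n)),
      QIso.IsTensorAction QIso.qq_ne_zero R) ∧
    (∃! F : QIso.MonoidalSuperfunctor QIso.Cq (QIso.AQcat QIso.zz)
        (QIso.SEnd QIso.Cq (QIso.SMod.{u} QIso.qq n)),
      QIso.IsTensorAction QIso.qq_ne_zero ((QIso.QtoAQ QIso.zz).comp F) ∧
        QIso.SendsDotToKappa QIso.qq_ne_zero F) := by
  have h := QIso.isTensorAction_tensorAction.{u} (n := n) QIso.qq_ne_zero
  refine ⟨⟨QIso.tensorAction QIso.qq_ne_zero, h, fun R hR => hR.eq h⟩,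
    ⟨QIso.affineAction QIso.qq_ne_zero, ⟨?_, QIso.affineAction_sendsDotToKappa QIso.qq_ne_zero⟩,
      fun F hF => ?_⟩⟩
  · exact (QIso.QtoAQ_comp_affineAction QIso.qq_ne_zero).symm ▸ h
  · exact QIso.eq_of_isTensorAction_of_sendsDotToKappa hF.1
      ((QIso.QtoAQ_comp_affineAction QIso.qq_ne_zero).symm ▸ h) hF.2
      (QIso.affineAction_sendsDotToKappa QIso.qq_ne_zero)
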